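/- Let $k\ge 3$ be a fixed integer and put $d=k-1$. A *rank-$k$ order type* on $E=\{0,\dots,n-1\}$ is the chirotope $\chi:E^k\to\{-1,0,1\}$ (not identically zero) of an acyclic oriented matroid of rank $k$; its *underlying matroid* has as bases the sets $\{x_1,\dots,x_k\}$ with $\chi(x_1,\dots,x_k)\ne 0$. Points $(p_e)_{e\in E}$ in $\mathbb{R}^{d}$ *realize* $\chi$ if $\operatorname{sign}\det\begin{pmatrix}p_{x_1}&\cdots&p_{x_k}\\1&\cdots&1\end{pmatrix}=\chi(x_1,\dots,x_k)$ for all $x_1,\dots,x_k\in E$. A *representation* of a rank-$k$ matroid $M$ assigns to each element $e$ a vector $v_e\in\mathbb{R}^k$ such that a set of elements is independent in $M$ if and only if the corresponding family of vectors is linearly independent. If a hyperplane (flat of rank $k-1$) $H$ of $M$ is distinguished as the *hyperplane at infinity*, a representation is *valid* if the last coordinate of $v_e$ is $0$ exactly for $e\in H$; every $e\notin H$ is then the point of $\mathbb{R}^{d}$ with homogeneous coordinates $v_e$. From a rank-$k$ order type $O$ on $E$ one can compute in linear time a rank-$k$ matroid $M$ with a hyperplane at infinity $H$ such that $M$ *simulates*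 $O$, that is: $E$ is contained in the ground set of $M$ and disjoint from $H$, the restriction of $M$ to $E$ is the underlying matroid of $O$, and 1. every realization $(p_e)_{e\in E}$ of $O$ extends to a representation $v$ of $M$, with $v_e=(p_e,1)$ for all $e\in E$; 2. for every valid representation of $M$, the induced points of $\mathbb{R}^{d}$ that correspond to the elements of $E$ realize $O$, possibly after a reflection in a hyperplane. Linear time means: $O$ is given as $n$ followed by the table of the $n^k$ values of $\chi$, of total length $N=n^k+1$. There are a program of a random access machine with words of $O(\log N)$ bits and a constant $C$, both depending only on $k$, such that on every $O$ the program halts after at most $CN$ steps and outputs a description of $(M,H)$, where $M$ has at most $CN$ elements. The description consists of the number of elements of $M$, the list of the elements of $H$, and a list of pairs $(r_j,F_j)$ of numbers $r_j$ and explicitly listed sets $F_j$ of elements such that a set $I$ is independent in $M$ if and only if $|I|\le k$ and $|I\cap F_j|\le r_j$ for all $j$. -/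

import Mathlib

/-! ## Abstract order types -/

/-- An abstract order type of rank `d + 1` on the ground set `Fin n`: the chirotope of an acyclic
oriented matroid of rank `d + 1`. -/
structure AbstractOrderType (d n : ℕ) where
  /-- the chirotope, on ordered `(d + 1)`-tuples -/
  χ : (Fin (d + 1) → Fin n) → SignType
  /-- the rank is `d + 1`: some tuple is independent -/
  nonzero : ∃ x, χ x ≠ 0
  /-- the chirotope is alternating -/
  alternating : ∀ (x : Fin (d + 1) → Fin n) (i j : Fin (d + 1)), i ≠ j →
    χ (x ∘ Equiv.swap i j) = -χ x
  /-- the (signed) basis exchange axiom of chirotopes -/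
  exchange : ∀ x y : Fin (d + 1) → Fin n, χ x * χ y ≠ 0 →
    ∃ i, χ (Function.update x 0 (y i)) * χ (Function.update y i (x 0)) = χ x * χ y
  /-- acyclicity: no signed circuit is nonnegative. Every signed circuit is obtained from a
  `(d + 2)`-tuple of rank `d + 1` by the rule `i ↦ (-1) ^ i * χ (the tuple without entry i)`. -/
  acyclic : ∀ x : Fin (d + 2) → Fin n,
    (∀ i : Fin (d + 2), 0 ≤ (-1 : SignType) ^ (i : ℕ) * χ (x ∘ i.succAbove)) →
    ∀ i : Fin (d + 2), χ (x ∘ i.succAbove) = 0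

namespace AbstractOrderType

variable {d n : ℕ}

/-- A set is a basis if it is the range of a tuple with nonzero orientation. -/
def IsBasis (O : AbstractOrderType d n) (B : Set (Fin n)) : Prop :=
  ∃ x, O.χ x ≠ 0 ∧ Set.range x = B

theorem injective_of_ne_zero (O : AbstractOrderType d n) {x : Fin (d + 1) → Fin n} (hx : O.χ x ≠ 0) :
    Function.Injective x := by
  intro i j hij
  by_contra hne
  have h := O.alternating x i j hne
  have h2 : x ∘ Equiv.swap i j = x := by
    funext l
    simp only [Function.comp_apply, Equiv.swap_apply_def]
    split_ifs with h1 h1 <;> simp [h1, hij]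
  rw [h2] at h
  revert h hx
  generalize O.χ x = s
  revert s
  decide

theorem range_update {x : Fin (d + 1) → Fin n} (hx : Function.Injective x) (i : Fin (d + 1))
    (a : Fin n) : Set.range (Function.update x i a) = insert a (Set.range x \ {x i}) := by
  ext b
  simp only [Set.mem_range, Set.mem_insert_iff, Set.mem_sdiff, Set.mem_singleton_iff]
  constructor
  · rintro ⟨j, rfl⟩
    by_cases h : j = i
    · subst h; simp
    · right
      simp only [Function.update_of_ne h]
      exact ⟨⟨j, rfl⟩, fun e => h (hx e)⟩
  · rintro (rfl | ⟨⟨j, rfl⟩, hj⟩)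
    · exact ⟨i, by simp⟩
    · exact ⟨j, Function.update_of_ne (fun e => hj (by rw [e])) _ _⟩

theorem exchangeProperty (O : AbstractOrderType d n) : Matroid.ExchangeProperty O.IsBasis := by
  rintro X Y ⟨x, hx, rfl⟩ ⟨y, hy, rfl⟩ a ⟨⟨i, rfl⟩, ha⟩
  -- bring the element `x i` to the front
  obtain ⟨x', hx', hr, h0⟩ : ∃ x', O.χ x' ≠ 0 ∧ Set.range x' = Set.range x ∧ x' 0 = x i := by
    by_cases hi : i = 0
    · exact ⟨x, hx, rfl, by rw [hi]⟩
    · refine ⟨x ∘ Equiv.swap 0 i, ?_, ?_, by simp⟩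
      · rw [O.alternating x 0 i (Ne.symm hi)]
        revert hx
        generalize O.χ x = s
        revert s
        decide
      · rw [Set.range_comp, Equiv.range_eq_univ, Set.image_univ]
  obtain ⟨j, hj⟩ := O.exchange x' y (mul_ne_zero hx' hy)
  have hne : O.χ (Function.update x' 0 (y j)) ≠ 0 := by
    intro h
    rw [h, zero_mul] at hj
    exact mul_ne_zero hx' hy hj.symm
  have hr2 := range_update (O.injective_of_ne_zero hx') 0 (y j)
  rw [hr, h0] at hr2
  refine ⟨y j, ⟨⟨j, rfl⟩, ?_⟩, ⟨_, hne, hr2⟩⟩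
  rintro ⟨l, hl⟩
  -- otherwise `y j` is repeated, or it equals `x i`, which is not in the range of `y`
  have hinj := O.injective_of_ne_zero hne
  have hmem : y j ∈ Set.range x' := by rw [hr]; exact ⟨l, hl⟩
  obtain ⟨m, hm⟩ := hmem
  by_cases hm0 : m = 0
  · subst hm0
    exact ha ⟨j, by rw [← hm, h0]⟩
  · exact hm0 (hinj (by simp [Function.update_of_ne hm0, hm]))

/-- The matroid underlying an order type. -/
def matroid (O : AbstractOrderType d n) : Matroid (Fin n) :=
  Matroid.ofIsBaseOfFinite (E := Set.univ) Set.finite_univ O.IsBasis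
    (let ⟨x, hx⟩ := O.nonzero; ⟨_, x, hx, rfl⟩) O.exchangeProperty (fun _ _ => Set.subset_univ _)

end AbstractOrderType

/-! ## Point configurations and representations -/

/-- Homogeneous coordinates `(p, 1)` of a point `p` of affine `d`-space. -/
def homogenize {d : ℕ} (p : Fin d → ℝ) : Fin (d + 1) → ℝ :=
  Fin.snoc (α := fun _ => ℝ) p 1

/-- The point of affine `d`-space with homogeneous coordinates `v`
(meaningful if the last coordinate of `v` is not zero). -/
noncomputable def dehomogenize {d : ℕ} (v : Fin (d + 1) → ℝ) : Fin d → ℝ :=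
  fun i => v i.castSucc / v (Fin.last d)

/-- The orientation of a `(d + 1)`-tuple of points of affine `d`-space. -/
noncomputable def orientation {d : ℕ} (q : Fin (d + 1) → Fin d → ℝ) : SignType :=
  SignType.sign (Matrix.det (Matrix.of fun i j => homogenize (q j) i))

/-- The points `p e` realize the order type. -/
def AbstractOrderType.Realizes {d n : ℕ} (O : AbstractOrderType d n) (p : Fin n → Fin d → ℝ) : Prop :=
  ∀ x, orientation (p ∘ x) = O.χ x

/-- The points `p e` realize the order type or its mirror image; equivalently (for `d ≥ 1`), they
or their image under a reflection in a hyperplane realize the order type. -/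
def AbstractOrderType.RealizesUpToReflection {d n : ℕ} (O : AbstractOrderType d n) (p : Fin n → Fin d → ℝ) :
    Prop :=
  (∀ x, orientation (p ∘ x) = O.χ x) ∨ (∀ x, orientation (p ∘ x) = -O.χ x)

/-- The vectors `v e` (the columns of a real matrix) represent the matroid `M`. -/
def IsRepresentation {α : Type*} {k : ℕ} (M : Matroid α) (v : α → Fin k → ℝ) : Prop :=
  ∀ I : Set α, M.Indep I ↔ LinearIndepOn ℝ v I

/-- A representation of `M` is valid, with respect to a distinguished hyperplane `H`, if exactly
the elements of `H` lie at infinity. -/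
def IsValidRepresentation {α : Type*} {d : ℕ} (M : Matroid α) (H : Set α)
    (v : α → Fin (d + 1) → ℝ) : Prop :=
  IsRepresentation M v ∧ ∀ e, v e (Fin.last d) = 0 ↔ e ∈ H

/-- The matroid `M` of rank `d + 1` with hyperplane at infinity `H` simulates the order type `O`,
where the element `e` of `O` is the element `ι e` of `M`. -/
structure Simulates {d n m : ℕ} (M : Matroid (Fin m)) (H : Set (Fin m)) (ι : Fin n ↪ Fin m)
    (O : AbstractOrderType d n) : Prop where
  ground : M.E = Set.univ
  rank : M.eRank = d + 1
  /-- `H` is a hyperplane of `M`, i.e. a flat of rank `d` -/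
  isFlat : M.IsFlat H
  rank_infinity : M.eRk H = d
  /-- the elements of `O` are not at infinity -/
  finite : ∀ e, ι e ∉ H
  /-- the underlying matroid of `O` is the restriction of `M` to the elements of `O` -/
  restricts : M.comap ι = O.matroid
  /-- every realization of `O` extends to a representation of `M` -/
  extends_realization : ∀ p, O.Realizes p →
    ∃ v : Fin m → Fin (d + 1) → ℝ, IsRepresentation M v ∧ ∀ e, v (ι e) = homogenize (p e)
  /-- every valid representation of `M` induces a realization of `O` -/
  induces_realization : ∀ v : Fin m → Fin (d + 1) → ℝ, IsValidRepresentation M H v →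
    O.RealizesUpToReflection fun e => dehomogenize (v (ι e))

/-! ## Encodings -/

/-- The number that encodes a sign. -/
def signCode : SignType → ℕ
  | SignType.zero => 0
  | SignType.pos => 1
  | SignType.neg => 2

/-- An order type is given by `n` and the table of all values of its chirotope
(with `n ^ (d + 1)` entries, the entry of the tuple `x` is in position `∑ i, x i * n ^ i`). -/
def AbstractOrderType.input {d n : ℕ} (O : AbstractOrderType d n) : List ℕ :=
  n :: List.ofFn fun i : Fin (n ^ (d + 1)) => signCode (O.χ (finFunctionFinEquiv.symm i))

/-- A description of a matroid with a distinguished hyperplane: the number of elements, the list of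
the elements of the hyperplane, and a list of pairs `(r, F)`, each of which says that the set `F`
of elements contains no more than `r` independent elements. -/
structure MatroidCode where
  size : ℕ
  infinity : List ℕ
  constraints : List (ℕ × List ℕ)

/-- The description written as a list of numbers. Every list is preceded by its length. -/
def MatroidCode.words (c : MatroidCode) : List ℕ :=
  c.size :: c.infinity.length :: (c.infinity ++
    c.constraints.flatMap fun p => p.1 :: p.2.length :: p.2)

/-- The description `c` describes the matroid `M` of rank at most `k` with distinguished hyperplane
`H`: a set is independent in `M` if and only if it has at most `k` elements and satisfies all the
listed constraints. -/
structure MatroidCode.Describes (c : MatroidCode) (k : ℕ) (M : Matroid (Fin c.size))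
    (H : Set (Fin c.size)) : Prop where
  infinity_lt : ∀ a ∈ c.infinity, a < c.size
  mem_infinity_iff : ∀ e : Fin c.size, e ∈ H ↔ (e : ℕ) ∈ c.infinity
  constraint_lt : ∀ p ∈ c.constraints, ∀ a ∈ p.2, a < c.size
  indep_iff : ∀ I : Finset (Fin c.size), M.Indep (I : Set (Fin c.size)) ↔
    I.card ≤ k ∧ ∀ p ∈ c.constraints, (I.filter fun e : Fin c.size => (e : ℕ) ∈ p.2).card ≤ p.1

/-! ## Random access machines -/

/-- Programs of a random access machine with registers `0, 1, 2, …`, a memory, and a write-only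
output tape. Every program mentions only finitely many registers. -/
inductive RAM where
  | skip : RAM
  /-- `const r c`: put the number `c` into register `r` -/
  | const (r c : ℕ) : RAM
  /-- `add r s t`: put the sum of registers `s` and `t` into register `r` -/
  | add (r s t : ℕ) : RAM
  /-- `sub r s t`: put the truncated difference of registers `s` and `t` into register `r` -/
  | sub (r s t : ℕ) : RAM
  /-- `mul r s t`: put the product of registers `s` and `t` into register `r` -/
  | mul (r s t : ℕ) : RAM
  /-- `load r s`: put the memory cell whose address is in register `s` into register `r` -/
  | load (r s : ℕ) : RAM
  /-- `store r s`: put register `s` into the memory cell whose address is in register `r` -/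
  | store (r s : ℕ) : RAM
  /-- `emit r`: append register `r` to the output -/
  | emit (r : ℕ) : RAM
  | seq (p q : RAM) : RAM
  /-- `ifNonzero r p q`: run `p` if register `r` is not zero, otherwise run `q` -/
  | ifNonzero (r : ℕ) (p q : RAM) : RAM
  /-- `whileNonzero r p`: repeat `p` as long as register `r` is not zero -/
  | whileNonzero (r : ℕ) (p : RAM) : RAM

namespace RAM

/-- A state of the machine. -/
structure State where
  reg : ℕ → ℕ
  mem : ℕ → ℕ
  output : List ℕ

/-- The initial state: the input is in memory cells `0, 1, 2, …`, all else is zero. -/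
def init (w : List ℕ) : State where
  reg := fun _ => 0
  mem := fun a => w.getD a 0
  output := []

/-- Put `a` into register `r`. -/
def State.setReg (σ : State) (r a : ℕ) : State :=
  { σ with reg := Function.update σ.reg r a }

/-- Put `a` into memory cell `i`. -/
def State.setMem (σ : State) (i a : ℕ) : State :=
  { σ with mem := Function.update σ.mem i a }

/-- `Runs W p σ t τ`: the program `p`, started in the state `σ`, halts in the state `τ` after
exactly `t` steps, and all numbers that it computes are at most `W`. Every instruction and every
test takes one step. -/
inductive Runs (W : ℕ) : RAM → State → ℕ → State → Prop
  | skip (σ : State) : Runs W skip σ 1 σ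
  | const (σ : State) (r c : ℕ) (h : c ≤ W) : Runs W (const r c) σ 1 (σ.setReg r c)
  | add (σ : State) (r s t : ℕ) (h : σ.reg s + σ.reg t ≤ W) :
      Runs W (add r s t) σ 1 (σ.setReg r (σ.reg s + σ.reg t))
  | sub (σ : State) (r s t : ℕ) : Runs W (sub r s t) σ 1 (σ.setReg r (σ.reg s - σ.reg t))
  | mul (σ : State) (r s t : ℕ) (h : σ.reg s * σ.reg t ≤ W) :
      Runs W (mul r s t) σ 1 (σ.setReg r (σ.reg s * σ.reg t))
  | load (σ : State) (r s : ℕ) : Runs W (load r s) σ 1 (σ.setReg r (σ.mem (σ.reg s)))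
  | store (σ : State) (r s : ℕ) : Runs W (store r s) σ 1 (σ.setMem (σ.reg r) (σ.reg s))
  | emit (σ : State) (r : ℕ) :
      Runs W (emit r) σ 1 { σ with output := σ.output ++ [σ.reg r] }
  | seq {p q : RAM} {σ σ' σ'' : State} {t t' : ℕ} (h : Runs W p σ t σ')
      (h' : Runs W q σ' t' σ'') : Runs W (seq p q) σ (t + t') σ''
  | if_true {r : ℕ} {p q : RAM} {σ σ' : State} {t : ℕ} (hr : σ.reg r ≠ 0)
      (h : Runs W p σ t σ') : Runs W (ifNonzero r p q) σ (t + 1) σ'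
  | if_false {r : ℕ} {p q : RAM} {σ σ' : State} {t : ℕ} (hr : σ.reg r = 0)
      (h : Runs W q σ t σ') : Runs W (ifNonzero r p q) σ (t + 1) σ'
  | while_true {r : ℕ} {p : RAM} {σ σ' σ'' : State} {t t' : ℕ} (hr : σ.reg r ≠ 0)
      (h : Runs W p σ t σ') (h' : Runs W (whileNonzero r p) σ' t' σ'') :
      Runs W (whileNonzero r p) σ (t + t' + 1) σ''
  | while_false {r : ℕ} {p : RAM} {σ : State} (hr : σ.reg r = 0) :
      Runs W (whileNonzero r p) σ 1 σ

end RAM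

/-!
The simulating matroid is the freest extension of the underlying matroid of the order type by
auxiliary elements, truncated to rank `k`, in which certain sets are prescribed to lie in hyperplanes.
A set is independent in it if its trace on the order type is independent, it has at most `k`
elements, and it has fewer than `k` elements if it lies in a prescribed hyperplane (`ExtIndep`). This
is a matroid as soon as the prescribed sets satisfy the local conditions `IsHyperplaneFamily`; they
hold for the planes used here (`isHyperplaneFamily`), which gives `simulation`.

**Forcing the signs.** The chirotope is determined up to a global sign by its signed cocircuits, that
is, by which elements lie on the same side of each hyperplane (`eq_or_eq_neg`). Each hyperplane `F` of
the order type has exactly one greedy basis `t` (`exists_canonical`, `Canonical.eq`) and gets one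
block of auxiliary elements. Of these, the `l j` and `g` span the intersection of `F` with the
hyperplane `H` at infinity. Modulo the `l j` everything happens in a plane, in which `F` and `H` are
two lines that meet in `g`, and "side" is the sign of the product of the functionals `φ` of `F` and
`ψ` of `H`. A complete quadrilateral with vertices `corner α β a`, one of them on `F`, one on `H` and
the other two on a line through `g`, forces a point `a` to be on the same side as a reference point
`q 1` or `q (-1)`: the product of their positions `φ / ψ` is a square (`quadrilateral_pos`). Another
quadrilateral, with two vertices `c` on `F` and two vertices `i` on `H`, forces `q 1` and `q (-1)` to
be harmonic conjugates, hence on different sides (`quadrilateral_harmonic`). Together this is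
`realizesUpToReflection`.

**Representing realizations.** Conversely, a realization is extended by a few elements at a time.
`PartialRep` says that a part of the matroid is represented, with a functional `ψ` whose zeros are
the elements of `H`. The representation need not be valid, so `ψ` may be a generic functional that is
positive on the given points; this avoids coincidences. In each step the new vectors depend on
parameters, the conditions are that certain polynomials do not vanish, and so it suffices to satisfy
them one at a time (`exists_generic`, `PartialRep.extend`). For the quadrilaterals, whose new points
move simultaneously in the direction `g`, this is `PartialRep.extend_pencil`. The result is
`Realizes.exists_representsOn`, and `simulates` combines both directions.

**Linear time.** There are `n ^ (k - 1)` tuples `t` with `O(n)` planes and elements each, so that the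
description `code` of the matroid (`code_describes`) has length linear in the table of the chirotope.
It is written by a program in a language of expressions and statements with loops and searches over
the numbers below `n`. These compile to the random access machine with syntactic bounds: a construct
of loop depth `e` takes `O(n ^ e)` steps, and its numbers are bounded by a fixed power of the input
length (`Expr.computes_compile`, `Stmt.writes_compile`). To keep the depth at most `k`, the
representatives of the parallel classes are first stored in a table behind the input. This
gives `eval_simulation` and `exists_runs_simulationProgram`.
-/

/-! ### Free extensions of a matroid with prescribed hyperplanes -/

/-- Independence in the matroid that arises from `M₀` when the elements of `γ` are added as freely
as the hyperplanes `Z i` permit, truncated to rank `k`. -/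
def ExtIndep {β γ ι : Type*} (M₀ : Matroid β) (k : ℕ) (Z : ι → Set (β ⊕ γ))
    (I : Set (β ⊕ γ)) : Prop :=
  M₀.Indep (Sum.inl ⁻¹' I) ∧ I.ncard ≤ k ∧ ∀ i, I ⊆ Z i → I.ncard < k

/-- The conditions under which sets `Z i` can be prescribed as the hyperplanes of a free extension of
`M₀` of rank `k`: a set of rank `k - 1` lies in no more than one of them, and a hyperplane
contains the closure of each of its subsets of rank `k - 1`. -/
structure IsHyperplaneFamily {β γ ι : Type*} (M₀ : Matroid β) (k : ℕ)
    (Z : ι → Set (β ⊕ γ)) : Prop where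
  pos : 0 < k
  ground : M₀.E = Set.univ
  unique : ∀ (i j : ι) (J : Set (β ⊕ γ)), M₀.Indep (Sum.inl ⁻¹' J) → J.ncard + 1 = k →
    J ⊆ Z i → J ⊆ Z j → Z i = Z j
  closed : ∀ (i : ι) (J : Set (β ⊕ γ)) (e : β), M₀.Indep (Sum.inl ⁻¹' J) → J.ncard + 1 = k →
    J ⊆ Z i → ¬ M₀.Indep (insert e (Sum.inl ⁻¹' J)) → Sum.inl e ∈ Z i

namespace IsHyperplaneFamily

variable {β γ ι : Type*} {M₀ : Matroid β} {k : ℕ} {Z : ι → Set (β ⊕ γ)}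

theorem preimage_insert_inl (e : β) (I : Set (β ⊕ γ)) :
    Sum.inl ⁻¹' (insert (Sum.inl e) I) = insert e (Sum.inl ⁻¹' I) := by
  ext x; simp

theorem preimage_insert_inr (c : γ) (I : Set (β ⊕ γ)) :
    (Sum.inl ⁻¹' (insert (Sum.inr c) I) : Set β) = Sum.inl ⁻¹' I := by
  ext x; simp

theorem preimage_insert_indep [Finite β] [Finite γ]
    {I J : Set (β ⊕ γ)} (hI : M₀.Indep (Sum.inl ⁻¹' I)) (hJ : M₀.Indep (Sum.inl ⁻¹' J))
    (hIJ : I.ncard < J.ncard) : ∃ e ∈ J, e ∉ I ∧ M₀.Indep (Sum.inl ⁻¹' (insert e I)) := by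
  by_cases hc : ∃ c, Sum.inr c ∈ J ∧ Sum.inr c ∉ I
  · obtain ⟨c, hcJ, hcI⟩ := hc
    exact ⟨Sum.inr c, hcJ, hcI, by rwa [preimage_insert_inr]⟩
  push Not at hc
  have key : ∀ K : Set (β ⊕ γ), K.ncard =
      (Sum.inl ⁻¹' K : Set β).ncard + (Sum.inr ⁻¹' K : Set γ).ncard := by
    intro K
    have h1 : K = Sum.inl '' (Sum.inl ⁻¹' K : Set β) ∪ Sum.inr '' (Sum.inr ⁻¹' K : Set γ) := by
      ext (x | x) <;> simp
    conv_lhs => rw [h1]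
    rw [Set.ncard_union_eq, Set.ncard_image_of_injective _ Sum.inl_injective,
      Set.ncard_image_of_injective _ Sum.inr_injective]
    rw [Set.disjoint_left]
    rintro _ ⟨x, _, rfl⟩ ⟨y, _, hy⟩
    cases hy
  have hle : (Sum.inr ⁻¹' J : Set γ).ncard ≤ (Sum.inr ⁻¹' I : Set γ).ncard :=
    Set.ncard_le_ncard (fun c hcJ => hc c hcJ) (Set.toFinite _)
  have hlt : (Sum.inl ⁻¹' I : Set β).ncard < (Sum.inl ⁻¹' J : Set β).ncard := by
    have := key I; have := key J; omega
  have hlt' : (Sum.inl ⁻¹' I : Set β).encard < (Sum.inl ⁻¹' J : Set β).encard := by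
    rw [← (Set.toFinite _).cast_ncard_eq, ← (Set.toFinite _).cast_ncard_eq]
    exact_mod_cast hlt
  obtain ⟨e, he, hi⟩ := hI.augment hJ hlt'
  exact ⟨Sum.inl e, he.1, he.2, by rwa [preimage_insert_inl]⟩

/-- Augmentation holds: if all candidates fail at size `k - 1`, each lies with `I` in a prescribed
hyperplane, which is unique and therefore contains all of `J`. -/
theorem ext_augment [Finite β] [Finite γ] (h : IsHyperplaneFamily M₀ k Z)
    {I J : Set (β ⊕ γ)} (hI : ExtIndep M₀ k Z I) (hJ : ExtIndep M₀ k Z J)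
    (hIJ : I.ncard < J.ncard) : ∃ e ∈ J, e ∉ I ∧ ExtIndep M₀ k Z (insert e I) := by
  obtain ⟨e, heJ, heI, he⟩ := preimage_insert_indep hI.1 hJ.1 hIJ
  have hcard : ∀ x ∉ I, (insert x I).ncard = I.ncard + 1 := fun x hx =>
    Set.ncard_insert_of_notMem hx (Set.toFinite _)
  have hJk := hJ.2.1
  by_cases hk : I.ncard + 1 = k
  · -- if every candidate fails, then all of `J` lies in a single hyperplane
    by_contra hcon
    push Not at hcon
    have hbad : ∀ x ∈ J, x ∉ I → M₀.Indep (Sum.inl ⁻¹' (insert x I)) →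
        ∃ i, insert x I ⊆ Z i := by
      intro x hxJ hxI hx
      by_contra hno
      push Not at hno
      refine hcon x hxJ hxI ⟨hx, ?_, fun i hi => absurd hi (hno i)⟩
      rw [hcard x hxI]; omega
    obtain ⟨i, hi⟩ := hbad e heJ heI he
    have hIi : I ⊆ Z i := (Set.subset_insert _ _).trans hi
    have hJi : J ⊆ Z i := by
      intro x hxJ
      by_cases hxI : x ∈ I
      · exact hIi hxI
      by_cases hx : M₀.Indep (Sum.inl ⁻¹' (insert x I))
      · obtain ⟨j, hj⟩ := hbad x hxJ hxI hx
        rw [h.unique i j I hI.1 hk hIi ((Set.subset_insert _ _).trans hj)]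
        exact hj (Set.mem_insert _ _)
      · rcases x with x | x
        · rw [preimage_insert_inl] at hx
          exact h.closed i I x hI.1 hk hIi hx
        · rw [preimage_insert_inr] at hx
          exact absurd hI.1 hx
    have := hJ.2.2 i hJi
    omega
  · refine ⟨e, heJ, heI, he, ?_, fun _ _ => ?_⟩ <;> rw [hcard e heI] <;> omega

/-- The free extension of `M₀` of rank `k` with prescribed hyperplanes `Z i`. -/
def matroid [Finite β] [Finite γ] (h : IsHyperplaneFamily M₀ k Z) : Matroid (β ⊕ γ) :=
  (IndepMatroid.ofFinite (E := Set.univ) Set.finite_univ (ExtIndep M₀ k Z)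
    ⟨by simp, by simp, fun i _ => by simpa using h.pos⟩
    (fun I J hJ hIJ => by
      have hle := Set.ncard_le_ncard hIJ (Set.toFinite _)
      refine ⟨hJ.1.subset (Set.preimage_mono hIJ), hle.trans hJ.2.1, fun i hi => ?_⟩
      by_contra hcon
      have hk : J.ncard ≤ I.ncard := by have := hJ.2.1; omega
      have hIJ' := Set.eq_of_subset_of_ncard_le hIJ hk (Set.toFinite _)
      subst hIJ'
      exact hcon (hJ.2.2 i hi))
    (fun _ _ => h.ext_augment) (fun _ _ => Set.subset_univ _)).matroid

end IsHyperplaneFamily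

/-! ### Order types: hyperplanes, three-term relations, parallel elements -/

/-- A sign function on tuples changes its sign if two entries are swapped. -/
def IsAlternating {k : ℕ} {α : Type*} (f : (Fin k → α) → SignType) : Prop :=
  ∀ (x : Fin k → α) (i j : Fin k), i ≠ j → f (x ∘ Equiv.swap i j) = -f x

namespace IsAlternating

variable {k : ℕ} {α : Type*} {f g : (Fin k → α) → SignType}

theorem mul_comp_perm (hf : IsAlternating f) (hg : IsAlternating g) (σ : Equiv.Perm (Fin k))
    (x : Fin k → α) : f (x ∘ σ) * g (x ∘ σ) = f x * g x := by
  induction σ using Equiv.Perm.swap_induction_on generalizing x with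
  | one => rfl
  | swap_mul σ i j hij ih =>
    have h : x ∘ (Equiv.swap i j * σ : Equiv.Perm (Fin k)) = (x ∘ Equiv.swap i j) ∘ σ := rfl
    rw [h, ih, hf x i j hij, hg x i j hij]
    generalize f x = s
    generalize g x = t
    revert s t
    decide

theorem comp_perm_eq_zero (hf : IsAlternating f) (σ : Equiv.Perm (Fin k)) (x : Fin k → α) :
    f (x ∘ σ) = 0 ↔ f x = 0 := by
  have h := hf.mul_comp_perm hf σ x
  revert h
  generalize f (x ∘ σ) = s
  generalize f x = t
  revert s t
  decide

end IsAlternating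

theorem exists_perm_of_range_eq {k : ℕ} {α : Type*} {x y : Fin k → α}
    (hx : Function.Injective x) (hy : Function.Injective y) (h : Set.range x = Set.range y) :
    ∃ σ : Equiv.Perm (Fin k), y = x ∘ σ := by
  refine ⟨(Equiv.ofInjective y hy).trans ((Equiv.setCongr h.symm).trans
    (Equiv.ofInjective x hx).symm), ?_⟩
  funext i
  simp [Equiv.apply_ofInjective_symm]

theorem range_snoc {d : ℕ} {α : Type*} (t : Fin d → α) (a : α) :
    Set.range (Fin.snoc (α := fun _ => α) t a : Fin (d + 1) → α) = insert a (Set.range t) := by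
  ext b
  simp only [Set.mem_range, Set.mem_insert_iff]
  constructor
  · rintro ⟨i, rfl⟩
    induction i using Fin.lastCases with
    | last => simp
    | cast i => simp
  · rintro (rfl | ⟨i, rfl⟩)
    · exact ⟨Fin.last d, by simp⟩
    · exact ⟨i.castSucc, by simp⟩

theorem injective_snoc_iff {d : ℕ} {α : Type*} (t : Fin d → α) (a : α) :
    Function.Injective (Fin.snoc (α := fun _ => α) t a : Fin (d + 1) → α) ↔
      Function.Injective t ∧ a ∉ Set.range t := by
  constructor
  · intro h
    refine ⟨fun i j hij => ?_, ?_⟩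
    · have := @h i.castSucc j.castSucc (by simpa using hij)
      simpa using this
    · rintro ⟨i, rfl⟩
      have := @h i.castSucc (Fin.last d) (by simp)
      exact (Fin.castSucc_lt_last i).ne this
  · rintro ⟨h, ha⟩ i j
    induction i using Fin.lastCases with
    | last =>
      induction j using Fin.lastCases with
      | last => simp
      | cast j => intro e; exact absurd ⟨j, by simpa using e.symm⟩ ha
    | cast i =>
      induction j using Fin.lastCases with
      | last => intro e; exact absurd ⟨i, by simpa using e⟩ ha
      | cast j =>
        intro e
        have : i = j := h (by simpa using e)
        rw [this]

/-- Three-term relations: two tuples `t`, `t'` of which the second arises by the exchange of one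
entry within the hyperplane that the first spans, define the same signed cocircuit up to sign. -/
def HasThreeTerm {d n : ℕ} (f : (Fin (d + 1) → Fin n) → SignType) : Prop :=
  ∀ (t : Fin d → Fin n) (j : Fin d) (y a b : Fin n), f (Fin.snoc t y) = 0 →
    f (Fin.snoc t a) ≠ 0 → f (Fin.snoc (Function.update t j y) b) ≠ 0 →
    f (Fin.snoc t a) * f (Fin.snoc (Function.update t j y) b) =
      f (Fin.snoc t b) * f (Fin.snoc (Function.update t j y) a)

namespace AbstractOrderType

variable {d n : ℕ} (O : AbstractOrderType d n)

theorem isAlternating : IsAlternating O.χ := O.alternating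

/-- The position of the element `a` relative to the hyperplane spanned by the tuple `t`. -/
def side (t : Fin d → Fin n) (a : Fin n) : SignType := O.χ (Fin.snoc t a)

theorem isBase_iff (B : Set (Fin n)) : O.matroid.IsBase B ↔ ∃ x, O.χ x ≠ 0 ∧ Set.range x = B := by
  simp [matroid, IsBasis]

theorem subset_ground (X : Set (Fin n)) : X ⊆ O.matroid.E := Set.subset_univ X

theorem ncard_of_isBase {B : Set (Fin n)} (hB : O.matroid.IsBase B) : B.ncard = d + 1 := by
  obtain ⟨x, hx, rfl⟩ := (O.isBase_iff B).1 hB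
  rw [← Set.image_univ, Set.ncard_image_of_injective _ (O.injective_of_ne_zero hx)]
  simp

theorem ncard_le_of_indep {I : Set (Fin n)} (hI : O.matroid.Indep I) : I.ncard ≤ d + 1 := by
  obtain ⟨B, hB, hIB⟩ := hI.exists_isBase_superset
  rw [← O.ncard_of_isBase hB]
  exact Set.ncard_le_ncard hIB (Set.toFinite _)

theorem isBase_of_indep {I : Set (Fin n)} (hI : O.matroid.Indep I) (h : I.ncard = d + 1) :
    O.matroid.IsBase I := by
  obtain ⟨B, hB, hIB⟩ := hI.exists_isBase_superset
  rwa [Set.eq_of_subset_of_ncard_le hIB (by rw [O.ncard_of_isBase hB, h]) (Set.toFinite _)]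

theorem chi_ne_zero_iff (x : Fin (d + 1) → Fin n) :
    O.χ x ≠ 0 ↔ Function.Injective x ∧ O.matroid.Indep (Set.range x) := by
  constructor
  · intro h
    exact ⟨O.injective_of_ne_zero h, ((O.isBase_iff _).2 ⟨x, h, rfl⟩).indep⟩
  · rintro ⟨hx, hi⟩
    have hB := O.isBase_of_indep hi (by
      rw [← Set.image_univ, Set.ncard_image_of_injective _ hx]; simp)
    obtain ⟨y, hy, hyx⟩ := (O.isBase_iff _).1 hB
    obtain ⟨σ, hσ⟩ := exists_perm_of_range_eq hx (O.injective_of_ne_zero hy) hyx.symm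
    rw [hσ] at hy
    exact fun h => hy ((O.isAlternating.comp_perm_eq_zero σ x).2 h)

theorem side_ne_zero_iff (t : Fin d → Fin n) (a : Fin n) :
    O.side t a ≠ 0 ↔ Function.Injective t ∧ a ∉ Set.range t ∧
      O.matroid.Indep (insert a (Set.range t)) := by
  rw [side, chi_ne_zero_iff, injective_snoc_iff, range_snoc, and_assoc]

theorem indep_range_of_side {t : Fin d → Fin n} {a : Fin n} (h : O.side t a ≠ 0) :
    O.matroid.Indep (Set.range t) :=
  ((O.side_ne_zero_iff t a).1 h).2.2.subset (Set.subset_insert _ _)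

theorem mem_closure_iff_side {t : Fin d → Fin n} {a : Fin n} (h : O.side t a ≠ 0) (y : Fin n) :
    y ∈ O.matroid.closure (Set.range t) ↔ O.side t y = 0 := by
  have h1 := (O.side_ne_zero_iff t a).1 h
  have h2 := (O.indep_range_of_side h).notMem_closure_iff (e := y) (Set.mem_univ _)
  rw [← not_iff_not, h2, ← ne_eq, side_ne_zero_iff]
  exact ⟨fun h => ⟨h1.1, h.2, h.1⟩, fun h => ⟨h.2.2, h.2.1⟩⟩

theorem side_range (t : Fin d → Fin n) (j : Fin d) : O.side t (t j) = 0 := by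
  by_contra h
  exact ((O.side_ne_zero_iff t _).1 h).2.1 ⟨j, rfl⟩

theorem hasThreeTerm : HasThreeTerm O.χ := by
  intro t j y a b hy ha hb
  set t' := Function.update t j y with ht'
  have hd : (0 : Fin (d + 1)) ≠ Fin.last d := fun e => by
    have := congrArg Fin.val e
    have := j.2
    simp only [Fin.val_zero, Fin.val_last] at *
    omega
  have hswap : ∀ c, Function.update ((Fin.snoc t a : Fin (d + 1) → Fin n) ∘
      Equiv.swap 0 (Fin.last d)) 0 c = (Fin.snoc t c : Fin (d + 1) → Fin n) ∘
      Equiv.swap 0 (Fin.last d) := by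
    intro c
    funext l
    by_cases hl : l = 0
    · subst hl; simp
    · rw [Function.update_of_ne hl]
      simp only [Function.comp_apply]
      have : Equiv.swap 0 (Fin.last d) l ≠ Fin.last d := fun e => hl
        ((Equiv.swap 0 (Fin.last d)).injective (e.trans (Equiv.swap_apply_left _ _).symm))
      obtain ⟨i, hi⟩ := Fin.exists_castSucc_eq.2 this
      rw [← hi]; simp
  have hx0 : O.χ ((Fin.snoc t a : Fin (d + 1) → Fin n) ∘ Equiv.swap 0 (Fin.last d)) ≠ 0 :=
    fun e => ha ((O.isAlternating.comp_perm_eq_zero _ _).1 e)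
  obtain ⟨i, hi⟩ := O.exchange _ _ (mul_ne_zero hx0 hb)
  have hne : O.χ ((Fin.snoc t ((Fin.snoc t' b : Fin (d + 1) → Fin n) i) : Fin (d + 1) → Fin n)) ≠ 0 := by
    intro e
    rw [hswap, (O.isAlternating.comp_perm_eq_zero _ _).2 e, zero_mul] at hi
    exact mul_ne_zero hx0 hb hi.symm
  induction i using Fin.lastCases with
  | last =>
    rw [hswap] at hi
    have h1 : Function.update (Fin.snoc t' b : Fin (d + 1) → Fin n) (Fin.last d)
        (((Fin.snoc t a : Fin (d + 1) → Fin n) ∘ Equiv.swap 0 (Fin.last d)) 0) = Fin.snoc t' a := by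
      simp [Fin.update_snoc_last]
    rw [h1, O.alternating _ _ _ hd, O.alternating _ _ _ hd] at hi
    simp only [Fin.snoc_last, neg_mul] at hi
    exact (neg_injective hi).symm
  | cast i =>
    exfalso
    rw [Fin.snoc_castSucc] at hne
    by_cases hij : i = j
    · subst hij
      rw [ht', Function.update_self] at hne
      exact hne hy
    · rw [ht', Function.update_of_ne hij] at hne
      exact hne (O.side_range t i)

theorem isNonloop (hd : 0 < d) (e : Fin n) : O.matroid.IsNonloop e := by
  rw [← Matroid.indep_singleton]
  by_contra hloop
  have h0 : ∀ x : Fin (d + 1) → Fin n, (∃ i, x i = e) → O.χ x = 0 := by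
    rintro x ⟨i, rfl⟩
    by_contra hx
    exact hloop (((O.chi_ne_zero_iff x).1 hx).2.subset (by rintro _ rfl; exact ⟨i, rfl⟩))
  have key : ∀ b, O.χ b ≠ 1 := by
    intro b hb
    have hall : ∀ i : Fin (d + 2), i ≠ 0 →
        O.χ ((Fin.cons e b : Fin (d + 2) → Fin n) ∘ i.succAbove) = 0 := by
      intro i hi
      refine h0 _ ⟨0, ?_⟩
      simp [Fin.succAbove_ne_zero_zero hi]
    have hzero : (Fin.cons e b : Fin (d + 2) → Fin n) ∘ (0 : Fin (d + 2)).succAbove = b := by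
      funext i; simp
    have := O.acyclic (Fin.cons e b) (fun i => by
      by_cases hi : i = 0
      · subst hi; rw [hzero, hb]; simp
      · rw [hall i hi, mul_zero]) 0
    rw [hzero, hb] at this
    exact absurd this (by decide)
  obtain ⟨b, hb⟩ := O.nonzero
  have hne : (0 : Fin (d + 1)) ≠ Fin.last d := fun e => hd.ne (by
    simpa using congrArg Fin.val e)
  have h2 := O.alternating b 0 (Fin.last d) hne
  have h3 := key b
  have h4 := key (b ∘ Equiv.swap 0 (Fin.last d))
  rw [h2] at h4
  revert hb h3 h4
  generalize O.χ b = s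
  revert s
  decide

end AbstractOrderType

namespace AbstractOrderType

variable {d n : ℕ} (O : AbstractOrderType d n)

/-- Two elements are parallel if they span the same flat, i.e. if they are the same point. -/
def Parallel (a b : Fin n) : Prop := O.matroid.closure {a} = O.matroid.closure {b}

theorem parallel_iff (hd : 0 < d) (a b : Fin n) :
    O.Parallel a b ↔ a = b ∨ ¬ O.matroid.Indep {a, b} := by
  rw [Parallel, (O.isNonloop hd a).closure_eq_closure_iff_eq_or_dep (O.isNonloop hd b)]

theorem Parallel.symm {O : AbstractOrderType d n} {a b : Fin n} (h : O.Parallel a b) :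
    O.Parallel b a := Eq.symm h

theorem Parallel.mem_closure {O : AbstractOrderType d n} {a b : Fin n}
    (h : O.Parallel a b) {X : Set (Fin n)} (hb : b ∈ O.matroid.closure X) :
    a ∈ O.matroid.closure X := by
  have h1 : a ∈ O.matroid.closure {b} := by
    rw [← h]; exact O.matroid.mem_closure_of_mem rfl (O.subset_ground _)
  exact O.matroid.closure_subset_closure_of_subset_closure
    (Set.singleton_subset_iff.2 hb) h1

theorem Parallel.side_eq_zero {O : AbstractOrderType d n} {a b : Fin n}
    (h : O.Parallel a b) {t : Fin d → Fin n} {c : Fin n} (hc : O.side t c ≠ 0)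
    (hb : O.side t b = 0) : O.side t a = 0 :=
  (O.mem_closure_iff_side hc a).1 (h.mem_closure ((O.mem_closure_iff_side hc b).2 hb))

theorem eq_zero_of_parallel (hd : 0 < d) {a b : Fin n} (h : O.Parallel a b)
    {x : Fin (d + 1) → Fin n} {i j : Fin (d + 1)} (hij : i ≠ j) (hi : x i = a) (hj : x j = b) :
    O.χ x = 0 := by
  by_contra hx
  obtain ⟨hinj, hind⟩ := (O.chi_ne_zero_iff x).1 hx
  rcases (O.parallel_iff hd a b).1 h with h | h
  · exact hij (hinj (by rw [hi, hj, h]))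
  · exact h (hind.subset (by
      rintro _ (rfl | rfl)
      exacts [⟨i, hi⟩, ⟨j, hj⟩]))

/-- Parallel elements lie on the same side of every hyperplane, since the order type is acyclic. -/
theorem Parallel.side_eq (hd : 0 < d) {O : AbstractOrderType d n} {a b : Fin n}
    (h : O.Parallel a b) {t : Fin d → Fin n} : O.side t a = O.side t b := by
  by_cases h0 : O.side t a = 0
  · by_contra hb
    exact hb (h0.trans (h.symm.side_eq_zero (Ne.symm (h0 ▸ hb)) h0).symm)
  by_cases h0' : O.side t b = 0
  · exact absurd (h.side_eq_zero h0 h0') h0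
  have key : ∀ a b : Fin n, O.Parallel a b → O.side t a ≠ 0 → O.side t b ≠ 0 →
      ¬ ((-1 : SignType) ^ d * O.side t b = 1 ∧ (-1 : SignType) ^ (d + 1) * O.side t a = 1) := by
    rintro a b h ha hb ⟨h1, h2⟩
    set x : Fin (d + 2) → Fin n := Fin.snoc (Fin.snoc t a : Fin (d + 1) → Fin n) b with hx
    have hlast : x ∘ (Fin.last (d + 1)).succAbove = Fin.snoc t a := by
      funext i; simp [hx]
    have hmid : x ∘ (Fin.last d).castSucc.succAbove = Fin.snoc t b := by
      funext i
      induction i using Fin.lastCases with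
      | last => simp [hx]
      | cast i =>
        have : (Fin.last d).castSucc.succAbove i.castSucc = i.castSucc.castSucc :=
          Fin.succAbove_of_castSucc_lt _ _ (by simp [Fin.lt_def])
        simp [hx, this]
    have hrest : ∀ i : Fin d, O.χ (x ∘ i.castSucc.castSucc.succAbove) = 0 := by
      intro i
      obtain ⟨j, hj⟩ := Fin.exists_succAbove_eq
        (show Fin.last (d + 1) ≠ i.castSucc.castSucc from (Fin.castSucc_lt_last _).ne')
      obtain ⟨l, hl⟩ := Fin.exists_succAbove_eq
        (show (Fin.last d).castSucc ≠ i.castSucc.castSucc from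
          fun e => (Fin.castSucc_lt_last i).ne' (Fin.castSucc_injective _ e))
      refine O.eq_zero_of_parallel hd h (i := l) (j := j) ?_ ?_ ?_
      · intro e
        rw [e, hj] at hl
        exact (Fin.castSucc_lt_last _).ne' hl
      · simp [hl, hx]
      · simp [hj, hx]
    have := O.acyclic x (fun i => by
      induction i using Fin.lastCases with
      | last => rw [hlast, ← side, Fin.val_last, h2]; decide
      | cast i =>
        induction i using Fin.lastCases with
        | last => rw [hmid, ← side, Fin.val_castSucc, Fin.val_last, h1]; decide
        | cast i => rw [hrest, mul_zero]) (Fin.last _)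
    rw [hlast] at this
    exact ha this
  have h1 := key a b h h0 h0'
  have h2 := key b a h.symm h0' h0
  have h3 : (-1 : SignType) ^ d = 1 ∨ (-1 : SignType) ^ d = -1 := neg_one_pow_eq_or _ d
  rw [pow_succ] at h1 h2
  revert h0 h0' h1 h2 h3
  generalize O.side t a = s
  generalize O.side t b = s'
  generalize (-1 : SignType) ^ d = e
  revert s s' e
  decide

/-- The first element of the parallel class of `a`. -/
noncomputable def rep (a : Fin n) : Fin n :=
  (wellFounded_lt (α := Fin n)).min {b | O.Parallel a b} ⟨a, rfl⟩

theorem parallel_rep (a : Fin n) : O.Parallel a (O.rep a) :=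
  (wellFounded_lt (α := Fin n)).min_mem {b | O.Parallel a b} ⟨a, rfl⟩

theorem rep_le {a b : Fin n} (h : O.Parallel a b) : O.rep a ≤ b :=
  not_lt.1 ((wellFounded_lt (α := Fin n)).not_lt_min {b | O.Parallel a b} h)

theorem rep_eq_of_parallel {a b : Fin n} (h : O.Parallel a b) : O.rep a = O.rep b :=
  le_antisymm (O.rep_le (Eq.trans h (O.parallel_rep b))) (O.rep_le (Eq.trans h.symm (O.parallel_rep a)))

theorem rep_rep (a : Fin n) : O.rep (O.rep a) = O.rep a :=
  (O.rep_eq_of_parallel (O.parallel_rep a)).symm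

/-! ### Canonical bases of hyperplanes -/

/-- The tuple `t` is the greedy basis of the hyperplane that it spans: it is increasing, and none of
its entries can be exchanged for a smaller element of the hyperplane. -/
def Canonical (t : Fin d → Fin n) : Prop :=
  StrictMono t ∧ ∃ a, O.side t a ≠ 0 ∧
    ∀ j y, O.side t y = 0 → y < t j → O.side (Function.update t j y) a = 0

/-- Exchanging an entry of a basis of a hyperplane for an element of the hyperplane preserves the
hyperplane. -/
theorem side_update_ne_zero_iff {t : Fin d → Fin n} {j : Fin d} {y c : Fin n}
    (hy : O.side t y = 0) (hc : O.side (Function.update t j y) c ≠ 0)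
    {c' : Fin n} (hc' : O.side t c' ≠ 0) (a : Fin n) :
    O.side (Function.update t j y) a ≠ 0 ↔ O.side t a ≠ 0 := by
  constructor
  · intro h
    have := O.hasThreeTerm t j y c' a hy hc' h
    exact left_ne_zero_of_mul (this ▸ mul_ne_zero hc' h)
  · intro h
    have := O.hasThreeTerm t j y a c hy h hc
    exact right_ne_zero_of_mul (this ▸ mul_ne_zero h hc)

theorem Canonical.side_update {O : AbstractOrderType d n} {t : Fin d → Fin n} (h : O.Canonical t)
    {j : Fin d} {y : Fin n} (hy : O.side t y = 0) (hj : y < t j) (a : Fin n) :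
    O.side (Function.update t j y) a = 0 := by
  obtain ⟨-, c, hc, hcan⟩ := h
  by_contra ha
  exact (O.side_update_ne_zero_iff hy ha hc c).2 hc (hcan j y hy hj)

theorem side_ne_zero_iff_of_range {t t' : Fin d → Fin n} (ht : Function.Injective t)
    (ht' : Function.Injective t') (h : Set.range t = Set.range t') (a : Fin n) :
    O.side t a ≠ 0 ↔ O.side t' a ≠ 0 := by
  rw [side_ne_zero_iff, side_ne_zero_iff, h]
  simp [ht, ht']

/-- Sorting a tuple preserves its range and its sum, the termination measure for the exchanges that
lead to a canonical basis. -/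
theorem exists_strictMono {t : Fin d → Fin n} (ht : Function.Injective t) :
    ∃ t' : Fin d → Fin n, StrictMono t' ∧ Set.range t' = Set.range t ∧
      ∑ i, (t' i : ℕ) = ∑ i, (t i : ℕ) := by
  classical
  have hc : (Finset.univ.image t).card = d := by
    rw [Finset.card_image_of_injective _ ht]; simp
  refine ⟨(Finset.univ.image t).orderEmbOfFin hc, OrderEmbedding.strictMono _, by simp, ?_⟩
  rw [← Finset.sum_image (s := Finset.univ) (g := t) (f := fun a : Fin n => (a : ℕ))
    (fun _ _ _ _ h => ht h), ← Finset.sum_image (s := Finset.univ)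
    (g := (Finset.univ.image t).orderEmbOfFin hc) (f := fun a : Fin n => (a : ℕ))
    (fun _ _ _ _ h => (OrderEmbedding.strictMono _).injective h), Finset.image_orderEmbOfFin_univ]

/-- Every hyperplane has a canonical basis. -/
theorem exists_canonical {t : Fin d → Fin n} {a : Fin n} (ha : O.side t a ≠ 0) :
    ∃ t', O.Canonical t' ∧ ∀ b, O.side t' b = 0 ↔ O.side t b = 0 := by
  let S : Set (Fin d → Fin n) := {u | StrictMono u ∧ ∀ b, O.side u b ≠ 0 ↔ O.side t b ≠ 0}
  have hS : S.Nonempty := by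
    have hinj := ((O.side_ne_zero_iff t a).1 ha).1
    obtain ⟨u, hu, hr, -⟩ := exists_strictMono hinj
    exact ⟨u, hu, fun b => O.side_ne_zero_iff_of_range hu.injective hinj hr b⟩
  obtain ⟨u, ⟨hu, hut⟩, hmin⟩ := (measure fun u : Fin d → Fin n => ∑ i, (u i : ℕ)).wf.has_min S hS
  have hua := (hut a).2 ha
  refine ⟨u, ⟨hu, a, hua, ?_⟩, fun b => not_iff_not.1 (hut b)⟩
  intro j y hy hj
  by_contra hcon
  obtain ⟨u', hu', hr, hsum⟩ := exists_strictMono ((O.side_ne_zero_iff _ _).1 hcon).1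
  refine hmin u' ⟨hu', fun b => ?_⟩ ?_
  · rw [O.side_ne_zero_iff_of_range hu'.injective ((O.side_ne_zero_iff _ _).1 hcon).1 hr,
      O.side_update_ne_zero_iff hy hcon hua, hut]
  · change ∑ i, (u' i : ℕ) < ∑ i, (u i : ℕ)
    rw [hsum]
    refine Finset.sum_lt_sum (fun i _ => ?_) ⟨j, Finset.mem_univ _, by simpa using hj⟩
    by_cases hij : i = j
    · subst hij; simpa using hj.le
    · rw [Function.update_of_ne hij]

/-- Exchange within a hyperplane: an element `y` of a second basis can replace an entry of the first
that is not in the second. -/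
theorem exists_exchange {t t' : Fin d → Fin n} {a : Fin n} (ha : O.side t a ≠ 0)
    (h' : O.side t' a ≠ 0) {y : Fin n} (hy : O.side t y = 0) (hy' : y ∈ Set.range t')
    (hyt : y ∉ Set.range t) :
    ∃ j, t j ∉ Set.range t' ∧ O.side (Function.update t j y) a ≠ 0 := by
  have hI := O.indep_range_of_side ha
  have hcl := (O.mem_closure_iff_side ha y).2 hy
  have hC := hI.fundCircuit_isCircuit hcl hyt
  obtain ⟨x, hxC, hx⟩ : ∃ x ∈ O.matroid.fundCircuit y (Set.range t), x ∉ Set.range t' := by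
    by_contra hcon
    push Not at hcon
    exact hC.not_indep ((O.indep_range_of_side h').subset hcon)
  obtain ⟨j, rfl⟩ : x ∈ Set.range t := by
    rcases O.matroid.fundCircuit_subset_insert y _ hxC with rfl | h
    · exact absurd hy' hx
    · exact h
  refine ⟨j, hx, ?_⟩
  have hind := (hI.mem_fundCircuit_iff hcl hyt).1 hxC
  have hinj := ((O.side_ne_zero_iff t a).1 ha).1
  have hyj : y ≠ t j := fun e => hyt ⟨j, e.symm⟩
  have hr : Set.range (Function.update t j y) = insert y (Set.range t) \ {t j} := by
    ext b
    simp only [Set.mem_range, Set.mem_insert_iff, Set.mem_sdiff, Set.mem_singleton_iff]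
    constructor
    · rintro ⟨i, rfl⟩
      by_cases hij : i = j
      · subst hij; simp [hyj]
      · rw [Function.update_of_ne hij]
        exact ⟨Or.inr ⟨i, rfl⟩, fun e => hij (hinj e)⟩
    · rintro ⟨rfl | ⟨i, rfl⟩, hb⟩
      · exact ⟨j, by simp⟩
      · exact ⟨i, Function.update_of_ne (fun e => hb (by rw [e])) _ _⟩
  have ha1 : a ∉ O.matroid.closure (Set.range t) := fun h => ha ((O.mem_closure_iff_side ha a).1 h)
  have ha2 : a ∉ O.matroid.closure (Set.range (Function.update t j y)) := fun h => ha1 (by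
    refine O.matroid.closure_subset_closure_of_subset_closure ?_ h
    rw [hr]
    rintro b ⟨rfl | hb, -⟩
    · exact hcl
    · exact O.matroid.mem_closure_of_mem hb (O.subset_ground _))
  rw [← hr] at hind
  rw [side_ne_zero_iff]
  have h3 := (hind.notMem_closure_iff (e := a) (Set.mem_univ _)).1 ha2
  refine ⟨?_, h3.2, h3.1⟩
  intro i i' hii
  by_cases hi : i = j
  · by_cases hi' : i' = j
    · rw [hi, hi']
    · subst hi
      rw [Function.update_self, Function.update_of_ne hi'] at hii
      exact absurd ⟨i', hii.symm⟩ hyt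
  · by_cases hi' : i' = j
    · subst hi'
      rw [Function.update_self, Function.update_of_ne hi] at hii
      exact absurd ⟨i, hii⟩ hyt
    · rw [Function.update_of_ne hi, Function.update_of_ne hi'] at hii
      exact hinj hii

/-- The greedy property: an element of another basis is in the canonical basis if that other basis
contains all smaller elements of the canonical one. -/
theorem Canonical.mem_of_forall_lt {O : AbstractOrderType d n} {t t' : Fin d → Fin n} {a : Fin n}
    (ht : O.Canonical t) (ha : O.side t a ≠ 0) (ha' : O.side t' a ≠ 0) {y : Fin n}
    (hy : O.side t y = 0) (hy' : y ∈ Set.range t')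
    (hlt : ∀ x ∈ Set.range t, x < y → x ∈ Set.range t') : y ∈ Set.range t := by
  by_contra hyt
  obtain ⟨j, hj, hne⟩ := O.exists_exchange ha ha' hy hy' hyt
  rcases lt_trichotomy y (t j) with h | h | h
  · exact hne (ht.side_update hy h a)
  · exact hyt ⟨j, h.symm⟩
  · exact hj (hlt _ ⟨j, rfl⟩ h)

/-- A hyperplane has only one canonical basis. -/
theorem Canonical.eq {O : AbstractOrderType d n} {t t' : Fin d → Fin n} (ht : O.Canonical t)
    (ht' : O.Canonical t') (h : ∀ b, O.side t b = 0 ↔ O.side t' b = 0) : t = t' := by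
  obtain ⟨a, ha, -⟩ := ht.2
  have ha' : O.side t' a ≠ 0 := fun e => ha ((h a).2 e)
  have hmem : ∀ y, y ∈ Set.range t ↔ y ∈ Set.range t' := by
    intro y
    induction y using WellFoundedLT.induction with
    | ind y ih =>
      constructor
      · intro hy
        refine ht'.mem_of_forall_lt ha' ha ((h y).1 ?_) hy fun x hx hxy => (ih x hxy).2 hx
        obtain ⟨j, rfl⟩ := hy
        exact O.side_range t j
      · intro hy
        refine ht.mem_of_forall_lt ha ha' ((h y).2 ?_) hy fun x hx hxy => (ih x hxy).1 hx
        obtain ⟨j, rfl⟩ := hy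
        exact O.side_range t' j
  exact (StrictMono.range_inj ht.1 ht'.1).1 (Set.ext hmem)

/-! ### A chirotope is determined by the hyperplanes up to a global sign -/

/-- Agreement up to sign on the canonical basis of a hyperplane extends to its other bases by
exchanges; the three-term relation controls each of them. -/
theorem mul_side_eq (f : (Fin (d + 1) → Fin n) → SignType)
    (hf : IsAlternating f) (h3 : HasThreeTerm f) (hz : ∀ x, f x = 0 ↔ O.χ x = 0)
    (hloc : ∀ t, O.Canonical t → ∀ a b, O.side t a ≠ 0 → O.side t b ≠ 0 →
      f (Fin.snoc t a) * O.side t a = f (Fin.snoc t b) * O.side t b)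
    (t : Fin d → Fin n) (a b : Fin n) (ha : O.side t a ≠ 0) (hb : O.side t b ≠ 0) :
    f (Fin.snoc t a) * O.side t a = f (Fin.snoc t b) * O.side t b := by
  obtain ⟨c, hc, hct⟩ := O.exists_canonical ha
  have hca : O.side c a ≠ 0 := fun e => ha ((hct a).1 e)
  have hcb : O.side c b ≠ 0 := fun e => hb ((hct b).1 e)
  induction hN : (Set.range c \ Set.range t).ncard using Nat.strong_induction_on generalizing t with
  | _ N ih =>
    have hinj := ((O.side_ne_zero_iff t a).1 ha).1
    have hcinj := ((O.side_ne_zero_iff c a).1 hca).1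
    by_cases hsub : Set.range c ⊆ Set.range t
    · have heq : Set.range c = Set.range t := by
        refine Set.eq_of_subset_of_ncard_le hsub ?_ (Set.toFinite _)
        rw [← Set.image_univ, ← Set.image_univ, Set.ncard_image_of_injective _ hinj,
          Set.ncard_image_of_injective _ hcinj]
      have key : ∀ e, O.side t e ≠ 0 → O.side c e ≠ 0 →
          f (Fin.snoc c e) * O.side c e = f (Fin.snoc t e) * O.side t e := by
        intro e he hce
        obtain ⟨σ, hσ⟩ := exists_perm_of_range_eq (O.injective_of_ne_zero he)
          (O.injective_of_ne_zero hce) (by rw [range_snoc, range_snoc, heq])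
        rw [side, side, hσ]
        exact hf.mul_comp_perm O.isAlternating σ _
      rw [← key a ha hca, ← key b hb hcb]
      exact hloc c hc a b hca hcb
    · obtain ⟨y, hyc, hyt⟩ := Set.not_subset.1 hsub
      have hy : O.side t y = 0 := by
        obtain ⟨i, rfl⟩ := hyc
        exact (hct _).1 (O.side_range c i)
      -- exchange an entry of `t` for an entry of the canonical basis `c`
      obtain ⟨j, hj, hja⟩ := O.exists_exchange ha hca hy hyc hyt
      set u := Function.update t j y with hu
      have hiff := O.side_update_ne_zero_iff hy hja ha
      have hub := (hiff b).2 hb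
      have hlt : (Set.range c \ Set.range u).ncard < N := by
        rw [← hN]
        refine Set.ncard_lt_ncard ?_ (Set.toFinite _)
        refine ⟨?_, fun hcon => (hcon ⟨hyc, hyt⟩).2 ⟨j, by simp [hu]⟩⟩
        rintro x ⟨hxc, hxu⟩
        refine ⟨hxc, ?_⟩
        rintro ⟨i, rfl⟩
        by_cases hij : i = j
        · subst hij; exact hj hxc
        · exact hxu ⟨i, by rw [hu, Function.update_of_ne hij]⟩
      have hIH := ih _ hlt u hja hub
        (fun e => (hct e).trans (not_iff_not.1 (hiff e).symm)) rfl
      -- both functions satisfy the same three-term relation for this exchange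
      have e1 := O.hasThreeTerm t j y a b hy ha hub
      have e2 := h3 t j y a b ((hz _).2 hy) (fun e => ha ((hz _).1 e)) (fun e => hub ((hz _).1 e))
      have n1 : f (Fin.snoc u a) ≠ 0 := fun e => hja ((hz _).1 e)
      have n2 : f (Fin.snoc u b) ≠ 0 := fun e => hub ((hz _).1 e)
      change O.side t a * O.side u b = O.side t b * O.side u a at e1
      change f (Fin.snoc t a) * f (Fin.snoc u b) = f (Fin.snoc t b) * f (Fin.snoc u a) at e2
      have a3 : ∀ p q r s p' q' r' s' : SignType, p * q = r * s → p' * q' = r' * s' →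
          (p * p') * (q * q') = (r * r') * (s * s') := by
        intro p q r s p' q' r' s' h h'
        rw [mul_mul_mul_comm, h, h', mul_mul_mul_comm]
      have := a3 _ _ _ _ _ _ _ _ e2 e1
      rw [hIH] at this
      exact mul_right_cancel₀ (mul_ne_zero n2 hub) this

/-- A sign function with the zero pattern of the chirotope that has, up to sign, the same signed
cocircuits for the canonical bases of all hyperplanes, is the chirotope up to sign. -/
theorem eq_or_eq_neg (f : (Fin (d + 1) → Fin n) → SignType)
    (hf : IsAlternating f) (h3 : HasThreeTerm f) (hz : ∀ x, f x = 0 ↔ O.χ x = 0)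
    (hloc : ∀ t, O.Canonical t → ∀ a b, O.side t a ≠ 0 → O.side t b ≠ 0 →
      f (Fin.snoc t a) * O.side t a = f (Fin.snoc t b) * O.side t b) :
    (∀ x, f x = O.χ x) ∨ (∀ x, f x = -O.χ x) := by
  obtain ⟨z, hzne⟩ := O.nonzero
  have hconst : ∀ x, O.χ x ≠ 0 → f x * O.χ x = f z * O.χ z := by
    intro x hx
    induction hN : (Set.range x \ Set.range z).ncard using Nat.strong_induction_on
      generalizing x with
    | _ N ih =>
      by_cases hsub : Set.range x ⊆ Set.range z
      · have heq : Set.range x = Set.range z := by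
          refine Set.eq_of_subset_of_ncard_le hsub ?_ (Set.toFinite _)
          rw [O.ncard_of_isBase ((O.isBase_iff _).2 ⟨x, hx, rfl⟩),
            O.ncard_of_isBase ((O.isBase_iff _).2 ⟨z, hzne, rfl⟩)]
        obtain ⟨σ, hσ⟩ := exists_perm_of_range_eq (O.injective_of_ne_zero hzne)
          (O.injective_of_ne_zero hx) heq.symm
        rw [hσ]
        exact hf.mul_comp_perm O.isAlternating σ _
      · obtain ⟨_, ⟨i, rfl⟩, hiz⟩ := Set.not_subset.1 hsub
        obtain ⟨y, ⟨hyz, hyx⟩, hB⟩ := ((O.isBase_iff _).2 ⟨x, hx, rfl⟩).exchange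
          ((O.isBase_iff _).2 ⟨z, hzne, rfl⟩) ⟨⟨i, rfl⟩, hiz⟩
        have hinj := O.injective_of_ne_zero hx
        let t : Fin d → Fin n := x ∘ i.succAbove
        have htinj : Function.Injective t := hinj.comp Fin.succAbove_right_injective
        have hrt : Set.range t = Set.range x \ {x i} := by
          ext b
          constructor
          · rintro ⟨l, rfl⟩
            exact ⟨⟨_, rfl⟩, fun e => Fin.succAbove_ne i l (hinj e)⟩
          · rintro ⟨⟨l, rfl⟩, hl⟩
            obtain ⟨l', hl'⟩ := Fin.exists_succAbove_eq (x := l) (y := i)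
              (fun e => hl (by rw [e]; rfl))
            exact ⟨l', by simp [t, hl']⟩
        have hsx : O.side t (x i) ≠ 0 := by
          rw [side_ne_zero_iff]
          refine ⟨htinj, by rw [hrt]; simp, ?_⟩
          rw [hrt, Set.insert_sdiff_singleton,
            Set.insert_eq_of_mem (Set.mem_range_self i)]
          exact ((O.chi_ne_zero_iff x).1 hx).2
        have hsy : O.side t y ≠ 0 := by
          rw [side_ne_zero_iff]
          refine ⟨htinj, by rw [hrt]; exact fun h => hyx h.1, ?_⟩
          rw [hrt]
          exact hB.indep
        obtain ⟨σ, hσ⟩ := exists_perm_of_range_eq (O.injective_of_ne_zero hsx) hinj (by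
          rw [range_snoc, hrt, Set.insert_sdiff_singleton,
            Set.insert_eq_of_mem (Set.mem_range_self i)])
        have e1 : f x * O.χ x = f (Fin.snoc t (x i)) * O.χ (Fin.snoc t (x i)) := by
          conv_lhs => rw [hσ]
          exact hf.mul_comp_perm O.isAlternating σ _
        rw [e1]
        have e2 := O.mul_side_eq f hf h3 hz hloc t (x i) y hsx hsy
        rw [side, side] at e2
        rw [e2]
        refine ih _ ?_ _ hsy rfl
        rw [← hN]
        refine Set.ncard_lt_ncard ?_ (Set.toFinite _)
        rw [range_snoc, hrt]
        refine ⟨?_, fun hcon => ?_⟩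
        · rintro b ⟨rfl | hb, hbz⟩
          · exact absurd hyz hbz
          · exact ⟨hb.1, hbz⟩
        · rcases (hcon ⟨⟨i, rfl⟩, hiz⟩).1 with h | h
          · exact hyx ⟨i, h⟩
          · exact h.2 rfl
  have hfz : f z ≠ 0 := fun e => hzne ((hz z).1 e)
  have a1 : ∀ p q r s : SignType, p * q = r * s → p ≠ 0 → q ≠ 0 → r = s → s ≠ 0 → p = q := by decide
  have a2 : ∀ p q r s : SignType, p * q = r * s → p ≠ 0 → q ≠ 0 → r ≠ s → r ≠ 0 → s ≠ 0 →
      p = -q := by decide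
  by_cases hs : f z = O.χ z
  · left
    intro x
    by_cases hx : O.χ x = 0
    · rw [hx, (hz x).2 hx]
    · exact a1 _ _ _ _ (hconst x hx) (fun e => hx ((hz x).1 e)) hx hs hzne
  · right
    intro x
    by_cases hx : O.χ x = 0
    · rw [hx, (hz x).2 hx]; rfl
    · exact a2 _ _ _ _ (hconst x hx) (fun e => hx ((hz x).1 e)) hx hs hfz hzne

end AbstractOrderType

/-! ### The simulating matroid -/

/-- The auxiliary elements that belong to a tuple `t`. If `t` spans a hyperplane `F`, then `l j` and
`g` are points of the intersection of `F` with the hyperplane at infinity, the `c b` are points of `F`,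
the `i b` are points at infinity, `q 1` and `q (-1)` are points on the two sides of `F` (and `q 0` is
not used). The points `corner α β a` link the position of `a` to the position of `q 1` or `q (-1)`. -/
inductive Aux (m n : ℕ) where
  | l (j : Fin m)
  | g
  | c (b : Bool)
  | i (b : Bool)
  | q (s : SignType)
  | corner (α β : Bool) (a : Fin n)

namespace Aux

variable {m n : ℕ}

/-- The auxiliary elements in the hyperplane at infinity. -/
def AtInfinity : Aux m n → Prop
  | l _ => True
  | g => True
  | i _ => True
  | corner α β _ => α = true ∧ β = true
  | _ => False

/-- The auxiliary elements in the hyperplane spanned by the tuple. -/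
def OnFlat : Aux m n → Prop
  | l _ => True
  | g => True
  | c _ => True
  | corner α β _ => α = false ∧ β = false
  | _ => False

/-- The lines `c x, i y, q (±1)` of a complete quadrilateral, which force `q 1` and `q (-1)` to be
harmonic conjugates with respect to the two hyperplanes. -/
def OnHarmonic (x y : Bool) : Aux m n → Prop
  | l _ => True
  | c b => b = x
  | i b => b = y
  | q s => s = if x = y then 1 else -1
  | _ => False

/-- The auxiliary elements on the lines of a complete quadrilateral that pass through `a`. -/
def OnRow (a : Fin n) (β : Bool) : Aux m n → Prop
  | l _ => True
  | corner _ β' a' => β' = β ∧ a' = a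
  | _ => False

/-- The auxiliary elements on the lines of a complete quadrilateral that pass through `q s`. -/
def OnColumn (a : Fin n) (s : SignType) (α : Bool) : Aux m n → Prop
  | l _ => True
  | q s' => s' = s
  | corner α' _ a' => α' = α ∧ a' = a
  | _ => False

/-- The diagonal of a complete quadrilateral that passes through `g`. -/
def OnDiagonal (a : Fin n) : Aux m n → Prop
  | l _ => True
  | g => True
  | corner α β a' => α ≠ β ∧ a' = a
  | _ => False

end Aux

/-- The elements of the simulating matroid: those of the order type and a set of auxiliary elements
for every tuple. -/
abbrev Elt (m n : ℕ) := Fin n ⊕ ((Fin (m + 2) → Fin n) × Aux m n)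

/-- The names of the prescribed hyperplanes of the simulating matroid. -/
inductive Plane (m n : ℕ) where
  | infinity
  | flat (t : Fin (m + 2) → Fin n)
  | harmonic (t : Fin (m + 2) → Fin n) (x y : Bool)
  | row (t : Fin (m + 2) → Fin n) (a : Fin n) (β : Bool)
  | column (t : Fin (m + 2) → Fin n) (a : Fin n) (α : Bool)
  | diagonal (t : Fin (m + 2) → Fin n) (a : Fin n)

/-- The tuple whose auxiliary elements lie on the prescribed hyperplane, if there is only one. -/
def Plane.block {m n : ℕ} : Plane m n → Option (Fin (m + 2) → Fin n)
  | .infinity => none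
  | .flat t => some t
  | .harmonic t _ _ => some t
  | .row t _ _ => some t
  | .column t _ _ => some t
  | .diagonal t _ => some t

namespace AbstractOrderType

variable {m n : ℕ} (O : AbstractOrderType (m + 2) n)

/-- The elements of a prescribed hyperplane. -/
def planeSet : Plane m n → Set (Elt m n)
  | .infinity => {x | x.elim (fun _ => False) fun p => p.2.AtInfinity}
  | .flat t => {x | x.elim (fun e => O.side t e = 0) fun p => p.1 = t ∧ p.2.OnFlat}
  | .harmonic t b b' => {x | x.elim (fun _ => False) fun p => p.1 = t ∧ p.2.OnHarmonic b b'}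
  | .row t a β => {x | x.elim (fun e => O.Parallel a e) fun p => p.1 = t ∧ p.2.OnRow a β}
  | .column t a α => {x | x.elim (fun _ => False) fun p => p.1 = t ∧ p.2.OnColumn a (O.side t a) α}
  | .diagonal t a => {x | x.elim (fun _ => False) fun p => p.1 = t ∧ p.2.OnDiagonal a}

/-- Only canonical tuples, so that every hyperplane is treated once, only one element of each parallel
class, and only elements outside of the hyperplane are used. -/
def PlaneValid : Plane m n → Prop
  | .infinity => True
  | .flat t => O.Canonical t
  | .harmonic t _ _ => O.Canonical t
  | .row t a _ => O.Canonical t ∧ O.rep a = a ∧ O.side t a ≠ 0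
  | .column t a _ => O.Canonical t ∧ O.rep a = a ∧ O.side t a ≠ 0
  | .diagonal t a => O.Canonical t ∧ O.rep a = a ∧ O.side t a ≠ 0

/-- The prescribed hyperplanes of the simulating matroid. -/
def planes (P : {P : Plane m n // O.PlaneValid P}) : Set (Elt m n) := O.planeSet P

theorem closure_eq_of_ncard {t : Fin (m + 2) → Fin n} {a : Fin n} (ha : O.side t a ≠ 0)
    {X : Set (Fin n)} (hX : O.matroid.Indep X) (hc : X.ncard = m + 2)
    (hXt : ∀ e ∈ X, O.side t e = 0) : O.matroid.closure X = O.matroid.closure (Set.range t) := by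
  have hsub : X ⊆ O.matroid.closure (Set.range t) := fun e he =>
    (O.mem_closure_iff_side ha e).2 (hXt e he)
  refine (O.matroid.closure_subset_closure_of_subset_closure hsub).antisymm
    (O.matroid.closure_subset_closure_of_subset_closure ?_)
  intro y hy
  by_contra hyX
  have h := (hX.notMem_closure_iff (e := y) (Set.mem_univ _)).1 hyX
  have hB := O.isBase_of_indep h.1 (by rw [Set.ncard_insert_of_notMem h.2 (Set.toFinite _), hc])
  refine ha ((O.mem_closure_iff_side ha a).1 ?_)
  refine O.matroid.closure_subset_closure_of_subset_closure (X := insert y X) ?_ ?_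
  · rintro b (rfl | hb)
    · exact O.matroid.mem_closure_of_mem hy (O.subset_ground _)
    · exact hsub hb
  · rw [hB.closure_eq]; exact Set.mem_univ _

theorem subsingleton_of_parallel {X : Set (Fin n)} (hX : O.matroid.Indep X) {a : Fin n}
    (h : ∀ e ∈ X, O.Parallel a e) {x y : Fin n} (hx : x ∈ X) (hy : y ∈ X) : x = y := by
  have hp : O.Parallel x y := (h x hx).symm.trans (h y hy)
  rcases (O.parallel_iff (by omega) x y).1 hp with h | h
  · exact h
  · exact absurd (hX.subset (by rintro _ (rfl | rfl) <;> assumption)) h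

/-- Modulo the `l j`, a prescribed hyperplane of a block has at most one point in common with any
other prescribed hyperplane, unless both are flats. -/
theorem plane_eq_of_pair {P P' : Plane m n} (hP : O.PlaneValid P) (hP' : O.PlaneValid P')
    {t : Fin (m + 2) → Fin n} (ht : P.block = some t) {x y : Elt m n} (hxy : x ≠ y)
    (hx : x ∈ O.planeSet P) (hx' : x ∈ O.planeSet P') (hy : y ∈ O.planeSet P)
    (hy' : y ∈ O.planeSet P') (hxl : ∀ j, x ≠ Sum.inr (t, .l j)) (hyl : ∀ j, y ≠ Sum.inr (t, .l j))
    (hpar : ∀ e e', x = Sum.inl e → y = Sum.inl e' → ¬ O.Parallel e e') :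
    P = P' ∨ ∃ t', P = .flat t ∧ P' = .flat t' := by
  have key : ∀ a b : Fin n, O.rep a = a → O.rep b = b → ∀ e, O.Parallel a e → O.Parallel b e →
      a = b := fun a b ha hb e h h' => by
    rw [← ha, ← hb]; exact O.rep_eq_of_parallel (h.trans h'.symm)
  have key2 : ∀ a e : Fin n, ∀ t, O.side t a ≠ 0 → O.Parallel a e → O.side t e ≠ 0 :=
    fun a e t ha h h' => ha (h.side_eq_zero ha h')
  have key3 : ∀ a e e' : Fin n, O.Parallel a e → O.Parallel a e' → O.Parallel e e' :=
    fun a e e' h h' => h.symm.trans h'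
  have key4 : ∀ x y x' y' : Bool, (if x = y then (1 : SignType) else -1) =
      (if x' = y' then 1 else -1) → (x = x' ↔ y = y') := by decide
  have key5 : ∀ α β α' β' : Bool, α ≠ β → α' ≠ β' → (α = α' ↔ β = β') := by decide
  cases P <;> simp only [Plane.block, reduceCtorEq, Option.some.injEq] at ht <;> subst ht
  all_goals
    rcases x with e | ⟨t₁, j | _ | b₁ | b₁ | s₁ | ⟨α₁, β₁, a₁⟩⟩ <;>
    simp only [planeSet, Set.mem_ofPred_eq, Sum.elim_inl, Sum.elim_inr, Aux.OnFlat, Aux.OnHarmonic,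
      Aux.OnRow, Aux.OnColumn, Aux.OnDiagonal, and_false, and_true] at hx hxl <;>
    (first | (exact hx.elim) | (exact absurd (by rw [hx]) (hxl _)) | skip) <;>
    rcases y with e' | ⟨t₂, j' | _ | b₂ | b₂ | s₂ | ⟨α₂, β₂, a₂⟩⟩ <;>
    simp only [planeSet, Set.mem_ofPred_eq, Sum.elim_inl, Sum.elim_inr, Aux.OnFlat, Aux.OnHarmonic,
      Aux.OnRow, Aux.OnColumn, Aux.OnDiagonal, and_false, and_true] at hy hyl <;>
    (first | (exact hy.elim) | (exact absurd (by rw [hy]) (hyl _)) | skip)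
  all_goals
    cases P' <;> simp only [planeSet, Set.mem_ofPred_eq, Sum.elim_inl, Sum.elim_inr, Aux.OnFlat,
      Aux.OnHarmonic, Aux.OnRow, Aux.OnColumn, Aux.OnDiagonal, Aux.AtInfinity, and_false,
      and_true, PlaneValid] at hx' hy' hP' hP
  all_goals first
    | grind
    | exact absurd (key3 _ _ _ ‹_› ‹_›) (hpar _ _ rfl rfl)
    | (have := key4 _ _ _ _ (hy.2.symm.trans hy'.2); grind)
    | (have := key4 _ _ _ _ (hx.2.symm.trans hx'.2); grind)
    | (have := key5 _ _ _ _ hx.2.1 hy.2.1; grind)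
    | (have := key5 _ _ _ _ hx'.2.1 hy'.2.1; grind)

theorem planes_unique (i j : {P : Plane m n // O.PlaneValid P}) (J : Set (Elt m n))
    (hJ : O.matroid.Indep (Sum.inl ⁻¹' J)) (hc : J.ncard + 1 = m + 3) (hi : J ⊆ O.planes i)
    (hj : J ⊆ O.planes j) : O.planes i = O.planes j := by
  have hfin : J.Finite := Set.finite_of_ncard_ne_zero (by omega)
  have key : ∀ (i j : {P : Plane m n // O.PlaneValid P}) (t : Fin (m + 2) → Fin n),
      i.1.block = some t → J ⊆ O.planes i → J ⊆ O.planes j → O.planes i = O.planes j := by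
    rintro ⟨P, hP⟩ ⟨P', hP'⟩ t ht hi hj
    let L : Set (Elt m n) := Set.range fun j : Fin m => Sum.inr (t, Aux.l j)
    have hL : L.ncard ≤ m := by
      have := Set.ncard_image_le (f := fun j : Fin m => (Sum.inr (t, Aux.l j) : Elt m n))
        (s := Set.univ) (Set.toFinite _)
      simpa [L, Set.image_univ] using this
    have hLfin : L.Finite := Set.finite_range _
    have h2 : 1 < (J \ L).ncard := by
      have := Set.le_ncard_sdiff L J hLfin
      omega
    obtain ⟨x, y, hx, hy, hxy⟩ := (Set.one_lt_ncard_iff (hfin.subset Set.sdiff_subset)).1 h2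
    have hpar : ∀ e e', x = Sum.inl e → y = Sum.inl e' → ¬ O.Parallel e e' := by
      rintro e e' rfl rfl hpar
      have hne : e ≠ e' := fun h => hxy (by rw [h])
      rcases (O.parallel_iff (by omega) e e').1 hpar with h | h
      · exact hne h
      · exact h (hJ.subset (by
          rintro _ (rfl | rfl)
          exacts [hx.1, hy.1]))
    rcases O.plane_eq_of_pair hP hP' ht hxy (hi hx.1) (hj hx.1) (hi hy.1) (hj hy.1)
      (fun j e => hx.2 ⟨j, e.symm⟩) (fun j e => hy.2 ⟨j, e.symm⟩) hpar with h | ⟨t', h, h'⟩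
    · subst h; rfl
    · subst h h'
      by_cases htt : t = t'
      · subst htt; rfl
      exfalso
      have hE : ∀ z ∈ J, ∃ e, z = Sum.inl e := by
        rintro (e | ⟨u, s⟩) hz
        · exact ⟨e, rfl⟩
        · exact absurd ((hi hz).1.symm.trans (hj hz).1) htt
      have hcE : (Sum.inl ⁻¹' J : Set (Fin n)).ncard = m + 2 := by
        rw [← Set.ncard_image_of_injective _ (Sum.inl_injective (β := (Fin (m + 2) → Fin n) × Aux m n)),
          Set.image_preimage_eq_of_subset]
        · omega
        · intro z hz
          obtain ⟨e, rfl⟩ := hE z hz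
          exact ⟨e, rfl⟩
      obtain ⟨a, ha, -⟩ := hP.2
      obtain ⟨a', ha', -⟩ := hP'.2
      have e1 := O.closure_eq_of_ncard ha hJ hcE (fun e he => hi he)
      have e2 := O.closure_eq_of_ncard ha' hJ hcE (fun e he => hj he)
      refine htt (hP.eq hP' fun b => ?_)
      rw [← O.mem_closure_iff_side ha, ← O.mem_closure_iff_side ha', ← e1, e2]
  rcases hbi : i.1.block with _ | t
  · rcases hbj : j.1.block with _ | t
    · obtain ⟨P, hP⟩ := i
      obtain ⟨P', hP'⟩ := j
      cases P <;> simp [Plane.block] at hbi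
      cases P' <;> simp [Plane.block] at hbj
      rfl
    · exact (key j i t hbj hj hi).symm
  · exact key i j t hbi hi hj

theorem planes_closed (i : {P : Plane m n // O.PlaneValid P}) (J : Set (Elt m n)) (e : Fin n)
    (hJ : O.matroid.Indep (Sum.inl ⁻¹' J)) (hi : J ⊆ O.planes i)
    (he : ¬ O.matroid.Indep (insert e (Sum.inl ⁻¹' J))) : Sum.inl e ∈ O.planes i := by
  have hone : O.matroid.Indep {e} := Matroid.indep_singleton.2 (O.isNonloop (by omega) e)
  have hempty : (∀ b, Sum.inl b ∉ J) → False := by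
    intro h
    have : (Sum.inl ⁻¹' J : Set (Fin n)) = ∅ := Set.eq_empty_of_forall_notMem h
    rw [this] at he
    exact he (by simpa using hone)
  obtain ⟨P, hP⟩ := i
  cases P with
  | infinity => exact (hempty fun b hb => hi hb).elim
  | harmonic => exact (hempty fun b hb => hi hb).elim
  | column => exact (hempty fun b hb => hi hb).elim
  | diagonal => exact (hempty fun b hb => hi hb).elim
  | flat t =>
    obtain ⟨a, ha, -⟩ := hP.2
    refine (O.mem_closure_iff_side ha e).1 ?_
    by_contra hcon
    have hsub : (Sum.inl ⁻¹' J : Set (Fin n)) ⊆ O.matroid.closure (Set.range t) := fun b hb =>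
      (O.mem_closure_iff_side ha b).2 (hi hb)
    have hecl : e ∉ O.matroid.closure (Sum.inl ⁻¹' J) := fun h =>
      hcon (O.matroid.closure_subset_closure_of_subset_closure hsub h)
    exact he ((hJ.notMem_closure_iff (e := e) (Set.mem_univ _)).1 hecl).1
  | row t a β =>
    have hpar : ∀ b ∈ (Sum.inl ⁻¹' J : Set (Fin n)), O.Parallel a b := fun b hb => hi hb
    by_contra hcon
    refine hempty fun b hb => ?_
    have hJb : (Sum.inl ⁻¹' J : Set (Fin n)) = {b} := by
      ext x
      exact ⟨fun hx => O.subsingleton_of_parallel hJ hpar hx hb, by rintro rfl; exact hb⟩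
    rw [hJb] at he
    exact hcon ((hpar b hb).trans ((O.parallel_iff (by omega) e b).2 (Or.inr he)).symm)

instance : Finite (Aux m n) := by
  refine Finite.of_injective (β := Fin m ⊕ Bool ⊕ Bool ⊕ SignType ⊕ (Bool × Bool × Fin n) ⊕ Unit)
    (fun s => match s with
      | .l j => Sum.inl j
      | .c b => Sum.inr (Sum.inl b)
      | .i b => Sum.inr (Sum.inr (Sum.inl b))
      | .q s => Sum.inr (Sum.inr (Sum.inr (Sum.inl s)))
      | .corner α β a => Sum.inr (Sum.inr (Sum.inr (Sum.inr (Sum.inl (α, β, a)))))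
      | .g => Sum.inr (Sum.inr (Sum.inr (Sum.inr (Sum.inr ()))))) ?_
  rintro (j | _ | b | b | s | ⟨α, β, a⟩) (j' | _ | b' | b' | s' | ⟨α', β', a'⟩) h <;> simp_all

theorem isHyperplaneFamily : IsHyperplaneFamily O.matroid (m + 3) O.planes where
  pos := by omega
  ground := rfl
  unique := O.planes_unique
  closed := fun i J e hJ _ hi he => O.planes_closed i J e hJ hi he

/-- The matroid that simulates the order type, on abstract elements. -/
def simulation : Matroid (Elt m n) := O.isHyperplaneFamily.matroid

theorem simulation_ground : O.simulation.E = Set.univ := rfl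

theorem simulation_indep_iff (I : Set (Elt m n)) : O.simulation.Indep I ↔
    O.matroid.Indep (Sum.inl ⁻¹' I) ∧ I.ncard ≤ m + 3 ∧
      ∀ P, O.PlaneValid P → I ⊆ O.planeSet P → I.ncard < m + 3 := by
  change ExtIndep _ _ _ _ ↔ _
  simp [ExtIndep, planes]

theorem simulation_indep_iff_of_ncard_lt {I : Set (Elt m n)} (h : I.ncard < m + 3) :
    O.simulation.Indep I ↔ O.matroid.Indep (Sum.inl ⁻¹' I) := by
  rw [simulation_indep_iff]
  exact ⟨fun h => h.1, fun hI => ⟨hI, h.le, fun _ _ _ => h⟩⟩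

end AbstractOrderType

/-! ### Determinants and functionals of hyperplanes -/

/-- The determinant of a tuple of vectors, as a function of its last entry. -/
noncomputable def detLast {d : ℕ} (w : Fin d → Fin (d + 1) → ℝ) :
    (Fin (d + 1) → ℝ) →ₗ[ℝ] ℝ :=
  (Matrix.detRowAlternating (R := ℝ) (n := Fin (d + 1))).toMultilinearMap.toLinearMap
    (Fin.snoc (α := fun _ => Fin (d + 1) → ℝ) w 0) (Fin.last d)

theorem detLast_apply {d : ℕ} (w : Fin d → Fin (d + 1) → ℝ) (x : Fin (d + 1) → ℝ) :
    detLast w x = Matrix.det (Matrix.of (Fin.snoc (α := fun _ => Fin (d + 1) → ℝ) w x)) := by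
  simp only [detLast, MultilinearMap.toLinearMap_apply, Fin.update_snoc_last]
  rfl

theorem det_ne_zero_iff_linearIndependent {k : ℕ} (w : Fin k → Fin k → ℝ) :
    Matrix.det (Matrix.of w) ≠ 0 ↔ LinearIndependent ℝ w := by
  rw [← isUnit_iff_ne_zero, ← Matrix.isUnit_iff_isUnit_det,
    ← Matrix.linearIndependent_rows_iff_isUnit]
  rfl

theorem detLast_ne_zero_iff {d : ℕ} (w : Fin d → Fin (d + 1) → ℝ) (x : Fin (d + 1) → ℝ) :
    detLast w x ≠ 0 ↔
      LinearIndependent ℝ (Fin.snoc (α := fun _ => Fin (d + 1) → ℝ) w x) := by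
  rw [detLast_apply, det_ne_zero_iff_linearIndependent]

theorem detLast_eq_zero_of_mem {d : ℕ} (w : Fin d → Fin (d + 1) → ℝ) (i : Fin d) :
    detLast w (w i) = 0 := by
  by_contra h
  have := ((detLast_ne_zero_iff _ _).1 h).injective
    (a₁ := i.castSucc) (a₂ := Fin.last d) (by simp)
  exact (Fin.castSucc_lt_last i).ne this

/-- Two hyperplanes with a common spanning set have proportional functionals. -/
theorem detLast_mul_eq {d : ℕ} (w : Fin d → Fin (d + 1) → ℝ) (j : Fin d)
    (y a b : Fin (d + 1) → ℝ) (hy : detLast w y = 0) (ha : detLast w a ≠ 0) :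
    detLast w a * detLast (Function.update w j y) b =
      detLast w b * detLast (Function.update w j y) a := by
  set w' := Function.update w j y with hw'
  have hli := (detLast_ne_zero_iff w a).1 ha
  have hspan := hli.span_eq_top_of_card_eq_finrank (by simp)
  let ψ : (Fin (d + 1) → ℝ) →ₗ[ℝ] ℝ := detLast w a • detLast w' - detLast w' a • detLast w
  have hψ : ψ = 0 := by
    refine LinearMap.ext_on_range hspan fun i => ?_
    induction i using Fin.lastCases with
    | last => simp [ψ, mul_comm]
    | cast i =>
      have h1 : detLast w (w i) = 0 := detLast_eq_zero_of_mem w i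
      have h2 : detLast w' (w i) = 0 := by
        by_cases hij : i = j
        · subst hij
          have hsw : (Fin.snoc (α := fun _ => Fin (d + 1) → ℝ) w' (w i)) =
              (Fin.snoc (α := fun _ => Fin (d + 1) → ℝ) w y) ∘
                Equiv.swap i.castSucc (Fin.last d) := by
            funext l
            induction l using Fin.lastCases with
            | last => simp
            | cast l =>
              by_cases hl : l = i
              · subst hl; simp [hw']
              · have h1 : l.castSucc ≠ i.castSucc := fun e => hl (Fin.castSucc_injective _ e)
                have h2 := (Fin.castSucc_lt_last l).ne
                simp [hw', Equiv.swap_apply_of_ne_of_ne h1 h2, Function.update_of_ne hl]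
          by_contra hcon
          have h3 := (detLast_ne_zero_iff _ _).1 hcon
          rw [hsw, linearIndependent_equiv] at h3
          exact (detLast_ne_zero_iff _ _).2 h3 hy
        · have := detLast_eq_zero_of_mem w' i
          rwa [hw', Function.update_of_ne hij] at this
      simp [ψ, h1, h2]
  have := LinearMap.congr_fun hψ b
  simp only [ψ, LinearMap.sub_apply, LinearMap.smul_apply, smul_eq_mul, LinearMap.zero_apply] at this
  linarith

theorem linearIndependent_comp_iff {α : Type*} {k : ℕ} {v : α → Fin k → ℝ} (x : Fin k → α) :
    LinearIndependent ℝ (v ∘ x) ↔ Function.Injective x ∧ LinearIndepOn ℝ v (Set.range x) := by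
  constructor
  · intro h
    have hx : Function.Injective x := h.injective.of_comp
    exact ⟨hx, (linearIndepOn_range_iff hx v).2 h⟩
  · rintro ⟨hx, h⟩
    exact (linearIndepOn_range_iff hx v).1 h

theorem orientation_eq_sign {d : ℕ} (q : Fin (d + 1) → Fin d → ℝ) :
    orientation q = SignType.sign (Matrix.det (Matrix.of fun j => homogenize (q j))) := by
  rw [orientation, ← Matrix.det_transpose]
  rfl

theorem orientation_alternating {d n : ℕ} (p : Fin n → Fin d → ℝ) :
    IsAlternating fun x : Fin (d + 1) → Fin n => orientation (p ∘ x) := by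
  intro x i j hij
  simp only [orientation_eq_sign]
  rw [← Left.sign_neg]
  congr 1
  exact (Matrix.detRowAlternating (R := ℝ) (n := Fin (d + 1))).map_swap
    (fun j => homogenize (p (x j))) hij

theorem orientation_snoc {d n : ℕ} (p : Fin n → Fin d → ℝ) (t : Fin d → Fin n) (a : Fin n) :
    orientation (p ∘ (Fin.snoc t a : Fin (d + 1) → Fin n)) =
      SignType.sign (detLast (fun j => homogenize (p (t j))) (homogenize (p a))) := by
  rw [orientation_eq_sign, detLast_apply]
  congr 3
  funext i
  induction i using Fin.lastCases <;> simp

theorem orientation_hasThreeTerm {d n : ℕ} (p : Fin n → Fin d → ℝ) :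
    HasThreeTerm fun x : Fin (d + 1) → Fin n => orientation (p ∘ x) := by
  intro t j y a b hy ha hb
  simp only [orientation_snoc] at *
  have hu : (fun i => homogenize (p (Function.update t j y i))) =
      Function.update (fun i => homogenize (p (t i))) j (homogenize (p y)) := by
    funext i
    by_cases hi : i = j
    · subst hi; simp
    · simp [Function.update_of_ne hi]
  rw [hu, ← sign_mul, ← sign_mul, detLast_mul_eq _ _ _ _ _ (sign_eq_zero_iff.1 hy)
    (fun e => ha (sign_eq_zero_iff.2 e))]

/-! ### The two kinds of complete quadrilaterals -/

section Quadrilaterals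

variable {V : Type*} [AddCommGroup V] [Module ℝ V] {φ ψ : V →ₗ[ℝ] ℝ} {L : Submodule ℝ V}

/-- The quadrilateral whose third diagonal passes through the intersection of the hyperplanes `φ = 0`
and `ψ = 0` forces the points `a` and `q` to the same side. -/
theorem quadrilateral_pos (hφ : ∀ x ∈ L, φ x = 0) (hψ : ∀ x ∈ L, ψ x = 0) {a q c i u w g : V}
    (hc : φ c = 0) (hi : ψ i = 0) (hgφ : φ g = 0) (hgψ : ψ g = 0)
    {α β γ δ α' β' γ' δ' μ ν : ℝ} (h1 : u - (α • a + β • c) ∈ L) (h2 : u - (γ • q + δ • i) ∈ L)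
    (h3 : w - (α' • a + β' • i) ∈ L) (h4 : w - (γ' • q + δ' • c) ∈ L)
    (h5 : w - (μ • g + ν • u) ∈ L) (hind : ∀ x y z : ℝ, x • c + y • q + z • i ∈ L → y = 0)
    (hφu : φ u ≠ 0) (hφw : φ w ≠ 0) (hψw : ψ w ≠ 0) :
    0 < (φ a * ψ a) * (φ q * ψ q) := by
  have e1 := hφ _ h1
  have e2 := hψ _ h2
  have e3 := hψ _ h3
  have e4 := hφ _ h4
  have e5 := hφ _ h5
  have e6 := hψ _ h5
  simp only [map_sub, map_add, map_smul, smul_eq_mul, hc, hi, hgφ, hgψ, mul_zero, add_zero,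
    zero_add] at e1 e2 e3 e4 e5 e6
  have e7 : α' * γ = α * γ' := by
    have h : (-(α' * β) - α * δ') • c + (α' * γ - α * γ') • q + (α' * δ + α * β') • i ∈ L := by
      have hm := L.sub_mem (L.sub_mem (L.smul_mem α' h1) (L.smul_mem α' h2))
        (L.sub_mem (L.smul_mem α h3) (L.smul_mem α h4))
      convert hm using 1
      module
    have := hind _ _ _ h
    linarith
  have f1 : φ u = α * φ a := by linarith
  have f2 : ψ u = γ * ψ q := by linarith
  have f3 : ψ w = α' * ψ a := by linarith
  have f4 : φ w = γ' * φ q := by linarith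
  have f5 : φ w = ν * φ u := by linarith
  have f6 : ψ w = ν * ψ u := by linarith
  have hα : α ≠ 0 := fun h => hφu (by rw [f1, h, zero_mul])
  have hγ' : γ' ≠ 0 := fun h => hφw (by rw [f4, h, zero_mul])
  have key : φ u * ψ w = φ w * ψ u := by rw [f5, f6]; ring
  have hne : φ u * ψ w ≠ 0 := mul_ne_zero hφu hψw
  have e8 : (α * γ') ^ 2 * ((φ a * ψ a) * (φ q * ψ q)) = (φ u * ψ w) ^ 2 := by
    calc (α * γ') ^ 2 * ((φ a * ψ a) * (φ q * ψ q))
        = (α * γ') * (α' * γ) * ((φ a * ψ a) * (φ q * ψ q)) := by rw [e7]; ring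
      _ = (φ u * ψ w) * (φ w * ψ u) := by rw [f1, f2, f3, f4]; ring
      _ = (φ u * ψ w) ^ 2 := by rw [← key]; ring
  have h9 : 0 < (φ u * ψ w) ^ 2 := by positivity
  rw [← e8] at h9
  exact pos_of_mul_pos_right h9 (by positivity)

/-- The quadrilateral whose first two diagonals lie on the hyperplanes `φ = 0` and `ψ = 0` forces the
other two vertices `p` and `q` to be harmonic conjugates. -/
theorem quadrilateral_harmonic (hφ : ∀ x ∈ L, φ x = 0) (hψ : ∀ x ∈ L, ψ x = 0)
    {c c' i i' p q : V} (hc : φ c = 0) (hc' : φ c' = 0) (hi : ψ i = 0) (hi' : ψ i' = 0)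
    {α β γ δ α' β' γ' δ' : ℝ} (h1 : p - (α • c + β • i) ∈ L) (h2 : p - (γ' • c' + δ' • i') ∈ L)
    (h3 : q - (α' • c + β' • i') ∈ L) (h4 : q - (γ • c' + δ • i) ∈ L)
    (hind : ∀ x y z : ℝ, x • c + y • c' + z • i ∈ L → x = 0) :
    φ p * ψ q = -(φ q * ψ p) := by
  have e1 := hψ _ h1
  have e2 := hφ _ h2
  have e3 := hφ _ h3
  have e4 := hψ _ h3
  simp only [map_sub, map_add, map_smul, smul_eq_mul, hc, hc', hi, hi', mul_zero, add_zero,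
    zero_add] at e1 e2 e3 e4
  have e7 : α * β' = -(α' * δ') := by
    have h : (α * β' + α' * δ') • c + (-(γ' * β') - γ * δ') • c' + (β * β' - δ * δ') • i ∈ L := by
      have hm := L.sub_mem (L.sub_mem (L.smul_mem β' h2) (L.smul_mem β' h1))
        (L.sub_mem (L.smul_mem δ' h3) (L.smul_mem δ' h4))
      convert hm using 1
      module
    have := hind _ _ _ h
    linarith
  have f1 : ψ p = α * ψ c := by linarith
  have f2 : φ p = δ' * φ i' := by linarith
  have f3 : φ q = β' * φ i' := by linarith
  have f4 : ψ q = α' * ψ c := by linarith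
  rw [f1, f2, f3, f4]
  linear_combination (φ i' * ψ c) * e7

end Quadrilaterals

/-! ### Independent sets of the simulating matroid -/

namespace AbstractOrderType

variable {m n : ℕ} (O : AbstractOrderType (m + 2) n)

/-- The elements `l j` of a tuple. -/
def lSet (t : Fin (m + 2) → Fin n) : Set (Elt m n) := Set.range fun j => Sum.inr (t, Aux.l j)

theorem ncard_lSet (t : Fin (m + 2) → Fin n) : (lSet (m := m) t).ncard = m := by
  rw [lSet, ← Set.image_univ, Set.ncard_image_of_injective]
  · simp
  · intro i j h; simpa using h

theorem inl_notMem_lSet (t : Fin (m + 2) → Fin n) (e : Fin n) : Sum.inl e ∉ lSet (m := m) t := by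
  rintro ⟨j, hj⟩; cases hj

theorem indep_of_subsingleton {X : Set (Fin n)} (h : X.Subsingleton) : O.matroid.Indep X := by
  rcases h.eq_empty_or_singleton with rfl | ⟨e, rfl⟩
  · exact O.matroid.empty_indep
  · exact Matroid.indep_singleton.2 (O.isNonloop (by omega) e)

/-- Modulo the elements `l j` of a tuple, the simulating matroid has rank three. Two of its other
elements are distinct points there, unless both are in the order type. -/
theorem simulation_indep_pair (t : Fin (m + 2) → Fin n) {x y : Elt m n}
    (hE : ∀ e e', x = Sum.inl e → y = Sum.inl e' → e = e') :
    O.simulation.Indep (insert x (insert y (lSet t))) := by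
  have hcard : (insert x (insert y (lSet (m := m) t))).ncard < m + 3 := by
    have h1 := Set.ncard_insert_le x (insert y (lSet (m := m) t))
    have h2 := Set.ncard_insert_le y (lSet (m := m) t)
    have h3 := ncard_lSet (m := m) t
    omega
  rw [O.simulation_indep_iff_of_ncard_lt hcard]
  refine O.indep_of_subsingleton ?_
  rintro e he e' he'
  simp only [Set.mem_preimage, Set.mem_insert_iff, inl_notMem_lSet, or_false] at he he'
  rcases he with he | he <;> rcases he' with he' | he'
  · exact Sum.inl_injective (he.trans he'.symm)
  · exact hE e e' he.symm he'.symm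
  · exact (hE e' e he'.symm he.symm).symm
  · exact Sum.inl_injective (he.trans he'.symm)

/-- Modulo the elements `l j` of a tuple, three elements are in general position if no prescribed
hyperplane contains them. -/
theorem simulation_indep_triple (t : Fin (m + 2) → Fin n) {x y z : Elt m n}
    (hE : ∀ e e', x = Sum.inl e → y = Sum.inl e' → e = e')
    (hz : ∀ e, z ≠ Sum.inl e)
    (hP : ∀ P, O.PlaneValid P → x ∈ O.planeSet P → y ∈ O.planeSet P → z ∈ O.planeSet P → False) :
    O.simulation.Indep (insert z (insert x (insert y (lSet t)))) := by
  rw [simulation_indep_iff]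
  refine ⟨?_, ?_, fun P hv hsub => (hP P hv (hsub (by simp)) (hsub (by simp)) (hsub (by simp))).elim⟩
  · have h := ((O.simulation_indep_iff _).1 (O.simulation_indep_pair t hE)).1
    refine h.subset ?_
    intro e he
    rcases he with he | he
    · exact absurd he.symm (hz e)
    · exact he
  · have h1 := Set.ncard_insert_le z (insert x (insert y (lSet (m := m) t)))
    have h2 := Set.ncard_insert_le x (insert y (lSet (m := m) t))
    have h3 := Set.ncard_insert_le y (lSet (m := m) t)
    have h4 := ncard_lSet (m := m) t
    omega

theorem ncard_triple {t : Fin (m + 2) → Fin n} {x y z : Elt m n} (hxy : x ≠ y) (hxz : x ≠ z)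
    (hyz : y ≠ z) (hx : x ∉ lSet t) (hy : y ∉ lSet t) (hz : z ∉ lSet t) :
    (insert z (insert x (insert y (lSet t)))).ncard = m + 3 := by
  have h4 := ncard_lSet (m := m) t
  rw [Set.ncard_insert_of_notMem, Set.ncard_insert_of_notMem, Set.ncard_insert_of_notMem, h4]
  · exact hy
  · simp [hxy, hx]
  · simp [hxz.symm, hyz.symm, hz]

theorem simulation_dep_triple {P : Plane m n} (hP : O.PlaneValid P) {t : Fin (m + 2) → Fin n}
    (hL : lSet t ⊆ O.planeSet P) {x y z : Elt m n} (hxy : x ≠ y) (hxz : x ≠ z)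
    (hyz : y ≠ z) (hx : x ∉ lSet t) (hy : y ∉ lSet t) (hz : z ∉ lSet t)
    (hxP : x ∈ O.planeSet P) (hyP : y ∈ O.planeSet P) (hzP : z ∈ O.planeSet P) :
    ¬ O.simulation.Indep (insert z (insert x (insert y (lSet t)))) := by
  rw [simulation_indep_iff]
  rintro ⟨-, -, h⟩
  have hc := ncard_triple hxy hxz hyz hx hy hz
  have := h P hP (Set.insert_subset hzP (Set.insert_subset hxP (Set.insert_subset hyP hL)))
  omega

/-- On the elements of the order type the matroid is the one of the order type. -/
theorem simulation_indep_image (X : Set (Fin n)) :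
    O.simulation.Indep (Sum.inl '' X) ↔ O.matroid.Indep X := by
  have hpre : (Sum.inl ⁻¹' (Sum.inl '' X : Set (Elt m n)) : Set (Fin n)) = X :=
    Set.preimage_image_eq _ Sum.inl_injective
  have hcard : (Sum.inl '' X : Set (Elt m n)).ncard = X.ncard :=
    Set.ncard_image_of_injective _ Sum.inl_injective
  rw [simulation_indep_iff, hpre, hcard]
  refine ⟨fun h => h.1, fun hX => ⟨hX, O.ncard_le_of_indep hX, ?_⟩⟩
  intro P hP hsub
  by_contra hcon
  have hk : X.ncard = m + 3 := by have := O.ncard_le_of_indep hX; omega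
  obtain ⟨e, he⟩ : X.Nonempty := by
    rw [← Set.ncard_pos (Set.toFinite _)]; omega
  have hmem : ∀ e ∈ X, Sum.inl e ∈ O.planeSet P := fun e he => hsub ⟨e, he, rfl⟩
  cases P with
  | infinity => exact (hmem e he).elim
  | harmonic => exact (hmem e he).elim
  | column => exact (hmem e he).elim
  | diagonal => exact (hmem e he).elim
  | row t a β =>
    have h1 : X.ncard ≤ 1 := (Set.ncard_le_one (Set.toFinite _)).2 fun x hx y hy =>
      O.subsingleton_of_parallel hX (a := a) (fun b hb => hmem b hb) hx hy
    omega
  | flat t =>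
    obtain ⟨a, ha, -⟩ := hP.2
    have hB := O.isBase_of_indep hX hk
    have hsub : X ⊆ O.matroid.closure (Set.range t) := fun b hb =>
      (O.mem_closure_iff_side ha b).2 (hmem b hb)
    refine ha ((O.mem_closure_iff_side ha a).1
      (O.matroid.closure_subset_closure_of_subset_closure hsub ?_))
    rw [hB.closure_eq]; exact Set.mem_univ _

/-- The prescribed hyperplane of a canonical tuple is its closure in the simulating matroid. -/
theorem Canonical.mem_flat_iff {O : AbstractOrderType (m + 2) n} {t : Fin (m + 2) → Fin n}
    (ht : O.Canonical t) (x : Elt m n) :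
    x ∈ O.planeSet (.flat t) ↔ ¬ (x ∉ Set.range (fun j => (Sum.inl (t j) : Elt m n)) ∧
      O.simulation.Indep (insert x (Set.range fun j => (Sum.inl (t j) : Elt m n)))) := by
  have hr : (Set.range fun j => (Sum.inl (t j) : Elt m n)) = Sum.inl '' Set.range t := by
    rw [← Set.range_comp]; rfl
  obtain ⟨a, ha, -⟩ := ht.2
  have hinj := ht.1.injective
  have hcard : (Sum.inl '' Set.range t : Set (Elt m n)).ncard = m + 2 := by
    rw [Set.ncard_image_of_injective _ Sum.inl_injective, ← Set.image_univ,
      Set.ncard_image_of_injective _ hinj]; simp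
  have hmem : (Sum.inl '' Set.range t : Set (Elt m n)) ⊆ O.planeSet (.flat t) := by
    rintro _ ⟨_, ⟨j, rfl⟩, rfl⟩
    exact O.side_range t j
  have hpre : (Sum.inl ⁻¹' (Sum.inl '' Set.range t : Set (Elt m n)) : Set (Fin n)) = Set.range t :=
    Set.preimage_image_eq _ Sum.inl_injective
  rw [hr]
  constructor
  · rintro hx ⟨hx1, hx2⟩
    have := ((O.simulation_indep_iff _).1 hx2).2.2 (.flat t) ht (Set.insert_subset hx hmem)
    rw [Set.ncard_insert_of_notMem hx1 (Set.toFinite _)] at this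
    omega
  · intro h
    by_contra hx
    refine h ⟨fun hx' => hx (hmem hx'), ?_⟩
    have hxr : x ∉ (Sum.inl '' Set.range t : Set (Elt m n)) := fun hx' => hx (hmem hx')
    rw [simulation_indep_iff]
    refine ⟨?_, by rw [Set.ncard_insert_of_notMem hxr (Set.toFinite _), hcard], ?_⟩
    · rcases x with e | ⟨u, s⟩
      · rw [IsHyperplaneFamily.preimage_insert_inl, hpre]
        exact ((O.side_ne_zero_iff t e).1 hx).2.2
      · rw [IsHyperplaneFamily.preimage_insert_inr, hpre]
        exact O.indep_range_of_side ha
    · intro P hP hsub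
      exfalso
      have := O.planes_unique ⟨P, hP⟩ ⟨.flat t, ht⟩ (Sum.inl '' Set.range t)
        (by rw [hpre]; exact O.indep_range_of_side ha) (by rw [hcard])
        ((Set.subset_insert _ _).trans hsub) hmem
      apply hx
      change x ∈ O.planes ⟨.flat t, ht⟩
      rw [← this]
      exact hsub (Set.mem_insert _ _)

/-! ### Partial representations -/

/-- The vectors `v x`, for `x` in `S`, represent the restriction of the simulating matroid to `S`. -/
def RepresentsOn (S : Set (Elt m n)) (v : Elt m n → Fin (m + 3) → ℝ) : Prop :=
  ∀ I ⊆ S, O.simulation.Indep I ↔ LinearIndepOn ℝ v I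

/-- The functional of the hyperplane that a tuple spans. -/
noncomputable def tupleFunctional (v : Elt m n → Fin (m + 3) → ℝ) (t : Fin (m + 2) → Fin n) :
    (Fin (m + 3) → ℝ) →ₗ[ℝ] ℝ :=
  detLast fun j => v (Sum.inl (t j))

variable {O} {S : Set (Elt m n)} {v : Elt m n → Fin (m + 3) → ℝ}

theorem RepresentsOn.tupleFunctional_eq_zero_iff (hv : O.RepresentsOn S v)
    (hS : ∀ e, Sum.inl e ∈ S) {t : Fin (m + 2) → Fin n} (ht : O.Canonical t) {x : Elt m n}
    (hx : x ∈ S) : tupleFunctional v t (v x) = 0 ↔ x ∈ O.planeSet (.flat t) := by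
  rw [ht.mem_flat_iff, iff_not_comm, ← ne_eq, tupleFunctional, detLast_ne_zero_iff]
  have h1 : (Fin.snoc (α := fun _ => Fin (m + 3) → ℝ) (fun j => v (Sum.inl (t j))) (v x)) =
      v ∘ (Fin.snoc (α := fun _ => Elt m n) (fun j => Sum.inl (t j)) x) := by
    funext i
    induction i using Fin.lastCases <;> simp
  rw [h1, linearIndependent_comp_iff, injective_snoc_iff, range_snoc, hv _ (Set.insert_subset hx (by
    rintro _ ⟨j, rfl⟩; exact hS _))]
  have hinj : Function.Injective fun j => (Sum.inl (t j) : Elt m n) :=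
    Sum.inl_injective.comp ht.1.injective
  tauto

/-- Three elements of a prescribed hyperplane of a block are collinear modulo the span of the `l
j`. -/
theorem RepresentsOn.exists_relation (hv : O.RepresentsOn S v) {P : Plane m n}
    (hP : O.PlaneValid P) {t : Fin (m + 2) → Fin n} (hL : lSet t ⊆ O.planeSet P)
    (hLS : lSet t ⊆ S) {x y z : Elt m n} (hxS : x ∈ S) (hyS : y ∈ S) (hzS : z ∈ S)
    (hE : ∀ e e', x = Sum.inl e → y = Sum.inl e' → e = e') (hxy : x ≠ y) (hxz : x ≠ z)
    (hyz : y ≠ z) (hx : x ∉ lSet t) (hy : y ∉ lSet t) (hz : z ∉ lSet t)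
    (hxP : x ∈ O.planeSet P) (hyP : y ∈ O.planeSet P) (hzP : z ∈ O.planeSet P) :
    ∃ α β : ℝ, v z - (α • v x + β • v y) ∈ Submodule.span ℝ (v '' lSet t) := by
  have hsub : insert x (insert y (lSet t)) ⊆ S :=
    Set.insert_subset hxS (Set.insert_subset hyS hLS)
  have h1 := (hv _ hsub).1 (O.simulation_indep_pair t hE)
  have h2 := O.simulation_dep_triple hP hL hxy hxz hyz hx hy hz hxP hyP hzP
  rw [hv _ (Set.insert_subset hzS hsub)] at h2
  have h3 := h1.mem_span_iff.2 fun h => absurd h h2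
  rw [Set.image_insert_eq, Set.image_insert_eq, Submodule.mem_span_insert] at h3
  obtain ⟨α, z', hz', hα⟩ := h3
  obtain ⟨β, z'', hz'', hβ⟩ := Submodule.mem_span_insert.1 hz'
  refine ⟨α, β, ?_⟩
  rw [hα, hβ]
  convert hz'' using 1
  module

theorem eq_zero_of_linearIndepOn {x y z : Elt m n} {L : Set (Elt m n)}
    (h : LinearIndepOn ℝ v (insert x (insert y (insert z L)))) (hxy : x ≠ y) (hxz : x ≠ z)
    (hx : x ∉ L) {α β γ : ℝ}
    (hr : α • v x + β • v y + γ • v z ∈ Submodule.span ℝ (v '' L)) : α = 0 := by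
  by_contra hα
  have h1 := ((linearIndepOn_insert (by simp [hxy, hxz, hx])).1 h).2
  apply h1
  rw [Set.image_insert_eq, Set.image_insert_eq, Submodule.mem_span_insert]
  refine ⟨-(β / α), -(γ / α) • v z + α⁻¹ • (α • v x + β • v y + γ • v z), ?_, ?_⟩
  · rw [Submodule.mem_span_insert]
    exact ⟨_, _, Submodule.smul_mem _ _ hr, rfl⟩
  · have : v x = (α⁻¹ * α) • v x := by rw [inv_mul_cancel₀ hα, one_smul]
    conv_lhs => rw [this]
    module

end AbstractOrderType

/-! ### Valid representations induce realizations -/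

theorem detLast_smul {d : ℕ} (r : Fin d → ℝ) (s : ℝ) (w : Fin d → Fin (d + 1) → ℝ)
    (x : Fin (d + 1) → ℝ) :
    detLast (fun j => r j • w j) (s • x) = (∏ j, r j) * s * detLast w x := by
  rw [map_smul, detLast_apply, detLast_apply]
  have h : (Fin.snoc (α := fun _ => Fin (d + 1) → ℝ) (fun j => r j • w j) x) =
      fun i => (Fin.snoc (α := fun _ => ℝ) r 1 : Fin (d + 1) → ℝ) i •
        (Fin.snoc (α := fun _ => Fin (d + 1) → ℝ) w x) i := by
    funext i
    induction i using Fin.lastCases <;> simp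
  have h2 : Matrix.det (Matrix.of fun i => (Fin.snoc (α := fun _ => ℝ) r 1 : Fin (d + 1) → ℝ) i •
      (Fin.snoc (α := fun _ => Fin (d + 1) → ℝ) w x) i) =
      (∏ i, (Fin.snoc (α := fun _ => ℝ) r 1 : Fin (d + 1) → ℝ) i) *
        Matrix.det (Matrix.of (Fin.snoc (α := fun _ => Fin (d + 1) → ℝ) w x)) :=
    (Matrix.detRowAlternating (R := ℝ) (n := Fin (d + 1))).map_smul_univ _ _
  rw [h, h2, Fin.prod_univ_castSucc]
  simp only [Fin.snoc_castSucc, Fin.snoc_last, smul_eq_mul]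
  ring

theorem homogenize_dehomogenize {d : ℕ} {w : Fin (d + 1) → ℝ} (h : w (Fin.last d) ≠ 0) :
    homogenize (dehomogenize w) = (w (Fin.last d))⁻¹ • w := by
  funext i
  induction i using Fin.lastCases with
  | last => simp [homogenize, h]
  | cast i => simp [homogenize, dehomogenize]; field_simp

namespace AbstractOrderType

variable {m n : ℕ} {O : AbstractOrderType (m + 2) n} {v : Elt m n → Fin (m + 3) → ℝ}
  {t : Fin (m + 2) → Fin n}

theorem lSet_subset {P : Plane m n} (hP : P = .infinity ∨ P.block = some t) :
    lSet t ⊆ O.planeSet P := by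
  rintro _ ⟨j, rfl⟩
  cases P <;> simp [Plane.block] at hP <;>
    simp [planeSet, hP, Aux.AtInfinity, Aux.OnFlat, Aux.OnHarmonic, Aux.OnRow, Aux.OnColumn,
      Aux.OnDiagonal]

theorem eq_zero_of_mem_span {P : Plane m n} (hP : P = .infinity ∨ P.block = some t)
    {φ : (Fin (m + 3) → ℝ) →ₗ[ℝ] ℝ} (hφ : ∀ y ∈ O.planeSet P, φ (v y) = 0) :
    ∀ x ∈ Submodule.span ℝ (v '' lSet t), φ x = 0 := by
  change Submodule.span ℝ (v '' lSet t) ≤ LinearMap.ker φ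
  rw [Submodule.span_le]
  rintro _ ⟨y, hy, rfl⟩
  exact hφ y (lSet_subset hP hy)

/-- The product of the positions of a vector with respect to the hyperplane spanned by a tuple and
the hyperplane at infinity. -/
noncomputable def position (v : Elt m n → Fin (m + 3) → ℝ) (t : Fin (m + 2) → Fin n)
    (x : Elt m n) : ℝ :=
  tupleFunctional v t (v x) * v x (Fin.last (m + 2))

/-- The points `corner α β a` force `q s` to the side of `a`, where `s` is the side of `a`. -/
theorem RepresentsOn.position_mul_pos (hv : O.RepresentsOn Set.univ v)
    (hinf : ∀ x, v x (Fin.last (m + 2)) = 0 ↔ x ∈ O.planeSet .infinity) (ht : O.Canonical t)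
    {a : Fin n} (hrep : O.rep a = a) (ha : O.side t a ≠ 0) :
    0 < position v t (Sum.inl a) * position v t (Sum.inr (t, .q (O.side t a))) := by
  set s := O.side t a
  have hφ0 := fun x => hv.tupleFunctional_eq_zero_iff (fun _ => trivial) ht (x := x) trivial
  have hrel : ∀ (P : Plane m n) (x y z : Elt m n), O.PlaneValid P → P.block = some t →
      (∀ e e', x = Sum.inl e → y = Sum.inl e' → e = e') → x ≠ y → x ≠ z → y ≠ z →
      x ∉ lSet t → y ∉ lSet t → z ∉ lSet t → x ∈ O.planeSet P → y ∈ O.planeSet P →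
      z ∈ O.planeSet P →
      ∃ α β : ℝ, v z - (α • v x + β • v y) ∈ Submodule.span ℝ (v '' lSet t) := by
    intro P x y z hP hb hE hxy hxz hyz hx hy hz hxP hyP hzP
    exact hv.exists_relation hP (lSet_subset (Or.inr hb)) (Set.subset_univ _) trivial trivial
      trivial hE hxy hxz hyz hx hy hz hxP hyP hzP
  have hvalid : O.Canonical t ∧ O.rep a = a ∧ O.side t a ≠ 0 := ⟨ht, hrep, ha⟩
  obtain ⟨α, β, h1⟩ := hrel (.row t a false) (Sum.inl a) (Sum.inr (t, .corner false false a))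
    (Sum.inr (t, .corner true false a)) hvalid rfl (by simp) (by simp) (by simp) (by simp)
    (by simp [lSet]) (by simp [lSet]) (by simp [lSet]) (rfl : O.Parallel a a)
    (by simp [planeSet, Aux.OnRow]) (by simp [planeSet, Aux.OnRow])
  obtain ⟨γ, δ, h2⟩ := hrel (.column t a true) (Sum.inr (t, .q s)) (Sum.inr (t, .corner true true a))
    (Sum.inr (t, .corner true false a)) hvalid rfl (by simp) (by simp) (by simp) (by simp)
    (by simp [lSet]) (by simp [lSet]) (by simp [lSet]) (by simp [planeSet, Aux.OnColumn, s])
    (by simp [planeSet, Aux.OnColumn]) (by simp [planeSet, Aux.OnColumn])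
  obtain ⟨α', β', h3⟩ := hrel (.row t a true) (Sum.inl a) (Sum.inr (t, .corner true true a))
    (Sum.inr (t, .corner false true a)) hvalid rfl (by simp) (by simp) (by simp) (by simp)
    (by simp [lSet]) (by simp [lSet]) (by simp [lSet]) (rfl : O.Parallel a a)
    (by simp [planeSet, Aux.OnRow]) (by simp [planeSet, Aux.OnRow])
  obtain ⟨γ', δ', h4⟩ := hrel (.column t a false) (Sum.inr (t, .q s))
    (Sum.inr (t, .corner false false a))
    (Sum.inr (t, .corner false true a)) hvalid rfl (by simp) (by simp) (by simp) (by simp)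
    (by simp [lSet]) (by simp [lSet]) (by simp [lSet]) (by simp [planeSet, Aux.OnColumn, s])
    (by simp [planeSet, Aux.OnColumn]) (by simp [planeSet, Aux.OnColumn])
  obtain ⟨μ, ν, h5⟩ := hrel (.diagonal t a) (Sum.inr (t, .g)) (Sum.inr (t, .corner true false a))
    (Sum.inr (t, .corner false true a)) hvalid rfl (by simp) (by simp) (by simp) (by simp)
    (by simp [lSet]) (by simp [lSet]) (by simp [lSet]) (by simp [planeSet, Aux.OnDiagonal])
    (by simp [planeSet, Aux.OnDiagonal]) (by simp [planeSet, Aux.OnDiagonal])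
  refine quadrilateral_pos (φ := tupleFunctional v t) (ψ := LinearMap.proj (Fin.last (m + 2)))
    (L := Submodule.span ℝ (v '' lSet t)) (eq_zero_of_mem_span (P := .flat t) (Or.inr rfl)
      fun y => (hφ0 y).2) (eq_zero_of_mem_span (P := .infinity) (Or.inl rfl) fun y => (hinf y).2) ((hφ0 _).2 ?_) ((hinf _).2 ?_) ((hφ0 _).2 ?_) ((hinf _).2 ?_)
      h1 h2 h3 h4 h5 ?_ (fun h => ?_) (fun h => ?_) (fun h => ?_)
  · simp [planeSet, Aux.OnFlat]
  · simp [planeSet, Aux.AtInfinity]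
  · simp [planeSet, Aux.OnFlat]
  · simp [planeSet, Aux.AtInfinity]
  · intro x y z hxyz
    refine eq_zero_of_linearIndepOn (v := v) (L := lSet t) (x := Sum.inr (t, .q s))
      (y := Sum.inr (t, .corner false false a)) (z := Sum.inr (t, .corner true true a))
      (α := y) (β := x) (γ := z) ((hv _ (Set.subset_univ _)).1 ?_) (by simp) (by simp)
      (by simp [lSet]) ?_
    · refine O.simulation_indep_triple t (by simp) (by simp) ?_
      intro P hP h1 h2 h3
      cases P <;> simp only [planeSet, Set.mem_ofPred_eq, Sum.elim_inr, Aux.AtInfinity, Aux.OnFlat,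
        Aux.OnHarmonic, Aux.OnRow, Aux.OnColumn, Aux.OnDiagonal] at h1 h2 h3 <;> grind
    · rwa [add_comm (y • _)]
  · have := (hφ0 _).1 h
    simp [planeSet, Aux.OnFlat] at this
  · have := (hφ0 _).1 h
    simp [planeSet, Aux.OnFlat] at this
  · have := (hinf _).1 h
    simp [planeSet, Aux.AtInfinity] at this

/-- The points `c` and `i` force `q 1` and `q (-1)` to opposite sides. -/
theorem RepresentsOn.position_harmonic (hv : O.RepresentsOn Set.univ v)
    (hinf : ∀ x, v x (Fin.last (m + 2)) = 0 ↔ x ∈ O.planeSet .infinity) (ht : O.Canonical t) :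
    position v t (Sum.inr (t, .q 1)) * position v t (Sum.inr (t, .q (-1))) < 0 := by
  have hφ0 := fun x => hv.tupleFunctional_eq_zero_iff (fun _ => trivial) ht (x := x) trivial
  have hrel : ∀ x y : Bool, ∃ α β : ℝ, v (Sum.inr (t, .q (if x = y then 1 else -1))) -
      (α • v (Sum.inr (t, .c x)) + β • v (Sum.inr (t, .i y))) ∈
        Submodule.span ℝ (v '' lSet t) := by
    intro x y
    exact hv.exists_relation (P := .harmonic t x y) ht (lSet_subset (Or.inr rfl))
      (Set.subset_univ _) trivial trivial trivial (by simp) (by simp) (by simp) (by simp)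
      (by simp [lSet]) (by simp [lSet]) (by simp [lSet]) (by simp [planeSet, Aux.OnHarmonic])
      (by simp [planeSet, Aux.OnHarmonic]) (by simp [planeSet, Aux.OnHarmonic])
  obtain ⟨α, β, h1⟩ := hrel false false
  obtain ⟨γ', δ', h2⟩ := hrel true true
  obtain ⟨α', β', h3⟩ := hrel false true
  obtain ⟨γ, δ, h4⟩ := hrel true false
  simp only [if_true, Bool.false_eq_true, if_false, reduceCtorEq] at h1 h2 h3 h4
  have key := quadrilateral_harmonic (φ := tupleFunctional v t)
    (ψ := LinearMap.proj (Fin.last (m + 2)))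
    (L := Submodule.span ℝ (v '' lSet t)) (eq_zero_of_mem_span (P := .flat t) (Or.inr rfl)
      fun y => (hφ0 y).2) (eq_zero_of_mem_span (P := .infinity) (Or.inl rfl) fun y => (hinf y).2) ((hφ0 (Sum.inr (t, .c false))).2 (by simp [planeSet, Aux.OnFlat]))
      ((hφ0 (Sum.inr (t, .c true))).2 (by simp [planeSet, Aux.OnFlat]))
      ((hinf (Sum.inr (t, .i false))).2 (by simp [planeSet, Aux.AtInfinity]))
      ((hinf (Sum.inr (t, .i true))).2 (by simp [planeSet, Aux.AtInfinity])) h1 h2 h3 h4 (by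
    intro x y z hxyz
    refine eq_zero_of_linearIndepOn (v := v) (L := lSet t) (x := Sum.inr (t, .c false))
      (y := Sum.inr (t, .c true)) (z := Sum.inr (t, .i false))
      ((hv _ (Set.subset_univ _)).1 ?_) (by simp) (by simp)
      (by simp [lSet]) hxyz
    refine O.simulation_indep_triple t (by simp) (by simp) ?_
    intro P hP h1 h2 h3
    cases P <;> simp only [planeSet, Set.mem_ofPred_eq, Sum.elim_inr, Aux.AtInfinity, Aux.OnFlat,
        Aux.OnHarmonic, Aux.OnRow, Aux.OnColumn, Aux.OnDiagonal] at h1 h2 h3 <;> grind)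
  simp only [LinearMap.proj_apply] at key
  have hp : tupleFunctional v t (v (Sum.inr (t, .q 1))) ≠ 0 := fun h => by
    have := (hφ0 _).1 h
    simp [planeSet, Aux.OnFlat] at this
  have hp2 : v (Sum.inr (t, .q (-1))) (Fin.last (m + 2)) ≠ 0 := fun h => by
    have := (hinf _).1 h
    simp [planeSet, Aux.AtInfinity] at this
  have : position v t (Sum.inr (t, .q 1)) * position v t (Sum.inr (t, .q (-1))) =
      -(tupleFunctional v t (v (Sum.inr (t, .q 1))) *
        v (Sum.inr (t, .q (-1))) (Fin.last (m + 2))) ^ 2 := by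
    rw [position, position]
    linear_combination (tupleFunctional v t (v (Sum.inr (t, .q 1))) *
        v (Sum.inr (t, .q (-1))) (Fin.last (m + 2))) * key
  rw [this]
  have := mul_ne_zero hp hp2
  have : 0 < (tupleFunctional v t (v (Sum.inr (t, .q 1))) *
        v (Sum.inr (t, .q (-1))) (Fin.last (m + 2))) ^ 2 := by positivity
  linarith

/-- Parallel elements are on the same side. -/
theorem RepresentsOn.sign_position_eq_of_parallel (hv : O.RepresentsOn Set.univ v) {a b : Fin n}
    (h : O.Parallel a b) (ha : position v t (Sum.inl a) ≠ 0) :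
    SignType.sign (position v t (Sum.inl a)) = SignType.sign (position v t (Sum.inl b)) := by
  rcases (O.parallel_iff (by omega) a b).1 h with rfl | hdep
  · rfl
  have hab : a ≠ b := by
    rintro rfl
    exact hdep (by simpa using O.isNonloop (by omega) a)
  have h1 : ¬ LinearIndepOn ℝ v (insert (Sum.inl a) {Sum.inl b}) := by
    rw [← hv _ (Set.subset_univ _), ← Set.image_singleton, ← Set.image_insert_eq,
      O.simulation_indep_image]
    exact hdep
  have h2 : LinearIndepOn ℝ v {Sum.inl b} := by
    rw [← hv _ (Set.subset_univ _), ← Set.image_singleton, O.simulation_indep_image]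
    simpa using O.isNonloop (by omega) b
  have h3 := h2.mem_span_iff.2 fun h => absurd h h1
  rw [Set.image_singleton, Submodule.mem_span_singleton] at h3
  obtain ⟨r, hr⟩ := h3
  have h4 : position v t (Sum.inl a) = r ^ 2 * position v t (Sum.inl b) := by
    simp only [position, ← hr, map_smul, Pi.smul_apply, smul_eq_mul]
    ring
  have hr0 : r ≠ 0 := by
    rintro rfl
    exact ha (by simp [h4])
  rw [h4, sign_mul, sign_pos (by positivity), one_mul]

/-- A valid representation of the simulating matroid induces a realization. -/
theorem realizesUpToReflection (hv : O.RepresentsOn Set.univ v)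
    (hinf : ∀ x, v x (Fin.last (m + 2)) = 0 ↔ x ∈ O.planeSet .infinity) :
    O.RealizesUpToReflection fun e => dehomogenize (v (Sum.inl e)) := by
  have hlast : ∀ e, v (Sum.inl e) (Fin.last (m + 2)) ≠ 0 := fun e h => (hinf _).1 h
  have hsnoc : ∀ (t : Fin (m + 2) → Fin n) (a : Fin n),
      orientation ((fun e => dehomogenize (v (Sum.inl e))) ∘
        (Fin.snoc t a : Fin (m + 3) → Fin n)) =
      SignType.sign (∏ j, (v (Sum.inl (t j)) (Fin.last (m + 2)))⁻¹) *
        SignType.sign (position v t (Sum.inl a)) := by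
    intro t a
    rw [orientation_snoc]
    simp only [homogenize_dehomogenize (hlast _)]
    rw [detLast_smul, sign_mul, sign_mul, mul_assoc, position, tupleFunctional, mul_comm _ (v _ _),
      sign_mul]
    congr 2
    rcases (hlast a).lt_or_gt with h | h
    · rw [sign_neg h, sign_neg (inv_lt_zero.2 h)]
    · rw [sign_pos h, sign_pos (inv_pos.2 h)]
  refine O.eq_or_eq_neg (fun x => orientation ((fun e => dehomogenize (v (Sum.inl e))) ∘ x))
    (orientation_alternating _) (orientation_hasThreeTerm _) ?_ ?_
  · intro x
    rw [iff_comm, ← not_iff_not, ← ne_eq, ← ne_eq, chi_ne_zero_iff, ← O.simulation_indep_image,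
      orientation_eq_sign, ne_eq, sign_eq_zero_iff, ← ne_eq, det_ne_zero_iff_linearIndependent]
    simp only [Function.comp_apply, homogenize_dehomogenize (hlast _)]
    have hu : (fun j => (v (Sum.inl (x j)) (Fin.last (m + 2)))⁻¹ • v (Sum.inl (x j))) =
        (fun j => Units.mk0 _ (inv_ne_zero (hlast (x j)))) • (v ∘ (fun j => Sum.inl (x j))) := by
      funext j; rfl
    rw [hu, LinearIndependent.units_smul_iff, linearIndependent_comp_iff, hv _ (Set.subset_univ _),
      ← Set.range_comp]
    exact and_congr (Sum.inl_injective.of_comp_iff x).symm Iff.rfl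
  · intro t ht a b ha hb
    have key : ∀ a, O.side t a ≠ 0 → SignType.sign (position v t (Sum.inl a)) * O.side t a =
        SignType.sign (position v t (Sum.inr (t, .q 1))) := by
      intro a ha
      have hne : position v t (Sum.inl a) ≠ 0 := by
        refine mul_ne_zero (fun h => ha ?_) (hlast a)
        exact (hv.tupleFunctional_eq_zero_iff (fun _ => trivial) ht (x := Sum.inl a) trivial).1 h
      have hp := O.parallel_rep a
      have hs := hp.side_eq (by omega) (t := t)
      rw [hv.sign_position_eq_of_parallel hp hne, hs]
      rw [hs] at ha
      have h1 := sign_pos (hv.position_mul_pos hinf ht (O.rep_rep a) ha)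
      have h2 := sign_neg (hv.position_harmonic hinf ht)
      rw [sign_mul] at h1 h2
      generalize O.side t (O.rep a) = s at *
      generalize SignType.sign (position v t (Sum.inl (O.rep a))) = σ at *
      cases s
      · exact absurd rfl ha
      · change σ * SignType.sign (position v t (Sum.inr (t, .q (-1)))) = 1 at h1
        change σ * -1 = _
        revert h1 h2
        generalize SignType.sign (position v t (Sum.inr (t, .q (-1)))) = s1
        generalize SignType.sign (position v t (Sum.inr (t, .q 1))) = s2
        revert σ s1 s2
        decide
      · change σ * SignType.sign (position v t (Sum.inr (t, .q 1))) = 1 at h1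
        change σ * 1 = _
        revert h1
        generalize SignType.sign (position v t (Sum.inr (t, .q 1))) = s2
        revert σ s2
        decide
    simp only [hsnoc]
    rw [mul_assoc, mul_assoc, key a ha, key b hb]

end AbstractOrderType

/-! ### Vectors in general position -/

section Generic

/-- Finitely many nonzero polynomials have a common non-root in every product of infinite sets. -/
theorem exists_eval_ne_zero {σ : Type*} {s : Set (MvPolynomial σ ℝ)} (hs : s.Finite)
    (hne : ∀ f ∈ s, f ≠ 0) (T : σ → Set ℝ) (hT : ∀ i, (T i).Infinite) :
    ∃ θ : σ → ℝ, (∀ i, θ i ∈ T i) ∧ ∀ f ∈ s, MvPolynomial.eval θ f ≠ 0 := by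
  by_contra hcon
  push Not at hcon
  have h0 : (∏ f ∈ hs.toFinset, f) ≠ 0 := Finset.prod_ne_zero_iff.2 fun f hf => hne f (by simpa using hf)
  refine h0 (MvPolynomial.funext_set T hT fun θ hθ => ?_)
  obtain ⟨f, hf, h⟩ := hcon θ fun i => hθ i trivial
  rw [map_prod, map_zero]
  exact Finset.prod_eq_zero (hs.mem_toFinset.2 hf) h

/-- Vectors that span the space together with a subspace `L` can be replaced by suitable combinations
with vectors of `L` that span the space without `L`, if there are enough of them. -/
theorem exists_lift {α V : Type*} [AddCommGroup V] [Module ℝ V] [FiniteDimensional ℝ V]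
    (L : Submodule ℝ V) (w : α → V) (D : Set α) (hD : D.Finite) (W : Submodule ℝ V)
    (hc : Module.finrank ℝ V ≤ Module.finrank ℝ W + D.ncard)
    (hs : W ⊔ Submodule.span ℝ (w '' D) ⊔ L = ⊤) :
    ∃ (s : α → ℝ) (l : α → V), (∀ j, l j ∈ L) ∧
      W ⊔ Submodule.span ℝ ((fun j => s j • w j + l j) '' D) = ⊤ := by
  classical
  induction D, hD using Set.Finite.induction_on generalizing W with
  | empty =>
    refine ⟨0, 0, fun _ => L.zero_mem, ?_⟩
    simp only [Set.ncard_empty, add_zero] at hc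
    rw [Submodule.eq_top_of_finrank_eq (le_antisymm (Submodule.finrank_le W) hc), top_sup_eq]
  | @insert j D hj hD ih =>
    rw [Set.ncard_insert_of_notMem hj hD] at hc
    -- in each case the vector `s • w j + l` is outside `W`, or everything is spanned already
    have key : ∀ (s₀ : ℝ) (l₀ : V), l₀ ∈ L → s₀ • w j + l₀ ∉ W →
        w j ∈ W ⊔ Submodule.span ℝ {s₀ • w j + l₀} → ∃ (s : α → ℝ) (l : α → V), (∀ j, l j ∈ L) ∧
        W ⊔ Submodule.span ℝ ((fun j => s j • w j + l j) '' insert j D) = ⊤ := by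
      intro s₀ l₀ hl₀ hn hwj
      have hlt : W < W ⊔ Submodule.span ℝ {s₀ • w j + l₀} := by
        refine lt_of_le_of_ne le_sup_left fun h => hn ?_
        rw [h]
        exact Submodule.mem_sup_right (Submodule.mem_span_singleton_self _)
      have hlt' := Submodule.finrank_lt_finrank_of_lt hlt
      obtain ⟨s, l, hl, h⟩ := ih (W ⊔ Submodule.span ℝ {s₀ • w j + l₀}) (by omega) (by
        rw [eq_top_iff, ← hs]
        refine sup_le_sup_right (sup_le (le_sup_of_le_left le_sup_left) ?_) L
        rw [Set.image_insert_eq, Submodule.span_insert]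
        refine sup_le ?_ le_sup_right
        rw [Submodule.span_singleton_le_iff_mem]
        exact Submodule.mem_sup_left hwj)
      refine ⟨Function.update s j s₀, Function.update l j l₀, fun i => ?_, ?_⟩
      · by_cases hi : i = j
        · subst hi; simpa using hl₀
        · simpa [Function.update_of_ne hi] using hl i
      · have himg : (fun i => Function.update s j s₀ i • w i + Function.update l j l₀ i) '' D =
            (fun i => s i • w i + l i) '' D := by
          refine Set.image_congr fun i hi => ?_
          have : i ≠ j := fun e => hj (e ▸ hi)
          simp [Function.update_of_ne this]
        rw [Set.image_insert_eq, himg, Submodule.span_insert, ← sup_assoc]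
        simpa using h
    by_cases hw : w j ∈ W
    · by_cases hL : L ≤ W
      · refine ⟨fun _ => 1, 0, fun _ => L.zero_mem, ?_⟩
        rw [eq_top_iff, ← hs]
        simp only [one_smul, Pi.zero_apply, add_zero]
        exact sup_le le_rfl (hL.trans le_sup_left)
      · obtain ⟨l₀, hl₀, hn⟩ := Set.not_subset.1 hL
        exact key 0 l₀ hl₀ (by simpa using hn) (Submodule.mem_sup_left hw)
    · exact key 1 0 L.zero_mem (by simpa using hw)
        (Submodule.mem_sup_right (by simp [Submodule.mem_span_singleton_self]))

variable {α β : Type*} {k : ℕ}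

open Classical in
/-- The vectors `v`, changed on the set `D` to the vectors `s x • (d x + y • g)` plus a combination of
the vectors `b`. -/
noncomputable def movedVector [Fintype β] (v : α → Fin k → ℝ) (D : Set α) (d : α → Fin k → ℝ)
    (g : Fin k → ℝ) (b : β → Fin k → ℝ) (y : ℝ) (s : α → ℝ) (c : α → β → ℝ) (x : α) : Fin k → ℝ :=
  if x ∈ D then s x • (d x + y • g) + ∑ l, c x l • b l else v x

open Classical in
/-- The vectors `movedVector` with indeterminate parameters. -/
noncomputable def movedPolynomial [Fintype β] (v : α → Fin k → ℝ) (D : Set α) (d : α → Fin k → ℝ)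
    (g : Fin k → ℝ) (b : β → Fin k → ℝ) (x : α) (i : Fin k) :
    MvPolynomial (Unit ⊕ α ⊕ α × β) ℝ :=
  open MvPolynomial in
  if x ∈ D then X (Sum.inr (Sum.inl x)) * (C (d x i) + X (Sum.inl ()) * C (g i)) +
    ∑ l, X (Sum.inr (Sum.inr (x, l))) * C (b l i) else C (v x i)

theorem eval_movedPolynomial [Fintype β] (v : α → Fin k → ℝ) (D : Set α) (d : α → Fin k → ℝ)
    (g : Fin k → ℝ) (b : β → Fin k → ℝ) (θ : Unit ⊕ α ⊕ α × β → ℝ) (x : α) (i : Fin k) :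
    MvPolynomial.eval θ (movedPolynomial v D d g b x i) =
      movedVector v D d g b (θ (Sum.inl ())) (fun x => θ (Sum.inr (Sum.inl x)))
        (fun x l => θ (Sum.inr (Sum.inr (x, l)))) x i := by
  by_cases hx : x ∈ D <;> simp [movedPolynomial, movedVector, hx, mul_add]

/-- The vectors of `D` can be put into general position: all prescribed sets `I` that are bases
for some values of the parameters become bases at the same time. -/
theorem exists_generic [Finite α] [Fintype β] (v : α → Fin k → ℝ) (D : Set α) (d : α → Fin k → ℝ)
    (g : Fin k → ℝ) (b : β → Fin k → ℝ) {Y : Set ℝ} (hY : Y.Infinite) (B : Set (Set α))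
    (hB : ∀ I ∈ B, I.ncard = k ∧ LinearIndepOn ℝ v (I \ D) ∧ ∃ y : ℝ,
      Submodule.span ℝ (v '' (I \ D)) ⊔ Submodule.span ℝ ((fun x => d x + y • g) '' (I ∩ D)) ⊔
        Submodule.span ℝ (Set.range b) = ⊤)
    (ψ : (Fin k → ℝ) →ₗ[ℝ] ℝ) (N : Set α)
    (hN : ∀ x ∈ N, ∃ y s c, ψ (movedVector v D d g b y s c x) ≠ 0) :
    ∃ y ∈ Y, ∃ s c, (∀ x, s x ≠ 0) ∧
      (∀ I ∈ B, LinearIndepOn ℝ (movedVector v D d g b y s c) I) ∧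
      ∀ x ∈ N, ψ (movedVector v D d g b y s c x) ≠ 0 := by
  classical
  let param : ℝ → (α → ℝ) → (α → β → ℝ) → (Unit ⊕ α ⊕ α × β → ℝ) := fun y s c =>
    Sum.elim (fun _ => y) (Sum.elim s fun p => c p.1 p.2)
  have hbasis : ∀ I ∈ B, ∃ x : Fin k → α, Function.Injective x ∧ Set.range x = I := by
    intro I hI
    have hc := (hB I hI).1
    rw [← Nat.card_coe_set_eq] at hc
    have e := Finite.equivFinOfCardEq hc
    exact ⟨fun i => e.symm i, Subtype.val_injective.comp e.symm.injective, by
      rw [← Function.comp_def, Set.range_comp, e.symm.range_eq_univ]; simp⟩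
  -- the determinant of the moved vectors, as a polynomial in the parameters
  let ind : (Fin k → α) → MvPolynomial (Unit ⊕ α ⊕ α × β) ℝ := fun x =>
    Matrix.det (Matrix.of fun i j => movedPolynomial v D d g b (x i) j)
  have hind : ∀ (θ : Unit ⊕ α ⊕ α × β → ℝ) x, MvPolynomial.eval θ (ind x) ≠ 0 ↔
      LinearIndependent ℝ (movedVector v D d g b (θ (Sum.inl ())) (fun x => θ (Sum.inr (Sum.inl x)))
        (fun x l => θ (Sum.inr (Sum.inr (x, l)))) ∘ x) := by
    intro θ x
    rw [← det_ne_zero_iff_linearIndependent, RingHom.map_det]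
    have : (MvPolynomial.eval θ).mapMatrix
        (Matrix.of fun i j => movedPolynomial v D d g b (x i) j) =
        Matrix.of (movedVector v D d g b (θ (Sum.inl ())) (fun x => θ (Sum.inr (Sum.inl x)))
          (fun x l => θ (Sum.inr (Sum.inr (x, l)))) ∘ x) := by
      ext i j
      simp [eval_movedPolynomial]
    rw [this]
  -- the value of `ψ` at a moved vector, as a polynomial in the parameters
  let out : α → MvPolynomial (Unit ⊕ α ⊕ α × β) ℝ := fun x =>
    ∑ i, movedPolynomial v D d g b x i * MvPolynomial.C (ψ fun j => if i = j then 1 else 0)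
  have hout : ∀ (θ : Unit ⊕ α ⊕ α × β → ℝ) x, MvPolynomial.eval θ (out x) =
      ψ (movedVector v D d g b (θ (Sum.inl ())) (fun x => θ (Sum.inr (Sum.inl x)))
        (fun x l => θ (Sum.inr (Sum.inr (x, l)))) x) := by
    intro θ x
    simp only [out, map_sum, map_mul, MvPolynomial.eval_C, eval_movedPolynomial]
    rw [LinearMap.pi_apply_eq_sum_univ ψ]
    simp only [smul_eq_mul]
  obtain ⟨θ, hθ, hne⟩ := exists_eval_ne_zero
    (s := ind '' {x | Function.Injective x ∧ Set.range x ∈ B} ∪ out '' N)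
    ((Set.toFinite _).image _ |>.union ((Set.toFinite _).image _)) (by
      rintro _ (⟨x, ⟨hx, hxB⟩, rfl⟩ | ⟨x, hx, rfl⟩)
      · obtain ⟨hc, hli, y, hy⟩ := hB _ hxB
        have hfr : Module.finrank ℝ (Submodule.span ℝ (v '' (Set.range x \ D))) =
            (Set.range x \ D).ncard := by
          have : v '' (Set.range x \ D) = Set.range fun i : (Set.range x \ D : Set α) => v i := by
            rw [Set.image_eq_range]
          rw [this, finrank_span_eq_card (R := ℝ) hli, Fintype.card_eq_nat_card,
            Nat.card_coe_set_eq]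
        obtain ⟨s, l, hl, h⟩ := exists_lift (Submodule.span ℝ (Set.range b)) (fun x => d x + y • g)
          (Set.range x ∩ D) (Set.toFinite _) (Submodule.span ℝ (v '' (Set.range x \ D))) (by
            rw [hfr, Module.finrank_fin_fun, add_comm, Set.ncard_inter_add_ncard_sdiff_eq_ncard _ _
              (Set.toFinite _), hc]) hy
        have hl' : ∀ j, ∃ c : β → ℝ, ∑ i, c i • b i = l j := fun j =>
          (Submodule.mem_span_range_iff_exists_fun ℝ).1 (hl j)
        choose c hc' using hl'
        intro h0
        have h1 : ¬ (MvPolynomial.eval (param y s c) (ind x) ≠ 0) := by simp [h0]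
        rw [hind] at h1
        refine h1 (linearIndependent_of_top_le_span_of_card_eq_finrank ?_ (by simp))
        rw [← h, Set.range_comp, ← Submodule.span_union]
        refine Submodule.span_mono ?_
        rintro _ (⟨z, hz, rfl⟩ | ⟨z, hz, rfl⟩)
        · exact ⟨z, hz.1, by simp [movedVector, hz.2]⟩
        · refine ⟨z, hz.1, by simp [movedVector, hz.2, param, hc']⟩
      · obtain ⟨y, s, c, h⟩ := hN x hx
        intro h0
        have := hout (param y s c) x
        rw [h0, map_zero] at this
        exact h this.symm)
    (Sum.elim (fun _ => Y) fun _ => {z | z ≠ 0}) (by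
      rintro (_ | i)
      · exact hY
      · exact (Set.finite_singleton (0 : ℝ)).infinite_compl)
  refine ⟨θ (Sum.inl ()), hθ (Sum.inl ()), fun x => θ (Sum.inr (Sum.inl x)),
    fun x l => θ (Sum.inr (Sum.inr (x, l))), fun x => hθ (Sum.inr (Sum.inl x)), ?_, ?_⟩
  · intro I hI
    obtain ⟨x, hx, rfl⟩ := hbasis I hI
    have := (hind θ x).1 (hne _ (Or.inl ⟨x, ⟨hx, hI⟩, rfl⟩))
    exact ((linearIndependent_comp_iff x).1 this).2
  · intro x hx
    rw [← hout]
    exact hne _ (Or.inr ⟨x, hx, rfl⟩)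

end Generic

/-! ### Extending a partial representation -/

theorem ncard_le_finrank {α : Type*} [Finite α] {k : ℕ} {v : α → Fin k → ℝ} {I : Set α}
    (h : LinearIndepOn ℝ v I) {U : Submodule ℝ (Fin k → ℝ)} (hU : ∀ x ∈ I, v x ∈ U) :
    I.ncard ≤ Module.finrank ℝ U := by
  classical
  have := Fintype.ofFinite I
  rw [← Nat.card_coe_set_eq, Nat.card_eq_fintype_card, ← finrank_span_eq_card (R := ℝ) h]
  refine Submodule.finrank_mono ?_
  rw [Submodule.span_le]
  rintro _ ⟨x, rfl⟩
  exact hU x x.2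

namespace AbstractOrderType

variable {m n : ℕ} {O : AbstractOrderType (m + 2) n}

/-- A representation of a restriction of the simulating matroid that contains the elements of the order
type, and a functional that vanishes exactly at the elements of the hyperplane at infinity. -/
structure PartialRep (O : AbstractOrderType (m + 2) n) (ψ : (Fin (m + 3) → ℝ) →ₗ[ℝ] ℝ)
    (S : Set (Elt m n)) (v : Elt m n → Fin (m + 3) → ℝ) : Prop where
  mem : ∀ e, Sum.inl e ∈ S
  represents : O.RepresentsOn S v
  infinity : ∀ x ∈ S, ψ (v x) = 0 ↔ x ∈ O.planeSet .infinity

theorem exists_indep_ncard (O : AbstractOrderType (m + 2) n) :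
    ∃ B : Set (Fin n), O.matroid.Indep B ∧ B.ncard = m + 3 := by
  obtain ⟨B, hB⟩ := O.matroid.exists_isBase
  exact ⟨B, hB.indep, O.ncard_of_isBase hB⟩

/-- Bases of the whole simulating matroid can be found within `S`, because the elements of the
order type have full rank. -/
theorem exists_indep_superset {S : Set (Elt m n)} (hS : ∀ e, Sum.inl e ∈ S) {I : Set (Elt m n)}
    (hI : O.simulation.Indep I) (hIS : I ⊆ S) :
    ∃ B, I ⊆ B ∧ B ⊆ S ∧ O.simulation.Indep B ∧ B.ncard = m + 3 := by
  obtain ⟨B, hB, hIB⟩ := hI.subset_isBasis_of_subset hIS (Set.subset_univ _)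
  refine ⟨B, hIB, hB.subset, hB.indep, le_antisymm ((O.simulation_indep_iff _).1 hB.indep).2.1 ?_⟩
  obtain ⟨B₀, hB₀, hc⟩ := O.exists_indep_ncard
  have h1 := (O.simulation_indep_image B₀).2 hB₀
  have h2 : (Sum.inl '' B₀ : Set (Elt m n)).encard ≤ O.simulation.eRk S :=
    h1.encard_le_eRk_of_subset (by rintro _ ⟨e, -, rfl⟩; exact hS e)
  rw [← hB.encard_eq_eRk, ← (Set.toFinite B).cast_ncard_eq,
    ← (Set.toFinite (Sum.inl '' B₀ : Set (Elt m n))).cast_ncard_eq,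
    Set.ncard_image_of_injective _ Sum.inl_injective, hc] at h2
  exact_mod_cast h2

namespace PartialRep

variable {ψ : (Fin (m + 3) → ℝ) →ₗ[ℝ] ℝ} {S : Set (Elt m n)} {v : Elt m n → Fin (m + 3) → ℝ}

theorem ne_zero (h : O.PartialRep ψ S v) : ψ ≠ 0 := by
  rintro rfl
  obtain ⟨x, -⟩ := O.nonzero
  exact (h.infinity _ (h.mem (x 0))).1 rfl

theorem finrank_ker_lt {ψ : (Fin (m + 3) → ℝ) →ₗ[ℝ] ℝ} (h : ψ ≠ 0) :
    Module.finrank ℝ (LinearMap.ker ψ) < m + 3 := by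
  have := Submodule.finrank_lt (s := LinearMap.ker ψ) (fun e => h (LinearMap.ker_eq_top.1 e))
  simpa using this

/-- New elements can be added to a partial representation: they are represented by the vectors
`d x + y • g`, up to factors and vectors of the span of `b`, if for every set that should be a basis
the vectors, together with the span of `b`, span the space. -/
theorem extend (h : O.PartialRep ψ S v) {D : Set (Elt m n)} (hdisj : Disjoint S D)
    (d : Elt m n → Fin (m + 3) → ℝ) (g : Fin (m + 3) → ℝ) {β : Type*} [Fintype β]
    (b : β → Fin (m + 3) → ℝ) {Y : Set ℝ} (hY : Y.Infinite)
    (hspan : ∀ J ⊆ S, ∀ D₀ ⊆ D, D₀.Nonempty → O.simulation.Indep (J ∪ D₀) →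
      (J ∪ D₀).ncard = m + 3 → ∃ y : ℝ, Submodule.span ℝ (v '' J) ⊔
        Submodule.span ℝ ((fun x => d x + y • g) '' D₀) ⊔ Submodule.span ℝ (Set.range b) = ⊤)
    (hfin : ∀ x ∈ D, x ∉ O.planeSet .infinity → ∃ (y s : ℝ) (c : β → ℝ),
      ψ (s • (d x + y • g) + ∑ l, c l • b l) ≠ 0)
    (hinf : ∀ x ∈ D, x ∈ O.planeSet .infinity → ψ (d x) = 0 ∧ ψ g = 0 ∧ ∀ l, ψ (b l) = 0)
    (hplane : ∀ P, O.PlaneValid P → P ≠ .infinity → (∃ x ∈ D, x ∈ O.planeSet P) → ∀ y ∈ Y,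
      ∀ w : Elt m n → Fin (m + 3) → ℝ, (∀ x ∈ S, w x = v x) → (∀ x ∈ D, ∃ s : ℝ,
        ∃ l ∈ Submodule.span ℝ (Set.range b), w x = s • (d x + y • g) + l) →
      ∃ U : Submodule ℝ (Fin (m + 3) → ℝ), Module.finrank ℝ U < m + 3 ∧
        ∀ x ∈ O.planeSet P, x ∈ S ∪ D → w x ∈ U) :
    ∃ y ∈ Y, ∃ w, (∀ x ∈ S, w x = v x) ∧ (∀ x ∈ D, ∃ s : ℝ, s ≠ 0 ∧
      ∃ l ∈ Submodule.span ℝ (Set.range b), w x = s • (d x + y • g) + l) ∧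
      O.PartialRep ψ (S ∪ D) w := by
  classical
  have hSD : ∀ x ∈ S, x ∉ D := fun x hx hx' => hdisj.le_bot ⟨hx, hx'⟩
  obtain ⟨y, hy, s, c, hs, hB, hN⟩ := exists_generic v D d g b hY
    {B | B ⊆ S ∪ D ∧ O.simulation.Indep B ∧ B.ncard = m + 3 ∧ (B ∩ D).Nonempty} (by
      rintro I ⟨hIS, hI, hc, hne⟩
      have hJ : I \ D ⊆ S := fun x hx => (hIS hx.1).resolve_right hx.2
      refine ⟨hc, (h.represents _ hJ).1 (hI.subset Set.sdiff_subset), ?_⟩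
      have hu : I \ D ∪ I ∩ D = I := by rw [Set.union_comm, Set.inter_union_sdiff]
      exact hspan _ hJ _ Set.inter_subset_right hne (by rwa [hu]) (by rwa [hu]))
    ψ (D \ O.planeSet .infinity) (by
      rintro x ⟨hx, hx'⟩
      obtain ⟨y, s, c, h⟩ := hfin x hx hx'
      exact ⟨y, fun _ => s, fun _ => c, by simpa [movedVector, hx] using h⟩)
  set w := movedVector v D d g b y s c with hw
  have hwS : ∀ x ∈ S, w x = v x := fun x hx => by simp [hw, movedVector, hSD x hx]
  have hwD : ∀ x ∈ D, ∃ s : ℝ, s ≠ 0 ∧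
      ∃ l ∈ Submodule.span ℝ (Set.range b), w x = s • (d x + y • g) + l := fun x hx =>
    ⟨s x, hs x, ∑ l, c x l • b l, Submodule.sum_mem _ fun l _ => Submodule.smul_mem _ (c x l)
      (Submodule.subset_span ⟨l, rfl⟩), by simp [hw, movedVector, hx]⟩
  have hψ : ∀ x ∈ S ∪ D, ψ (w x) = 0 ↔ x ∈ O.planeSet .infinity := by
    rintro x (hx | hx)
    · rw [hwS x hx, h.infinity x hx]
    · refine ⟨fun h0 => by_contra fun hx' => hN x ⟨hx, hx'⟩ h0, fun hx' => ?_⟩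
      obtain ⟨h1, h2, h3⟩ := hinf x hx hx'
      simp [hw, movedVector, hx, h1, h2, h3]
  have hcongr : ∀ I ⊆ S, LinearIndepOn ℝ w I ↔ LinearIndepOn ℝ v I := fun I hI =>
    linearIndepOn_congr fun x hx => hwS x (hI hx)
  refine ⟨y, hy, w, hwS, hwD, fun e => Or.inl (h.mem e), fun I hI => ⟨fun hind => ?_, fun hli => ?_⟩,
    hψ⟩
  -- independent sets extend to bases, which the generic choice makes linearly independent
  · obtain ⟨B, hIB, hBS, hBi, hBc⟩ :=
      exists_indep_superset (S := S ∪ D) (fun e => Or.inl (h.mem e)) hind hI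
    refine LinearIndepOn.mono (?_ : LinearIndepOn ℝ w B) hIB
    by_cases hBD : (B ∩ D).Nonempty
    · exact hB B ⟨hBS, hBi, hBc, hBD⟩
    · have hB' : B ⊆ S := fun x hx => (hBS hx).resolve_right fun hx' => hBD ⟨x, hx, hx'⟩
      exact (hcongr B hB').2 ((h.represents B hB').1 hBi)
  -- dependent sets remain dependent because the prescribed hyperplanes span proper subspaces
  · have hE : Sum.inl '' (Sum.inl ⁻¹' I : Set (Fin n)) ⊆ I := Set.image_preimage_subset _ _
    have hES : (Sum.inl '' (Sum.inl ⁻¹' I : Set (Fin n)) : Set (Elt m n)) ⊆ S := by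
      rintro _ ⟨e, -, rfl⟩; exact h.mem e
    have hcard := ncard_le_finrank hli (U := ⊤) (fun _ _ => trivial)
    rw [finrank_top, Module.finrank_fin_fun] at hcard
    refine (O.simulation_indep_iff I).2 ⟨?_, hcard, ?_⟩
    · rw [← O.simulation_indep_image, h.represents _ hES, ← hcongr _ hES]
      exact hli.mono hE
    · intro P hP hIP
      by_cases hID : ∃ x ∈ I, x ∈ D
      · obtain ⟨x, hxI, hxD⟩ := hID
        have : ∃ U : Submodule ℝ (Fin (m + 3) → ℝ), Module.finrank ℝ U < m + 3 ∧
            ∀ x ∈ O.planeSet P, x ∈ S ∪ D → w x ∈ U := by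
          by_cases hPi : P = .infinity
          · subst hPi
            exact ⟨_, finrank_ker_lt h.ne_zero, fun x hx hx' => (hψ x hx').2 hx⟩
          · exact hplane P hP hPi ⟨x, hxD, hIP hxI⟩ y hy w hwS fun x hx => by
              obtain ⟨s, -, h⟩ := hwD x hx
              exact ⟨s, h⟩
        obtain ⟨U, hU, hmem⟩ := this
        exact (ncard_le_finrank hli fun x hx => hmem x (hIP hx) (hI hx)).trans_lt hU
      · have hIS : I ⊆ S := fun x hx => (hI hx).resolve_right fun hx' => hID ⟨x, hx, hx'⟩
        exact ((O.simulation_indep_iff I).1 ((h.represents I hIS).2 ((hcongr I hIS).1 hli))).2.2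
          P hP hIP

end PartialRep

end AbstractOrderType

/-! ### The pencil of two hyperplanes -/

section Pencil

variable {V : Type*} [AddCommGroup V] [Module ℝ V] {φ ψ : V →ₗ[ℝ] ℝ}

/-- A proper subspace that contains the intersection of the kernels of `φ` and `ψ` is contained in a
hyperplane of their pencil, so that the ratio of `φ` and `ψ` is constant on it. -/
theorem mul_eq_of_ker_inf_ker_le {N : Submodule ℝ V} (hN : LinearMap.ker φ ⊓ LinearMap.ker ψ ≤ N)
    (hne : N ≠ ⊤) {z z' : V} (hz : z ∈ N) (hz' : z' ∈ N) : φ z * ψ z' = φ z' * ψ z := by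
  by_contra hcon
  refine hne (eq_top_iff.2 fun w _ => ?_)
  have hΔ : φ z * ψ z' - φ z' * ψ z ≠ 0 := sub_ne_zero.2 hcon
  set Δ := φ z * ψ z' - φ z' * ψ z with hΔdef
  have hk : w - (((φ w * ψ z' - φ z' * ψ w) / Δ) • z + ((φ z * ψ w - φ w * ψ z) / Δ) • z') ∈ N := by
    refine hN ⟨?_, ?_⟩
    · simp only [SetLike.mem_coe, LinearMap.mem_ker, map_sub, map_add, map_smul, smul_eq_mul]
      field_simp
      rw [hΔdef]; ring
    · simp only [SetLike.mem_coe, LinearMap.mem_ker, map_sub, map_add, map_smul, smul_eq_mul]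
      field_simp
      rw [hΔdef]; ring
  have := N.add_mem hk (N.add_mem (N.smul_mem ((φ w * ψ z' - φ z' * ψ w) / Δ) hz)
    (N.smul_mem ((φ z * ψ w - φ w * ψ z) / Δ) hz'))
  simpa using this

end Pencil

/-- There is a hyperplane arbitrarily close to the hyperplane at infinity that avoids a given finite
set of directions. -/
theorem exists_functional {d n : ℕ} (p : Fin n → Fin d → ℝ) (Z : Set (Fin (d + 1) → ℝ))
    (hZ : Z.Finite) (h0 : ∀ z ∈ Z, z ≠ 0) : ∃ ψ : (Fin (d + 1) → ℝ) →ₗ[ℝ] ℝ,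
      (∀ e, 0 < ψ (homogenize (p e))) ∧ ∀ z ∈ Z, ψ z ≠ 0 := by
  let δ : ℝ := 1 / (1 + ∑ e, ∑ i, |p e i|)
  have hsum : 0 ≤ ∑ e, ∑ i, |p e i| := Finset.sum_nonneg fun e _ => Finset.sum_nonneg fun i _ =>
    abs_nonneg _
  have hδ : 0 < δ := by positivity
  let P : (Fin (d + 1) → ℝ) → MvPolynomial (Fin d) ℝ := fun z =>
    MvPolynomial.C (z (Fin.last d)) + ∑ i, MvPolynomial.X i * MvPolynomial.C (z i.castSucc)
  have heval : ∀ θ z, MvPolynomial.eval θ (P z) = z (Fin.last d) + ∑ i, θ i * z i.castSucc := by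
    intro θ z; simp [P]
  obtain ⟨θ, hθ, hne⟩ := exists_eval_ne_zero (s := P '' Z) (hZ.image _) (by
    rintro _ ⟨z, hz, rfl⟩ hP
    refine h0 z hz ?_
    have h1 := heval 0 z
    simp only [hP, map_zero, Pi.zero_apply, zero_mul, Finset.sum_const_zero, add_zero] at h1
    funext i
    induction i using Fin.lastCases with
    | last => exact h1.symm
    | cast i =>
      have h2 := heval (Pi.single i 1) z
      rw [hP, map_zero, ← h1, zero_add, Finset.sum_eq_single i] at h2
      · simpa using h2.symm
      · intro j _ hj; simp [hj]
      · simp) (fun _ => Set.Ioo 0 δ) (fun _ => Set.Ioo_infinite hδ)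
  let ψ : (Fin (d + 1) → ℝ) →ₗ[ℝ] ℝ :=
    LinearMap.proj (Fin.last d) + ∑ i : Fin d, θ i • LinearMap.proj i.castSucc
  have hψ : ∀ z, ψ z = z (Fin.last d) + ∑ i, θ i * z i.castSucc := by
    intro z; simp [ψ]
  refine ⟨ψ, fun e => ?_, fun z hz => ?_⟩
  · rw [hψ]
    have h1 : ∑ i, |p e i| ≤ ∑ e, ∑ i, |p e i| :=
      Finset.single_le_sum (f := fun e => ∑ i, |p e i|)
        (fun e _ => Finset.sum_nonneg fun i _ => abs_nonneg _) (Finset.mem_univ e)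
    have h2 : ∀ i, -(δ * |p e i|) ≤ θ i * p e i := by
      intro i
      have h3 : |θ i * p e i| ≤ δ * |p e i| := by
        rw [abs_mul, abs_of_pos (hθ i).1]
        exact mul_le_mul_of_nonneg_right (hθ i).2.le (abs_nonneg _)
      exact (neg_le_neg h3).trans (neg_abs_le _)
    have h3 := Finset.sum_le_sum fun i (_ : i ∈ Finset.univ) => h2 i
    rw [Finset.sum_neg_distrib, ← Finset.mul_sum] at h3
    have h4 : δ * ∑ i, |p e i| < 1 := by
      calc δ * ∑ i, |p e i| ≤ δ * ∑ e, ∑ i, |p e i| := mul_le_mul_of_nonneg_left h1 hδ.le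
        _ < 1 := by
          simp only [δ]
          rw [one_div, inv_mul_lt_iff₀ (by positivity)]
          linarith
    simp only [homogenize, Fin.snoc_last, Fin.snoc_castSucc]
    linarith
  · rw [hψ, ← heval]
    exact hne _ ⟨z, hz, rfl⟩

namespace AbstractOrderType

variable {m n : ℕ} {O : AbstractOrderType (m + 2) n}

theorem RepresentsOn.mem_span_of_parallel {S : Set (Elt m n)} {v : Elt m n → Fin (m + 3) → ℝ}
    (hv : O.RepresentsOn S v) (hS : ∀ e, Sum.inl e ∈ S) {a b : Fin n} (h : O.Parallel a b) :
    v (Sum.inl a) ∈ Submodule.span ℝ {v (Sum.inl b)} := by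
  rcases (O.parallel_iff (by omega) a b).1 h with rfl | hdep
  · exact Submodule.mem_span_singleton_self _
  have hsub : ∀ X : Set (Fin n), (Sum.inl '' X : Set (Elt m n)) ⊆ S := by
    rintro X _ ⟨e, -, rfl⟩; exact hS e
  have h1 : ¬ LinearIndepOn ℝ v (insert (Sum.inl a) {Sum.inl b}) := by
    rw [← Set.image_singleton, ← Set.image_insert_eq, ← hv _ (hsub _), O.simulation_indep_image]
    exact hdep
  have h2 : LinearIndepOn ℝ v {Sum.inl b} := by
    rw [← Set.image_singleton, ← hv _ (hsub _), O.simulation_indep_image]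
    simpa using O.isNonloop (by omega) b
  have h3 := h2.mem_span_iff.2 fun h => absurd h h1
  rwa [Set.image_singleton] at h3

/-- The elements in the intersection of the hyperplane of a tuple with the hyperplane at infinity. -/
def gSet (t : Fin (m + 2) → Fin n) : Set (Elt m n) := insert (Sum.inr (t, Aux.g)) (lSet t)

theorem ncard_gSet (t : Fin (m + 2) → Fin n) : (gSet (m := m) t).ncard = m + 1 := by
  rw [gSet, Set.ncard_insert_of_notMem (by simp [lSet]), ncard_lSet]

namespace PartialRep

variable {ψ : (Fin (m + 3) → ℝ) →ₗ[ℝ] ℝ} {S : Set (Elt m n)} {v : Elt m n → Fin (m + 3) → ℝ}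

theorem tupleFunctional_congr {v w : Elt m n → Fin (m + 3) → ℝ}
    (h : ∀ e, w (Sum.inl e) = v (Sum.inl e)) (t : Fin (m + 2) → Fin n) :
    tupleFunctional w t = tupleFunctional v t := by
  simp only [tupleFunctional, h]

theorem flat_iff (h : O.PartialRep ψ S v) {t : Fin (m + 2) → Fin n} (ht : O.Canonical t)
    {x : Elt m n} (hx : x ∈ S) : tupleFunctional v t (v x) = 0 ↔ x ∈ O.planeSet (.flat t) :=
  h.represents.tupleFunctional_eq_zero_iff h.mem ht hx

theorem finrank_span (h : O.PartialRep ψ S v) {J : Set (Elt m n)} (hJS : J ⊆ S)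
    (hJ : O.simulation.Indep J) : Module.finrank ℝ (Submodule.span ℝ (v '' J)) = J.ncard := by
  classical
  have := Fintype.ofFinite J
  rw [Set.image_eq_range, finrank_span_eq_card (R := ℝ) ((h.represents J hJS).1 hJ),
    ← Nat.card_coe_set_eq, Nat.card_eq_fintype_card]

/-- An element can be represented by a generic vector of a subspace `U`, if `U` is contained in the
hyperplanes of the planes through the element, and not in the span of other sets. -/
theorem extend_subspace (h : O.PartialRep ψ S v) {x : Elt m n} (hx : x ∉ S)
    (U : Submodule ℝ (Fin (m + 3) → ℝ))
    (hU : ∀ J ⊆ S, O.simulation.Indep (insert x J) → J.ncard = m + 2 →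
      ¬ U ≤ Submodule.span ℝ (v '' J))
    (hfin : x ∉ O.planeSet .infinity → ¬ U ≤ LinearMap.ker ψ)
    (hinf : x ∈ O.planeSet .infinity → U ≤ LinearMap.ker ψ)
    (hplane : ∀ P, O.PlaneValid P → P ≠ .infinity → x ∈ O.planeSet P →
      ∀ u ∈ U, ∃ U' : Submodule ℝ (Fin (m + 3) → ℝ), Module.finrank ℝ U' < m + 3 ∧ u ∈ U' ∧
        ∀ z ∈ O.planeSet P, z ∈ S → v z ∈ U') :
    ∃ w, (∀ z ∈ S, w z = v z) ∧ O.PartialRep ψ (insert x S) w := by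
  let b : Fin (Module.finrank ℝ U) → Fin (m + 3) → ℝ := fun i => (Module.finBasis ℝ U i : _)
  have hb : Submodule.span ℝ (Set.range b) = U := by
    have h1 := (Module.finBasis ℝ U).span_eq
    have h2 : Set.range b = U.subtype '' Set.range (Module.finBasis ℝ U) := by
      rw [← Set.range_comp]; rfl
    rw [h2, Submodule.span_image, h1, Submodule.map_top, Submodule.range_subtype]
  obtain ⟨-, -, w, hwS, -, hw⟩ := h.extend (D := {x}) (by simpa using hx) 0 0 b
    Set.infinite_univ (by
      intro J hJS D₀ hD₀ hne hI hc
      obtain rfl : D₀ = {x} := (Set.Nonempty.subset_singleton_iff hne).1 hD₀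
      refine ⟨0, ?_⟩
      rw [hb]
      have hxJ : x ∉ J := fun hxJ => hx (hJS hxJ)
      rw [Set.union_singleton] at hI hc
      rw [Set.ncard_insert_of_notMem hxJ (Set.toFinite _)] at hc
      have hr := h.finrank_span hJS (hI.subset (Set.subset_insert _ _))
      have hlt : Submodule.span ℝ (v '' J) < Submodule.span ℝ (v '' J) ⊔ U :=
        lt_of_le_of_ne le_sup_left fun e => hU J hJS hI (by omega) (by rw [e]; exact le_sup_right)
      have hlt' := Submodule.finrank_lt_finrank_of_lt hlt
      rw [eq_top_iff, ← Submodule.eq_top_of_finrank_eq (S := Submodule.span ℝ (v '' J) ⊔ U)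
        (le_antisymm (Submodule.finrank_le _) (by rw [Module.finrank_fin_fun]; omega))]
      exact sup_le_sup_right le_sup_left U)
    (by
      rintro _ rfl hxi
      obtain ⟨u, hu, hne⟩ := Set.not_subset.1 (hfin hxi)
      obtain ⟨c, hc⟩ := (Submodule.mem_span_range_iff_exists_fun ℝ).1 (by rw [hb]; exact hu : u ∈ Submodule.span ℝ (Set.range b))
      exact ⟨0, 0, c, by simpa [hc] using hne⟩)
    (by
      rintro _ rfl hxi
      exact ⟨by simp, by simp, fun l => hinf hxi (Submodule.coe_mem _)⟩)
    (by
      rintro P hP hPi ⟨x', hx', hxP⟩ y - w hwS hwD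
      rw [Set.mem_singleton_iff.1 hx'] at hxP
      have hwx : w x ∈ U := by
        obtain ⟨s, l, hl, hw⟩ := hwD x rfl
        rw [hw, hb] at *
        simpa using hl
      obtain ⟨U', hU', hle, hmem⟩ := hplane P hP hPi hxP _ hwx
      refine ⟨U', hU', fun z hz hz' => ?_⟩
      rcases hz' with hz' | rfl
      · rw [hwS z hz']; exact hmem z hz hz'
      · exact hle)
  exact ⟨w, hwS, by rwa [Set.union_singleton] at hw⟩

theorem not_ker_le (h : O.PartialRep ψ S v) {t : Fin (m + 2) → Fin n} :
    ¬ LinearMap.ker (tupleFunctional v t) ≤ LinearMap.ker ψ := by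
  intro hle
  have h1 : v (Sum.inl (t 0)) ∈ LinearMap.ker (tupleFunctional v t) := detLast_eq_zero_of_mem _ 0
  exact (h.infinity _ (h.mem _)).1 (hle h1)

theorem tupleFunctional_ne_zero (h : O.PartialRep ψ S v) {t : Fin (m + 2) → Fin n}
    (ht : O.Canonical t) : tupleFunctional v t ≠ 0 := by
  intro h0
  obtain ⟨a, ha, -⟩ := ht.2
  exact ha ((h.flat_iff ht (h.mem a)).1 (by rw [h0]; rfl))

/-- The kernel of `ζ` has at least the dimension `m + 2` of the span of `J`; hence they are
equal. -/
theorem ker_le_span {ζ : (Fin (m + 3) → ℝ) →ₗ[ℝ] ℝ} (h : O.PartialRep ψ S v)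
    {J : Set (Elt m n)} (hJS : J ⊆ S) (hJ : O.simulation.Indep J) (hc : J.ncard = m + 2)
    (hle : LinearMap.ker ζ ≤ Submodule.span ℝ (v '' J)) {z : Elt m n} (hz : z ∈ J) :
    ζ (v z) = 0 := by
  have h1 := h.finrank_span hJS hJ
  have h2 := LinearMap.finrank_range_add_finrank_ker ζ
  have h3 := Submodule.finrank_le (LinearMap.range ζ)
  rw [Module.finrank_fin_fun] at h2
  rw [Module.finrank_self] at h3
  have h4 := Submodule.eq_of_le_of_finrank_le hle (by omega)
  have h5 : v z ∈ LinearMap.ker ζ := by rw [h4]; exact Submodule.subset_span ⟨z, hz, rfl⟩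
  exact h5

/-- The hyperplane `ζ = 0` has vectors outside of the span of `J` for a new element `x`. -/
theorem not_ker_le_span {ζ : (Fin (m + 3) → ℝ) →ₗ[ℝ] ℝ} (h : O.PartialRep ψ S v) {x : Elt m n}
    (hx : x ∉ S) {P : Plane m n} (hP : O.PlaneValid P) (hxP : x ∈ O.planeSet P)
    (hζ : ∀ z ∈ S, ζ (v z) = 0 ↔ z ∈ O.planeSet P) {J : Set (Elt m n)} (hJS : J ⊆ S)
    (hI : O.simulation.Indep (insert x J)) (hc : J.ncard = m + 2) :
    ¬ LinearMap.ker ζ ≤ Submodule.span ℝ (v '' J) := by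
  intro hle
  have hI' := ((O.simulation_indep_iff _).1 hI).2.2 P hP (Set.insert_subset hxP fun z hz =>
    (hζ z (hJS hz)).1 (h.ker_le_span hJS (hI.subset (Set.subset_insert _ _)) hc hle hz))
  rw [Set.ncard_insert_of_notMem (fun hxJ => hx (hJS hxJ)) (Set.toFinite _)] at hI'
  omega

theorem finrank_sup_pair_lt (v : Elt m n → Fin (m + 3) → ℝ) (t : Fin (m + 2) → Fin n)
    (a b : Fin (m + 3) → ℝ) :
    Module.finrank ℝ ↑(Submodule.span ℝ (v '' lSet t) ⊔ Submodule.span ℝ {a, b}) < m + 3 := by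
  classical
  have e1 : Module.finrank ℝ (Submodule.span ℝ (v '' lSet t)) ≤ m := by
    have h1 := finrank_span_finset_le_card (R := ℝ)
      (Finset.univ.image fun j : Fin m => v (Sum.inr (t, Aux.l j)))
    have h2 : ((Finset.univ.image fun j : Fin m => v (Sum.inr (t, Aux.l j)) : Finset _) : Set _) =
        v '' lSet t := by
      rw [lSet, ← Set.range_comp]; simp [Function.comp_def]
    rw [h2] at h1
    exact h1.trans (Finset.card_image_le.trans (by simp))
  have e2 : Module.finrank ℝ (Submodule.span ℝ {a, b}) ≤ 2 := by
    have := finrank_span_finset_le_card (R := ℝ) {a, b}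
    simp only [Finset.coe_pair] at this
    exact this.trans Finset.card_le_two
  have e3 := Submodule.finrank_add_le_finrank_add_finrank (Submodule.span ℝ (v '' lSet t))
    (Submodule.span ℝ {a, b})
  omega

/-- The other prescribed planes through a new element contain so few old elements that they do not
restrict its position. -/
def FewInOtherPlanes (O : AbstractOrderType (m + 2) n) (S : Set (Elt m n)) (P₀ : Plane m n)
    (x : Elt m n) : Prop :=
  ∀ P, O.PlaneValid P → P ≠ .infinity → P ≠ P₀ → x ∈ O.planeSet P →
    ∃ t c, ∀ z ∈ O.planeSet P, z ∈ S → z = c ∨ z ∈ lSet t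

theorem exists_finrank_lt (v : Elt m n → Fin (m + 3) → ℝ) (u : Fin (m + 3) → ℝ) {A : Set (Elt m n)}
    (hA : ∃ t c, ∀ z ∈ A, z ∈ S → z = c ∨ z ∈ lSet t) :
    ∃ U' : Submodule ℝ (Fin (m + 3) → ℝ), Module.finrank ℝ U' < m + 3 ∧ u ∈ U' ∧
      ∀ z ∈ A, z ∈ S → v z ∈ U' := by
  obtain ⟨t, c, hc⟩ := hA
  refine ⟨_, finrank_sup_pair_lt v t (v c) u,
    Submodule.mem_sup_right (Submodule.subset_span (by simp)), fun z hz hzS => ?_⟩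
  rcases hc z hz hzS with rfl | hz
  · exact Submodule.mem_sup_right (Submodule.subset_span (by simp))
  · exact Submodule.mem_sup_left (Submodule.subset_span ⟨z, hz, rfl⟩)

/-- A new element is represented by a generic vector of the hyperplane at infinity. -/
theorem extend_infinity (h : O.PartialRep ψ S v) {x : Elt m n} (hx : x ∉ S)
    (hinf : x ∈ O.planeSet .infinity) (hP : FewInOtherPlanes O S .infinity x) :
    ∃ w, (∀ z ∈ S, w z = v z) ∧ O.PartialRep ψ (insert x S) w :=
  h.extend_subspace hx (LinearMap.ker ψ)
    (fun _ hJS hI hc => h.not_ker_le_span hx (P := .infinity) trivial hinf h.infinity hJS hI hc)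
    (fun h => (h hinf).elim) (fun _ => le_rfl) fun P hPv hPi hxP u _ =>
      exists_finrank_lt v u (hP P hPv hPi hPi hxP)

/-- A new element is represented by a generic vector of the hyperplane of the tuple `t`. -/
theorem extend_flat (h : O.PartialRep ψ S v) {x : Elt m n} (hx : x ∉ S)
    (hinf : x ∉ O.planeSet .infinity) {t : Fin (m + 2) → Fin n} (ht : O.Canonical t)
    (hxt : x ∈ O.planeSet (.flat t)) (hP : FewInOtherPlanes O S (.flat t) x) :
    ∃ w, (∀ z ∈ S, w z = v z) ∧ O.PartialRep ψ (insert x S) w := by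
  refine h.extend_subspace hx (LinearMap.ker (tupleFunctional v t))
    (fun _ hJS hI hc => h.not_ker_le_span hx (P := .flat t) ht hxt
      (fun z hz => h.flat_iff ht hz) hJS hI hc)
    (fun _ => h.not_ker_le) (fun h => (hinf h).elim) fun P hPv hPi hxP u hu => ?_
  by_cases hPt : P = .flat t
  · subst hPt
    exact ⟨_, finrank_ker_lt (h.tupleFunctional_ne_zero ht), hu, fun z hz hz' =>
      (h.flat_iff ht hz').2 hz⟩
  · exact exists_finrank_lt v u (hP P hPv hPi hPt hxP)

/-- A new element outside of all prescribed hyperplanes is represented by a generic vector. -/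
theorem extend_free (h : O.PartialRep ψ S v) {x : Elt m n} (hx : x ∉ S)
    (hP : ∀ P, O.PlaneValid P → x ∉ O.planeSet P) :
    ∃ w, (∀ z ∈ S, w z = v z) ∧ O.PartialRep ψ (insert x S) w := by
  refine h.extend_subspace hx ⊤ (fun J hJS hI hc hle => ?_) (fun _ hle => ?_)
    (fun h => (hP .infinity trivial h).elim) fun P hPv hPi hxP => (hP P hPv hxP).elim
  · have h1 := h.finrank_span hJS (hI.subset (Set.subset_insert _ _))
    rw [top_le_iff.1 hle, finrank_top, Module.finrank_fin_fun] at h1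
    omega
  · exact h.ne_zero (LinearMap.ker_eq_top.1 (top_le_iff.1 hle))

/-- An element in the intersection of the hyperplane of a tuple with the hyperplane at infinity can be
represented by a generic vector of the intersection. -/
theorem extend_gSet (h : O.PartialRep ψ S v) {t : Fin (m + 2) → Fin n} (ht : O.Canonical t)
    {x : Elt m n} (hxt : x ∈ gSet t) (hx : x ∉ S)
    (hS : ∀ z ∈ S, (∃ e, z = Sum.inl e) ∨ ∃ t, z ∈ gSet t)
    (hψ : ∀ a b, O.side t a ≠ 0 → O.side t b ≠ 0 → ¬ O.Parallel a b →
      tupleFunctional v t (v (Sum.inl a)) * ψ (v (Sum.inl b)) ≠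
        tupleFunctional v t (v (Sum.inl b)) * ψ (v (Sum.inl a))) :
    ∃ w, (∀ z ∈ S, w z = v z) ∧ O.PartialRep ψ (insert x S) w := by
  have hxi : x ∈ O.planeSet .infinity := by
    rcases hxt with rfl | ⟨j, rfl⟩ <;> simp [planeSet, Aux.AtInfinity]
  have hxf : x ∈ O.planeSet (.flat t) := by
    rcases hxt with rfl | ⟨j, rfl⟩ <;> simp [planeSet, Aux.OnFlat]
  refine h.extend_subspace hx (LinearMap.ker (tupleFunctional v t) ⊓ LinearMap.ker ψ) ?_
    (fun h => (h hxi).elim) (fun _ => inf_le_right) ?_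
  · intro J hJS hI hc hle
    have hJ := hI.subset (Set.subset_insert x J)
    have hxJ : x ∉ J := fun hxJ => hx (hJS hxJ)
    have hcI : (insert x J).ncard = m + 3 := by
      rw [Set.ncard_insert_of_notMem hxJ (Set.toFinite _), hc]
    have hmul : ∀ z ∈ J, ∀ z' ∈ J, tupleFunctional v t (v z) * ψ (v z') =
        tupleFunctional v t (v z') * ψ (v z) := fun z hz z' hz' =>
      mul_eq_of_ker_inf_ker_le hle (fun e => by
        have := h.finrank_span hJS hJ
        rw [e, finrank_top, Module.finrank_fin_fun] at this
        omega) (Submodule.subset_span ⟨z, hz, rfl⟩) (Submodule.subset_span ⟨z', hz', rfl⟩)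
    -- `J` spans a hyperplane of the pencil, but not the flat or infinity, which contain `x` as well
    obtain ⟨z₀, hz₀, h₀⟩ : ∃ z ∈ J, z ∉ O.planeSet (.flat t) := by
      by_contra hcon
      push Not at hcon
      have := ((O.simulation_indep_iff _).1 hI).2.2 (.flat t) ht (Set.insert_subset hxf hcon)
      omega
    obtain ⟨z₁, hz₁, h₁⟩ : ∃ z ∈ J, z ∉ O.planeSet .infinity := by
      by_contra hcon
      push Not at hcon
      have := ((O.simulation_indep_iff _).1 hI).2.2 .infinity trivial (Set.insert_subset hxi hcon)
      omega
    rw [← h.flat_iff ht (hJS hz₀)] at h₀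
    rw [← h.infinity _ (hJS hz₁)] at h₁
    have hE : ∀ z ∈ J, z ∉ gSet t → ∃ e, z = Sum.inl e ∧ O.side t e ≠ 0 := by
      intro z hz hzt
      rcases hS z (hJS hz) with ⟨e, rfl⟩ | ⟨t', ht'⟩
      · refine ⟨e, rfl, fun h0 => ?_⟩
        have h2 := (h.flat_iff ht (hJS hz)).2 h0
        have h3 := hmul _ hz₀ _ hz
        rw [h2, zero_mul] at h3
        exact (mul_ne_zero h₀ fun h4 => (h.infinity _ (hJS hz)).1 h4) h3
      · exfalso
        have h2 : z ∈ O.planeSet .infinity := by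
          rcases ht' with rfl | ⟨j, rfl⟩ <;> simp [planeSet, Aux.AtInfinity]
        have h3 : z ∉ O.planeSet (.flat t) := by
          intro h3
          apply hzt
          rcases ht' with rfl | ⟨j, rfl⟩
          · obtain ⟨rfl, -⟩ := h3; exact Or.inl rfl
          · obtain ⟨rfl, -⟩ := h3; exact Or.inr ⟨j, rfl⟩
        rw [← h.flat_iff ht (hJS hz)] at h3
        have h4 := hmul _ hz _ hz₁
        rw [(h.infinity _ (hJS hz)).2 h2, mul_zero] at h4
        exact mul_ne_zero h3 h₁ h4
    -- elements of `J` outside of `gSet t` have the same position, so they are parallel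
    have hone : (J \ gSet t).ncard ≤ 1 := by
      rw [Set.ncard_le_one (Set.toFinite _)]
      rintro z ⟨hz, hzt⟩ z' ⟨hz', hzt'⟩
      obtain ⟨e, rfl, he⟩ := hE z hz hzt
      obtain ⟨e', rfl, he'⟩ := hE z' hz' hzt'
      by_contra hne
      refine hψ e e' he he' ?_ (hmul _ hz _ hz')
      intro hpar
      rcases (O.parallel_iff (by omega) e e').1 hpar with h | h
      · exact hne (by rw [h])
      · refine h (((O.simulation_indep_iff _).1 hJ).1.subset ?_)
        rintro _ (rfl | rfl) <;> assumption
    have h5 : (J ∩ gSet t).ncard ≤ m := by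
      have h6 : J ∩ gSet t ⊆ gSet t \ {x} := fun z hz => ⟨hz.2, fun e => hxJ (e ▸ hz.1)⟩
      have h7 := Set.ncard_le_ncard h6 (Set.toFinite _)
      rw [Set.ncard_sdiff_singleton_of_mem hxt, ncard_gSet] at h7
      omega
    have := Set.ncard_inter_add_ncard_sdiff_eq_ncard J (gSet t) (Set.toFinite _)
    omega
  · intro P hP hPi hxP u hu
    have hG : ∀ z ∈ gSet t, z ∈ S → tupleFunctional v t (v z) = 0 ∧ ψ (v z) = 0 := by
      intro z hz hzS
      rw [h.flat_iff ht hzS, h.infinity z hzS]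
      rcases hz with rfl | ⟨j, rfl⟩ <;> simp [planeSet, Aux.AtInfinity, Aux.OnFlat]
    have hPt : P.block = some t := by
      rcases hxt with rfl | ⟨j, rfl⟩ <;> cases P <;>
        simp only [planeSet, Set.mem_ofPred_eq, Sum.elim_inr, Aux.OnFlat, Aux.OnHarmonic, Aux.OnRow,
          Aux.OnColumn, Aux.OnDiagonal, and_false, and_true] at hxP hPi <;>
        first
        | exact hxP.elim
        | exact (hPi rfl).elim
        | (subst hxP; rfl)
    have hzG : ∀ z ∈ O.planeSet P, z ∈ S → (∃ e, z = Sum.inl e) ∨ z ∈ gSet t := by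
      intro z hz hzS
      refine (hS z hzS).imp_right ?_
      rintro ⟨t', ht'⟩
      have : t' = t := by
        rcases ht' with rfl | ⟨j, rfl⟩ <;> cases P <;> simp only [Plane.block, reduceCtorEq,
          Option.some.injEq] at hPt <;> subst hPt <;> exact hz.1
      rwa [this] at ht'
    by_cases hrow : ∃ a β, P = .row t a β
    · obtain ⟨a, β, rfl⟩ := hrow
      have ha : tupleFunctional v t (v (Sum.inl a)) ≠ 0 := fun h0 =>
        hP.2.2 ((h.flat_iff ht (h.mem a)).1 h0)
      refine ⟨LinearMap.ker (tupleFunctional v t (v (Sum.inl a)) • ψ -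
        ψ (v (Sum.inl a)) • tupleFunctional v t), finrank_ker_lt fun h0 => ?_, ?_,
        fun z hz hzS => ?_⟩
      · refine h.not_ker_le (t := t) fun z hz => ?_
        have := LinearMap.congr_fun h0 z
        rw [LinearMap.mem_ker] at hz
        simp only [LinearMap.sub_apply, LinearMap.smul_apply, hz, smul_eq_mul, mul_zero, sub_zero,
          LinearMap.zero_apply, mul_eq_zero, ha, false_or] at this
        exact this
      · have h1 : tupleFunctional v t u = 0 := hu.1
        have h2 : ψ u = 0 := hu.2
        simp [h1, h2]
      · rcases hzG z hz hzS with ⟨e, rfl⟩ | hzt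
        · have hpar : O.Parallel e a := Parallel.symm hz
          obtain ⟨r, hr⟩ := Submodule.mem_span_singleton.1
            (h.represents.mem_span_of_parallel h.mem hpar)
          simp only [← hr, map_smul, LinearMap.mem_ker, LinearMap.sub_apply, LinearMap.smul_apply,
            smul_eq_mul]
          ring
        · obtain ⟨h1, h2⟩ := hG z hzt hzS
          simp [h1, h2]
    · by_cases hflat : P = .flat t
      · subst hflat
        exact ⟨_, finrank_ker_lt (h.tupleFunctional_ne_zero ht), hu.1, fun z hz hzS =>
          (h.flat_iff ht hzS).2 hz⟩
      · refine ⟨_, finrank_ker_lt h.ne_zero, hu.2, fun z hz hzS => ?_⟩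
        rcases hzG z hz hzS with ⟨e, rfl⟩ | hzt
        · exfalso
          cases P <;> simp only [Plane.block, reduceCtorEq, Option.some.injEq] at hPt <;> subst hPt
          · exact hflat rfl
          · exact hz
          · exact hrow ⟨_, _, rfl⟩
          · exact hz
          · exact hz
        · exact (hG z hzt hzS).2

end PartialRep

end AbstractOrderType

/-! ### Realizations represent the order type and the elements at the intersections with infinity -/

namespace AbstractOrderType

variable {m n : ℕ} {O : AbstractOrderType (m + 2) n}

theorem Realizes.chi_ne_zero_iff {d n : ℕ} {O : AbstractOrderType d n} {p : Fin n → Fin d → ℝ}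
    (hp : O.Realizes p) (x : Fin (d + 1) → Fin n) :
    O.χ x ≠ 0 ↔ LinearIndependent ℝ ((fun e => homogenize (p e)) ∘ x) := by
  rw [← hp x, orientation_eq_sign, ne_eq, sign_eq_zero_iff, ← ne_eq,
    det_ne_zero_iff_linearIndependent]
  rfl

theorem Realizes.indep_iff {d n : ℕ} {O : AbstractOrderType d n} {p : Fin n → Fin d → ℝ}
    (hp : O.Realizes p) (X : Set (Fin n)) :
    O.matroid.Indep X ↔ LinearIndepOn ℝ (fun e => homogenize (p e)) X := by
  constructor
  · intro hX
    obtain ⟨B, hB, hXB⟩ := hX.exists_isBase_superset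
    obtain ⟨x, hx, rfl⟩ := (O.isBase_iff B).1 hB
    exact ((linearIndependent_comp_iff x).1 ((hp.chi_ne_zero_iff x).1 hx)).2.mono hXB
  · intro hX
    let B := hX.extend (Set.subset_univ X)
    have hB : LinearIndepOn ℝ (fun e => homogenize (p e)) B := hX.linearIndepOn_extend _
    have hXB : X ⊆ B := hX.subset_extend _
    have hspan := hX.image_subset_span_image_extend (Set.subset_univ X)
    obtain ⟨z, hz⟩ := O.nonzero
    have hz' := (hp.chi_ne_zero_iff z).1 hz
    have htop : Submodule.span ℝ ((fun e => homogenize (p e)) '' B) = ⊤ := by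
      rw [eq_top_iff, ← hz'.span_eq_top_of_card_eq_finrank (by simp), Submodule.span_le]
      rintro _ ⟨i, rfl⟩
      exact hspan ⟨z i, trivial, rfl⟩
    have hcard : B.ncard = d + 1 := by
      classical
      have := Fintype.ofFinite B
      have h1 := finrank_span_eq_card (R := ℝ) hB
      rw [← Set.image_eq_range (fun e => homogenize (p e)), htop, finrank_top,
        Module.finrank_fin_fun] at h1
      rw [← Nat.card_coe_set_eq, Nat.card_eq_fintype_card, ← h1]
    obtain ⟨e⟩ : Nonempty (Fin (d + 1) ≃ B) := by
      rw [← Nat.card_coe_set_eq] at hcard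
      exact ⟨(Finite.equivFinOfCardEq hcard).symm⟩
    have hr : Set.range (fun i => (e i : Fin n)) = B := by
      rw [← Function.comp_def Subtype.val e, Set.range_comp, e.range_eq_univ]; simp
    have hχ : O.χ (fun i => e i) ≠ 0 := by
      rw [hp.chi_ne_zero_iff, linearIndependent_comp_iff, hr]
      exact ⟨Subtype.val_injective.comp e.injective, hB⟩
    exact ((O.isBase_iff B).2 ⟨_, hχ, hr⟩).indep.subset hXB

/-- The elements of the order type and all elements in intersections of its hyperplanes with the
hyperplane at infinity. -/
def baseSet (O : AbstractOrderType (m + 2) n) : Set (Elt m n) :=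
  Set.range Sum.inl ∪ ⋃ t ∈ {t | O.Canonical t}, gSet t

/-- A functional that is positive on the elements of the order type and separates their positions
relative to the hyperplanes of the order type. -/
structure Separates (O : AbstractOrderType (m + 2) n) (ψ : (Fin (m + 3) → ℝ) →ₗ[ℝ] ℝ)
    (v : Elt m n → Fin (m + 3) → ℝ) : Prop where
  sign : ∀ t a, SignType.sign (tupleFunctional v t (v (Sum.inl a))) = O.side t a
  pos : ∀ e, 0 < ψ (v (Sum.inl e))
  ne : ∀ t, O.Canonical t → ∀ a b, O.side t a ≠ 0 → O.side t b ≠ 0 → ¬ O.Parallel a b →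
    (tupleFunctional v t (v (Sum.inl a)) * ψ (v (Sum.inl b))) ^ 2 ≠
      (tupleFunctional v t (v (Sum.inl b)) * ψ (v (Sum.inl a))) ^ 2

theorem Separates.congr {ψ : (Fin (m + 3) → ℝ) →ₗ[ℝ] ℝ} {v w : Elt m n → Fin (m + 3) → ℝ}
    (h : O.Separates ψ v) (hvw : ∀ e, w (Sum.inl e) = v (Sum.inl e)) : O.Separates ψ w := by
  have ht := PartialRep.tupleFunctional_congr hvw
  refine ⟨fun t a => ?_, fun e => ?_, fun t htc a b => ?_⟩
  · rw [ht, hvw]; exact h.sign t a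
  · rw [hvw]; exact h.pos e
  · rw [ht, hvw, hvw]; exact h.ne t htc a b

/-- A realization extends to the intersections of the hyperplanes with the infinite one, which is
represented by a generic hyperplane `ψ = 0`. -/
theorem Realizes.exists_baseSet {p : Fin n → Fin (m + 2) → ℝ} (hp : O.Realizes p) :
    ∃ (ψ : (Fin (m + 3) → ℝ) →ₗ[ℝ] ℝ) (v : Elt m n → Fin (m + 3) → ℝ),
      (∀ e, v (Sum.inl e) = homogenize (p e)) ∧ O.Separates ψ v ∧ O.PartialRep ψ O.baseSet v := by
  classical
  let v₀ : Elt m n → Fin (m + 3) → ℝ := Sum.elim (fun e => homogenize (p e)) fun _ => 0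
  have hrep : O.RepresentsOn (Set.range Sum.inl) v₀ := by
    intro I hI
    obtain ⟨X, rfl⟩ := Set.subset_range_iff_exists_image_eq.1 hI
    rw [O.simulation_indep_image, hp.indep_iff]
    exact ⟨fun h => LinearIndepOn.image_of_comp _ _ h, fun h => h.comp_of_image Sum.inl_injective.injOn⟩
  have hsign : ∀ t a, SignType.sign (tupleFunctional v₀ t (v₀ (Sum.inl a))) = O.side t a := by
    intro t a
    rw [side, ← hp, orientation_snoc]
    rfl
  have hne : ∀ t a, O.side t a ≠ 0 → tupleFunctional v₀ t (v₀ (Sum.inl a)) ≠ 0 := by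
    intro t a ha h0
    rw [← hsign, h0, sign_zero] at ha
    exact ha rfl
  -- the two signs are the factors of the difference of squares in `Separates.ne`
  obtain ⟨ψ, hψ, hψZ⟩ := exists_functional p
    ((fun q : (Fin (m + 2) → Fin n) × Fin n × Fin n × Bool =>
      tupleFunctional v₀ q.1 (v₀ (Sum.inl q.2.1)) • v₀ (Sum.inl q.2.2.1) -
        ((if q.2.2.2 then 1 else -1) * tupleFunctional v₀ q.1 (v₀ (Sum.inl q.2.2.1))) •
          v₀ (Sum.inl q.2.1)) '' {q | O.side q.1 q.2.1 ≠ 0 ∧ ¬ O.Parallel q.2.1 q.2.2.1})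
    ((Set.toFinite _).image _) (by
      rintro _ ⟨⟨t, a, b, s⟩, ⟨ha, hpar⟩, rfl⟩ h0
      have hli : LinearIndepOn ℝ v₀ (Sum.inl '' {b, a}) := by
        rw [← hrep _ (Set.image_subset_range _ _), O.simulation_indep_image]
        by_contra hdep
        exact hpar (Eq.symm ((O.parallel_iff (by omega) b a).2 (Or.inr hdep)))
      have hab : (Sum.inl b : Elt m n) ≠ Sum.inl a := by
        intro e
        exact hpar (by rw [Sum.inl_injective e]; rfl)
      rw [Set.image_pair, LinearIndepOn.pair_iff _ hab] at hli
      refine hne t a ha (hli _ (-((if s then 1 else -1) *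
        tupleFunctional v₀ t (v₀ (Sum.inl b)))) ?_).1
      rw [neg_smul, ← sub_eq_add_neg]
      exact h0)
  have hsep : O.Separates ψ v₀ := by
    refine ⟨hsign, hψ, fun t ht a b ha hb hpar h0 => ?_⟩
    rcases sq_eq_sq_iff_eq_or_eq_neg.1 h0 with h | h
    · refine hψZ _ ⟨⟨t, a, b, true⟩, ⟨ha, hpar⟩, rfl⟩ ?_
      simp only [if_true, one_mul, map_sub, map_smul, smul_eq_mul]
      linarith
    · refine hψZ _ ⟨⟨t, a, b, false⟩, ⟨ha, hpar⟩, rfl⟩ ?_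
      simp only [Bool.false_eq_true, if_false, map_sub, map_smul, smul_eq_mul]
      linarith
  have h₀ : O.PartialRep ψ (Set.range Sum.inl) v₀ := by
    refine ⟨fun e => ⟨e, rfl⟩, hrep, ?_⟩
    rintro _ ⟨e, rfl⟩
    exact ⟨fun h => ((hψ e).ne' h).elim, fun h => h.elim⟩
  suffices h : ∀ A : Set (Elt m n), A ⊆ ⋃ t ∈ {t | O.Canonical t}, gSet t →
      ∃ v : Elt m n → Fin (m + 3) → ℝ, (∀ e, v (Sum.inl e) = v₀ (Sum.inl e)) ∧
        O.PartialRep ψ (Set.range Sum.inl ∪ A) v by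
    obtain ⟨v, hv, h⟩ := h _ le_rfl
    exact ⟨ψ, v, hv, hsep.congr hv, h⟩
  intro A
  induction A, Set.toFinite A using Set.Finite.induction_on with
  | empty => exact fun _ => ⟨v₀, fun _ => rfl, by simpa using h₀⟩
  | @insert x A hxA _ ih =>
    intro hA
    obtain ⟨v, hv, h⟩ := ih ((Set.subset_insert _ _).trans hA)
    have hx := hA (Set.mem_insert x A)
    simp only [Set.mem_iUnion] at hx
    obtain ⟨t, ht, hxt⟩ := hx
    obtain ⟨w, hw, hw'⟩ := h.extend_gSet ht hxt (by
      rintro (⟨e, rfl⟩ | hx)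
      · rcases hxt with h | ⟨j, h⟩ <;> cases h
      · exact hxA hx) (by
      rintro z (⟨e, rfl⟩ | hz)
      · exact Or.inl ⟨e, rfl⟩
      · have := hA (Set.mem_insert_of_mem _ hz)
        simp only [Set.mem_iUnion] at this
        obtain ⟨t, -, ht⟩ := this
        exact Or.inr ⟨t, ht⟩) (fun a b ha hb hpar h0 =>
          (hsep.congr hv).ne t ht a b ha hb hpar (by rw [h0]))
    refine ⟨w, fun e => (hw _ (h.mem e)).trans (hv e), ?_⟩
    rwa [Set.union_insert]

end AbstractOrderType

/-! ### Adding several elements whose vectors move along a common direction -/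

section Pencil

variable {V : Type*} [AddCommGroup V] [Module ℝ V] {φ ψ : V →ₗ[ℝ] ℝ} {L : Submodule ℝ V} {g : V}

theorem left_mem_sup_pair (a b : V) : a ∈ L ⊔ Submodule.span ℝ {a, b} :=
  Submodule.mem_sup_right (Submodule.subset_span (by simp))

theorem right_mem_sup_pair (a b : V) : b ∈ L ⊔ Submodule.span ℝ {a, b} :=
  Submodule.mem_sup_right (Submodule.subset_span (by simp))

/-- Two vectors with different positions span the space together with `g` and `L`. -/
theorem exists_mem_of_mul_ne (hK : LinearMap.ker φ ⊓ LinearMap.ker ψ ≤ L ⊔ Submodule.span ℝ {g})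
    {a b : V} (hab : φ a * ψ b ≠ φ b * ψ a) (w : V) :
    ∃ α β γ : ℝ, w - (α • a + β • b + γ • g) ∈ L := by
  have htop : L ⊔ Submodule.span ℝ {g} ⊔ Submodule.span ℝ {a, b} = ⊤ := by
    by_contra hne
    exact hab (mul_eq_of_ker_inf_ker_le (hK.trans le_sup_left) hne
      (left_mem_sup_pair a b) (right_mem_sup_pair a b))
  have hw : w ∈ L ⊔ Submodule.span ℝ {g} ⊔ Submodule.span ℝ {a, b} := by rw [htop]; trivial
  obtain ⟨x, hx, y, hy, rfl⟩ := Submodule.mem_sup.1 hw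
  obtain ⟨l, hl, z, hz, rfl⟩ := Submodule.mem_sup.1 hx
  obtain ⟨γ, rfl⟩ := Submodule.mem_span_singleton.1 hz
  obtain ⟨α, β, rfl⟩ := Submodule.mem_span_pair.1 hy
  refine ⟨α, β, γ, ?_⟩
  convert hl using 1
  module

theorem eq_top_of_mul_ne (hK : LinearMap.ker φ ⊓ LinearMap.ker ψ ≤ L ⊔ Submodule.span ℝ {g})
    {a b : V} (hab : φ a * ψ b ≠ φ b * ψ a) {A : Submodule ℝ V} (hL : L ≤ A) (hg : g ∈ A)
    (ha : a ∈ A) (hb : b ∈ A) : A = ⊤ := by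
  by_contra hne
  exact hab (mul_eq_of_ker_inf_ker_le (hK.trans (sup_le hL (by simpa using hg))) hne ha hb)

/-- Two vectors that move along `g`, and a fixed vector that is not on the line through them, span
the space at some moment. -/
theorem exists_forall_eq_top_of_mul_ne
    (hK : LinearMap.ker φ ⊓ LinearMap.ker ψ ≤ L ⊔ Submodule.span ℝ {g}) {a b x : V}
    (hab : φ a * ψ b ≠ φ b * ψ a) (hx : x ∉ L ⊔ Submodule.span ℝ {b - a}) :
    ∃ y : ℝ, ∀ A : Submodule ℝ V, L ≤ A → a + y • g ∈ A → b + y • g ∈ A → x ∈ A → A = ⊤ := by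
  obtain ⟨α, β, γ, hl⟩ := exists_mem_of_mul_ne hK hab x
  obtain ⟨y, hy⟩ : ∃ y : ℝ, γ - y * (α + β) ≠ 0 := by
    by_cases hγ : γ = 0
    · refine ⟨1, fun h => hx ?_⟩
      have hα : α = -β := by linarith
      subst hγ hα
      refine Submodule.mem_sup.2 ⟨_, hl, β • (b - a), Submodule.smul_mem _ _
        (Submodule.mem_span_singleton_self _), by module⟩
    · exact ⟨0, by simpa using hγ⟩
  refine ⟨y, fun A hL ha hb hxA => ?_⟩
  have hg : g ∈ A := by
    have : (γ - y * (α + β)) • g ∈ A := by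
      convert A.sub_mem (A.sub_mem (A.sub_mem hxA (hL hl)) (A.smul_mem α ha)) (A.smul_mem β hb)
        using 1
      module
    exact (A.smul_mem_iff hy).1 this
  refine eq_top_of_mul_ne hK hab hL hg ?_ ?_
  · simpa using A.sub_mem ha (A.smul_mem y hg)
  · simpa using A.sub_mem hb (A.smul_mem y hg)

/-- The case that `a` and `b`, which move in the direction `g`, have the same position. -/
theorem exists_forall_eq_top_of_mul_eq
    (hK : LinearMap.ker φ ⊓ LinearMap.ker ψ ≤ L ⊔ Submodule.span ℝ {g})
    (hL : L ≤ LinearMap.ker φ ⊓ LinearMap.ker ψ) (hg : g ∈ LinearMap.ker φ ⊓ LinearMap.ker ψ)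
    {a b x : V} (hab : φ a * ψ b = φ b * ψ a) (hax : φ a * ψ x ≠ φ x * ψ a) (hba : b - a ∉ L) :
    ∃ y : ℝ, ∀ A : Submodule ℝ V, L ≤ A → a + y • g ∈ A → b + y • g ∈ A → x ∈ A → A = ⊤ := by
  obtain ⟨α, β, γ, hl⟩ := exists_mem_of_mul_ne hK hax b
  have hβ : β = 0 := by
    have h1 : φ _ = 0 := (hL hl).1
    have h2 : ψ _ = 0 := (hL hl).2
    have h3 : φ g = 0 := hg.1
    have h4 : ψ g = 0 := hg.2
    simp only [map_sub, map_add, map_smul, smul_eq_mul, h3, h4, mul_zero, add_zero] at h1 h2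
    have h5 : β * (φ a * ψ x - φ x * ψ a) = 0 := by
      linear_combination hab - φ a * h2 + ψ a * h1
    exact (mul_eq_zero.1 h5).resolve_right (sub_ne_zero.2 hax)
  subst hβ
  obtain ⟨y, hy⟩ : ∃ y : ℝ, γ + y * (1 - α) ≠ 0 := by
    by_cases hγ : γ = 0
    · refine ⟨1, fun h => hba ?_⟩
      have hα : α = 1 := by linarith
      subst hγ hα
      convert hl using 1
      module
    · exact ⟨0, by simpa using hγ⟩
  refine ⟨y, fun A hLA ha hb hxA => ?_⟩
  have hg : g ∈ A := by
    have : (γ + y * (1 - α)) • g ∈ A := by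
      convert A.sub_mem (A.sub_mem hb (hLA hl)) (A.smul_mem α ha) using 1
      module
    exact (A.smul_mem_iff hy).1 this
  refine eq_top_of_mul_ne hK hax hLA hg ?_ hxA
  simpa using A.sub_mem ha (A.smul_mem y hg)

/-- The case that three vectors move in the direction `g`. -/
theorem exists_forall_eq_top_of_triple
    (hK : LinearMap.ker φ ⊓ LinearMap.ker ψ ≤ L ⊔ Submodule.span ℝ {g}) {a b c : V}
    (hab : φ a * ψ b ≠ φ b * ψ a)
    (habc : ∀ α β : ℝ, α • (b - a) + β • (c - a) ∈ L → α = 0 ∧ β = 0) :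
    ∃ y : ℝ, ∀ A : Submodule ℝ V, L ≤ A → a + y • g ∈ A → b + y • g ∈ A → c + y • g ∈ A →
      A = ⊤ := by
  obtain ⟨α, β, γ, hl⟩ := exists_mem_of_mul_ne hK hab c
  obtain ⟨y, hy⟩ : ∃ y : ℝ, γ + y * (1 - α - β) ≠ 0 := by
    by_cases hγ : γ = 0
    · refine ⟨1, fun h => ?_⟩
      have hα : α = 1 - β := by linarith
      subst hγ hα
      refine one_ne_zero (habc (-β) 1 ?_).2
      convert hl using 1
      module
    · exact ⟨0, by simpa using hγ⟩
  refine ⟨y, fun A hL ha hb hc => ?_⟩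
  have hg : g ∈ A := by
    have : (γ + y * (1 - α - β)) • g ∈ A := by
      convert A.sub_mem (A.sub_mem (A.sub_mem hc (hL hl)) (A.smul_mem α ha)) (A.smul_mem β hb)
        using 1
      module
    exact (A.smul_mem_iff hy).1 this
  refine eq_top_of_mul_ne hK hab hL hg ?_ ?_
  · simpa using A.sub_mem ha (A.smul_mem y hg)
  · simpa using A.sub_mem hb (A.smul_mem y hg)

end Pencil

namespace AbstractOrderType

variable {m n : ℕ} {O : AbstractOrderType (m + 2) n}

theorem lSet_subset_of_mem {P : Plane m n} {t : Fin (m + 2) → Fin n} {s : Aux m n}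
    (h : Sum.inr (t, s) ∈ O.planeSet P) : lSet t ⊆ O.planeSet P := by
  cases P with
  | infinity => exact lSet_subset (Or.inl rfl)
  | flat t' => obtain ⟨rfl, -⟩ := h; exact lSet_subset (Or.inr rfl)
  | harmonic t' => obtain ⟨rfl, -⟩ := h; exact lSet_subset (Or.inr rfl)
  | row t' => obtain ⟨rfl, -⟩ := h; exact lSet_subset (Or.inr rfl)
  | column t' => obtain ⟨rfl, -⟩ := h; exact lSet_subset (Or.inr rfl)
  | diagonal t' => obtain ⟨rfl, -⟩ := h; exact lSet_subset (Or.inr rfl)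

namespace PartialRep

variable {ψ : (Fin (m + 3) → ℝ) →ₗ[ℝ] ℝ} {S : Set (Elt m n)} {v : Elt m n → Fin (m + 3) → ℝ}
  {t : Fin (m + 2) → Fin n}

theorem span_lSet_le (h : O.PartialRep ψ S v) (ht : O.Canonical t) (hG : gSet t ⊆ S) :
    Submodule.span ℝ (v '' gSet t) ≤ LinearMap.ker (tupleFunctional v t) ⊓ LinearMap.ker ψ := by
  rw [Submodule.span_le]
  rintro _ ⟨x, hx, rfl⟩
  constructor
  · refine (h.flat_iff ht (hG hx)).2 ?_
    rcases hx with rfl | ⟨j, rfl⟩ <;> simp [planeSet, Aux.OnFlat]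
  · refine (h.infinity x (hG hx)).2 ?_
    rcases hx with rfl | ⟨j, rfl⟩ <;> simp [planeSet, Aux.AtInfinity]

theorem indep_gSet (t : Fin (m + 2) → Fin n) : O.simulation.Indep (gSet t) := by
  refine (O.simulation_indep_pair t (x := Sum.inr (t, Aux.g)) (y := Sum.inr (t, Aux.g))
    (by simp)).subset ?_
  exact Set.insert_subset_insert (Set.subset_insert _ _)

theorem ker_inf_ker_le (h : O.PartialRep ψ S v) (ht : O.Canonical t) (hG : gSet t ⊆ S) :
    LinearMap.ker (tupleFunctional v t) ⊓ LinearMap.ker ψ ≤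
      Submodule.span ℝ (v '' lSet t) ⊔ Submodule.span ℝ {v (Sum.inr (t, Aux.g))} := by
  have h1 := h.finrank_span hG (indep_gSet t)
  rw [ncard_gSet] at h1
  have h2 : LinearMap.ker (tupleFunctional v t) ⊓ LinearMap.ker ψ <
      LinearMap.ker (tupleFunctional v t) :=
    lt_of_le_of_ne inf_le_left fun e => h.not_ker_le (inf_eq_left.1 e)
  have h3 := Submodule.finrank_lt_finrank_of_lt h2
  have h4 := finrank_ker_lt (h.tupleFunctional_ne_zero ht)
  have h5 := Submodule.eq_of_le_of_finrank_le (h.span_lSet_le ht hG) (by omega)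
  rw [← h5, gSet, Set.image_insert_eq, Submodule.span_insert, sup_comm]

/-- Elements of a block can be added with vectors `d x + y • g` for a common `y`, up to factors and
vectors of the span of the elements `l j`, if they are in sufficiently general position relative
to the pencil of the hyperplane of the tuple and the hyperplane at infinity. -/
theorem extend_pencil (h : O.PartialRep ψ S v) (ht : O.Canonical t) (hG : gSet t ⊆ S)
    {D : Set (Elt m n)} (hdisj : Disjoint S D) (hblock : ∀ x ∈ D, ∃ s, x = Sum.inr (t, s))
    (d : Elt m n → Fin (m + 3) → ℝ)
    (hflat : ∀ z ∈ D, tupleFunctional v t (d z) = 0 ↔ z ∈ O.planeSet (.flat t))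
    (hinf : ∀ z ∈ D, ψ (d z) = 0 ↔ z ∈ O.planeSet .infinity)
    (hne : ∀ z ∈ D, tupleFunctional v t (d z) = 0 → ψ (d z) ≠ 0)
    (havoid : ∀ z ∈ D, tupleFunctional v t (d z) ≠ 0 → ψ (d z) ≠ 0 → ∀ x ∈ S,
      tupleFunctional v t (v x) * ψ (d z) = tupleFunctional v t (d z) * ψ (v x) → x ∈ gSet t)
    (hpair : ∀ x ∈ S, x ∉ lSet t → ∀ z ∈ D, ∀ z' ∈ D, z ≠ z' →
      (∀ P, O.PlaneValid P → x ∈ O.planeSet P → z ∈ O.planeSet P → z' ∈ O.planeSet P → False) →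
      (tupleFunctional v t (d z) * ψ (d z') ≠ tupleFunctional v t (d z') * ψ (d z) ∧
        v x ∉ Submodule.span ℝ (v '' lSet t) ⊔ Submodule.span ℝ {d z' - d z}) ∨
      (tupleFunctional v t (d z) * ψ (d z') = tupleFunctional v t (d z') * ψ (d z) ∧
        tupleFunctional v t (d z) ≠ 0 ∧ ψ (d z) ≠ 0 ∧ x ∉ gSet t ∧
        d z' - d z ∉ Submodule.span ℝ (v '' lSet t)))
    (hthree : ∀ z₁ ∈ D, ∀ z₂ ∈ D, ∀ z₃ ∈ D, z₁ ≠ z₂ → z₁ ≠ z₃ → z₂ ≠ z₃ → ∀ P, O.PlaneValid P →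
      z₁ ∈ O.planeSet P → z₂ ∈ O.planeSet P → z₃ ∈ O.planeSet P → False)
    (htriple : ∀ z₁ ∈ D, ∀ z₂ ∈ D, ∀ z₃ ∈ D, z₁ ≠ z₂ → z₁ ≠ z₃ → z₂ ≠ z₃ →
      (tupleFunctional v t (d z₁) * ψ (d z₂) ≠ tupleFunctional v t (d z₂) * ψ (d z₁) ∨
        tupleFunctional v t (d z₁) * ψ (d z₃) ≠ tupleFunctional v t (d z₃) * ψ (d z₁)) ∧
      ∀ α β : ℝ, α • (d z₂ - d z₁) + β • (d z₃ - d z₁) ∈ Submodule.span ℝ (v '' lSet t) →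
        α = 0 ∧ β = 0)
    (hplane : ∀ P, O.PlaneValid P → P ≠ .infinity → P ≠ .flat t → (∃ x ∈ D, x ∈ O.planeSet P) →
      ∀ y : ℝ, ∃ a b : Fin (m + 3) → ℝ,
        (∀ x ∈ O.planeSet P, x ∈ S → v x ∈ Submodule.span ℝ (v '' lSet t) ⊔ Submodule.span ℝ {a, b}) ∧
        ∀ x ∈ O.planeSet P, x ∈ D → d x + y • v (Sum.inr (t, Aux.g)) ∈
          Submodule.span ℝ (v '' lSet t) ⊔ Submodule.span ℝ {a, b}) :
    ∃ y : ℝ, ∃ w, (∀ x ∈ S, w x = v x) ∧ (∀ x ∈ D, ∃ s : ℝ, s ≠ 0 ∧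
      ∃ l ∈ Submodule.span ℝ (v '' lSet t), w x = s • (d x + y • v (Sum.inr (t, Aux.g))) + l) ∧
      O.PartialRep ψ (S ∪ D) w := by
  set φ := tupleFunctional v t with hφ
  set L := Submodule.span ℝ (v '' lSet t) with hLdef
  set g := v (Sum.inr (t, Aux.g)) with hg
  have hlS : lSet t ⊆ S := (Set.subset_insert _ _).trans hG
  have hK : LinearMap.ker φ ⊓ LinearMap.ker ψ ≤ L ⊔ Submodule.span ℝ {g} := h.ker_inf_ker_le ht hG
  have hGK := h.span_lSet_le ht hG
  have hLK : L ≤ LinearMap.ker φ ⊓ LinearMap.ker ψ :=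
    (Submodule.span_mono (Set.image_mono (Set.subset_insert _ _))).trans hGK
  have hgK : g ∈ LinearMap.ker φ ⊓ LinearMap.ker ψ :=
    hGK (Submodule.subset_span ⟨_, Set.mem_insert _ _, rfl⟩)
  have hφg : φ g = 0 := hgK.1
  have hψg : ψ g = 0 := hgK.2
  let b : Fin m → Fin (m + 3) → ℝ := fun j => v (Sum.inr (t, Aux.l j))
  have hb : Submodule.span ℝ (Set.range b) = L := by
    rw [hLdef, lSet, ← Set.range_comp]; rfl
  have hPL : ∀ z ∈ D, ∀ P, z ∈ O.planeSet P → lSet t ⊆ O.planeSet P := by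
    intro z hz P hzP
    obtain ⟨s, rfl⟩ := hblock z hz
    exact lSet_subset_of_mem hzP
  have hnl : ∀ z ∈ D, z ∉ lSet t := fun z hz hz' => hdisj.le_bot ⟨hlS hz', hz⟩
  obtain ⟨y, -, w, hwS, hwD, hw⟩ := h.extend hdisj d g b Set.infinite_univ (by
    intro J hJS D₀ hD₀ hne₀ hI hc
    rw [hb]
    have hJ := hI.subset (Set.subset_union_left (s := J) (t := D₀))
    have hcJ : J.ncard + D₀.ncard = m + 3 := by
      rw [← hc, Set.ncard_union_eq (Set.disjoint_of_subset hJS hD₀ hdisj) (Set.toFinite _)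
        (Set.toFinite _)]
    have hcX := Set.ncard_inter_add_ncard_sdiff_eq_ncard J (lSet t) (Set.toFinite _)
    have hcl : (J ∩ lSet t).ncard ≤ m :=
      (Set.ncard_le_ncard Set.inter_subset_right (Set.toFinite _)).trans_eq (ncard_lSet t)
    have hmemD : ∀ y : ℝ, ∀ z ∈ D₀, d z + y • g ∈ Submodule.span ℝ (v '' J) ⊔
        Submodule.span ℝ ((fun x => d x + y • g) '' D₀) ⊔ L := fun y z hz =>
      Submodule.mem_sup_left (Submodule.mem_sup_right (Submodule.subset_span ⟨z, hz, rfl⟩))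
    have hmemJ : ∀ y : ℝ, ∀ x ∈ J, v x ∈ Submodule.span ℝ (v '' J) ⊔
        Submodule.span ℝ ((fun x => d x + y • g) '' D₀) ⊔ L := fun y z hz =>
      Submodule.mem_sup_left (Submodule.mem_sup_left (Submodule.subset_span ⟨z, hz, rfl⟩))
    rcases Nat.lt_or_ge 1 (J \ lSet t).ncard with h2 | h1
    · -- the sum of the spans of `J` and `L` is at least a hyperplane
      obtain ⟨x₁, x₂, ⟨hx₁, hxl₁⟩, ⟨hx₂, hxl₂⟩, hx₁₂⟩ := (Set.one_lt_ncard_iff (Set.toFinite _)).1 h2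
      have hT : insert x₁ (insert x₂ (lSet t)) ⊆ S :=
        Set.insert_subset (hJS hx₁) (Set.insert_subset (hJS hx₂) hlS)
      have hTc : (insert x₁ (insert x₂ (lSet t))).ncard = m + 2 := by
        rw [Set.ncard_insert_of_notMem (by simp [hx₁₂, hxl₁]), Set.ncard_insert_of_notMem hxl₂,
          ncard_lSet]
      have hTi : O.simulation.Indep (insert x₁ (insert x₂ (lSet t))) := by
        rw [O.simulation_indep_iff_of_ncard_lt (by omega)]
        refine ((O.simulation_indep_iff _).1 hJ).1.subset ?_
        intro e he
        simp only [Set.mem_preimage, Set.mem_insert_iff, inl_notMem_lSet, or_false] at he ⊢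
        rcases he with he | he <;> rw [he] <;> assumption
      have hTr := h.finrank_span hT hTi
      set N := Submodule.span ℝ (v '' J) ⊔ L with hN
      have hTN : Submodule.span ℝ (v '' insert x₁ (insert x₂ (lSet t))) ≤ N := by
        rw [Submodule.span_le]
        rintro _ ⟨x, (rfl | rfl | hx), rfl⟩
        · exact Submodule.mem_sup_left (Submodule.subset_span ⟨_, hx₁, rfl⟩)
        · exact Submodule.mem_sup_left (Submodule.subset_span ⟨_, hx₂, rfl⟩)
        · exact Submodule.mem_sup_right (Submodule.subset_span ⟨_, hx, rfl⟩)
      have hNr := Submodule.finrank_mono hTN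
      by_contra hcon
      push Not at hcon
      have hNA : ∀ y : ℝ, ∀ z ∈ D₀, d z + y • g ∈ N := by
        intro y z hz
        have hle : N ≤ Submodule.span ℝ (v '' J) ⊔
            Submodule.span ℝ ((fun x => d x + y • g) '' D₀) ⊔ L :=
          sup_le_sup_right le_sup_left L
        have hlt := Submodule.finrank_lt (hcon y)
        rw [Module.finrank_fin_fun] at hlt
        rw [Submodule.eq_of_le_of_finrank_le hle (by omega)]
        exact hmemD y z hz
      have hNtop : N ≠ ⊤ := fun e => hcon 0 (by
        rw [eq_top_iff, ← e]
        exact sup_le_sup_right le_sup_left L)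
      obtain ⟨z₀, hz₀⟩ := hne₀
      have hd : ∀ z ∈ D₀, d z ∈ N := fun z hz => by simpa using hNA 0 z hz
      have hgN : g ∈ N := by
        have := N.sub_mem (hNA 1 z₀ hz₀) (hd z₀ hz₀)
        simpa using this
      have hmul : ∀ z ∈ N, φ z * ψ (d z₀) = φ (d z₀) * ψ z := fun z hz =>
        mul_eq_of_ker_inf_ker_le (hK.trans (sup_le le_sup_right (by simpa using hgN))) hNtop hz
          (hd z₀ hz₀)
      have hJN : ∀ x ∈ J, v x ∈ N := fun x hx =>
        Submodule.mem_sup_left (Submodule.subset_span ⟨x, hx, rfl⟩)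
      -- all vectors of `N` have the position of `d z₀`: if that is on the flat or at infinity, so are all
      -- elements; otherwise only `g` among the elements outside the `l j` can have it
      by_cases hφ0 : φ (d z₀) = 0
      · have hψ0 := hne z₀ (hD₀ hz₀) hφ0
        have hall : ∀ z ∈ N, φ z = 0 := fun z hz => by
          have := hmul z hz
          rw [hφ0, zero_mul] at this
          exact (mul_eq_zero.1 this).resolve_right hψ0
        have := ((O.simulation_indep_iff _).1 hI).2.2 (.flat t) ht (Set.union_subset
          (fun x hx => (h.flat_iff ht (hJS hx)).1 (hall _ (hJN x hx)))
          fun x hx => (hflat x (hD₀ hx)).1 (hall _ (hd x hx)))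
        omega
      by_cases hψ0 : ψ (d z₀) = 0
      · have hall : ∀ z ∈ N, ψ z = 0 := fun z hz => by
          have := hmul z hz
          rw [hψ0, mul_zero] at this
          exact (mul_eq_zero.1 this.symm).resolve_left hφ0
        have := ((O.simulation_indep_iff _).1 hI).2.2 .infinity trivial (Set.union_subset
          (fun x hx => (h.infinity _ (hJS hx)).1 (hall _ (hJN x hx)))
          fun x hx => (hinf x (hD₀ hx)).1 (hall _ (hd x hx)))
        omega
      have g₁ := havoid z₀ (hD₀ hz₀) hφ0 hψ0 x₁ (hJS hx₁) (hmul _ (hJN _ hx₁))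
      have g₂ := havoid z₀ (hD₀ hz₀) hφ0 hψ0 x₂ (hJS hx₂) (hmul _ (hJN _ hx₂))
      exact hx₁₂ ((g₁.resolve_right hxl₁).trans (g₂.resolve_right hxl₂).symm)
    rcases Nat.lt_or_ge 0 (J \ lSet t).ncard with h2 | h0
    · obtain ⟨x, hxJ, hxl⟩ := (Set.ncard_pos (Set.toFinite _)).1 h2
      have hxS := hJS hxJ
      have hxD : x ∉ D := fun hx => hdisj.le_bot ⟨hxS, hx⟩
      -- a single element `x` besides the `l j`: two new ones are not on a common plane with it
      obtain ⟨z, hz, z', hz', hzz, hP⟩ : ∃ z ∈ D₀, ∃ z' ∈ D₀, z ≠ z' ∧ ∀ P, O.PlaneValid P →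
          x ∈ O.planeSet P → z ∈ O.planeSet P → z' ∈ O.planeSet P → False := by
        rcases Nat.lt_or_ge 2 D₀.ncard with h3 | h3
        · obtain ⟨z₁, z₂, z₃, hz₁, hz₂, hz₃, h12, h13, h23⟩ :=
            (Set.two_lt_ncard_iff (Set.toFinite _)).1 h3
          by_contra hcon
          push Not at hcon
          obtain ⟨P, hP, hxP, h1P, h2P, -⟩ := hcon z₁ hz₁ z₂ hz₂ h12
          obtain ⟨P', hP', hxP', h1P', h3P', -⟩ := hcon z₁ hz₁ z₃ hz₃ h13
          have hxz : x ≠ z₁ := fun e => hxD (e ▸ hD₀ hz₁)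
          have huniq := O.planes_unique ⟨P, hP⟩ ⟨P', hP'⟩ (insert x (insert z₁ (lSet t)))
            (((O.simulation_indep_iff _).1 (O.simulation_indep_pair t (by
              rintro e e' - h1
              obtain ⟨s, hs⟩ := hblock z₁ (hD₀ hz₁)
              rw [hs] at h1; cases h1))).1)
            (by
              rw [Set.ncard_insert_of_notMem (by simp [hxz, hxl]),
                Set.ncard_insert_of_notMem (hnl z₁ (hD₀ hz₁)), ncard_lSet])
            (Set.insert_subset hxP (Set.insert_subset h1P (hPL z₁ (hD₀ hz₁) P h1P)))
            (Set.insert_subset hxP' (Set.insert_subset h1P' (hPL z₁ (hD₀ hz₁) P' h1P')))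
          have h3P : z₃ ∈ O.planeSet P := by
            change z₃ ∈ O.planes ⟨P, hP⟩
            rw [huniq]; exact h3P'
          exact hthree z₁ (hD₀ hz₁) z₂ (hD₀ hz₂) z₃ (hD₀ hz₃) h12 h13 h23 P hP h1P h2P h3P
        · obtain ⟨z, z', hzz, rfl⟩ := Set.ncard_eq_two.1 (show D₀.ncard = 2 by omega)
          have hz : z ∈ ({z, z'} : Set (Elt m n)) := by simp
          have hz' : z' ∈ ({z, z'} : Set (Elt m n)) := by simp
          refine ⟨z, hz, z', hz', hzz, fun P hP hxP hzP hz'P => ?_⟩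
          have := ((O.simulation_indep_iff _).1 hI).2.2 P hP (by
            rintro u (hu | hu | hu)
            · by_cases hul : u ∈ lSet t
              · exact hPL z (hD₀ hz) P hzP hul
              · rwa [(Set.ncard_le_one (Set.toFinite _)).1 h1 u ⟨hu, hul⟩ x ⟨hxJ, hxl⟩]
            · rwa [hu]
            · rwa [hu])
          omega
      have hex : ∃ y : ℝ, ∀ A : Submodule ℝ (Fin (m + 3) → ℝ), L ≤ A → d z + y • g ∈ A →
          d z' + y • g ∈ A → v x ∈ A → A = ⊤ := by
        rcases hpair x hxS hxl z (hD₀ hz) z' (hD₀ hz') hzz hP with ⟨h1, h2⟩ | ⟨h1, h2, h3, h4, h5⟩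
        · exact exists_forall_eq_top_of_mul_ne hK h1 h2
        · exact exists_forall_eq_top_of_mul_eq hK hLK hgK h1 (fun e => h4
            (havoid z (hD₀ hz) h2 h3 x hxS e.symm)) h5
      obtain ⟨y, hy⟩ := hex
      exact ⟨y, hy _ le_sup_right (hmemD y z hz) (hmemD y z' hz') (hmemJ y x hxJ)⟩
    -- `J` consists of `l j` only, so there are three new elements
    · obtain ⟨z₁, z₂, z₃, hz₁, hz₂, hz₃, h12, h13, h23⟩ :=
        (Set.two_lt_ncard_iff (Set.toFinite _)).1 (show 2 < D₀.ncard by omega)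
      obtain ⟨h1, h2⟩ := htriple z₁ (hD₀ hz₁) z₂ (hD₀ hz₂) z₃ (hD₀ hz₃) h12 h13 h23
      rcases h1 with h1 | h1
      · obtain ⟨y, hy⟩ := exists_forall_eq_top_of_triple hK h1 h2
        exact ⟨y, hy _ le_sup_right (hmemD y _ hz₁) (hmemD y _ hz₂) (hmemD y _ hz₃)⟩
      · obtain ⟨y, hy⟩ := exists_forall_eq_top_of_triple hK h1 (fun α β hαβ => by
          exact (h2 β α (by rwa [add_comm (α • _)] at hαβ)).symm)
        exact ⟨y, hy _ le_sup_right (hmemD y _ hz₁) (hmemD y _ hz₃) (hmemD y _ hz₂)⟩)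
    (by
      intro x hx hxi
      refine ⟨0, 1, 0, ?_⟩
      simpa using fun e => hxi ((hinf x hx).1 e))
    (by
      intro x hx hxi
      refine ⟨(hinf x hx).2 hxi, hψg, fun l => ?_⟩
      exact (hLK (Submodule.subset_span ⟨_, ⟨l, rfl⟩, rfl⟩)).2)
    (by
      intro P hP hPi hPD y _ w hwS hwD
      rw [hb] at hwD
      by_cases hPf : P = .flat t
      · subst hPf
        refine ⟨_, finrank_ker_lt (h.tupleFunctional_ne_zero ht), fun x hx hx' => ?_⟩
        rcases hx' with hx' | hx'
        · rw [hwS x hx']; exact (h.flat_iff ht hx').2 hx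
        · obtain ⟨s, l, hl, hwx⟩ := hwD x hx'
          have h1 : φ l = 0 := (hLK hl).1
          have h2 : φ (d x) = 0 := (hflat x hx').2 hx
          rw [LinearMap.mem_ker, hwx]
          simp only [map_add, map_smul, ← hφ, h1, h2, hφg, smul_zero, add_zero]
      · obtain ⟨a, b, h1, h2⟩ := hplane P hP hPi hPf hPD y
        refine ⟨L ⊔ Submodule.span ℝ {a, b}, finrank_sup_pair_lt v t a b, fun x hx hx' => ?_⟩
        · rcases hx' with hx' | hx'
          · rw [hwS x hx']; exact h1 x hx hx'
          · obtain ⟨s, l, hl, hw⟩ := hwD x hx'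
            rw [hw]
            exact Submodule.add_mem _ (Submodule.smul_mem _ _ (h2 x hx hx'))
              (Submodule.mem_sup_left hl))
  rw [hb] at hwD
  exact ⟨y, w, hwS, hwD, hw⟩

end PartialRep

end AbstractOrderType

/-! ### The points that fix the scale of a block -/

namespace AbstractOrderType

variable {m n : ℕ} {O : AbstractOrderType (m + 2) n}

theorem mem_gSet_of_mem_planes {t : Fin (m + 2) → Fin n} {x : Elt m n}
    (h₁ : x ∈ O.planeSet (.flat t)) (h₂ : x ∈ O.planeSet .infinity) : x ∈ gSet t := by
  rcases x with e | ⟨t', j | _ | b | b | s | ⟨α, β, a⟩⟩ <;>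
    simp only [planeSet, Set.mem_ofPred_eq, Sum.elim_inl, Sum.elim_inr, Aux.AtInfinity,
      Aux.OnFlat, and_true, and_false] at h₁ h₂
  · subst h₁; exact Or.inr ⟨j, rfl⟩
  · subst h₁; exact Or.inl rfl
  · grind

namespace PartialRep

variable {ψ : (Fin (m + 3) → ℝ) →ₗ[ℝ] ℝ} {S : Set (Elt m n)} {v : Elt m n → Fin (m + 3) → ℝ}
  {t : Fin (m + 2) → Fin n}

/-- Outside of the intersection of the two hyperplanes, an element is not represented in the
intersection. -/
theorem mem_gSet (h : O.PartialRep ψ S v) (ht : O.Canonical t) {x : Elt m n} (hx : x ∈ S)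
    (h₁ : tupleFunctional v t (v x) = 0) (h₂ : ψ (v x) = 0) : x ∈ gSet t :=
  mem_gSet_of_mem_planes ((h.flat_iff ht hx).1 h₁) ((h.infinity x hx).1 h₂)

/-- The point `q 1` can be put on the line of the points `c false` and `i false`, so that its position
`y` relative to the two hyperplanes avoids finitely many values. -/
theorem extend_q (h : O.PartialRep ψ S v) (ht : O.Canonical t)
    (hG : gSet t ⊆ S) (hc₀ : Sum.inr (t, .c false) ∈ S) (hi₀ : Sum.inr (t, .i false) ∈ S)
    (hSt : ∀ s, Sum.inr (t, s) ∈ S → Sum.inr (t, s) ∈ gSet t ∨ s = .c false ∨ s = .i false)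
    (F : Set ℝ) (hF : F.Finite) :
    ∃ y : ℝ, 0 < y ∧ y ∉ F ∧ ∃ w, (∀ z ∈ S, w z = v z) ∧
      (∃ s : ℝ, s ≠ 0 ∧ ∃ l ∈ Submodule.span ℝ (v '' lSet t), w (Sum.inr (t, .q 1)) =
        s • ((ψ (v (Sum.inr (t, .c false))))⁻¹ • v (Sum.inr (t, .c false)) +
          y • (tupleFunctional v t (v (Sum.inr (t, .i false))))⁻¹ • v (Sum.inr (t, .i false))) + l) ∧
      O.PartialRep ψ (insert (Sum.inr (t, .q 1)) S) w := by
  set φ := tupleFunctional v t with hφ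
  set c : Elt m n := Sum.inr (t, .c false) with hc
  set i : Elt m n := Sum.inr (t, .i false) with hi
  set q : Elt m n := Sum.inr (t, .q 1) with hq
  have hψc : ψ (v c) ≠ 0 := fun h0 => by
    have := (h.infinity _ hc₀).1 h0
    simp [planeSet, hc, Aux.AtInfinity] at this
  have hφi : φ (v i) ≠ 0 := fun h0 => by
    have := (h.flat_iff ht hi₀).1 h0
    simp [planeSet, hi, Aux.OnFlat] at this
  have hψi : ψ (v i) = 0 := (h.infinity _ hi₀).2 (by simp [planeSet, hi, Aux.AtInfinity])
  have hqS : q ∉ S := by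
    intro hqS
    rcases hSt _ hqS with (h | ⟨j, h⟩) | h | h <;> simp at h
  have hlS : lSet t ⊆ S := (Set.subset_insert _ _).trans hG
  let b : Fin m → Fin (m + 3) → ℝ := fun j => v (Sum.inr (t, Aux.l j))
  have hb : Submodule.span ℝ (Set.range b) = Submodule.span ℝ (v '' lSet t) := by
    rw [lSet, ← Set.range_comp]; rfl
  have hB : O.simulation.Indep (insert c (insert i (lSet t))) :=
    O.simulation_indep_pair t (by simp [hc])
  obtain ⟨y, ⟨hy, hyF⟩, w, hwS, hwD, hw⟩ := h.extend (D := {q}) (by simpa using hqS)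
    (fun _ => (ψ (v c))⁻¹ • v c) ((φ (v i))⁻¹ • v i) b (Y := Set.Ioi 0 \ F)
    ((Set.Ioi_infinite 0).sdiff hF) (by
      intro J hJS D₀ hD₀ hne hI hcard
      obtain rfl : D₀ = {q} := (Set.Nonempty.subset_singleton_iff hne).1 hD₀
      rw [Set.union_singleton] at hI hcard
      have hqJ : q ∉ J := fun hqJ => hqS (hJS hqJ)
      have hJ := hI.subset (Set.subset_insert q J)
      rw [Set.ncard_insert_of_notMem hqJ (Set.toFinite _)] at hcard
      have hJr := h.finrank_span hJS hJ
      simp only [Set.image_singleton]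
      rw [hb]
      -- otherwise the flats spanned by `J` and by `c`, `i` and the `l j` are equal
      by_contra hcon
      push Not at hcon
      have hA : ∀ y : ℝ, Submodule.span ℝ (v '' J) = Submodule.span ℝ (v '' J) ⊔
          Submodule.span ℝ {(ψ (v c))⁻¹ • v c + y • (φ (v i))⁻¹ • v i} ⊔
            Submodule.span ℝ (v '' lSet t) := by
        intro y
        have hlt := Submodule.finrank_lt (hcon y)
        rw [Module.finrank_fin_fun] at hlt
        exact Submodule.eq_of_le_of_finrank_le (le_sup_left.trans le_sup_left) (by omega)
      have hmem : ∀ y : ℝ, (ψ (v c))⁻¹ • v c + y • (φ (v i))⁻¹ • v i ∈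
          Submodule.span ℝ (v '' J) := by
        intro y
        rw [hA y]
        exact Submodule.mem_sup_left (Submodule.mem_sup_right
          (Submodule.mem_span_singleton_self _))
      have hcm : v c ∈ Submodule.span ℝ (v '' J) := by
        have := hmem 0
        rw [zero_smul, add_zero] at this
        exact (Submodule.smul_mem_iff _ (inv_ne_zero hψc)).1 this
      have him : v i ∈ Submodule.span ℝ (v '' J) := by
        have := Submodule.sub_mem _ (hmem 1) (hmem 0)
        rw [zero_smul, add_zero, add_sub_cancel_left, one_smul] at this
        exact (Submodule.smul_mem_iff _ (inv_ne_zero hφi)).1 this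
      have hcl : ∀ z ∈ S, v z ∈ Submodule.span ℝ (v '' J) → z ∈ O.simulation.closure J := by
        intro z hz hzm
        by_contra hzc
        obtain ⟨h1, h2⟩ := (hJ.notMem_closure_iff (e := z) (Set.mem_univ _)).1 hzc
        exact ((linearIndepOn_insert h2).1
          ((h.represents _ (Set.insert_subset hz hJS)).1 h1)).2 hzm
      have hsub : insert c (insert i (lSet t)) ⊆ O.simulation.closure J := by
        rintro z (rfl | rfl | hz)
        · exact hcl _ hc₀ hcm
        · exact hcl _ hi₀ him
        · refine hcl z (hlS hz) ?_
          rw [hA 0]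
          exact Submodule.mem_sup_right (Submodule.subset_span ⟨z, hz, rfl⟩)
      refine (hJ.notMem_closure_iff (e := q) (Set.mem_univ _)).2 ⟨hI, hqJ⟩
        (O.simulation.closure_subset_closure_of_subset_closure hsub ?_)
      by_contra hqc
      have h1 := ((hB.notMem_closure_iff (e := q) (Set.mem_univ _)).1 hqc).1
      exact O.simulation_dep_triple (P := .harmonic t false false) ht (lSet_subset (Or.inr rfl))
        (x := c) (y := i) (z := q) (by simp [hc, hi]) (by simp [hc, hq]) (by simp [hi, hq])
        (by simp [hc, lSet]) (by simp [hi, lSet]) (by simp [hq, lSet])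
        (by simp [planeSet, hc, Aux.OnHarmonic]) (by simp [planeSet, hi, Aux.OnHarmonic])
        (by simp [planeSet, hq, Aux.OnHarmonic]) h1)
    (by
      intro x hx hxi
      exact ⟨0, 1, 0, by simpa using hψc⟩)
    (by
      rintro x rfl hxi
      simp [planeSet, hq, Aux.AtInfinity] at hxi)
    (by
      rintro P hP hPi ⟨x, hx, hxP⟩ y - w hwS hwD
      rw [Set.mem_singleton_iff.1 hx] at hxP
      rw [hb] at hwD
      refine ⟨_, finrank_sup_pair_lt v t (v c) (v i), fun z hz hz' => ?_⟩
      rcases hz' with hz' | hz'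
      · rw [hwS z hz']
        have hzt : ∃ s, z = Sum.inr (t, s) := by
          rcases z with e | ⟨t', s⟩
          · exfalso
            cases P <;> simp [planeSet, hq, Aux.OnFlat, Aux.OnHarmonic, Aux.OnRow, Aux.OnColumn,
              Aux.OnDiagonal] at hxP hz hPi
          · refine ⟨s, ?_⟩
            cases P <;> simp [planeSet, hq, Aux.OnFlat, Aux.OnHarmonic, Aux.OnRow, Aux.OnColumn,
              Aux.OnDiagonal] at hxP hz hPi <;> simp [hxP, hz]
        obtain ⟨s, rfl⟩ := hzt
        rcases hSt s hz' with (h | ⟨j, h⟩) | rfl | rfl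
        · exfalso
          rw [h] at hz
          cases P <;> simp [planeSet, hq, Aux.OnFlat, Aux.OnHarmonic, Aux.OnRow, Aux.OnColumn,
              Aux.OnDiagonal] at hxP hz hPi
        · exact Submodule.mem_sup_left (Submodule.subset_span ⟨_, ⟨j, h⟩, rfl⟩)
        · exact left_mem_sup_pair _ _
        · exact right_mem_sup_pair _ _
      · obtain ⟨s, l, hl, hwx⟩ := hwD z hz'
        rw [hwx]
        exact Submodule.add_mem _ (Submodule.smul_mem _ _ (Submodule.add_mem _
          (Submodule.smul_mem _ _ (left_mem_sup_pair _ _)) (Submodule.smul_mem _ _ (Submodule.smul_mem _ _ (right_mem_sup_pair _ _)))))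
          (Submodule.mem_sup_left hl))
  rw [hb] at hwD
  exact ⟨y, hy, hyF, w, hwS, hwD q rfl, by rwa [Set.union_singleton] at hw⟩

/-- The position of no element coincides with the positions `± f` of the corners that belong to `a`,
where `f ^ 2` is the product of `y` and the absolute value of the position of `a`. -/
def AvoidsAt (ψ : (Fin (m + 3) → ℝ) →ₗ[ℝ] ℝ) (S : Set (Elt m n)) (v : Elt m n → Fin (m + 3) → ℝ)
    (t : Fin (m + 2) → Fin n) (y : ℝ) (a : Fin n) : Prop :=
  ∀ x ∈ S, x ∉ gSet t → tupleFunctional v t (v x) ^ 2 * ψ (v (Sum.inl a)) ≠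
    |tupleFunctional v t (v (Sum.inl a))| * y * ψ (v x) ^ 2

/-- The points `c false`, `i false` and `q 1` can be added. Only finitely many positions `y` of `q
1` would cause a coincidence with another element. -/
theorem exists_q (h : O.PartialRep ψ S v) (hsep : O.Separates ψ v) (ht : O.Canonical t)
    (hG : gSet t ⊆ S) (hSt : ∀ s, Sum.inr (t, s) ∈ S → Sum.inr (t, s) ∈ gSet t) :
    ∃ y : ℝ, 0 < y ∧ ∃ w, (∀ z ∈ S, w z = v z) ∧
      (∃ s : ℝ, s ≠ 0 ∧ ∃ l ∈ Submodule.span ℝ (w '' lSet t), w (Sum.inr (t, .q 1)) =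
        s • ((ψ (w (Sum.inr (t, .c false))))⁻¹ • w (Sum.inr (t, .c false)) +
          y • (tupleFunctional w t (w (Sum.inr (t, .i false))))⁻¹ • w (Sum.inr (t, .i false))) + l) ∧
      (∀ a, O.side t a ≠ 0 → AvoidsAt ψ (insert (Sum.inr (t, .q 1)) (insert (Sum.inr (t, .i false))
        (insert (Sum.inr (t, .c false)) S))) w t y a) ∧
      (∀ x ∈ insert (Sum.inr (t, .q 1)) (insert (Sum.inr (t, .i false))
        (insert (Sum.inr (t, .c false)) S)), x ∉ gSet t →
          tupleFunctional w t (w x) ≠ -y * ψ (w x)) ∧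
      O.PartialRep ψ (insert (Sum.inr (t, .q 1)) (insert (Sum.inr (t, .i false))
        (insert (Sum.inr (t, .c false)) S))) w := by
  have hfew : ∀ P, O.PlaneValid P → P ≠ .infinity → P ≠ .flat t →
      (Sum.inr (t, .c false) ∈ O.planeSet P ∨ Sum.inr (t, .i false) ∈ O.planeSet P) →
      ∀ z ∈ O.planeSet P, z ∈ S → z ∈ lSet t := by
    intro P hP hPi hPt hxP z hz hzS
    obtain ⟨x, y, rfl⟩ : ∃ x y, P = .harmonic t x y := by
      cases P <;> simp [planeSet, Aux.OnFlat, Aux.OnHarmonic, Aux.OnRow, Aux.OnColumn,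
        Aux.OnDiagonal] at hxP hPi hPt ⊢
      · exact (hPt hxP.symm).elim
      · rcases hxP with h | h <;> exact h.1.symm
    rcases z with e | ⟨t', s⟩
    · exact hz.elim
    · obtain ⟨rfl, hz⟩ := hz
      rcases hSt s hzS with h | ⟨j, h⟩
      · simp only [Sum.inr.injEq, Prod.mk.injEq, true_and] at h
        subst h; exact hz.elim
      · exact ⟨j, h⟩
  obtain ⟨v₁, hv₁, h₁⟩ := h.extend_flat (x := Sum.inr (t, .c false))
    (fun hx => by rcases hSt _ hx with h | ⟨j, h⟩ <;> simp at h) (by simp [planeSet, Aux.AtInfinity]) ht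
    (by simp [planeSet, Aux.OnFlat]) (fun P hP hPi hPt hxP => ⟨t, Sum.inr (t, .c false),
      fun z hz hzS => Or.inr (hfew P hP hPi hPt (Or.inl hxP) z hz hzS)⟩)
  obtain ⟨v₂, hv₂, h₂⟩ := h₁.extend_infinity (x := Sum.inr (t, .i false))
    (by
      rintro (hx | hx)
      · simp at hx
      · rcases hSt _ hx with h | ⟨j, h⟩ <;> simp at h) (by simp [planeSet, Aux.AtInfinity])
    (fun P hP hPi _ hxP => ⟨t, Sum.inr (t, .c false), fun z hz hzS => hzS.imp_right
      (hfew P hP hPi (by rintro rfl; simp [planeSet, Aux.OnFlat] at hxP) (Or.inr hxP) z hz)⟩)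
  have hv₂S : ∀ z ∈ S, v₂ z = v z := fun z hz => (hv₂ z (Or.inr hz)).trans (hv₁ z hz)
  set S₁ : Set (Elt m n) := insert (Sum.inr (t, .i false)) (insert (Sum.inr (t, .c false)) S) with hS₁
  set φ := tupleFunctional v₂ t with hφ
  -- the positions of `q 1` for which `AvoidsAt` fails for an old element, which `q (-1)` would share
  -- with an old element, or for which `AvoidsAt` fails for `q 1` itself
  let F : Set ℝ := (fun p : Elt m n × Fin n => φ (v₂ p.1) ^ 2 * ψ (v₂ (Sum.inl p.2)) /
      (|φ (v₂ (Sum.inl p.2))| * ψ (v₂ p.1) ^ 2)) '' Set.univ ∪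
    (fun x => -φ (v₂ x) / ψ (v₂ x)) '' Set.univ ∪
    (fun a : Fin n => |φ (v₂ (Sum.inl a))| / ψ (v₂ (Sum.inl a))) '' Set.univ
  have hFfin : F.Finite := ((Set.toFinite _).union (Set.toFinite _)).union (Set.toFinite _)
  obtain ⟨y, hy, hyF, w, hw, ⟨s, hs, l, hl, hwq⟩, h₃⟩ := h₂.extend_q ht
    (hG.trans ((Set.subset_insert _ _).trans (Set.subset_insert _ _)))
    (Or.inr (Or.inl rfl)) (Or.inl rfl) (by
      rintro s (hs | hs | hs)
      · simp only [Sum.inr.injEq, Prod.mk.injEq, true_and] at hs; exact Or.inr (Or.inr hs)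
      · simp only [Sum.inr.injEq, Prod.mk.injEq, true_and] at hs; exact Or.inr (Or.inl hs)
      · exact Or.inl (hSt s hs)) F hFfin
  have hφw : tupleFunctional w t = φ := tupleFunctional_congr (fun e => hw _ (h₂.mem e)) t
  have hwE : ∀ e, w (Sum.inl e) = v (Sum.inl e) := fun e =>
    (hw _ (h₂.mem e)).trans (hv₂S _ (h.mem e))
  have hwS : ∀ z ∈ S, w z = v z := fun z hz =>
    (hw z (Or.inr (Or.inr hz))).trans (hv₂S z hz)
  have hlS : lSet t ⊆ S := (Set.subset_insert _ _).trans hG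
  have hpos : ∀ a, 0 < ψ (v₂ (Sum.inl a)) := fun a => by
    rw [hv₂S _ (h.mem a)]; exact hsep.pos a
  have hne : ∀ a, O.side t a ≠ 0 → 0 < |φ (v₂ (Sum.inl a))| := fun a ha =>
    abs_pos.2 fun h0 => ha ((h₂.flat_iff ht (h₂.mem a)).1 h0)
  have hwc := hw (Sum.inr (t, .c false)) (Or.inr (Or.inl rfl))
  have hwi := hw (Sum.inr (t, .i false)) (Or.inl rfl)
  have hc0 : φ (v₂ (Sum.inr (t, .c false))) = 0 := (h₂.flat_iff ht (Or.inr (Or.inl rfl))).2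
    (by simp [planeSet, Aux.OnFlat])
  have hi0 : ψ (v₂ (Sum.inr (t, .i false))) = 0 := (h₂.infinity _ (Or.inl rfl)).2
    (by simp [planeSet, Aux.AtInfinity])
  have hc1 : ψ (v₂ (Sum.inr (t, .c false))) ≠ 0 := fun h0 => by
    have := (h₂.infinity _ (Or.inr (Or.inl rfl))).1 h0
    simp [planeSet, Aux.AtInfinity] at this
  have hi1 : φ (v₂ (Sum.inr (t, .i false))) ≠ 0 := fun h0 => by
    have := (h₂.flat_iff ht (Or.inl rfl)).1 h0
    simp [planeSet, Aux.OnFlat] at this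
  have hlK := h₂.span_lSet_le ht
    (hG.trans ((Set.subset_insert _ _).trans (Set.subset_insert _ _)))
    (Submodule.span_mono (Set.image_mono (Set.subset_insert _ _)) hl)
  have hl1 : φ l = 0 := hlK.1
  have hl2 : ψ l = 0 := hlK.2
  have hq1 : φ (w (Sum.inr (t, .q 1))) = s * y := by
    rw [hwq]
    simp only [map_add, map_smul, smul_eq_mul, ← hφ, hc0, hl1, inv_mul_cancel₀ hi1]
    ring
  have hq2 : ψ (w (Sum.inr (t, .q 1))) = s := by
    rw [hwq]
    simp only [map_add, map_smul, smul_eq_mul, hi0, hl2, inv_mul_cancel₀ hc1]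
    ring
  have hzero : ∀ x ∈ S₁, x ∉ gSet t → ψ (v₂ x) = 0 → φ (v₂ x) ≠ 0 := fun x hx hxg h1 h2 =>
    hxg (h₂.mem_gSet ht hx h2 h1)
  refine ⟨y, hy, w, hwS, ⟨s, hs, l, ?_, ?_⟩, ?_, ?_, h₃⟩
  · have : w '' lSet t = v₂ '' lSet t :=
      Set.image_congr fun x hx => hw x (Or.inr (Or.inr (hlS hx)))
    rwa [this]
  · rw [hwq, hφw, hwc, hwi]
  · intro a ha x hx hxg
    rw [hφw, hw _ (h₂.mem a)]
    rcases hx with rfl | hx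
    · rw [hq1, hq2]
      intro h0
      refine hyF (Or.inr ⟨a, trivial, ?_⟩)
      have h1 : s ^ 2 * y ≠ 0 := by positivity
      have h2 : (s ^ 2 * y) * (y * ψ (v₂ (Sum.inl a))) =
          (s ^ 2 * y) * |φ (v₂ (Sum.inl a))| := by linear_combination h0
      have h3 := mul_left_cancel₀ h1 h2
      have := (hpos a).ne'
      simp only
      rw [← h3]
      field_simp
    · rw [hw x hx]
      intro h0
      by_cases hψ0 : ψ (v₂ x) = 0
      · rw [hψ0] at h0
        have h1 := hzero x hx hxg hψ0
        have h2 := hpos a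
        have : φ (v₂ x) ^ 2 * ψ (v₂ (Sum.inl a)) ≠ 0 := by positivity
        exact this (by rw [h0]; ring)
      · refine hyF (Or.inl (Or.inl ⟨(x, a), trivial, ?_⟩))
        have h1 := (hne a ha).ne'
        simp only
        rw [h0]
        field_simp
  · intro x hx hxg
    rw [hφw]
    rcases hx with rfl | hx
    · rw [hq1, hq2]
      intro h0
      have : s * y = 0 := by linarith
      exact (mul_ne_zero hs hy.ne') this
    · rw [hw x hx]
      intro h0
      by_cases hψ0 : ψ (v₂ x) = 0
      · rw [hψ0, mul_zero] at h0
        exact hzero x hx hxg hψ0 h0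
      · refine hyF (Or.inl (Or.inr ⟨x, trivial, ?_⟩))
        simp only
        rw [h0]
        field_simp

end PartialRep

end AbstractOrderType

/-! ### The harmonic quadrilateral of a block -/

namespace AbstractOrderType

variable {m n : ℕ} {O : AbstractOrderType (m + 2) n}

namespace PartialRep

variable {ψ : (Fin (m + 3) → ℝ) →ₗ[ℝ] ℝ} {S : Set (Elt m n)} {v : Elt m n → Fin (m + 3) → ℝ}
  {t : Fin (m + 2) → Fin n}

theorem notMem_sup_span (h : O.PartialRep ψ S v) (hlS : lSet t ⊆ S) {x z : Elt m n} (hx : x ∈ S)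
    (hz : z ∈ S) (hxz : x ≠ z) (hxl : x ∉ lSet t)
    (hE : ∀ e e', x = Sum.inl e → z = Sum.inl e' → O.matroid.Indep {e, e'}) :
    v x ∉ Submodule.span ℝ (v '' lSet t) ⊔ Submodule.span ℝ {v z} := by
  have hT : insert x (insert z (lSet t)) ⊆ S := Set.insert_subset hx (Set.insert_subset hz hlS)
  have hxT : x ∉ insert z (lSet t) := by simp [hxz, hxl]
  have hI : O.simulation.Indep (insert x (insert z (lSet t))) := by
    have hcard : (insert x (insert z (lSet (m := m) t))).ncard < m + 3 := by
      have h1 := Set.ncard_insert_le x (insert z (lSet (m := m) t))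
      have h2 := Set.ncard_insert_le z (lSet (m := m) t)
      have h3 := ncard_lSet (m := m) t
      omega
    rw [O.simulation_indep_iff_of_ncard_lt hcard]
    rcases x with e | p
    · rcases z with e' | p'
      · refine (hE e e' rfl rfl).subset fun a ha => ?_
        simpa [inl_notMem_lSet] using ha
      · refine O.indep_of_subsingleton fun a ha b hb => ?_
        simp only [Set.mem_preimage, Set.mem_insert_iff, inl_notMem_lSet, Sum.inl.injEq, reduceCtorEq,
          or_false] at ha hb
        rw [ha, hb]
    · refine O.indep_of_subsingleton fun a ha b hb => ?_
      simp only [Set.mem_preimage, Set.mem_insert_iff, inl_notMem_lSet, reduceCtorEq,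
        or_false, false_or] at ha hb
      exact Sum.inl_injective (ha.trans hb.symm)
  have h1 := ((linearIndepOn_insert hxT).1 ((h.represents _ hT).1 hI)).2
  rwa [Set.image_insert_eq, Submodule.span_insert, sup_comm] at h1

theorem notMem_span_lSet (h : O.PartialRep ψ S v) (hlS : lSet t ⊆ S) {x : Elt m n} (hx : x ∈ S)
    (hxl : x ∉ lSet t) : v x ∉ Submodule.span ℝ (v '' lSet t) := by
  have hT : insert x (lSet t) ⊆ S := Set.insert_subset hx hlS
  have hI : O.simulation.Indep (insert x (lSet t)) :=
    (O.simulation_indep_pair t (x := x) (y := x) (fun e e' h h' =>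
      Sum.inl_injective (h.symm.trans h'))).subset (Set.subset_insert _ _)
  exact ((linearIndepOn_insert hxl).1 ((h.represents _ hT).1 hI)).2

theorem plane_of_mem_harmonic {P : Plane m n} (hPi : P ≠ .infinity) (hPf : P ≠ .flat t)
    {x : Elt m n} (hx : x ∈ ({Sum.inr (t, .c true), Sum.inr (t, .i true),
      Sum.inr (t, .q (-1))} : Set (Elt m n))) (hxP : x ∈ O.planeSet P) :
    (∃ x' y', P = .harmonic t x' y') ∨
      ∃ a α, P = .column t a α ∧ O.side t a = -1 ∧ x = Sum.inr (t, .q (-1)) := by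
  rcases hx with rfl | rfl | rfl <;> cases P <;>
    simp only [planeSet, Set.mem_ofPred_eq, Sum.elim_inr, Aux.OnFlat, Aux.OnHarmonic, Aux.OnRow,
      Aux.OnColumn, Aux.OnDiagonal, and_false, and_true, ne_eq, not_true_eq_false] at hxP hPi
  · subst hxP; exact (hPf rfl).elim
  · obtain ⟨rfl, -⟩ := hxP; exact Or.inl ⟨_, _, rfl⟩
  · obtain ⟨rfl, -⟩ := hxP; exact Or.inl ⟨_, _, rfl⟩
  · obtain ⟨rfl, -⟩ := hxP; exact Or.inl ⟨_, _, rfl⟩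
  · obtain ⟨rfl, h⟩ := hxP; exact Or.inr ⟨_, _, rfl, h.symm, rfl⟩

set_option maxHeartbeats 2000000 in
/-- The points `c true`, `i true` and `q (-1)` can be added: with `c` and `i` scaled so that `c +
i` represents `q 1`, they are `c + θ • g`, `-i + θ • g` and `c - i + θ • g` for a generic `θ`. -/
theorem extend_harmonic (h : O.PartialRep ψ S v) (ht : O.Canonical t) (hG : gSet t ⊆ S)
    (hc₀ : Sum.inr (t, .c false) ∈ S) (hi₀ : Sum.inr (t, .i false) ∈ S)
    (hq₀ : Sum.inr (t, .q 1) ∈ S)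
    (hSt : ∀ s, Sum.inr (t, s) ∈ S → Sum.inr (t, s) ∈ gSet t ∨ s = .c false ∨ s = .i false ∨ s = .q 1)
    {y : ℝ} (hy : 0 < y)
    (hq : ∃ s : ℝ, s ≠ 0 ∧ ∃ l ∈ Submodule.span ℝ (v '' lSet t), v (Sum.inr (t, .q 1)) =
      s • ((ψ (v (Sum.inr (t, .c false))))⁻¹ • v (Sum.inr (t, .c false)) +
        y • (tupleFunctional v t (v (Sum.inr (t, .i false))))⁻¹ • v (Sum.inr (t, .i false))) + l)
    (hav : ∀ a, O.side t a ≠ 0 → AvoidsAt ψ S v t y a)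
    (hav' : ∀ x ∈ S, x ∉ gSet t → tupleFunctional v t (v x) ≠ -y * ψ (v x)) :
    ∃ w, (∀ z ∈ S, w z = v z) ∧
      tupleFunctional w t (w (Sum.inr (t, .q 1))) = y * ψ (w (Sum.inr (t, .q 1))) ∧
      tupleFunctional w t (w (Sum.inr (t, .q (-1)))) = -y * ψ (w (Sum.inr (t, .q (-1)))) ∧
      (∀ a, O.side t a ≠ 0 → AvoidsAt ψ
        (S ∪ {Sum.inr (t, .c true), Sum.inr (t, .i true), Sum.inr (t, .q (-1))}) w t y a) ∧
      O.PartialRep ψ (S ∪ {Sum.inr (t, .c true), Sum.inr (t, .i true), Sum.inr (t, .q (-1))}) w := by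
  set φ := tupleFunctional v t with hφ
  set D : Set (Elt m n) := {Sum.inr (t, .c true), Sum.inr (t, .i true), Sum.inr (t, .q (-1))} with hD
  have hlS : lSet t ⊆ S := (Set.subset_insert _ _).trans hG
  have hψc : ψ (v (Sum.inr (t, .c false))) ≠ 0 := fun h0 => by
    have := (h.infinity _ hc₀).1 h0
    simp [planeSet, Aux.AtInfinity] at this
  have hφi : φ (v (Sum.inr (t, .i false))) ≠ 0 := fun h0 => by
    have := (h.flat_iff ht hi₀).1 h0
    simp [planeSet, Aux.OnFlat] at this
  have hψi : ψ (v (Sum.inr (t, .i false))) = 0 :=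
    (h.infinity _ hi₀).2 (by simp [planeSet, Aux.AtInfinity])
  have hφc : φ (v (Sum.inr (t, .c false))) = 0 :=
    (h.flat_iff ht hc₀).2 (by simp [planeSet, Aux.OnFlat])
  have hLK : ∀ l ∈ Submodule.span ℝ (v '' lSet t), φ l = 0 ∧ ψ l = 0 := fun l hl =>
    h.span_lSet_le ht hG (Submodule.span_mono (Set.image_mono (Set.subset_insert _ _)) hl)
  have hgK : φ (v (Sum.inr (t, .g))) = 0 ∧ ψ (v (Sum.inr (t, .g))) = 0 :=
    h.span_lSet_le ht hG (Submodule.subset_span ⟨_, Set.mem_insert _ _, rfl⟩)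
  set c := (ψ (v (Sum.inr (t, .c false))))⁻¹ • v (Sum.inr (t, .c false)) with hc
  set i := y • (φ (v (Sum.inr (t, .i false))))⁻¹ • v (Sum.inr (t, .i false)) with hi
  have hc1 : φ c = 0 := by simp [hc, hφc]
  have hc2 : ψ c = 1 := by simp [hc, hψc]
  have hi1 : φ i = y := by simp [hi, hφi]
  have hi2 : ψ i = 0 := by simp [hi, hψi]
  have hy0 : y ≠ 0 := hy.ne'
  have hcs : ∀ r : ℝ, Submodule.span ℝ {r • c} ≤ Submodule.span ℝ {v (Sum.inr (t, .c false))} := by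
    intro r
    rw [Submodule.span_singleton_le_iff_mem]
    exact Submodule.smul_mem _ _ (Submodule.smul_mem _ _ (Submodule.mem_span_singleton_self _))
  have his : ∀ r : ℝ, Submodule.span ℝ {r • i} ≤ Submodule.span ℝ {v (Sum.inr (t, .i false))} := by
    intro r
    rw [Submodule.span_singleton_le_iff_mem]
    exact Submodule.smul_mem _ _ (Submodule.smul_mem _ _
      (Submodule.smul_mem _ _ (Submodule.mem_span_singleton_self _)))
  obtain ⟨s₀, hs₀, l₀, hl₀, hq⟩ := hq
  have hci : c + i ∈ Submodule.span ℝ (v '' lSet t) ⊔ Submodule.span ℝ {v (Sum.inr (t, .q 1))} := by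
    have h1 : c + i = -(s₀⁻¹ • l₀) + s₀⁻¹ • v (Sum.inr (t, .q 1)) := by
      rw [hq, smul_add, smul_smul, inv_mul_cancel₀ hs₀]
      module
    rw [h1]
    exact Submodule.add_mem_sup (Submodule.neg_mem _ (Submodule.smul_mem _ _ hl₀))
      (Submodule.smul_mem _ _ (Submodule.mem_span_singleton_self _))
  have hcis : ∀ r : ℝ, Submodule.span ℝ (v '' lSet t) ⊔ Submodule.span ℝ {r • (c + i)} ≤
      Submodule.span ℝ (v '' lSet t) ⊔ Submodule.span ℝ {v (Sum.inr (t, .q 1))} := by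
    intro r
    refine sup_le le_sup_left ?_
    rw [Submodule.span_singleton_le_iff_mem]
    exact Submodule.smul_mem _ _ hci
  let d : Elt m n → Fin (m + 3) → ℝ := fun x => match x with
    | Sum.inr (_, .c _) => c
    | Sum.inr (_, .i _) => -i
    | Sum.inr (_, .q _) => c - i
    | _ => 0
  have hdisj : Disjoint S D := by
    rw [Set.disjoint_left]
    rintro x hx (rfl | rfl | rfl) <;> rcases hSt _ hx with (h | ⟨j, h⟩) | h | h | h <;> simp at h
  -- modulo the span of the `l j`, no other element is parallel to an auxiliary one
  have hnot : ∀ x ∈ S, x ∉ lSet t → ∀ z ∈ S, (∀ e, z ≠ Sum.inl e) → x ≠ z →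
      v x ∉ Submodule.span ℝ (v '' lSet t) ⊔ Submodule.span ℝ {v z} := fun x hx hxl z hz hzE hxz =>
    h.notMem_sup_span hlS hx hz hxz hxl fun e e' _ h' => (hzE e' h').elim
  have hpc : ∀ x ∈ S, x ∉ lSet t → x ≠ Sum.inr (t, .c false) → ∀ r : ℝ,
      v x ∉ Submodule.span ℝ (v '' lSet t) ⊔ Submodule.span ℝ {r • c} := fun x hx hxl hne r hm =>
    hnot x hx hxl _ hc₀ (by simp) hne (sup_le_sup_left (hcs r) _ hm)
  have hpi : ∀ x ∈ S, x ∉ lSet t → x ≠ Sum.inr (t, .i false) → ∀ r : ℝ,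
      v x ∉ Submodule.span ℝ (v '' lSet t) ⊔ Submodule.span ℝ {r • i} := fun x hx hxl hne r hm =>
    hnot x hx hxl _ hi₀ (by simp) hne (sup_le_sup_left (his r) _ hm)
  have hpq : ∀ x ∈ S, x ∉ lSet t → x ≠ Sum.inr (t, .q 1) → ∀ r : ℝ,
      v x ∉ Submodule.span ℝ (v '' lSet t) ⊔ Submodule.span ℝ {r • (c + i)} := fun x hx hxl hne r hm =>
    hnot x hx hxl _ hq₀ (by simp) hne (hcis r hm)
  obtain ⟨y', w, hwS, hwD, hw⟩ := h.extend_pencil ht hG hdisj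
    (by rintro x (rfl | rfl | rfl) <;> exact ⟨_, rfl⟩) d
    (by
      rintro x (rfl | rfl | rfl) <;>
        simp [d, planeSet, Aux.OnFlat, ← hφ, hc1, hi1, hy0])
    (by
      rintro x (rfl | rfl | rfl) <;>
        simp [d, planeSet, Aux.AtInfinity, hc2, hi2])
    (by
      rintro x (rfl | rfl | rfl) <;> simp [d, ← hφ, hc1, hc2, hi1, hi2, hy0])
    (by
      rintro x (rfl | rfl | rfl) <;> simp only [d, ← hφ, map_sub, map_neg, hc1, hc2, hi1, hi2]
      · simp
      · simp
      · intro _ _ x hx hx'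
        by_contra hxg
        exact hav' x hx hxg (by linarith))
    (by
      intro x hx hxl z hz z' hz' hzz hP
      have e1 : c - (c - i) = (1 : ℝ) • i := by module
      have e2 : c - i - c = (-1 : ℝ) • i := by module
      have e3 : c - -i = (1 : ℝ) • (c + i) := by module
      have e4 : -i - c = (-1 : ℝ) • (c + i) := by module
      have e5 : c - i - -i = (1 : ℝ) • c := by module
      have e6 : -i - (c - i) = (-1 : ℝ) • c := by module
      left
      rcases hz with rfl | rfl | rfl <;> rcases hz' with rfl | rfl | rfl <;>
        (first | exact (hzz rfl).elim | skip) <;>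
        simp only [d, ← hφ, map_sub, map_neg, hc1, hc2, hi1, hi2]
      · refine ⟨by simp [hy0], ?_⟩
        rw [e4]
        refine hpq x hx hxl ?_ _
        rintro rfl
        exact hP (.harmonic t true true) ht (by simp [planeSet, Aux.OnHarmonic])
          (by simp [planeSet, Aux.OnHarmonic]) (by simp [planeSet, Aux.OnHarmonic])
      · refine ⟨by simp [hy0], ?_⟩
        rw [e2]
        refine hpi x hx hxl ?_ _
        rintro rfl
        exact hP (.harmonic t true false) ht (by simp [planeSet, Aux.OnHarmonic])
          (by simp [planeSet, Aux.OnHarmonic]) (by simp [planeSet, Aux.OnHarmonic])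
      · refine ⟨by simp [hy0], ?_⟩
        rw [e3]
        refine hpq x hx hxl ?_ _
        rintro rfl
        exact hP (.harmonic t true true) ht (by simp [planeSet, Aux.OnHarmonic])
          (by simp [planeSet, Aux.OnHarmonic]) (by simp [planeSet, Aux.OnHarmonic])
      · refine ⟨by simp [hy0], ?_⟩
        rw [e5]
        refine hpc x hx hxl ?_ _
        rintro rfl
        exact hP (.harmonic t false true) ht (by simp [planeSet, Aux.OnHarmonic])
          (by simp [planeSet, Aux.OnHarmonic]) (by simp [planeSet, Aux.OnHarmonic])
      · refine ⟨by simp [hy0], ?_⟩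
        rw [e1]
        refine hpi x hx hxl ?_ _
        rintro rfl
        exact hP (.harmonic t true false) ht (by simp [planeSet, Aux.OnHarmonic])
          (by simp [planeSet, Aux.OnHarmonic]) (by simp [planeSet, Aux.OnHarmonic])
      · refine ⟨by simp [hy0], ?_⟩
        rw [e6]
        refine hpc x hx hxl ?_ _
        rintro rfl
        exact hP (.harmonic t false true) ht (by simp [planeSet, Aux.OnHarmonic])
          (by simp [planeSet, Aux.OnHarmonic]) (by simp [planeSet, Aux.OnHarmonic]))
    (by
      have key : ∀ P, O.PlaneValid P → Sum.inr (t, .c true) ∈ O.planeSet P →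
          Sum.inr (t, .i true) ∈ O.planeSet P → Sum.inr (t, .q (-1)) ∈ O.planeSet P → False := by
        intro P _ h1 h2 h3
        cases P <;> simp [planeSet, Aux.AtInfinity, Aux.OnFlat, Aux.OnHarmonic, Aux.OnRow,
          Aux.OnColumn, Aux.OnDiagonal] at h1 h2 h3
        obtain ⟨-, h1⟩ := h1
        obtain ⟨-, h2⟩ := h2
        obtain ⟨-, h3⟩ := h3
        subst h1 h2
        simp at h3
      rintro z₁ (rfl | rfl | rfl) z₂ (rfl | rfl | rfl) z₃ (rfl | rfl | rfl) h12 h13 h23 P hP h1 h2 h3 <;>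
        first
        | exact (h12 rfl).elim
        | exact (h13 rfl).elim
        | exact (h23 rfl).elim
        | exact key P hP ‹_› ‹_› ‹_›)
    (by
      have key : ∀ α β : ℝ, φ (α • c + β • i) = β * y ∧ ψ (α • c + β • i) = α := by
        intro α β
        simp [hc1, hc2, hi1, hi2]
      rintro z₁ (rfl | rfl | rfl) z₂ (rfl | rfl | rfl) z₃ (rfl | rfl | rfl) h12 h13 h23 <;>
        first
        | exact (h12 rfl).elim
        | exact (h13 rfl).elim
        | exact (h23 rfl).elim
        | (refine ⟨by simp [d, ← hφ, hc1, hc2, hi1, hi2, hy0], fun α β hαβ => ?_⟩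
           obtain ⟨f1, f2⟩ := hLK _ hαβ
           simp only [d, map_add, map_smul, map_sub, map_neg, hc1, hc2, hi1, hi2, smul_eq_mul]
             at f1 f2
           ring_nf at f1 f2
           have f3 : (α + β) * y = 0 ∨ β * y = 0 ∨ α * y = 0 := by
             first
             | (left; linarith)
             | (right; left; linarith)
             | (right; right; linarith)
           simp only [mul_eq_zero, hy0, or_false] at f3
           rcases f3 with f3 | f3 | f3 <;> constructor <;> first | linarith | nlinarith))
    (by
      intro P hP hPi hPf hPD y'
      obtain ⟨x₀, hx₀, hx₀P⟩ := hPD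
      have hPt := plane_of_mem_harmonic hPi hPf hx₀ hx₀P
      have hlmem : ∀ x ∈ lSet t, ∀ a b : Fin (m + 3) → ℝ,
          v x ∈ Submodule.span ℝ (v '' lSet t) ⊔ Submodule.span ℝ {a, b} := fun x hx a b =>
        Submodule.mem_sup_left (Submodule.subset_span ⟨x, hx, rfl⟩)
      set g := v (Sum.inr (t, .g))
      rcases hPt with ⟨x', y₁, rfl⟩ | ⟨a, α, rfl, hside, rfl⟩
      · have hmemS : ∀ x ∈ O.planeSet (.harmonic t x' y₁), x ∈ S → x ∈ lSet t ∨
            (x = Sum.inr (t, .c false) ∧ x' = false) ∨ (x = Sum.inr (t, .i false) ∧ y₁ = false) ∨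
              (x = Sum.inr (t, .q 1) ∧ x' = y₁) := by
          rintro (e | ⟨t', s⟩) hxP hxS
          · exact hxP.elim
          · obtain ⟨rfl, hx⟩ := hxP
            rcases hSt s hxS with (h | h) | rfl | rfl | rfl
            · simp only [Sum.inr.injEq, Prod.mk.injEq, true_and] at h
              subst h; exact hx.elim
            · exact Or.inl h
            · exact Or.inr (Or.inl ⟨rfl, hx.symm⟩)
            · exact Or.inr (Or.inr (Or.inl ⟨rfl, hx.symm⟩))
            · refine Or.inr (Or.inr (Or.inr ⟨rfl, ?_⟩))
              by_contra hne
              simp [Aux.OnHarmonic, hne] at hx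
        have hmemD : ∀ x ∈ O.planeSet (.harmonic t x' y₁), x ∈ D →
            (x = Sum.inr (t, .c true) ∧ x' = true ∨ x = Sum.inr (t, .i true) ∧ y₁ = true ∨
            x = Sum.inr (t, .q (-1)) ∧ x' ≠ y₁) := by
          rintro x hxP (rfl | rfl | rfl)
          · exact Or.inl ⟨rfl, hxP.2.symm⟩
          · exact Or.inr (Or.inl ⟨rfl, hxP.2.symm⟩)
          · refine Or.inr (Or.inr ⟨rfl, ?_⟩)
            rintro rfl
            simp [planeSet, Aux.OnHarmonic] at hxP
        cases x' <;> cases y₁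
        · rcases hmemD x₀ hx₀P hx₀ with h | h | h <;> simp at h
        · refine ⟨v (Sum.inr (t, .c false)), -i + y' • g, fun x hxP hxS => ?_, fun x hxP hxD => ?_⟩
          · rcases hmemS x hxP hxS with h | h1 | h1 | h1
            · exact hlmem x h _ _
            · rw [h1.1]; exact left_mem_sup_pair _ _
            · simp at h1
            · simp at h1
          · rcases hmemD x hxP hxD with h | ⟨rfl, -⟩ | ⟨rfl, -⟩
            · simp at h
            · exact right_mem_sup_pair _ _
            · have : c - i + y' • g = (ψ (v (Sum.inr (t, .c false))))⁻¹ •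
                  v (Sum.inr (t, .c false)) + (-i + y' • g) := by rw [← hc]; module
              simp only [d]
              rw [this]
              exact Submodule.add_mem _ (Submodule.smul_mem _ _ (left_mem_sup_pair _ _)) (right_mem_sup_pair _ _)
        · refine ⟨v (Sum.inr (t, .i false)), c + y' • g, fun x hxP hxS => ?_, fun x hxP hxD => ?_⟩
          · rcases hmemS x hxP hxS with h | h1 | h1 | h1
            · exact hlmem x h _ _
            · simp at h1
            · rw [h1.1]; exact left_mem_sup_pair _ _
            · simp at h1
          · rcases hmemD x hxP hxD with ⟨rfl, -⟩ | h | ⟨rfl, -⟩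
            · exact right_mem_sup_pair _ _
            · simp at h
            · have : c - i + y' • g = (c + y' • g) - y • (φ (v (Sum.inr (t, .i false))))⁻¹ •
                v (Sum.inr (t, .i false)) := by rw [← hi]; module
              simp only [d]
              rw [this]
              exact Submodule.sub_mem _ (right_mem_sup_pair _ _)
                (Submodule.smul_mem _ _ (Submodule.smul_mem _ _ (left_mem_sup_pair _ _)))
        · refine ⟨v (Sum.inr (t, .q 1)), c + y' • g, fun x hxP hxS => ?_, fun x hxP hxD => ?_⟩
          · rcases hmemS x hxP hxS with h | h1 | h1 | h1
            · exact hlmem x h _ _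
            · simp at h1
            · simp at h1
            · rw [h1.1]; exact left_mem_sup_pair _ _
          · rcases hmemD x hxP hxD with ⟨rfl, -⟩ | ⟨rfl, -⟩ | h
            · exact right_mem_sup_pair _ _
            · have : -i + y' • g = (c + y' • g) - (c + i) := by module
              simp only [d]
              rw [this]
              have h2 : Submodule.span ℝ {v (Sum.inr (t, .q 1))} ≤
                  Submodule.span ℝ {v (Sum.inr (t, .q 1)), c + y' • g} :=
                Submodule.span_mono (by simp)
              exact Submodule.sub_mem _ (right_mem_sup_pair _ _) (sup_le_sup_left h2 _ hci)
            · simp at h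
      · refine ⟨d (Sum.inr (t, .q (-1))) + y' • g, 0, fun x hxP hxS => ?_, fun x hxP hxD => ?_⟩
        · rcases x with e | ⟨t', s⟩
          · exact hxP.elim
          · obtain ⟨rfl, hx⟩ := hxP
            rcases hSt s hxS with (h | h) | rfl | rfl | rfl
            · simp only [Sum.inr.injEq, Prod.mk.injEq, true_and] at h
              subst h; exact hx.elim
            · exact hlmem _ h _ _
            · exact hx.elim
            · exact hx.elim
            · have : (1 : SignType) = O.side t' a := hx
              rw [hside] at this
              exact absurd this (by decide)
        · rcases hxD with rfl | rfl | rfl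
          · exact hxP.2.elim
          · exact hxP.2.elim
          · exact left_mem_sup_pair _ _)
  have hφw : tupleFunctional w t = φ := tupleFunctional_congr (fun e => hwS _ (h.mem e)) t
  have hval : ∀ x ∈ D, ∃ s : ℝ, s ≠ 0 ∧ φ (w x) = s * φ (d x) ∧ ψ (w x) = s * ψ (d x) := by
    intro x hx
    obtain ⟨s, hs, l, hl, hwx⟩ := hwD x hx
    refine ⟨s, hs, ?_, ?_⟩ <;> rw [hwx] <;>
      simp [(hLK l hl).1, (hLK l hl).2, hgK.1, hgK.2]
  refine ⟨w, hwS, ?_, ?_, ?_, hw⟩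
  · rw [hφw, hwS _ hq₀, hq]
    simp [(hLK l₀ hl₀).1, (hLK l₀ hl₀).2, hc1, hc2, hi1, hi2, mul_comm]
  · obtain ⟨s, -, h1, h2⟩ := hval (Sum.inr (t, .q (-1))) (by simp [hD])
    rw [hφw, h1, h2]
    simp [d, hc1, hc2, hi1, hi2, mul_comm]
  · intro a ha x hx hxg
    rw [hφw, hwS _ (h.mem a)]
    rcases hx with hx | hx
    · rw [hwS x hx]; exact hav a ha x hx hxg
    · obtain ⟨s, hs, h1, h2⟩ := hval x hx
      have hψa : ψ (v (Sum.inl a)) ≠ 0 := fun h0 => (h.infinity _ (h.mem a)).1 h0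
      have hφa : φ (v (Sum.inl a)) ≠ 0 := fun h0 => ha ((h.flat_iff ht (h.mem a)).1 h0)
      rw [h1, h2]
      rcases hx with rfl | rfl | rfl
      · simp [d, hc1, hc2, hs, hy0, hφa]
      · simp [d, hi1, hi2, hs, hy0, hψa]
      · -- `q 1` and `q (-1)` have opposite positions
        have h3 := hav a ha _ hq₀ (by
          rintro (h | ⟨j, h⟩) <;> simp at h)
        intro h4
        apply h3
        simp only [← hφ, hq, map_add, map_smul, hc1, hc2, hi1, hi2, (hLK l₀ hl₀).1, (hLK l₀ hl₀).2,
          smul_eq_mul]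
        simp only [d, map_sub, hc1, hc2, hi1, hi2] at h4
        have h5 : s ^ 2 * (y ^ 2 * ψ (v (Sum.inl a))) = s ^ 2 * (|φ (v (Sum.inl a))| * y) := by
          linear_combination h4
        have h6 := mul_left_cancel₀ (pow_ne_zero 2 hs) h5
        linear_combination s₀ ^ 2 * h6

end PartialRep

end AbstractOrderType

/-! ### The quadrilateral that links a point to a block -/

/-- The vertices of the complete quadrilateral that relates the position `A` of `a`, the position
`f ^ 2 / A` of `q` and the position `f` of the points of the diagonal. -/
def cornerVector {V : Type*} [AddCommGroup V] [Module ℝ V] (A f : ℝ) (c a q : V) (α β : Bool) : V :=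
  (A - f) • c + (if α then f else 0) • a - (if β then A else 0) • q

/-- The positions of the vectors that define a quadrilateral. -/
structure IsQuadrilateral {V : Type*} [AddCommGroup V] [Module ℝ V] (φ ψ : V →ₗ[ℝ] ℝ) (A f : ℝ)
    (c a q : V) : Prop where
  pos : 0 < f
  ne_zero : A ≠ 0
  sq_ne : f ^ 2 ≠ A ^ 2
  flat_c : φ c = 0
  flat_a : φ a = A
  flat_q : A * φ q = f ^ 2
  infinity_c : ψ c = 1
  infinity_a : ψ a = 1
  infinity_q : ψ q = 1

namespace IsQuadrilateral

variable {V : Type*} [AddCommGroup V] [Module ℝ V] {φ ψ : V →ₗ[ℝ] ℝ} {A f : ℝ} {c a q : V}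

theorem flat_corner (h : IsQuadrilateral φ ψ A f c a q) (α β : Bool) :
    φ (cornerVector A f c a q α β) = f * ((if α then A else 0) - if β then f else 0) := by
  have h1 := h.flat_q
  cases α <;> cases β <;> simp [cornerVector, h.flat_c, h.flat_a] <;>
    first | linear_combination -h1 | linear_combination h1

theorem infinity_corner (h : IsQuadrilateral φ ψ A f c a q) (α β : Bool) :
    ψ (cornerVector A f c a q α β) = A - f + (if α then f else 0) - if β then A else 0 := by
  cases α <;> cases β <;> simp [cornerVector, h.infinity_c, h.infinity_a, h.infinity_q]

theorem sub_ne (h : IsQuadrilateral φ ψ A f c a q) : A - f ≠ 0 := fun h0 =>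
  h.sq_ne (by linear_combination (-(A + f)) * h0)

theorem add_ne (h : IsQuadrilateral φ ψ A f c a q) : A + f ≠ 0 := fun h0 =>
  h.sq_ne (by linear_combination (f - A) * h0)

theorem flat_corner_eq_zero_iff (h : IsQuadrilateral φ ψ A f c a q) (α β : Bool) :
    φ (cornerVector A f c a q α β) = 0 ↔ α = false ∧ β = false := by
  rw [h.flat_corner]
  have := h.pos.ne'
  have := h.ne_zero
  have := h.sub_ne
  cases α <;> cases β <;> simp_all

theorem infinity_corner_eq_zero_iff (h : IsQuadrilateral φ ψ A f c a q) (α β : Bool) :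
    ψ (cornerVector A f c a q α β) = 0 ↔ α = true ∧ β = true := by
  rw [h.infinity_corner]
  have := h.pos.ne'
  have := h.ne_zero
  have := h.sub_ne
  cases α <;> cases β <;> simp_all

/-- The position of the two vertices on the diagonal is `f`. -/
theorem flat_eq_mul (h : IsQuadrilateral φ ψ A f c a q) {α β : Bool} (hαβ : α ≠ β) :
    φ (cornerVector A f c a q α β) = f * ψ (cornerVector A f c a q α β) := by
  rw [h.flat_corner, h.infinity_corner]
  cases α <;> cases β <;> simp at hαβ ⊢

/-- Two vertices have the same position only if they are equal or both on the diagonal. -/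
theorem mul_eq_iff (h : IsQuadrilateral φ ψ A f c a q) (α β α' β' : Bool) :
    φ (cornerVector A f c a q α β) * ψ (cornerVector A f c a q α' β') =
      φ (cornerVector A f c a q α' β') * ψ (cornerVector A f c a q α β) ↔
      (α = α' ∧ β = β') ∨ (α ≠ β ∧ α' ≠ β') := by
  rw [h.flat_corner, h.infinity_corner, h.flat_corner, h.infinity_corner]
  have h1 := h.pos.ne'
  have h2 := h.ne_zero
  have h3 := h.sub_ne
  cases α <;> cases β <;> cases α' <;> cases β' <;> simp [h1, h2, h3] <;> ring

/-- Three vertices are not collinear, even modulo the intersection of the two hyperplanes. -/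
theorem eq_zero_of_mem_ker (h : IsQuadrilateral φ ψ A f c a q) {α₁ β₁ α₂ β₂ α₃ β₃ : Bool}
    (h₁₂ : ¬ (α₁ = α₂ ∧ β₁ = β₂)) (h₁₃ : ¬ (α₁ = α₃ ∧ β₁ = β₃)) (h₂₃ : ¬ (α₂ = α₃ ∧ β₂ = β₃))
    {r s : ℝ}
    (hφ : φ (r • (cornerVector A f c a q α₂ β₂ - cornerVector A f c a q α₁ β₁) +
      s • (cornerVector A f c a q α₃ β₃ - cornerVector A f c a q α₁ β₁)) = 0)
    (hψ : ψ (r • (cornerVector A f c a q α₂ β₂ - cornerVector A f c a q α₁ β₁) +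
      s • (cornerVector A f c a q α₃ β₃ - cornerVector A f c a q α₁ β₁)) = 0) : r = 0 ∧ s = 0 := by
  simp only [map_add, map_sub, map_smul, smul_eq_mul, h.flat_corner, h.infinity_corner] at hφ hψ
  have h1 := h.pos.ne'
  have h3 := mul_ne_zero h.sub_ne h.add_ne
  let e : Bool → ℝ := fun b => if b then 1 else 0
  have hA : ∀ b : Bool, (if b then A else 0) = A * e b := fun b => by cases b <;> simp [e]
  have hf : ∀ b : Bool, (if b then f else 0) = f * e b := fun b => by cases b <;> simp [e]
  simp only [hA, hf] at hφ hψ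
  have k1 : r * (e α₂ - e α₁) + s * (e α₃ - e α₁) = 0 := by
    refine (mul_eq_zero.1 (?_ : (f * ((A - f) * (A + f))) * _ = 0)).resolve_left (mul_ne_zero h1 h3)
    linear_combination A * hφ - f ^ 2 * hψ
  have k2 : r * (e β₂ - e β₁) + s * (e β₃ - e β₁) = 0 := by
    refine (mul_eq_zero.1 (?_ : (f * ((A - f) * (A + f))) * _ = 0)).resolve_left (mul_ne_zero h1 h3)
    linear_combination f * hφ - f * A * hψ
  clear hA hf hφ hψ
  cases α₁ <;> cases β₁ <;> cases α₂ <;> cases β₂ <;> cases α₃ <;> cases β₃ <;>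
    simp [e] at h₁₂ h₁₃ h₂₃ k1 k2 <;> constructor <;> linarith

end IsQuadrilateral

namespace AbstractOrderType

variable {m n : ℕ} {O : AbstractOrderType (m + 2) n}

theorem plane_of_mem_corner {t : Fin (m + 2) → Fin n} {P : Plane m n} (hPi : P ≠ .infinity)
    (hPf : P ≠ .flat t) {α β : Bool} {a : Fin n}
    (hP : (Sum.inr (t, .corner α β a) : Elt m n) ∈ O.planeSet P) :
    P = .row t a β ∨ P = .column t a α ∨ (P = .diagonal t a ∧ α ≠ β) := by
  cases P <;> simp only [planeSet, Set.mem_ofPred_eq, Sum.elim_inr, Aux.OnFlat, Aux.OnHarmonic,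
    Aux.OnRow, Aux.OnColumn, Aux.OnDiagonal, and_false, ne_eq, not_true_eq_false] at hP hPi
  · obtain ⟨rfl, -⟩ := hP; exact (hPf rfl).elim
  · obtain ⟨rfl, rfl, rfl⟩ := hP; exact Or.inl rfl
  · obtain ⟨rfl, rfl, rfl⟩ := hP; exact Or.inr (Or.inl rfl)
  · obtain ⟨rfl, h, rfl⟩ := hP; exact Or.inr (Or.inr ⟨rfl, h⟩)

theorem not_three_off_diagonal {α₁ β₁ α₂ β₂ α₃ β₃ : Bool} (h₁₂ : ¬ (α₁ = α₂ ∧ β₁ = β₂))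
    (h₁₃ : ¬ (α₁ = α₃ ∧ β₁ = β₃)) (h₂₃ : ¬ (α₂ = α₃ ∧ β₂ = β₃)) (h₂ : α₁ ≠ β₁ ∧ α₂ ≠ β₂)
    (h₃ : α₁ ≠ β₁ ∧ α₃ ≠ β₃) : False := by
  cases α₁ <;> cases β₁ <;> cases α₂ <;> cases β₂ <;> simp at h₁₂ h₂ <;>
    cases α₃ <;> cases β₃ <;> simp_all

/-- The four points of a block that are used for the element `a`. -/
def cornerSet (t : Fin (m + 2) → Fin n) (a : Fin n) : Set (Elt m n) :=
  Set.range fun p : Bool × Bool => Sum.inr (t, .corner p.1 p.2 a)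

/-- No prescribed hyperplane contains three vertices of a quadrilateral. -/
theorem not_cornerSet_three {t : Fin (m + 2) → Fin n} {a : Fin n} {z₁ z₂ z₃ : Elt m n}
    (h₁ : z₁ ∈ cornerSet t a) (h₂ : z₂ ∈ cornerSet t a) (h₃ : z₃ ∈ cornerSet t a)
    (h₁₂ : z₁ ≠ z₂) (h₁₃ : z₁ ≠ z₃) (h₂₃ : z₂ ≠ z₃) {P : Plane m n}
    (k₁ : z₁ ∈ O.planeSet P) (k₂ : z₂ ∈ O.planeSet P) (k₃ : z₃ ∈ O.planeSet P) : False := by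
  obtain ⟨⟨α₁, β₁⟩, rfl⟩ := h₁
  obtain ⟨⟨α₂, β₂⟩, rfl⟩ := h₂
  obtain ⟨⟨α₃, β₃⟩, rfl⟩ := h₃
  have e₁₂ : ¬ (α₁ = α₂ ∧ β₁ = β₂) := fun h => h₁₂ (by rw [h.1, h.2])
  have e₁₃ : ¬ (α₁ = α₃ ∧ β₁ = β₃) := fun h => h₁₃ (by rw [h.1, h.2])
  have e₂₃ : ¬ (α₂ = α₃ ∧ β₂ = β₃) := fun h => h₂₃ (by rw [h.1, h.2])
  clear h₁₂ h₁₃ h₂₃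
  have three : ∀ x y z : Bool, x ≠ y → x ≠ z → y ≠ z → False := by decide
  cases P with
  | infinity => exact e₁₂ ⟨k₁.1.trans k₂.1.symm, k₁.2.trans k₂.2.symm⟩
  | flat => exact e₁₂ ⟨k₁.2.1.trans k₂.2.1.symm, k₁.2.2.trans k₂.2.2.symm⟩
  | harmonic => exact k₁.2
  | row =>
    have f₁₂ := k₁.2.1.trans k₂.2.1.symm
    have f₁₃ := k₁.2.1.trans k₃.2.1.symm
    exact three α₁ α₂ α₃ (fun h => e₁₂ ⟨h, f₁₂⟩) (fun h => e₁₃ ⟨h, f₁₃⟩)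
      fun h => e₂₃ ⟨h, f₁₂.symm.trans f₁₃⟩
  | column =>
    have f₁₂ := k₁.2.1.trans k₂.2.1.symm
    have f₁₃ := k₁.2.1.trans k₃.2.1.symm
    exact three β₁ β₂ β₃ (fun h => e₁₂ ⟨f₁₂, h⟩) (fun h => e₁₃ ⟨f₁₃, h⟩)
      fun h => e₂₃ ⟨f₁₂.symm.trans f₁₃, h⟩
  | diagonal => exact not_three_off_diagonal e₁₂ e₁₃ e₂₃ ⟨k₁.2.1, k₂.2.1⟩ ⟨k₁.2.1, k₃.2.1⟩

namespace PartialRep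

variable {ψ : (Fin (m + 3) → ℝ) →ₗ[ℝ] ℝ} {S : Set (Elt m n)} {v : Elt m n → Fin (m + 3) → ℝ}
  {t : Fin (m + 2) → Fin n}

theorem eq_g_of_mem_gSet {x : Elt m n} (hx : x ∈ gSet t) (hxl : x ∉ lSet t) :
    x = Sum.inr (t, .g) := hx.resolve_right hxl

/-- The four vertices, translated by a common multiple of `g`, extend the representation if they
avoid the positions of all other elements. -/
theorem extend_cornerSet (h : O.PartialRep ψ S v) (ht : O.Canonical t) (hG : gSet t ⊆ S)
    {a : Fin n} (ha : O.side t a ≠ 0) (hrep : O.rep a = a)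
    (hqS : Sum.inr (t, .q (O.side t a)) ∈ S) (hS : ∀ α β, Sum.inr (t, .corner α β a) ∉ S)
    {A f : ℝ} {c a' q' : Fin (m + 3) → ℝ}
    (hquad : IsQuadrilateral (tupleFunctional v t) ψ A f c a' q')
    (ha' : a' ∈ Submodule.span ℝ {v (Sum.inl a)})
    (hq' : q' ∈ Submodule.span ℝ {v (Sum.inr (t, .q (O.side t a)))})
    (hav : ∀ x ∈ S, x ∉ gSet t → tupleFunctional v t (v x) ^ 2 ≠ f ^ 2 * ψ (v x) ^ 2) :
    ∃ y : ℝ, ∃ w, (∀ z ∈ S, w z = v z) ∧ (∀ α β, ∃ s : ℝ, s ≠ 0 ∧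
      ∃ l ∈ Submodule.span ℝ (v '' lSet t), w (Sum.inr (t, .corner α β a)) =
        s • (cornerVector A f c a' q' α β + y • v (Sum.inr (t, Aux.g))) + l) ∧
      O.PartialRep ψ (S ∪ cornerSet t a) w := by
  have hlS : lSet t ⊆ S := (Set.subset_insert _ _).trans hG
  have hLK : ∀ l ∈ Submodule.span ℝ (v '' lSet t), tupleFunctional v t l = 0 ∧ ψ l = 0 := fun l hl =>
    h.span_lSet_le ht hG (Submodule.span_mono (Set.image_mono (Set.subset_insert _ _)) hl)
  have hgK : tupleFunctional v t (v (Sum.inr (t, .g))) = 0 ∧ ψ (v (Sum.inr (t, .g))) = 0 :=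
    h.span_lSet_le ht hG (Submodule.subset_span ⟨_, Set.mem_insert _ _, rfl⟩)
  let d : Elt m n → Fin (m + 3) → ℝ := fun x => match x with
    | Sum.inr (_, .corner α β _) => cornerVector A f c a' q' α β
    | _ => 0
  have hpa : ∀ x ∈ S, x ∉ lSet t → (∀ e, x = Sum.inl e → ¬ O.Parallel a e) → ∀ r : ℝ,
      v x ∉ Submodule.span ℝ (v '' lSet t) ⊔ Submodule.span ℝ {r • a'} := by
    intro x hx hxl hne r hm
    refine h.notMem_sup_span hlS hx (h.mem a) ?_ hxl ?_ (SetLike.le_def.1 (sup_le_sup_left ?_ _) hm)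
    · rintro rfl
      exact hne a rfl ((O.parallel_iff (by omega) a a).2 (Or.inl rfl))
    · rintro e e' rfl h'
      rw [← Sum.inl_injective h', Set.pair_comm]
      by_contra hcon
      exact hne e rfl ((O.parallel_iff (by omega) a e).2 (Or.inr hcon))
    · rw [Submodule.span_singleton_le_iff_mem]
      exact Submodule.smul_mem _ _ ha'
  have hpq : ∀ x ∈ S, x ∉ lSet t → x ≠ Sum.inr (t, .q (O.side t a)) → ∀ r : ℝ,
      v x ∉ Submodule.span ℝ (v '' lSet t) ⊔ Submodule.span ℝ {r • q'} := by
    intro x hx hxl hne r hm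
    refine h.notMem_sup_span hlS hx hqS hne hxl (fun e e' _ h' => by cases h') (SetLike.le_def.1 (sup_le_sup_left ?_ _) hm)
    rw [Submodule.span_singleton_le_iff_mem]
    exact Submodule.smul_mem _ _ hq'
  have hpd : ∀ x ∈ S, x ∉ lSet t → ∀ r : ℝ,
      v x ∉ Submodule.span ℝ (v '' lSet t) ⊔ Submodule.span ℝ {r • (f • a' - A • q')} := by
    intro x hx hxl r hm
    obtain ⟨l, hl, z, hz, hlz⟩ := Submodule.mem_sup.1 hm
    obtain ⟨r', rfl⟩ := Submodule.mem_span_singleton.1 hz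
    have e1 : tupleFunctional v t (v x) = r' * r * (f * (A - f)) := by
      rw [← hlz]
      simp only [map_add, map_smul, map_sub, (hLK l hl).1, hquad.flat_a, smul_eq_mul, hquad.flat_q]
      ring
    have e2 : ψ (v x) = - (r' * r * (A - f)) := by
      rw [← hlz]
      simp only [map_add, map_smul, map_sub, (hLK l hl).2, hquad.infinity_a, hquad.infinity_q,
        smul_eq_mul]
      ring
    by_cases hxg : x ∈ gSet t
    · have hx0 := eq_g_of_mem_gSet hxg hxl
      rw [hx0, hgK.2] at e2
      have h0 : r' * r = 0 := by
        rcases mul_eq_zero.1 (neg_eq_zero.1 e2.symm) with h0 | h0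
        · exact h0
        · exact (hquad.sub_ne h0).elim
      refine h.notMem_span_lSet hlS hx hxl ?_
      rw [← hlz, smul_smul, h0, zero_smul, add_zero]
      exact hl
    · exact hav x hx hxg (by rw [e1, e2]; ring)
  obtain ⟨y, w, hwS, hwD, hw⟩ := h.extend_pencil ht hG (D := cornerSet t a)
    (Set.disjoint_left.2 (by rintro _ hx ⟨p, rfl⟩; exact hS _ _ hx))
    (by rintro _ ⟨p, rfl⟩; exact ⟨_, rfl⟩) d
    (by
      rintro _ ⟨p, rfl⟩
      exact (hquad.flat_corner_eq_zero_iff _ _).trans (by simp [planeSet, Aux.OnFlat]))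
    (by
      rintro _ ⟨p, rfl⟩
      exact (hquad.infinity_corner_eq_zero_iff _ _).trans (by simp [planeSet, Aux.AtInfinity]))
    (by
      rintro _ ⟨p, rfl⟩ h1 h2
      have h1 := (hquad.flat_corner_eq_zero_iff _ _).1 h1
      have h2 := (hquad.infinity_corner_eq_zero_iff _ _).1 h2
      rw [h1.1] at h2; simp at h2)
    (by
      rintro _ ⟨⟨α, β⟩, rfl⟩ h1 h2 x hx he
      have hαβ : α ≠ β := by
        rintro rfl
        cases α
        · exact h1 ((hquad.flat_corner_eq_zero_iff _ _).2 ⟨rfl, rfl⟩)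
        · exact h2 ((hquad.infinity_corner_eq_zero_iff _ _).2 ⟨rfl, rfl⟩)
      have h3 := hquad.flat_eq_mul hαβ
      by_contra hxg
      refine hav x hx hxg ?_
      change _ * ψ (cornerVector A f c a' q' α β) = _ at he
      change _ = tupleFunctional v t (cornerVector A f c a' q' α β) * _ at he
      rw [h3] at he
      have h4 : tupleFunctional v t (v x) = f * ψ (v x) :=
        mul_right_cancel₀ h2 (he.trans (by ring))
      rw [h4]; ring)
    (by
      rintro x hx hxl _ ⟨⟨α, β⟩, rfl⟩ _ ⟨⟨α', β'⟩, rfl⟩ hzz hP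
      have hne : ¬ (α = α' ∧ β = β') := fun h => hzz (by rw [h.1, h.2])
      have hwedge := hquad.mul_eq_iff α β α' β'
      have hmem : α = α' → x ≠ Sum.inr (t, .q (O.side t a)) := by
        rintro rfl rfl
        exact hP (.column t a α) ⟨ht, hrep, ha⟩ ⟨rfl, rfl⟩ ⟨rfl, rfl, rfl⟩ ⟨rfl, rfl, rfl⟩
      have hmem' : β = β' → ∀ e, x = Sum.inl e → ¬ O.Parallel a e := by
        rintro rfl e rfl hpar
        exact hP (.row t a β) ⟨ht, hrep, ha⟩ hpar ⟨rfl, rfl, rfl⟩ ⟨rfl, rfl, rfl⟩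
      have hdiff : cornerVector A f c a' q' α' β' - cornerVector A f c a' q' α β =
          ((if α' then f else 0) - if α then f else 0) • a' -
            ((if β' then A else 0) - if β then A else 0) • q' := by
        simp only [cornerVector]; module
      change (_ ∧ v x ∉ Submodule.span ℝ (v '' lSet t) ⊔ Submodule.span ℝ
        {cornerVector A f c a' q' α' β' - cornerVector A f c a' q' α β}) ∨
        (_ ∧ _ ∧ _ ∧ _ ∧ cornerVector A f c a' q' α' β' - cornerVector A f c a' q' α β ∉ _)
      by_cases hdiag : α ≠ β ∧ α' ≠ β'
      · refine Or.inr ⟨hwedge.2 (Or.inr hdiag), ?_, ?_, ?_, ?_⟩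
        · exact fun h0 => hdiag.1 (by
            have := (hquad.flat_corner_eq_zero_iff _ _).1 h0; exact this.1.trans this.2.symm)
        · exact fun h0 => hdiag.1 (by
            have := (hquad.infinity_corner_eq_zero_iff _ _).1 h0; exact this.1.trans this.2.symm)
        · intro hxg
          have hx0 := eq_g_of_mem_gSet hxg hxl
          exact hP (.diagonal t a) ⟨ht, hrep, ha⟩ (hx0 ▸ ⟨rfl, trivial⟩) ⟨rfl, hdiag.1, rfl⟩
            ⟨rfl, hdiag.2, rfl⟩
        · intro h0
          have h1 := (hLK _ h0).1
          rw [map_sub, hquad.flat_corner, hquad.flat_corner] at h1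
          have h2 := mul_ne_zero hquad.pos.ne' hquad.add_ne
          cases α <;> cases β <;> cases α' <;> cases β' <;> simp at hdiag hne h1 <;>
            exact h2 (by linarith)
      · refine Or.inl ⟨fun h0 => (hwedge.1 h0).elim hne hdiag, ?_⟩
        rw [hdiff]
        by_cases hα : α = α'
        · subst hα
          rw [sub_self, zero_smul, zero_sub, ← neg_smul]
          exact hpq x hx hxl (hmem rfl) _
        · by_cases hβ : β = β'
          · subst hβ
            rw [sub_self, zero_smul, sub_zero]
            exact hpa x hx hxl (hmem' rfl) _
          · have key : ((if α' then f else 0) - if α then f else 0) • a' -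
                ((if β' then A else 0) - if β then A else 0) • q' =
                (if α' then (1 : ℝ) else -1) • (f • a' - A • q') := by
              cases α <;> cases β <;> cases α' <;> cases β' <;> simp at hdiag hα hβ ⊢
              module
            rw [key]
            exact hpd x hx hxl _)
    (fun z₁ h₁ z₂ h₂ z₃ h₃ h₁₂ h₁₃ h₂₃ P _ => not_cornerSet_three h₁ h₂ h₃ h₁₂ h₁₃ h₂₃)
    (by
      rintro _ ⟨⟨α₁, β₁⟩, rfl⟩ _ ⟨⟨α₂, β₂⟩, rfl⟩ _ ⟨⟨α₃, β₃⟩, rfl⟩ h₁₂ h₁₃ h₂₃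
      have e₁₂ : ¬ (α₁ = α₂ ∧ β₁ = β₂) := fun h => h₁₂ (by rw [h.1, h.2])
      have e₁₃ : ¬ (α₁ = α₃ ∧ β₁ = β₃) := fun h => h₁₃ (by rw [h.1, h.2])
      have e₂₃ : ¬ (α₂ = α₃ ∧ β₂ = β₃) := fun h => h₂₃ (by rw [h.1, h.2])
      refine ⟨?_, fun r s hrs => hquad.eq_zero_of_mem_ker e₁₂ e₁₃ e₂₃ (hLK _ hrs).1 (hLK _ hrs).2⟩
      by_contra hcon
      push Not at hcon
      have k1 := (hquad.mul_eq_iff α₁ β₁ α₂ β₂).1 hcon.1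
      have k2 := (hquad.mul_eq_iff α₁ β₁ α₃ β₃).1 hcon.2
      exact not_three_off_diagonal e₁₂ e₁₃ e₂₃ (k1.resolve_left e₁₂) (k2.resolve_left e₁₃))
    (by
      rintro P hP hPi hPf ⟨_, ⟨⟨α, β⟩, rfl⟩, hxP⟩ y
      have hlmem : ∀ x ∈ lSet t, ∀ a b : Fin (m + 3) → ℝ,
          v x ∈ Submodule.span ℝ (v '' lSet t) ⊔ Submodule.span ℝ {a, b} := fun x hx a b =>
        Submodule.mem_sup_left (Submodule.subset_span ⟨x, hx, rfl⟩)
      have hone : ∀ a b : Fin (m + 3) → ℝ, Submodule.span ℝ {a} ≤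
          Submodule.span ℝ (v '' lSet t) ⊔ Submodule.span ℝ {a, b} := fun a b =>
        (Submodule.span_mono (by simp)).trans le_sup_right
      rcases plane_of_mem_corner hPi hPf hxP with rfl | rfl | ⟨rfl, hαβ⟩
      · refine ⟨v (Sum.inl a), (A - f) • c - (if β then A else 0) • q' + y • v (Sum.inr (t, .g)),
          ?_, ?_⟩
        · rintro (e | ⟨t', s⟩) hx hxS
          · exact hone _ _ (h.represents.mem_span_of_parallel h.mem hx.symm)
          · obtain ⟨rfl, hx⟩ := hx
            cases s <;> simp only [Aux.OnRow] at hx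
            · exact hlmem _ ⟨_, rfl⟩ _ _
            · obtain ⟨rfl, rfl⟩ := hx; exact (hS _ _ hxS).elim
        · rintro _ hx ⟨⟨α', β'⟩, rfl⟩
          obtain ⟨-, hx, -⟩ := hx
          obtain rfl : β' = β := hx
          have : cornerVector A f c a' q' α' β' + y • v (Sum.inr (t, .g)) =
              (if α' then f else 0) • a' +
              ((A - f) • c - (if β' then A else 0) • q' + y • v (Sum.inr (t, .g))) := by
            simp only [cornerVector]; module
          change cornerVector A f c a' q' α' β' + y • v (Sum.inr (t, .g)) ∈ _
          rw [this]
          exact Submodule.add_mem _ (Submodule.smul_mem _ _ (hone _ _ ha')) (right_mem_sup_pair _ _)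
      · refine ⟨v (Sum.inr (t, .q (O.side t a))),
          (A - f) • c + (if α then f else 0) • a' + y • v (Sum.inr (t, .g)), ?_, ?_⟩
        · rintro (e | ⟨t', s⟩) hx hxS
          · exact hx.elim
          · obtain ⟨rfl, hx⟩ := hx
            cases s <;> simp only [Aux.OnColumn] at hx
            · exact hlmem _ ⟨_, rfl⟩ _ _
            · rw [hx]; exact hone _ _ (Submodule.mem_span_singleton_self _)
            · obtain ⟨rfl, rfl⟩ := hx; exact (hS _ _ hxS).elim
        · rintro _ hx ⟨⟨α', β'⟩, rfl⟩
          obtain ⟨-, hx, -⟩ := hx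
          obtain rfl : α' = α := hx
          have : cornerVector A f c a' q' α' β' + y • v (Sum.inr (t, .g)) =
              (-(if β' then A else 0)) • q' +
              ((A - f) • c + (if α' then f else 0) • a' + y • v (Sum.inr (t, .g))) := by
            simp only [cornerVector]; module
          change cornerVector A f c a' q' α' β' + y • v (Sum.inr (t, .g)) ∈ _
          rw [this]
          exact Submodule.add_mem _ (Submodule.smul_mem _ _ (hone _ _ hq')) (right_mem_sup_pair _ _)
      · refine ⟨v (Sum.inr (t, .g)), cornerVector A f c a' q' true false, ?_, ?_⟩
        · rintro (e | ⟨t', s⟩) hx hxS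
          · exact hx.elim
          · obtain ⟨rfl, hx⟩ := hx
            cases s <;> simp only [Aux.OnDiagonal] at hx
            · exact hlmem _ ⟨_, rfl⟩ _ _
            · exact hone _ _ (Submodule.mem_span_singleton_self _)
            · obtain ⟨_, rfl⟩ := hx; exact (hS _ _ hxS).elim
        · rintro _ hx ⟨⟨α', β'⟩, rfl⟩
          obtain ⟨-, hx, -⟩ := hx
          have hne : α' ≠ β' := hx
          have hg : v (Sum.inr (t, .g)) ∈ Submodule.span ℝ (v '' lSet t) ⊔
              Submodule.span ℝ {v (Sum.inr (t, .g)), cornerVector A f c a' q' true false} :=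
            hone _ _ (Submodule.mem_span_singleton_self _)
          refine Submodule.add_mem _ ?_ (Submodule.smul_mem _ _ hg)
          change cornerVector A f c a' q' α' β' ∈ _
          cases α' <;> cases β' <;> simp only [ne_eq, not_true_eq_false, reduceCtorEq] at hne
          · -- a combination of the two vertices is in both hyperplanes
            have hK : cornerVector A f c a' q' false true + (f / A) •
                cornerVector A f c a' q' true false ∈
                LinearMap.ker (tupleFunctional v t) ⊓ LinearMap.ker ψ := by
              have hA := hquad.ne_zero
              constructor <;>
                simp only [SetLike.mem_coe, LinearMap.mem_ker, map_add, map_smul,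
                  hquad.flat_corner, hquad.infinity_corner, smul_eq_mul] <;>
                simp <;> field_simp <;> ring
            have h1 := sup_le le_sup_left (hone _ (cornerVector A f c a' q' true false))
              (h.ker_inf_ker_le ht hG hK)
            exact (Submodule.add_mem_iff_left _ (Submodule.smul_mem _ _ (right_mem_sup_pair _ _))).1 h1
          · exact right_mem_sup_pair _ _)
  exact ⟨y, w, hwS, fun α β => hwD _ ⟨(α, β), rfl⟩, hw⟩

/-- The points `corner α β a` can be added for a single `a`. -/
theorem extend_corners (h : O.PartialRep ψ S v) (hsep : O.Separates ψ v) (ht : O.Canonical t)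
    (hG : gSet t ⊆ S) {a : Fin n} (ha : O.side t a ≠ 0) (hrep : O.rep a = a)
    (hc : Sum.inr (t, .c false) ∈ S) (hqS : ∀ σ, σ ≠ 0 → Sum.inr (t, .q σ) ∈ S)
    (hS : ∀ α β, Sum.inr (t, .corner α β a) ∉ S) {y : ℝ} (hy : 0 < y)
    (hq₁ : tupleFunctional v t (v (Sum.inr (t, .q 1))) = y * ψ (v (Sum.inr (t, .q 1))))
    (hq₂ : tupleFunctional v t (v (Sum.inr (t, .q (-1)))) = -y * ψ (v (Sum.inr (t, .q (-1)))))
    (hav : AvoidsAt ψ S v t y a) :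
    ∃ w, (∀ z ∈ S, w z = v z) ∧
      (∀ b, O.side t b ≠ 0 → ¬ O.Parallel a b → AvoidsAt ψ S v t y b →
        AvoidsAt ψ (S ∪ cornerSet t a) w t y b) ∧
      O.PartialRep ψ (S ∪ cornerSet t a) w := by
  set φ := tupleFunctional v t with hφ
  have hψa := hsep.pos a
  have hφa : φ (v (Sum.inl a)) ≠ 0 := fun h0 => ha ((h.flat_iff ht (h.mem a)).1 h0)
  have hψc : ψ (v (Sum.inr (t, .c false))) ≠ 0 := fun h0 => by
    have := (h.infinity _ hc).1 h0
    simp [planeSet, Aux.AtInfinity] at this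
  have hψq : ψ (v (Sum.inr (t, .q (O.side t a)))) ≠ 0 := fun h0 => by
    have := (h.infinity _ (hqS _ ha)).1 h0
    simp [planeSet, Aux.AtInfinity] at this
  have hφc : φ (v (Sum.inr (t, .c false))) = 0 :=
    (h.flat_iff ht hc).2 (by simp [planeSet, Aux.OnFlat])
  have hq : φ (v (Sum.inl a)) * φ (v (Sum.inr (t, .q (O.side t a)))) =
      |φ (v (Sum.inl a))| * y * ψ (v (Sum.inr (t, .q (O.side t a)))) := by
    have hs := hsep.sign t a
    rw [← hφ] at hs
    rcases lt_or_gt_of_ne hφa with h0 | h0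
    · rw [sign_neg h0] at hs
      rw [← hs, hq₂, abs_of_neg h0]; ring
    · rw [sign_pos h0] at hs
      rw [← hs, hq₁, abs_of_pos h0]; ring
  have hpos : 0 < |φ (v (Sum.inl a))| * y / ψ (v (Sum.inl a)) := by positivity
  -- the diagonal forces the square of the position of its vertices to be the product of the
  -- positions of `a` and `q`
  set f := Real.sqrt (|φ (v (Sum.inl a))| * y / ψ (v (Sum.inl a))) with hf
  have hf2 : f ^ 2 = |φ (v (Sum.inl a))| * y / ψ (v (Sum.inl a)) := Real.sq_sqrt hpos.le
  have hf3 : f ^ 2 * ψ (v (Sum.inl a)) = |φ (v (Sum.inl a))| * y := by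
    rw [hf2, div_mul_cancel₀ _ hψa.ne']
  have hf0 : 0 < f := Real.sqrt_pos.2 hpos
  have hav' : ∀ x ∈ S, x ∉ gSet t → φ (v x) ^ 2 ≠ f ^ 2 * ψ (v x) ^ 2 := by
    intro x hx hxg h0
    refine hav x hx hxg ?_
    rw [← hφ, h0, ← hf3]; ring
  have haG : (Sum.inl a : Elt m n) ∉ gSet t := by
    rintro (h | ⟨j, h⟩) <;> cases h
  have hquad : IsQuadrilateral φ ψ (φ (v (Sum.inl a)) / ψ (v (Sum.inl a))) f
      ((ψ (v (Sum.inr (t, .c false))))⁻¹ • v (Sum.inr (t, .c false)))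
      ((ψ (v (Sum.inl a)))⁻¹ • v (Sum.inl a))
      ((ψ (v (Sum.inr (t, .q (O.side t a)))))⁻¹ • v (Sum.inr (t, .q (O.side t a)))) := by
    refine ⟨hf0, div_ne_zero hφa hψa.ne', ?_, ?_, ?_, ?_, ?_, ?_, ?_⟩
    · intro h0
      refine hav' _ (h.mem a) haG ?_
      rw [h0]; field_simp
    · rw [map_smul, hφc, smul_zero]
    · rw [map_smul, smul_eq_mul]; field_simp
    · rw [map_smul, smul_eq_mul, hf2]
      field_simp
      linear_combination hq
    · rw [map_smul, smul_eq_mul, inv_mul_cancel₀ hψc]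
    · rw [map_smul, smul_eq_mul, inv_mul_cancel₀ hψa.ne']
    · rw [map_smul, smul_eq_mul, inv_mul_cancel₀ hψq]
  obtain ⟨y', w, hwS, hwD, hw⟩ := h.extend_cornerSet ht hG ha hrep (hqS _ ha) hS hquad
    (Submodule.smul_mem _ _ (Submodule.mem_span_singleton_self _))
    (Submodule.smul_mem _ _ (Submodule.mem_span_singleton_self _)) hav'
  refine ⟨w, hwS, fun b hb hab hbS x hx hxg => ?_, hw⟩
  have hφw : tupleFunctional w t = φ := tupleFunctional_congr (fun e => hwS _ (h.mem e)) t
  rw [hφw, hwS _ (h.mem b)]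
  rcases hx with hx | ⟨⟨α, β⟩, rfl⟩
  · rw [hwS x hx]; exact hbS x hx hxg
  · obtain ⟨s, hs, l, hl, hwx⟩ := hwD α β
    have hlK := h.span_lSet_le ht hG
      (Submodule.span_mono (Set.image_mono (Set.subset_insert _ _)) hl)
    have hgK := h.span_lSet_le ht hG (Submodule.subset_span ⟨_, Set.mem_insert _ _, rfl⟩)
    have hl1 : φ l = 0 := hlK.1
    have hl2 : ψ l = 0 := hlK.2
    have hg1 : φ (v (Sum.inr (t, .g))) = 0 := hgK.1
    have hg2 : ψ (v (Sum.inr (t, .g))) = 0 := hgK.2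
    have hφb : φ (v (Sum.inl b)) ≠ 0 := fun h0 => hb ((h.flat_iff ht (h.mem b)).1 h0)
    have hψb := hsep.pos b
    change φ (w (Sum.inr (t, .corner α β a))) ^ 2 * _ ≠
      _ * ψ (w (Sum.inr (t, .corner α β a))) ^ 2
    rw [hwx]
    simp only [map_add, map_smul, hl1, hl2, hg1, hg2, smul_eq_mul, mul_zero, add_zero]
    have k1 := hquad.flat_corner_eq_zero_iff α β
    have k2 := hquad.infinity_corner_eq_zero_iff α β
    have k3 := hquad.flat_eq_mul (α := α) (β := β)
    generalize cornerVector (φ (v (Sum.inl a)) / ψ (v (Sum.inl a))) f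
      ((ψ (v (Sum.inr (t, .c false))))⁻¹ • v (Sum.inr (t, .c false)))
      ((ψ (v (Sum.inl a)))⁻¹ • v (Sum.inl a))
      ((ψ (v (Sum.inr (t, .q (O.side t a)))))⁻¹ • v (Sum.inr (t, .q (O.side t a)))) α β = D
      at k1 k2 k3 ⊢
    by_cases hαβ : α = β
    · subst hαβ
      have h1 := k1
      have h2 := k2
      cases α
      · have h1 := h1.2 ⟨rfl, rfl⟩
        have h2 : _ ≠ _ := fun h0 => Bool.false_ne_true (h2.1 h0).1
        rw [h1]
        simp [hs, h2, hφb, hy.ne']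
      · have h2 := h2.2 ⟨rfl, rfl⟩
        have h1 : _ ≠ _ := fun h0 => Bool.false_ne_true (h1.1 h0).1.symm
        rw [h2]
        simp [hs, h1, hψb.ne']
    · have h0 : ψ D ≠ 0 := fun h0 => hαβ ((k2.1 h0).1.trans (k2.1 h0).2.symm)
      rw [k3 hαβ]
      intro h1
      refine hsep.ne t ht a b ha hb hab ?_
      have h2 : (s * ψ D) ^ 2 * (f ^ 2 * ψ (v (Sum.inl b))) =
        (s * ψ D) ^ 2 * (|φ (v (Sum.inl b))| * y) := by
        linear_combination h1
      have h3 := mul_left_cancel₀ (pow_ne_zero 2 (mul_ne_zero hs h0)) h2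
      have h4 : y * (|φ (v (Sum.inl a))| * ψ (v (Sum.inl b))) =
          y * (|φ (v (Sum.inl b))| * ψ (v (Sum.inl a))) := by
        linear_combination ψ (v (Sum.inl a)) * h3 - ψ (v (Sum.inl b)) * hf3
      have h5 := mul_left_cancel₀ hy.ne' h4
      rw [← hφ, mul_pow, mul_pow, ← sq_abs (φ _), ← sq_abs (φ (v (Sum.inl b))), ← mul_pow,
        ← mul_pow, h5]

end PartialRep

end AbstractOrderType

/-! ### Every realization extends -/

namespace AbstractOrderType

variable {m n : ℕ} {O : AbstractOrderType (m + 2) n}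

/-- The auxiliary elements of a canonical tuple that are subject to constraints other than those of
its hyperplane and the hyperplane at infinity. -/
def blockSet (O : AbstractOrderType (m + 2) n) (t : Fin (m + 2) → Fin n) : Set (Elt m n) :=
  {x | ∃ s : Aux m n, x = Sum.inr (t, s) ∧ ((∃ b, s = .c b) ∨ (∃ b, s = .i b) ∨
    (∃ σ, σ ≠ 0 ∧ s = .q σ) ∨ ∃ α β a, O.rep a = a ∧ O.side t a ≠ 0 ∧ s = .corner α β a)}

namespace PartialRep

variable {ψ : (Fin (m + 3) → ℝ) →ₗ[ℝ] ℝ} {S : Set (Elt m n)} {v : Elt m n → Fin (m + 3) → ℝ}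
  {t : Fin (m + 2) → Fin n}

theorem extend_all_corners (h : O.PartialRep ψ S v) (hsep : O.Separates ψ v) (ht : O.Canonical t)
    (hG : gSet t ⊆ S) (hc : Sum.inr (t, .c false) ∈ S) (hqS : ∀ σ, σ ≠ 0 → Sum.inr (t, .q σ) ∈ S)
    (hS : ∀ α β a, Sum.inr (t, .corner α β a) ∉ S) {y : ℝ} (hy : 0 < y)
    (hq₁ : tupleFunctional v t (v (Sum.inr (t, .q 1))) = y * ψ (v (Sum.inr (t, .q 1))))
    (hq₂ : tupleFunctional v t (v (Sum.inr (t, .q (-1)))) = -y * ψ (v (Sum.inr (t, .q (-1)))))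
    (hav : ∀ a, O.side t a ≠ 0 → AvoidsAt ψ S v t y a) (B : Finset (Fin n))
    (hB : ∀ a ∈ B, O.rep a = a ∧ O.side t a ≠ 0) :
    ∃ w, (∀ z ∈ S, w z = v z) ∧
      (∀ b, O.side t b ≠ 0 → O.rep b = b → b ∉ B →
        AvoidsAt ψ (S ∪ ⋃ a ∈ B, cornerSet t a) w t y b) ∧
      O.PartialRep ψ (S ∪ ⋃ a ∈ B, cornerSet t a) w := by
  classical
  induction B using Finset.induction_on with
  | empty => exact ⟨v, fun _ _ => rfl, by simpa using fun b hb _ => hav b hb, by simpa using h⟩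
  | insert a B haB ih =>
    obtain ⟨w, hwS, hwav, hw⟩ := ih fun a ha => hB a (Finset.mem_insert_of_mem ha)
    obtain ⟨hrep, ha⟩ := hB a (Finset.mem_insert_self _ _)
    have hE : ∀ e, w (Sum.inl e) = v (Sum.inl e) := fun e => hwS _ (h.mem e)
    obtain ⟨w', hw'S, hw'av, hw'⟩ := hw.extend_corners (hsep.congr hE) ht
      (hG.trans Set.subset_union_left) ha hrep (Or.inl hc) (fun σ hσ => Or.inl (hqS σ hσ)) (by
        rintro α β (hx | hx)
        · exact hS _ _ _ hx
        · simp only [Set.mem_iUnion] at hx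
          obtain ⟨b, hb, ⟨p, hp⟩⟩ := hx
          simp only [Sum.inr.injEq, Prod.mk.injEq, Aux.corner.injEq, true_and] at hp
          exact haB (hp.2.2 ▸ hb)) hy
      (by rw [tupleFunctional_congr hE, hwS _ (hqS 1 (by decide))]; exact hq₁)
      (by rw [tupleFunctional_congr hE, hwS _ (hqS (-1) (by decide))]; exact hq₂)
      (hwav a ha hrep haB)
    have hset : S ∪ ⋃ b ∈ insert a B, cornerSet (m := m) t b =
        (S ∪ ⋃ b ∈ B, cornerSet t b) ∪ cornerSet t a := by
      rw [Finset.set_biUnion_insert, Set.union_comm (cornerSet t a), Set.union_assoc]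
    rw [hset]
    refine ⟨w', fun z hz => (hw'S z (Or.inl hz)).trans (hwS z hz), fun b hb hbr hbB => ?_, hw'⟩
    have hba : b ≠ a := fun e => hbB (e ▸ Finset.mem_insert_self _ _)
    refine hw'av b hb (fun hpar => hba ?_) (hwav b hb hbr fun hb => hbB (Finset.mem_insert_of_mem hb))
    rw [← hbr, ← hrep, O.rep_eq_of_parallel hpar]

theorem extend_block (h : O.PartialRep ψ S v) (hsep : O.Separates ψ v) (ht : O.Canonical t)
    (hG : gSet t ⊆ S) (hSt : ∀ s, Sum.inr (t, s) ∈ S → Sum.inr (t, s) ∈ gSet t) :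
    ∃ w, (∀ z ∈ S, w z = v z) ∧ O.PartialRep ψ (S ∪ O.blockSet t) w := by
  classical
  obtain ⟨y, hy, v₁, hv₁, hq, hav, hav', h₁⟩ := h.exists_q hsep ht hG hSt
  have hG₁ : gSet t ⊆ insert (Sum.inr (t, .q 1)) (insert (Sum.inr (t, .i false))
      (insert (Sum.inr (t, .c false)) S)) := hG.trans fun x hx => Or.inr (Or.inr (Or.inr hx))
  obtain ⟨v₂, hv₂, hq₁, hq₂, hav₂, h₂⟩ := h₁.extend_harmonic ht hG₁
    (Or.inr (Or.inr (Or.inl rfl))) (Or.inr (Or.inl rfl)) (Or.inl rfl) (by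
      rintro s (hs | hs | hs | hs)
      · simp only [Sum.inr.injEq, Prod.mk.injEq, true_and] at hs; simp [hs]
      · simp only [Sum.inr.injEq, Prod.mk.injEq, true_and] at hs; simp [hs]
      · simp only [Sum.inr.injEq, Prod.mk.injEq, true_and] at hs; simp [hs]
      · exact Or.inl (hSt s hs)) hy hq hav hav'
  have hE₁ : ∀ e, v₁ (Sum.inl e) = v (Sum.inl e) := fun e => hv₁ _ (h.mem e)
  have hE₂ : ∀ e, v₂ (Sum.inl e) = v₁ (Sum.inl e) := fun e => hv₂ _ (h₁.mem e)
  obtain ⟨w, hw, -, h₃⟩ := h₂.extend_all_corners ((hsep.congr hE₁).congr hE₂) ht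
    (hG₁.trans Set.subset_union_left) (by simp) (by
      intro σ hσ
      rcases σ with _ | _ | _
      · exact (hσ rfl).elim
      · exact Or.inr (by simp [SignType.neg_eq_neg_one])
      · exact Or.inl (Or.inl rfl)) (by
      rintro α β a ((hs | hs | hs | hs) | hs)
      · simp at hs
      · simp at hs
      · simp at hs
      · rcases hSt _ hs with hs | ⟨j, hs⟩ <;> simp at hs
      · simp at hs) hy hq₁ hq₂ hav₂ (Finset.univ.filter fun a => O.rep a = a ∧ O.side t a ≠ 0)
      (by simp)
  refine ⟨w, fun z hz => ?_, ?_⟩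
  · rw [hw z (by simp [hz]), hv₂ z (by simp [hz]), hv₁ z hz]
  · convert h₃ using 1
    ext x
    simp only [Set.mem_union, Set.mem_insert_iff, Set.mem_singleton_iff, Set.mem_iUnion,
      Finset.mem_filter, Finset.mem_univ, true_and, blockSet, Set.mem_ofPred_eq, cornerSet,
      Set.mem_range, Prod.exists]
    constructor
    · rintro (hx | ⟨s, rfl, ⟨b, rfl⟩ | ⟨b, rfl⟩ | ⟨σ, hσ, rfl⟩ | ⟨α, β, a, h1, h2, rfl⟩⟩)
      · simp [hx]
      · cases b <;> simp
      · cases b <;> simp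
      · rcases σ with _ | _ | _
        · exact (hσ rfl).elim
        · simp [SignType.neg_eq_neg_one]
        · simp [SignType.pos_eq_one]
      · exact Or.inr ⟨a, ⟨h1, h2⟩, α, β, rfl⟩
    · rintro (((rfl | rfl | rfl | hx) | rfl | rfl | rfl) | ⟨a, ⟨h1, h2⟩, α, β, rfl⟩)
      · exact Or.inr ⟨_, rfl, by simp⟩
      · exact Or.inr ⟨_, rfl, by simp⟩
      · exact Or.inr ⟨_, rfl, by simp⟩
      · exact Or.inl hx
      · exact Or.inr ⟨_, rfl, by simp⟩
      · exact Or.inr ⟨_, rfl, by simp⟩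
      · exact Or.inr ⟨_, rfl, by simp⟩
      · exact Or.inr ⟨_, rfl, Or.inr (Or.inr (Or.inr ⟨α, β, a, h1, h2, rfl⟩))⟩

/-- The blocks are added one after the other: the planes of a block contain no auxiliary elements
of other blocks. -/
theorem extend_blocks (h : O.PartialRep ψ O.baseSet v) (hsep : O.Separates ψ v)
    (A : Finset (Fin (m + 2) → Fin n)) (hA : ∀ t ∈ A, O.Canonical t) :
    ∃ w, (∀ e, w (Sum.inl e) = v (Sum.inl e)) ∧
      O.PartialRep ψ (O.baseSet ∪ ⋃ t ∈ A, O.blockSet t) w := by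
  classical
  induction A using Finset.induction_on with
  | empty => exact ⟨v, fun _ => rfl, by simpa using h⟩
  | insert t A htA ih =>
    obtain ⟨w, hwE, hw⟩ := ih fun t ht => hA t (Finset.mem_insert_of_mem ht)
    have ht := hA t (Finset.mem_insert_self _ _)
    obtain ⟨w', hw'S, hw'⟩ := hw.extend_block (hsep.congr hwE) ht
      (fun x hx => Or.inl (Or.inr (Set.mem_biUnion (show t ∈ {t | O.Canonical t} from ht) hx))) (by
        rintro s ((⟨e, hs⟩ | hs) | hs)
        · cases hs
        · simp only [Set.mem_iUnion] at hs
          obtain ⟨t', _, hs⟩ := hs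
          have htt : t = t' := by
            rcases hs with hs | ⟨j, hs⟩ <;> simp only [Sum.inr.injEq, Prod.mk.injEq] at hs
            exacts [hs.1, hs.1.symm]
          rw [htt] at hs ⊢
          exact hs
        · simp only [Set.mem_iUnion] at hs
          obtain ⟨t', ht', s', hs, -⟩ := hs
          simp only [Sum.inr.injEq, Prod.mk.injEq] at hs
          exact (htA (hs.1 ▸ ht')).elim)
    refine ⟨w', fun e => (hw'S _ (hw.mem e)).trans (hwE e), ?_⟩
    rwa [Finset.set_biUnion_insert, Set.union_comm (O.blockSet t), ← Set.union_assoc]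

/-- Unused elements, like `q 0`, lie on no prescribed hyperplanes except flats and the infinite
one. -/
theorem eq_of_notMem {P : Plane m n} (hP : O.PlaneValid P) {x : Elt m n} (hxP : x ∈ O.planeSet P)
    (hx : x ∉ O.baseSet ∪ ⋃ t ∈ {t | O.Canonical t}, O.blockSet t) :
    P = .infinity ∨ ∃ t, P = .flat t := by
  have hb : ∀ t, O.Canonical t → x ∉ O.blockSet t := fun t ht hxt =>
    hx (Or.inr (Set.mem_biUnion (show t ∈ {t | O.Canonical t} from ht) hxt))
  have hg : ∀ t, O.Canonical t → x ∉ gSet t := fun t ht hxt =>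
    hx (Or.inl (Or.inr (Set.mem_biUnion (show t ∈ {t | O.Canonical t} from ht) hxt)))
  rcases x with e | ⟨t', s⟩
  · exact (hx (Or.inl (Or.inl ⟨e, rfl⟩))).elim
  cases P with
  | infinity => exact Or.inl rfl
  | flat t => exact Or.inr ⟨t, rfl⟩
  | harmonic t b b' =>
    exfalso
    obtain ⟨rfl, hs⟩ := hxP
    cases s <;> simp only [Aux.OnHarmonic] at hs
    · exact hg _ hP (Or.inr ⟨_, rfl⟩)
    · exact hb _ hP ⟨_, rfl, by simp⟩
    · exact hb _ hP ⟨_, rfl, by simp⟩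
    · refine hb _ hP ⟨_, rfl, Or.inr (Or.inr (Or.inl ⟨_, ?_, rfl⟩))⟩
      rw [hs]; split_ifs <;> decide
  | row t a β =>
    exfalso
    obtain ⟨rfl, hs⟩ := hxP
    cases s <;> simp only [Aux.OnRow] at hs
    · exact hg _ hP.1 (Or.inr ⟨_, rfl⟩)
    · exact hb _ hP.1 ⟨_, rfl, Or.inr (Or.inr (Or.inr ⟨_, _, a, hP.2.1, hP.2.2, by rw [hs.2]⟩))⟩
  | column t a α =>
    exfalso
    obtain ⟨rfl, hs⟩ := hxP
    cases s <;> simp only [Aux.OnColumn] at hs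
    · exact hg _ hP.1 (Or.inr ⟨_, rfl⟩)
    · exact hb _ hP.1 ⟨_, rfl, Or.inr (Or.inr (Or.inl ⟨_, hs ▸ hP.2.2, rfl⟩))⟩
    · exact hb _ hP.1 ⟨_, rfl, Or.inr (Or.inr (Or.inr ⟨_, _, a, hP.2.1, hP.2.2, by rw [hs.2]⟩))⟩
  | diagonal t a =>
    exfalso
    obtain ⟨rfl, hs⟩ := hxP
    cases s <;> simp only [Aux.OnDiagonal] at hs
    · exact hg _ hP.1 (Or.inr ⟨_, rfl⟩)
    · exact hg _ hP.1 (Or.inl rfl)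
    · exact hb _ hP.1 ⟨_, rfl, Or.inr (Or.inr (Or.inr ⟨_, _, a, hP.2.1, hP.2.2, by rw [hs.2]⟩))⟩

/-- The elements that are not used by any block are represented generically. -/
theorem extend_rest (h : O.PartialRep ψ (O.baseSet ∪ ⋃ t ∈ {t | O.Canonical t}, O.blockSet t) v)
    (X : Finset (Elt m n)) :
    ∃ w, (∀ e, w (Sum.inl e) = v (Sum.inl e)) ∧
      O.PartialRep ψ ((O.baseSet ∪ ⋃ t ∈ {t | O.Canonical t}, O.blockSet t) ∪ X) w := by
  classical
  set F := O.baseSet ∪ ⋃ t ∈ {t | O.Canonical t}, O.blockSet t with hF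
  induction X using Finset.induction_on with
  | empty => exact ⟨v, fun _ => rfl, by simpa using h⟩
  | insert x X hxX ih =>
    obtain ⟨w, hwE, hw⟩ := ih
    rw [Finset.coe_insert, Set.union_insert]
    by_cases hxF : x ∈ F
    · exact ⟨w, hwE, by rwa [Set.insert_eq_of_mem (s := F ∪ X) (Or.inl hxF)]⟩
    have hx : x ∉ F ∪ X := by simp [hxF, hxX]
    have hplane := fun P hP hxP => eq_of_notMem (P := P) hP hxP hxF
    have hnot : x ∈ O.planeSet .infinity → ∀ t, O.Canonical t → x ∉ O.planeSet (.flat t) :=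
      fun h1 t ht h2 => hxF (Or.inl (Or.inr (Set.mem_biUnion
        (show t ∈ {t | O.Canonical t} from ht) (mem_gSet_of_mem_planes h2 h1))))
    obtain ⟨w', hw'S, hw'⟩ : ∃ w', (∀ z ∈ F ∪ X, w' z = w z) ∧
        O.PartialRep ψ (insert x (F ∪ X)) w' := by
      by_cases hxi : x ∈ O.planeSet .infinity
      · refine hw.extend_infinity hx hxi fun P hP hPi _ hxP => ?_
        rcases hplane P hP hxP with rfl | ⟨t, rfl⟩
        · exact (hPi rfl).elim
        · exact (hnot hxi t hP hxP).elim
      by_cases hxf : ∃ t, O.Canonical t ∧ x ∈ O.planeSet (.flat t)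
      · obtain ⟨t, ht, hxt⟩ := hxf
        refine hw.extend_flat hx hxi ht hxt fun P hP hPi hPt hxP => ?_
        rcases hplane P hP hxP with rfl | ⟨t', rfl⟩
        · exact (hPi rfl).elim
        · rcases x with e | p
          · exact (hxF (Or.inl (Or.inl ⟨e, rfl⟩))).elim
          · exact (hPt (congrArg Plane.flat (hxP.1.symm.trans hxt.1))).elim
      · refine hw.extend_free hx fun P hP hxP => ?_
        rcases hplane P hP hxP with rfl | ⟨t', rfl⟩
        · exact hxi hxP
        · exact hxf ⟨t', hP, hxP⟩
    exact ⟨w', fun e => (hw'S _ (hw.mem e)).trans (hwE e), hw'⟩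

end PartialRep

/-- Every realization extends to a representation of the simulating matroid. The hyperplane at
infinity of the matroid is represented by a generic hyperplane, not by that of the coordinates. -/
theorem Realizes.exists_representsOn {p : Fin n → Fin (m + 2) → ℝ} (hp : O.Realizes p) :
    ∃ v, O.RepresentsOn Set.univ v ∧ ∀ e, v (Sum.inl e) = homogenize (p e) := by
  classical
  obtain ⟨ψ, v, hv, hsep, h⟩ := hp.exists_baseSet
  obtain ⟨w, hwE, hw⟩ := h.extend_blocks hsep (Finset.univ.filter fun t => O.Canonical t) (by simp)
  have hset : (⋃ t ∈ Finset.univ.filter fun t => O.Canonical t, O.blockSet t) =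
      ⋃ t ∈ {t | O.Canonical t}, O.blockSet t := by
    ext x; simp
  rw [hset] at hw
  obtain ⟨u, huE, hu⟩ := hw.extend_rest (Set.toFinite Set.univ).toFinset
  refine ⟨u, ?_, fun e => (huE e).trans ((hwE e).trans (hv e))⟩
  have := hu.represents
  rwa [Set.Finite.coe_toFinset, Set.union_univ] at this

end AbstractOrderType

/-! ### The rank and the hyperplane at infinity of the simulating matroid -/

namespace AbstractOrderType

variable {m n : ℕ} (O : AbstractOrderType (m + 2) n)

theorem linearIndepOn_comp_iff_image {α β V : Type*} [AddCommGroup V] [Module ℝ V] {f : α → β}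
    (hf : f.Injective) (v : β → V) (I : Set α) :
    LinearIndepOn ℝ (v ∘ f) I ↔ LinearIndepOn ℝ v (f '' I) :=
  ⟨fun h => h.image_of_comp f v, fun h => h.comp_of_image hf.injOn⟩

theorem eRank_simulation : O.simulation.eRank = ((m + 2 : ℕ) : ℕ∞) + 1 := by
  obtain ⟨x, hx⟩ := O.nonzero
  have hb := (O.isBase_iff _).2 ⟨x, hx, rfl⟩
  have hi := (O.simulation_indep_image _).2 hb.indep
  have hc : (Sum.inl '' Set.range x : Set (Elt m n)).ncard = m + 3 := by
    rw [Set.ncard_image_of_injective _ Sum.inl_injective, O.ncard_of_isBase hb]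
  have he : (Sum.inl '' Set.range x : Set (Elt m n)).encard = ((m + 2 : ℕ) : ℕ∞) + 1 := by
    rw [← (Set.toFinite _).cast_ncard_eq, hc]; rfl
  obtain ⟨B, hB⟩ := O.simulation.exists_isBase
  apply le_antisymm
  · rw [← hB.encard_eq_eRank, ← (Set.toFinite B).cast_ncard_eq]
    exact_mod_cast ((O.simulation_indep_iff _).1 hB.indep).2.1
  · rw [← he, ← hi.eRk_eq_encard]
    exact O.simulation.eRk_le_eRank _

theorem exists_isBasis_infinity : ∃ I, O.simulation.IsBasis I (O.planeSet .infinity) ∧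
    I.ncard = m + 2 ∧ O.simulation.closure I ⊆ O.planeSet .infinity := by
  let t : Fin (m + 2) → Fin n := fun i => O.nonzero.choose i.castSucc
  let I : Set (Elt m n) := insert (Sum.inr (t, .i false)) (gSet t)
  have hIH : I ⊆ O.planeSet .infinity := by
    rintro x (rfl | rfl | ⟨j, rfl⟩) <;> simp [planeSet, Aux.AtInfinity]
  have hIc : I.ncard = m + 2 := by
    rw [Set.ncard_insert_of_notMem, ncard_gSet]
    rintro (h | ⟨j, h⟩) <;> simp at h
  have hpre : (Sum.inl ⁻¹' I : Set (Fin n)) = ∅ :=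
    Set.eq_empty_of_forall_notMem fun e he => (hIH he).elim
  have hI : O.simulation.Indep I := by
    rw [O.simulation_indep_iff_of_ncard_lt (by omega), hpre]
    exact O.matroid.empty_indep
  have hcl : O.simulation.closure I ⊆ O.planeSet .infinity := by
    intro x hx
    by_contra hxH
    have hxI : x ∉ I := fun h => hxH (hIH h)
    refine (hI.notMem_closure_iff (e := x) (Set.mem_univ _)).2 ⟨?_, hxI⟩ hx
    rw [simulation_indep_iff, Set.ncard_insert_of_notMem hxI, hIc]
    refine ⟨O.indep_of_subsingleton ?_, le_rfl, fun P hP hIP => ?_⟩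
    · have : (Sum.inl ⁻¹' insert x I : Set (Fin n)) ⊆ {e | Sum.inl e = x} := fun e he =>
        he.resolve_right fun h => hIH h
      exact Set.Subsingleton.anti (fun a ha b hb => Sum.inl_injective
        ((show Sum.inl a = x from ha).trans (show Sum.inl b = x from hb).symm)) this
    · have := O.planes_unique ⟨P, hP⟩ ⟨.infinity, trivial⟩ I
        (by rw [hpre]; exact O.matroid.empty_indep) (by omega)
        ((Set.subset_insert _ _).trans hIP) hIH
      have hxP : x ∈ O.planes ⟨P, hP⟩ := hIP (Set.mem_insert _ _)
      rw [this] at hxP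
      exact (hxH hxP).elim
  refine ⟨I, ?_, hIc, hcl⟩
  refine hI.isBasis_of_maximal_subset hIH (fun J hJ hIJ hJH => ?_) (Set.subset_univ _)
  have h1 := ((O.simulation_indep_iff _).1 hJ).2.2 .infinity trivial hJH
  have h2 := Set.eq_of_subset_of_ncard_le hIJ (by omega) (Set.toFinite _)
  rw [h2]

theorem isFlat_infinity : O.simulation.IsFlat (O.planeSet .infinity) := by
  obtain ⟨I, hI, -, hcl⟩ := O.exists_isBasis_infinity
  rw [Matroid.isFlat_iff_closure_eq, ← hI.closure_eq_closure]
  refine hcl.antisymm ?_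
  rw [hI.closure_eq_closure]
  exact O.simulation.subset_closure _ (Set.subset_univ _)

theorem eRk_infinity : O.simulation.eRk (O.planeSet .infinity) = ((m + 2 : ℕ) : ℕ∞) := by
  obtain ⟨I, hI, hc, -⟩ := O.exists_isBasis_infinity
  rw [← hI.encard_eq_eRk, ← (Set.toFinite I).cast_ncard_eq, hc]

/-- The simulating matroid simulates the order type, also after its elements are numbered so that the
elements of the order type come first. -/
theorem simulates {N : ℕ} (f : Elt m n ≃ Fin N) (hn : n ≤ N)
    (hf : ∀ e : Fin n, f (Sum.inl e) = Fin.castLE hn e) :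
    Simulates (O.simulation.mapEquiv f) (f '' O.planeSet .infinity) (Fin.castLEEmb hn) O where
  ground := by
    rw [Matroid.mapEquiv_ground_eq, simulation_ground, Set.image_univ, f.range_eq_univ]
  rank := by
    rw [Matroid.mapEquiv_eq_map, Matroid.eRank_map]; exact O.eRank_simulation
  isFlat := by
    have hfl := O.isFlat_infinity
    refine ⟨fun I X hI hX => ?_, ?_⟩
    · rw [Matroid.mapEquiv_isBasis_iff] at hI hX
      rw [Equiv.symm_image_image] at hI
      have := hfl.1 hI hX
      rwa [← Equiv.subset_symm_image, Equiv.symm_symm] at this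
    · rw [Matroid.mapEquiv_ground_eq]
      exact Set.image_mono hfl.2
  rank_infinity := by
    rw [Matroid.mapEquiv_eq_map, Matroid.eRk_map _ _ (Set.subset_univ _)]; exact O.eRk_infinity
  finite e := by
    rintro ⟨x, hx, he⟩
    have : x = Sum.inl e := f.injective (he.trans (hf e).symm)
    subst this
    exact hx
  restricts := by
    refine Matroid.ext_indep ?_ fun I _ => ?_
    · rw [Matroid.comap_ground_eq, Matroid.mapEquiv_ground_eq, simulation_ground, Set.image_univ,
        f.range_eq_univ]
      rfl
    · rw [Matroid.comap_indep_iff, Matroid.mapEquiv_indep_iff]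
      have : f.symm '' (Fin.castLEEmb hn '' I) = Sum.inl '' I := by
        rw [← f.symm_image_image (Sum.inl '' I), Set.image_image f]
        simp [hf]
      rw [this, simulation_indep_image]
      exact and_iff_left (Fin.castLEEmb hn).injective.injOn
  extends_realization p hp := by
    obtain ⟨v, hv, hvE⟩ := hp.exists_representsOn
    refine ⟨v ∘ f.symm, fun I => ?_, fun e => ?_⟩
    · rw [Matroid.mapEquiv_indep_iff, hv _ (Set.subset_univ _), linearIndepOn_comp_iff_image f.symm.injective]
    · rw [← hvE e]
      change v (f.symm (Fin.castLE hn e)) = _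
      rw [← hf, f.symm_apply_apply]
  induces_realization v hv := by
    have h1 : O.RepresentsOn Set.univ (v ∘ f) := by
      intro I _
      have := hv.1 (f '' I)
      rw [Matroid.mapEquiv_indep_iff, Equiv.symm_image_image] at this
      rw [this, linearIndepOn_comp_iff_image f.injective]
    have h2 := O.realizesUpToReflection h1 fun x =>
      (hv.2 (f x)).trans (f.injective.mem_set_image)
    have h3 : (fun e => dehomogenize ((v ∘ f) (Sum.inl e))) =
        fun e => dehomogenize (v (Fin.castLEEmb hn e)) := by
      funext e
      simp [hf]
    rwa [h3] at h2

end AbstractOrderType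

/-! ### A programming language for the random access machine -/

namespace RAM

/-- Arithmetic expressions over an environment of variables (given by their positions in a list), the
number `size` and a memory. -/
inductive Expr where
  | const (c : ℕ)
  | var (i : ℕ)
  | size
  | read (e : Expr)
  | add (e e' : Expr)
  | sub (e e' : Expr)
  | mul (e e' : Expr)
  /-- the sum of `e` over all values less than `size` of a new variable -/
  | sum (e : Expr)
  /-- the least value less than `size` of a new variable for which `e` is not zero -/
  | find (e : Expr)

/-- The least `x < c` with `f x ≠ 0`, or `a` if there is none. -/
def findBelow (f : ℕ → ℕ) : ℕ → ℕ → ℕ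
  | 0, a => a
  | c + 1, a => findBelow f c (if f c ≠ 0 then c else a)

/-- The list of all numbers less than `c`, in descending order. -/
def down : ℕ → List ℕ
  | 0 => []
  | c + 1 => c :: down c

namespace Expr

/-- The value of an expression. -/
def eval (n : ℕ) (μ : ℕ → ℕ) : Expr → List ℕ → ℕ
  | const c, _ => c
  | var i, ε => ε.getD i 0
  | size, _ => n
  | read e, ε => μ (e.eval n μ ε)
  | add e e', ε => e.eval n μ ε + e'.eval n μ ε
  | sub e e', ε => e.eval n μ ε - e'.eval n μ ε
  | mul e e', ε => e.eval n μ ε * e'.eval n μ ε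
  | sum e, ε => ∑ x ∈ Finset.range n, e.eval n μ (x :: ε)
  | find e, ε => findBelow (fun x => e.eval n μ (x :: ε)) n 0

/-- Put register `s` into register `r` (where register `r` is not register `s`). -/
def _root_.RAM.copy (r s : ℕ) : RAM := seq (.const r 0) (.add r r s)

/-- A program that evaluates an expression. The variables are in the registers `ρ`, the number `size`
is in register `0`, and register `1` contains `1`. The result is put into register `r`, and only
registers from `r` on are changed. -/
def compile : Expr → List ℕ → ℕ → RAM
  | const c, _, r => .const r c
  | var i, ρ, r => if i < ρ.length then copy r (ρ.getD i 0) else .const r 0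
  | size, _, r => copy r 0
  | read e, ρ, r => .seq (e.compile ρ r) (.load r r)
  | add e e', ρ, r => .seq (e.compile ρ r) (.seq (e'.compile ρ (r + 1)) (.add r r (r + 1)))
  | sub e e', ρ, r => .seq (e.compile ρ r) (.seq (e'.compile ρ (r + 1)) (.sub r r (r + 1)))
  | mul e e', ρ, r => .seq (e.compile ρ r) (.seq (e'.compile ρ (r + 1)) (.mul r r (r + 1)))
  | sum e, ρ, r => .seq (.const r 0) (.seq (copy (r + 1) 0) (.whileNonzero (r + 1)
      (.seq (.sub (r + 1) (r + 1) 1) (.seq (e.compile ((r + 1) :: ρ) (r + 2)) (.add r r (r + 2))))))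
  | find e, ρ, r => .seq (.const r 0) (.seq (copy (r + 1) 0) (.whileNonzero (r + 1)
      (.seq (.sub (r + 1) (r + 1) 1) (.seq (e.compile ((r + 1) :: ρ) (r + 2))
        (.ifNonzero (r + 2) (copy r (r + 1)) .skip)))))

/-- The number of nested loops. -/
def depth : Expr → ℕ
  | const _ | var _ | size => 0
  | read e => e.depth
  | add e e' | sub e e' | mul e e' => max e.depth e'.depth
  | sum e | find e => e.depth + 1

/-- The factor in the bound `factor * n ^ depth` for the number of steps. -/
def factor : Expr → ℕ
  | const _ => 1
  | var _ | size => 2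
  | read e => e.factor + 1
  | add e e' | sub e e' | mul e e' => e.factor + e'.factor + 1
  | sum e | find e => e.factor + 9

/-- The exponent in a bound for all numbers that are computed. -/
def degree : Expr → ℕ
  | const c => c
  | var _ | size => 1
  | read e => e.degree + 1
  | add e e' => e.degree + e'.degree + 1
  | sub e e' | mul e e' => e.degree + e'.degree
  | sum e | find e => e.degree + 1

end Expr

theorem findBelow_le {f : ℕ → ℕ} {c a b : ℕ} (ha : a ≤ b) (hc : c ≤ b) : findBelow f c a ≤ b := by
  induction c generalizing a with
  | zero => exact ha
  | succ c ih => exact ih (by split_ifs <;> omega) (by omega)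

theorem findBelow_eq_of_forall {f : ℕ → ℕ} {c a : ℕ} (h : ∀ x < c, f x = 0) : findBelow f c a = a := by
  induction c with
  | zero => rfl
  | succ c ih => simp [findBelow, h c, ih fun x hx => h x (by omega)]

theorem findBelow_eq {f : ℕ → ℕ} {c a b : ℕ} (hb : b < c) (hf : f b ≠ 0) (h : ∀ x < b, f x = 0) :
    findBelow f c a = b := by
  induction c generalizing a with
  | zero => omega
  | succ c ih =>
    rcases Nat.lt_or_ge b c with h1 | h1
    · exact ih h1
    · obtain rfl : b = c := by omega
      rw [findBelow, if_pos hf, findBelow_eq_of_forall h]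

namespace Expr

/-- Values are at most a fixed power of `R`, so that they fit into words of logarithmic length. -/
theorem eval_le {n R : ℕ} {μ : ℕ → ℕ} (hn : n ≤ R) (hR : 2 ≤ R) (hμ : ∀ a, μ a ≤ R) (e : Expr)
    (ε : List ℕ) (hε : ∀ x ∈ ε, x ≤ R) : e.eval n μ ε ≤ R ^ e.degree := by
  have hR0 : 0 < R := by omega
  induction e generalizing ε with
  | const c => exact (Nat.lt_two_pow_self.le).trans (Nat.pow_le_pow_left hR c)
  | var i =>
    simp only [eval, degree, pow_one, List.getD_eq_getElem?_getD]
    rcases h : ε[i]? with _ | x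
    · simp
    · exact hε x (List.mem_of_getElem? h)
  | size => simpa [eval, degree] using hn
  | read e ih =>
    exact (hμ _).trans (by simpa [degree] using Nat.pow_le_pow_right hR0 (show 1 ≤ e.degree + 1 by omega))
  | add e e' ih ih' =>
    have h1 := (ih ε hε).trans (Nat.pow_le_pow_right hR0 (show e.degree ≤ e.degree + e'.degree by omega))
    have h2 := (ih' ε hε).trans (Nat.pow_le_pow_right hR0 (show e'.degree ≤ e.degree + e'.degree by omega))
    simp only [eval, degree, pow_succ (n := e.degree + e'.degree)]
    nlinarith
  | sub e e' ih ih' =>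
    exact (Nat.sub_le _ _).trans ((ih ε hε).trans (Nat.pow_le_pow_right hR0 (by simp [degree])))
  | mul e e' ih ih' =>
    simp only [eval, degree, pow_add]
    exact Nat.mul_le_mul (ih ε hε) (ih' ε hε)
  | sum e ih =>
    simp only [eval, degree, pow_succ]
    refine (Finset.sum_le_card_nsmul _ _ (R ^ e.degree) fun x hx => ih _ ?_).trans ?_
    · have := Finset.mem_range.1 hx
      intro y hy
      rcases List.mem_cons.1 hy with rfl | hy
      · omega
      · exact hε y hy
    · rw [Finset.card_range, smul_eq_mul, mul_comm]
      exact Nat.mul_le_mul_left _ hn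
  | find e ih =>
    refine (findBelow_le (b := n) (Nat.zero_le _) le_rfl).trans (hn.trans ?_)
    simpa [degree] using Nat.pow_le_pow_right hR0 (show 1 ≤ e.degree + 1 by omega)

end Expr

theorem runs_copy {W : ℕ} {σ : State} {r s : ℕ} (hrs : s ≠ r) (h : σ.reg s ≤ W) :
    Runs W (copy r s) σ 2 (σ.setReg r (σ.reg s)) := by
  have h1 := Runs.const (W := W) σ r 0 (Nat.zero_le _)
  have h2 := Runs.add (W := W) (σ.setReg r 0) r r s (by simpa [State.setReg, hrs] using h)
  have h3 := h1.seq h2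
  have h4 : (σ.setReg r 0).setReg r ((σ.setReg r 0).reg r + (σ.setReg r 0).reg s) =
      σ.setReg r (σ.reg s) := by simp [State.setReg, hrs]
  rwa [h4] at h3

/-- The effect of a program on the registers and on the memory: the memory is unchanged, and so are the
registers below `r`. -/
def State.Agrees (r : ℕ) (σ τ : State) : Prop :=
  τ.mem = σ.mem ∧ ∀ s < r, τ.reg s = σ.reg s

theorem State.Agrees.trans {r : ℕ} {σ τ υ : State} (h : σ.Agrees r τ) (h' : τ.Agrees r υ) :
    σ.Agrees r υ := ⟨h'.1.trans h.1, fun s hs => (h'.2 s hs).trans (h.2 s hs)⟩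

theorem State.Agrees.mono {r r' : ℕ} {σ τ : State} (h : σ.Agrees r τ) (hr : r' ≤ r) :
    σ.Agrees r' τ := ⟨h.1, fun s hs => h.2 s (hs.trans_le hr)⟩

theorem State.agrees_setReg {r r' : ℕ} (σ : State) (a : ℕ) (h : r' ≤ r) :
    σ.Agrees r' (σ.setReg r a) :=
  ⟨rfl, fun s hs => by simp [State.setReg, show s ≠ r by omega]⟩

theorem State.Agrees.map_eq {r : ℕ} {σ τ : State} (h : σ.Agrees r τ) {ρ : List ℕ}
    (hρ : ∀ s ∈ ρ, s < r) : ρ.map τ.reg = ρ.map σ.reg :=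
  List.map_congr_left fun s hs => h.2 s (hρ s hs)

/-- A loop that counts down register `r`. The invariant `Inv c` holds before the rounds with counter
values less than `c`. -/
theorem runs_loop {W r : ℕ} {body : RAM} (Inv : ℕ → State → Prop) (T : ℕ)
    (hreg : ∀ c σ, Inv c σ → σ.reg r = c ∧ σ.reg 1 = 1)
    (hstep : ∀ c σ, Inv (c + 1) σ → ∃ t τ, t ≤ T ∧ Runs W body (σ.setReg r c) t τ ∧ Inv c τ)
    (c : ℕ) (σ : State) (h : Inv c σ) :
    ∃ t τ, t ≤ c * (T + 2) + 1 ∧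
      Runs W (.whileNonzero r (.seq (.sub r r 1) body)) σ t τ ∧ Inv 0 τ := by
  induction c generalizing σ with
  | zero => exact ⟨1, σ, by omega, .while_false (hreg _ _ h).1, h⟩
  | succ c ih =>
    obtain ⟨t, τ, ht, hr, hi⟩ := hstep c σ h
    obtain ⟨t', τ', ht', hr', hi'⟩ := ih τ hi
    obtain ⟨h1, h2⟩ := hreg _ _ h
    have h3 := Runs.sub (W := W) σ r r 1
    rw [h1, h2, Nat.add_sub_cancel] at h3
    refine ⟨1 + t + t' + 1, τ', ?_, .while_true (by omega) (h3.seq hr) hr', hi'⟩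
    have : (c + 1) * (T + 2) = c * (T + 2) + (T + 2) := by ring
    omega

/-- In the state `σ`, the program `p` computes the number `a` in register `r` within `T` steps, and the
memory, the output and the registers below `r` are unchanged. -/
def Computes (W r : ℕ) (p : RAM) (σ : State) (T a : ℕ) : Prop :=
  ∃ t τ, t ≤ T ∧ Runs W p σ t τ ∧ σ.Agrees r τ ∧ τ.output = σ.output ∧ τ.reg r = a

theorem Computes.binary {W r : ℕ} {p p' o : RAM} {σ : State} {T T' a a' b : ℕ}
    (h : Computes W r p σ T a)
    (h' : ∀ τ, σ.Agrees r τ → Computes W (r + 1) p' τ T' a')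
    (ho : ∀ τ : State, τ.reg r = a → τ.reg (r + 1) = a' → Runs W o τ 1 (τ.setReg r b)) :
    Computes W r (.seq p (.seq p' o)) σ (T + T' + 1) b := by
  obtain ⟨t, τ, ht, hrun, hag, hout, hval⟩ := h
  obtain ⟨t', τ', ht', hrun', hag', hout', hval'⟩ := h' τ hag
  refine ⟨t + (t' + 1), _, by omega,
    hrun.seq (hrun'.seq (ho τ' ((hag'.2 r (by omega)).trans hval) hval')),
    (hag.trans (hag'.mono (by omega))).trans (τ'.agrees_setReg _ le_rfl), hout'.trans hout, ?_⟩
  simp [State.setReg]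

theorem Computes.mono {W r : ℕ} {p : RAM} {σ : State} {T T' a : ℕ} (h : Computes W r p σ T a)
    (hT : T ≤ T') : Computes W r p σ T' a := by
  obtain ⟨t, τ, ht, h⟩ := h
  exact ⟨t, τ, ht.trans hT, h⟩

/-- A loop that changes register `r` by a step function `g` for all values of the counter. -/
theorem Computes.loop {W r n T : ℕ} {body : RAM} {σ : State} (hr : 2 ≤ r) (h0 : σ.reg 0 = n)
    (h1 : σ.reg 1 = 1) (hn : n ≤ W) (Inv : ℕ → ℕ → Prop) (a : ℕ) (hstart : Inv n 0)
    (hend : ∀ b, Inv 0 b → b = a)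
    (hstep : ∀ c < n, ∀ b, Inv (c + 1) b → ∀ τ, σ.Agrees r τ → τ.reg r = b → τ.reg (r + 1) = c →
      ∃ b', Inv c b' ∧ ∃ t τ', t ≤ T ∧ Runs W body τ t τ' ∧ τ.Agrees r τ' ∧ τ'.output = τ.output ∧
        τ'.reg r = b' ∧ τ'.reg (r + 1) = c) :
    Computes W r (.seq (.const r 0) (.seq (copy (r + 1) 0) (.whileNonzero (r + 1)
      (.seq (.sub (r + 1) (r + 1) 1) body)))) σ (n * (T + 2) + 4) a := by
  have hs1 := Runs.const (W := W) σ r 0 (Nat.zero_le _)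
  have h0' : (σ.setReg r 0).reg 0 = n := by simp [State.setReg, show (0 : ℕ) ≠ r by omega, h0]
  have hs2 := runs_copy (W := W) (σ := σ.setReg r 0) (r := r + 1) (s := 0) (by omega)
    (by rw [h0']; exact hn)
  rw [h0'] at hs2
  obtain ⟨t, τ, ht, hrun, hi⟩ := runs_loop (W := W) (r := r + 1) (body := body)
    (fun c τ => c ≤ n ∧ σ.Agrees r τ ∧ τ.output = σ.output ∧ τ.reg (r + 1) = c ∧ Inv c (τ.reg r)) T
    (fun c τ hτ => ⟨hτ.2.2.2.1, (hτ.2.1.2 1 (by omega)).trans h1⟩)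
    (fun c τ hτ => by
      obtain ⟨hc, hag, hout, -, hInv⟩ := hτ
      have hag' : τ.Agrees r (τ.setReg (r + 1) c) := τ.agrees_setReg c (by omega)
      obtain ⟨b', hb', t, τ', ht, hrun, hagt, hout', hreg, hreg'⟩ := hstep c (by omega) _ hInv
        (τ.setReg (r + 1) c) (hag.trans hag') (by simp [State.setReg]) (by simp [State.setReg])
      exact ⟨t, τ', ht, hrun, by omega, (hag.trans hag').trans hagt, hout'.trans hout, hreg',
        by rwa [hreg]⟩)
    n ((σ.setReg r 0).setReg (r + 1) n)
    ⟨le_rfl, (σ.agrees_setReg 0 le_rfl).trans (State.agrees_setReg _ n (by omega)), rfl,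
      by simp [State.setReg], by simpa [State.setReg] using hstart⟩
  exact ⟨1 + (2 + t), τ, by omega, hs1.seq (hs2.seq hrun), hi.2.1, hi.2.2.1, hend _ hi.2.2.2.2⟩

theorem factor_add_le {n K K' D D' : ℕ} (hn0 : 0 < n) :
    K * n ^ D + K' * n ^ D' + 1 ≤ (K + K' + 1) * n ^ max D D' := by
  have h2 := Nat.mul_le_mul_left K (Nat.pow_le_pow_right hn0 (le_max_left D D'))
  have h3 := Nat.mul_le_mul_left K' (Nat.pow_le_pow_right hn0 (le_max_right D D'))
  have h4 := Nat.one_le_pow (max D D') n hn0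
  linarith [add_mul (K + K') 1 (n ^ max D D'), add_mul K K' (n ^ max D D')]

theorem factor_loop_le {n K D : ℕ} (hn0 : 0 < n) :
    n * (K * n ^ D + 3 + 2) + 4 ≤ (K + 9) * n ^ (D + 1) := by
  have h4 := Nat.one_le_pow D n hn0
  rw [pow_succ]
  nlinarith

theorem Expr.computes_compile {n R W : ℕ} {μ : ℕ → ℕ} (hn : n ≤ R) (hn0 : 0 < n) (hR : 2 ≤ R)
    (hμ : ∀ a, μ a ≤ R) (e : Expr) (ρ : List ℕ) (r : ℕ) (σ : State) (hr : 2 ≤ r)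
    (hρ : ∀ s ∈ ρ, s < r) (hε : ∀ x ∈ ρ.map σ.reg, x ≤ R) (h0 : σ.reg 0 = n) (h1 : σ.reg 1 = 1)
    (hm : σ.mem = μ) (hW : R ^ e.degree ≤ W) :
    Computes W r (e.compile ρ r) σ (e.factor * n ^ e.depth) (e.eval n μ (ρ.map σ.reg)) := by
  have hR0 : 0 < R := by omega
  induction e generalizing ρ r σ with
  | const c =>
    refine ⟨1, _, by simp [factor, depth], .const σ r c ?_, σ.agrees_setReg c le_rfl, rfl, ?_⟩
    · exact (Nat.lt_two_pow_self.le).trans ((Nat.pow_le_pow_left hR c).trans hW)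
    · simp [State.setReg, eval]
  | var i =>
    simp only [degree, pow_one] at hW
    by_cases hi : i < ρ.length
    · have hmem : ρ.getD i 0 ∈ ρ := by
        rw [List.getD_eq_getElem _ _ hi]; exact List.getElem_mem hi
      have hlt := hρ _ hmem
      refine ⟨2, _, by simp [factor, depth], ?_, σ.agrees_setReg (σ.reg (ρ.getD i 0)) le_rfl, rfl, ?_⟩
      · rw [compile, if_pos hi]
        exact runs_copy (by omega) ((hε _ (List.mem_map_of_mem hmem)).trans hW)
      · simp [State.setReg, eval, hi]
    · refine ⟨1, _, by simp [factor, depth], ?_, σ.agrees_setReg 0 le_rfl, rfl, ?_⟩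
      · rw [compile, if_neg hi]; exact .const σ r 0 (Nat.zero_le _)
      · simp [State.setReg, eval, hi]
  | size =>
    simp only [degree, pow_one] at hW
    refine ⟨2, _, by simp [factor, depth], runs_copy (by omega) (by omega),
      σ.agrees_setReg _ le_rfl, rfl, ?_⟩
    simp [State.setReg, eval, h0]
  | read e ih =>
    obtain ⟨t, τ, ht, hrun, hag, hout, hval⟩ := ih ρ r σ hr hρ hε h0 h1 hm
      ((Nat.pow_le_pow_right hR0 (by simp [degree])).trans hW)
    refine ⟨t + 1, _, ?_, hrun.seq (.load τ r r), hag.trans (τ.agrees_setReg _ le_rfl), hout, ?_⟩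
    · simp only [factor, depth]
      have := Nat.one_le_pow e.depth n hn0
      nlinarith
    · simp [State.setReg, eval, hval, hag.1, hm]
  | add e e' ih ih' =>
    refine (Computes.binary (a' := e'.eval n μ (ρ.map σ.reg)) (ih ρ r σ hr hρ hε h0 h1 hm
      ((Nat.pow_le_pow_right hR0 (by simp [degree]; omega)).trans hW)) (fun τ hag => ?_)
      (fun τ h2 h3 => ?_)).mono (factor_add_le hn0)
    · have hmap := hag.map_eq hρ
      rw [← hmap]
      exact ih' ρ (r + 1) τ (by omega) (fun s hs => (hρ s hs).trans (by omega)) (by rwa [hmap])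
        ((hag.2 0 (by omega)).trans h0) ((hag.2 1 (by omega)).trans h1) (hag.1.trans hm)
        ((Nat.pow_le_pow_right hR0 (by simp [degree]; omega)).trans hW)
    · have := Runs.add (W := W) τ r r (r + 1) (by
        rw [h2, h3]; exact (eval_le hn hR hμ (.add e e') _ hε).trans hW)
      rwa [h2, h3] at this
  | sub e e' ih ih' =>
    refine (Computes.binary (a' := e'.eval n μ (ρ.map σ.reg)) (ih ρ r σ hr hρ hε h0 h1 hm
      ((Nat.pow_le_pow_right hR0 (by simp [degree])).trans hW)) (fun τ hag => ?_)
      (fun τ h2 h3 => ?_)).mono (factor_add_le hn0)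
    · have hmap := hag.map_eq hρ
      rw [← hmap]
      exact ih' ρ (r + 1) τ (by omega) (fun s hs => (hρ s hs).trans (by omega)) (by rwa [hmap])
        ((hag.2 0 (by omega)).trans h0) ((hag.2 1 (by omega)).trans h1) (hag.1.trans hm)
        ((Nat.pow_le_pow_right hR0 (by simp [degree])).trans hW)
    · have := Runs.sub (W := W) τ r r (r + 1)
      rwa [h2, h3] at this
  | mul e e' ih ih' =>
    refine (Computes.binary (a' := e'.eval n μ (ρ.map σ.reg)) (ih ρ r σ hr hρ hε h0 h1 hm
      ((Nat.pow_le_pow_right hR0 (by simp [degree])).trans hW)) (fun τ hag => ?_)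
      (fun τ h2 h3 => ?_)).mono (factor_add_le hn0)
    · have hmap := hag.map_eq hρ
      rw [← hmap]
      exact ih' ρ (r + 1) τ (by omega) (fun s hs => (hρ s hs).trans (by omega)) (by rwa [hmap])
        ((hag.2 0 (by omega)).trans h0) ((hag.2 1 (by omega)).trans h1) (hag.1.trans hm)
        ((Nat.pow_le_pow_right hR0 (by simp [degree])).trans hW)
    · have := Runs.mul (W := W) τ r r (r + 1) (by
        rw [h2, h3]; exact (eval_le hn hR hμ (.mul e e') _ hε).trans hW)
      rwa [h2, h3] at this
  | sum e ih =>
    have hRW : R ≤ W :=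
      (pow_one R).symm.le.trans ((Nat.pow_le_pow_right hR0 (by simp [degree])).trans hW)
    set f : ℕ → ℕ := fun x => e.eval n μ (x :: ρ.map σ.reg) with hf
    have htotal : ∑ x ∈ Finset.range n, f x ≤ W := (eval_le hn hR hμ (.sum e) _ hε).trans hW
    refine (Computes.loop (T := e.factor * n ^ e.depth + 3) hr h0 h1 (hn.trans hRW)
      (fun c b => b + ∑ x ∈ Finset.range c, f x = ∑ x ∈ Finset.range n, f x) _ (by simp)
      (fun b hb => by change b = ∑ x ∈ Finset.range n, f x; simpa using hb)
      (fun c hc b hb τ hag hτr hτc => ?_)).mono (factor_loop_le hn0)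
    have hmap : ((r + 1) :: ρ).map τ.reg = c :: ρ.map σ.reg := by
      rw [List.map_cons, hτc, hag.map_eq hρ]
    obtain ⟨t, τ', ht, hrun, hag', hout, hval⟩ := ih ((r + 1) :: ρ) (r + 2) τ (by omega)
      (by
        intro s hs
        rcases List.mem_cons.1 hs with rfl | hs
        · omega
        · exact (hρ s hs).trans (by omega))
      (by
        rw [hmap]
        intro x hx
        rcases List.mem_cons.1 hx with rfl | hx
        · omega
        · exact hε x hx)
      ((hag.2 0 (by omega)).trans h0) ((hag.2 1 (by omega)).trans h1) (hag.1.trans hm)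
      ((Nat.pow_le_pow_right hR0 (by simp [degree])).trans hW)
    rw [hmap] at hval
    rw [Finset.sum_range_succ] at hb
    have hb' : τ'.reg r = b := (hag'.2 r (by omega)).trans hτr
    refine ⟨b + f c, by omega, t + 1, _, by omega, hrun.seq (.add τ' r r (r + 2) ?_),
      (hag'.mono (by omega)).trans (τ'.agrees_setReg _ le_rfl), hout, ?_, ?_⟩
    · rw [hb', hval]
      change b + f c ≤ W
      omega
    · simp [State.setReg, hb', hval, hf]
    · simp [State.setReg, hag'.2 (r + 1) (by omega), hτc]
  | find e ih =>
    have hRW : R ≤ W :=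
      (pow_one R).symm.le.trans ((Nat.pow_le_pow_right hR0 (by simp [degree])).trans hW)
    set f : ℕ → ℕ := fun x => e.eval n μ (x :: ρ.map σ.reg) with hf
    refine (Computes.loop (T := e.factor * n ^ e.depth + 3) hr h0 h1 (hn.trans hRW)
      (fun c b => findBelow f c b = findBelow f n 0) _ rfl
      (fun b hb => hb) (fun c hc b hb τ hag hτr hτc => ?_)).mono (factor_loop_le hn0)
    have hmap : ((r + 1) :: ρ).map τ.reg = c :: ρ.map σ.reg := by
      rw [List.map_cons, hτc, hag.map_eq hρ]
    obtain ⟨t, τ', ht, hrun, hag', hout, hval⟩ := ih ((r + 1) :: ρ) (r + 2) τ (by omega)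
      (by
        intro s hs
        rcases List.mem_cons.1 hs with rfl | hs
        · omega
        · exact (hρ s hs).trans (by omega))
      (by
        rw [hmap]
        intro x hx
        rcases List.mem_cons.1 hx with rfl | hx
        · omega
        · exact hε x hx)
      ((hag.2 0 (by omega)).trans h0) ((hag.2 1 (by omega)).trans h1) (hag.1.trans hm)
      ((Nat.pow_le_pow_right hR0 (by simp [degree])).trans hW)
    rw [hmap] at hval
    have hb' : τ'.reg r = b := (hag'.2 r (by omega)).trans hτr
    have hc' : τ'.reg (r + 1) = c := (hag'.2 (r + 1) (by omega)).trans hτc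
    refine ⟨_, hb, ?_⟩
    by_cases h : f c = 0
    · exact ⟨t + (1 + 1), τ', by omega, hrun.seq (.if_false (hval.trans h) (.skip τ')),
        hag'.mono (by omega), hout, by simp [h, hb'], hc'⟩
    · refine ⟨t + (2 + 1), _, by omega, hrun.seq (.if_true (by rw [hval]; exact h)
        (runs_copy (s := r + 1) (by omega) (by omega))),
        (hag'.mono (by omega)).trans (τ'.agrees_setReg _ le_rfl), hout, ?_, ?_⟩
      · simp [State.setReg, h, hc']
      · simp [State.setReg, hc']

end RAM

namespace RAM

/-- Programs that write a list of numbers, with variables as in expressions. -/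
inductive Stmt where
  | emit (e : Expr)
  | seq (s s' : Stmt)
  /-- run `s` if `e` is not zero -/
  | when (e : Expr) (s : Stmt)
  /-- run `s` for all values less than `size` of a new variable, in descending order -/
  | loop (s : Stmt)
  /-- run `s` with a new variable that is the least value with `e` not zero -/
  | bind (e : Expr) (s : Stmt)

namespace Stmt

/-- The output of a program. -/
def eval (n : ℕ) (μ : ℕ → ℕ) : Stmt → List ℕ → List ℕ
  | emit e, ε => [e.eval n μ ε]
  | seq s s', ε => s.eval n μ ε ++ s'.eval n μ ε
  | when e s, ε => if e.eval n μ ε ≠ 0 then s.eval n μ ε else []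
  | loop s, ε => (down n).flatMap fun x => s.eval n μ (x :: ε)
  | bind e s, ε => s.eval n μ (e.find.eval n μ ε :: ε)

/-- The program of the random access machine. -/
def compile : Stmt → List ℕ → ℕ → RAM
  | emit e, ρ, r => .seq (e.compile ρ r) (.emit r)
  | seq s s', ρ, r => .seq (s.compile ρ r) (s'.compile ρ r)
  | when e s, ρ, r => .seq (e.compile ρ r) (.ifNonzero r (s.compile ρ r) .skip)
  | loop s, ρ, r => .seq (copy r 0) (.whileNonzero r (.seq (.sub r r 1)
      (s.compile (r :: ρ) (r + 1))))
  | bind e s, ρ, r => .seq (e.find.compile ρ r) (s.compile (r :: ρ) (r + 1))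

/-- The number of nested loops. -/
def depth : Stmt → ℕ
  | emit e => e.depth
  | seq s s' => max s.depth s'.depth
  | when e s => max e.depth s.depth
  | loop s => s.depth + 1
  | bind e s => max e.find.depth s.depth

/-- The factor in the bound `factor * n ^ depth` for the number of steps. -/
def factor : Stmt → ℕ
  | emit e => e.factor + 1
  | seq s s' => s.factor + s'.factor + 1
  | when e s => e.factor + (s.factor + 1) + 1
  | loop s => s.factor + 5
  | bind e s => e.find.factor + s.factor + 1

/-- The exponent in a bound for all numbers that are computed. -/
def degree : Stmt → ℕ
  | emit e => e.degree
  | seq s s' => s.degree + s'.degree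
  | when e s => e.degree + s.degree
  | loop s => s.degree + 1
  | bind e s => e.find.degree + s.degree

end Stmt

/-- In the state `σ`, the program `p` writes the list `l` within `T` steps, and the memory and the
registers below `r` are unchanged. -/
def Writes (W r : ℕ) (p : RAM) (σ : State) (T : ℕ) (l : List ℕ) : Prop :=
  ∃ t τ, t ≤ T ∧ Runs W p σ t τ ∧ σ.Agrees r τ ∧ τ.output = σ.output ++ l

theorem Stmt.writes_compile {n R W : ℕ} {μ : ℕ → ℕ} (hn : n ≤ R) (hn0 : 0 < n) (hR : 2 ≤ R)
    (hμ : ∀ a, μ a ≤ R) (s : Stmt) (ρ : List ℕ) (r : ℕ) (σ : State) (hr : 2 ≤ r)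
    (hρ : ∀ s ∈ ρ, s < r) (hε : ∀ x ∈ ρ.map σ.reg, x ≤ R) (h0 : σ.reg 0 = n) (h1 : σ.reg 1 = 1)
    (hm : σ.mem = μ) (hW : R ^ s.degree ≤ W) :
    Writes W r (s.compile ρ r) σ (s.factor * n ^ s.depth) (s.eval n μ (ρ.map σ.reg)) := by
  have hR0 : 0 < R := by omega
  have hρ' : ∀ s ∈ r :: ρ, s < r + 1 := fun s hs => by
    rcases List.mem_cons.1 hs with rfl | hs
    · omega
    · exact (hρ s hs).trans (by omega)
  induction s generalizing ρ r σ with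
  | emit e =>
    obtain ⟨t, τ, ht, hrun, hag, hout, hval⟩ :=
      e.computes_compile hn hn0 hR hμ ρ r σ hr hρ hε h0 h1 hm hW
    refine ⟨t + 1, _, ?_, hrun.seq (.emit τ r), hag, ?_⟩
    · simp only [factor, depth]
      have := Nat.one_le_pow e.depth n hn0
      nlinarith
    · simp [eval, hout, hval]
  | seq s s' ih ih' =>
    obtain ⟨t, τ, ht, hrun, hag, hout⟩ := ih ρ r σ hr hρ hε h0 h1 hm
      ((Nat.pow_le_pow_right hR0 (by simp [degree])).trans hW) hρ'
    have hmap := hag.map_eq hρ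
    obtain ⟨t', τ', ht', hrun', hag', hout'⟩ := ih' ρ r τ hr hρ (by rwa [hmap])
      ((hag.2 0 (by omega)).trans h0) ((hag.2 1 (by omega)).trans h1) (hag.1.trans hm)
      ((Nat.pow_le_pow_right hR0 (by simp [degree])).trans hW) hρ'
    refine ⟨t + t', τ', ?_, hrun.seq hrun', hag.trans hag', ?_⟩
    · exact (Nat.le_succ_of_le (Nat.add_le_add ht ht')).trans (factor_add_le hn0)
    · rw [hout', hout, hmap, List.append_assoc]; rfl
  | when e s ih =>
    obtain ⟨t, τ, ht, hrun, hag, hout, hval⟩ := e.computes_compile hn hn0 hR hμ ρ r σ hr hρ hε h0 h1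
      hm ((Nat.pow_le_pow_right hR0 (by simp [degree])).trans hW)
    have hmap := hag.map_eq hρ
    have h2 := factor_add_le (K := e.factor) (K' := s.factor + 1) (D := e.depth) (D' := s.depth) hn0
    have h3 := Nat.one_le_pow s.depth n hn0
    rw [add_mul s.factor, one_mul] at h2
    by_cases h : e.eval n μ (ρ.map σ.reg) = 0
    · refine ⟨t + (1 + 1), τ, ?_, hrun.seq (.if_false (hval.trans h) (.skip τ)), hag, ?_⟩
      · change _ ≤ (e.factor + (s.factor + 1) + 1) * n ^ max e.depth s.depth
        have := Nat.zero_le (s.factor * n ^ s.depth)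
        omega
      · simp [eval, h, hout]
    · obtain ⟨t', τ', ht', hrun', hag', hout'⟩ := ih ρ r τ hr hρ (by rwa [hmap])
        ((hag.2 0 (by omega)).trans h0) ((hag.2 1 (by omega)).trans h1) (hag.1.trans hm)
        ((Nat.pow_le_pow_right hR0 (by simp [degree])).trans hW) hρ'
      refine ⟨t + (t' + 1), τ', ?_, hrun.seq (.if_true (by rwa [hval]) hrun'), hag.trans hag', ?_⟩
      · change _ ≤ (e.factor + (s.factor + 1) + 1) * n ^ max e.depth s.depth
        omega
      · simp [eval, h, hout', hout, hmap]
  | loop s ih =>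
    have hRW : R ≤ W :=
      (pow_one R).symm.le.trans ((Nat.pow_le_pow_right hR0 (by simp [degree])).trans hW)
    have hs := runs_copy (W := W) (σ := σ) (r := r) (s := 0) (by omega) (by omega)
    rw [h0] at hs
    obtain ⟨t, τ, ht, hrun, -, hag, -, hout⟩ := runs_loop (W := W) (r := r)
      (body := s.compile (r :: ρ) (r + 1))
      (fun c τ => c ≤ n ∧ σ.Agrees r τ ∧ τ.reg r = c ∧ τ.output ++
        (down c).flatMap (fun x => s.eval n μ (x :: ρ.map σ.reg)) = σ.output ++
          (down n).flatMap (fun x => s.eval n μ (x :: ρ.map σ.reg)))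
      (s.factor * n ^ s.depth) (fun c τ hτ => ⟨hτ.2.2.1, (hτ.2.1.2 1 (by omega)).trans h1⟩)
      (fun c τ hτ => by
        obtain ⟨hc, hag, hreg, hout⟩ := hτ
        have hag' := hag.trans (τ.agrees_setReg (r := r) c le_rfl)
        have hmap : (r :: ρ).map (τ.setReg r c).reg = c :: ρ.map σ.reg := by
          rw [List.map_cons, hag'.map_eq hρ]; simp [State.setReg]
        obtain ⟨t, τ', ht, hrun, hag'', hout'⟩ := ih (r :: ρ) (r + 1) (τ.setReg r c) (by omega) hρ'
          (by
            rw [hmap]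
            intro x hx
            rcases List.mem_cons.1 hx with rfl | hx
            · omega
            · exact hε x hx)
          ((hag'.2 0 (by omega)).trans h0) ((hag'.2 1 (by omega)).trans h1) (hag'.1.trans hm)
          ((Nat.pow_le_pow_right hR0 (by simp [degree])).trans hW)
          (fun s hs => by
            rcases List.mem_cons.1 hs with rfl | hs
            · omega
            · exact (hρ' s hs).trans (by omega))
        refine ⟨t, τ', ht, hrun, by omega, hag'.trans (hag''.mono (by omega)),
          (hag''.2 r (by omega)).trans (by simp [State.setReg]), ?_⟩
        rw [hout', hmap, ← hout, down, List.flatMap_cons, List.append_assoc]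
        rfl)
      n (σ.setReg r n) ⟨le_rfl, σ.agrees_setReg n le_rfl, by simp [State.setReg], rfl⟩
    refine ⟨2 + t, τ, ?_, hs.seq hrun, hag, ?_⟩
    · simp only [factor, depth]
      have h4 := Nat.one_le_pow s.depth n hn0
      have h5 : n ≤ n ^ s.depth * n := Nat.le_mul_of_pos_left n (by omega)
      rw [pow_succ, add_mul]
      have h6 : s.factor * (n ^ s.depth * n) = n * (s.factor * n ^ s.depth) := by ring
      rw [mul_add] at ht
      omega
    · have := hout
      rw [down, List.flatMap_nil, List.append_nil] at this
      exact this
  | bind e s ih =>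
    obtain ⟨t, τ, ht, hrun, hag, hout, hval⟩ := e.find.computes_compile hn hn0 hR hμ ρ r σ hr hρ hε h0
      h1 hm ((Nat.pow_le_pow_right hR0 (by simp [degree])).trans hW)
    have hmap : (r :: ρ).map τ.reg = e.find.eval n μ (ρ.map σ.reg) :: ρ.map σ.reg := by
      rw [List.map_cons, hag.map_eq hρ, hval]
    obtain ⟨t', τ', ht', hrun', hag', hout'⟩ := ih (r :: ρ) (r + 1) τ (by omega) hρ'
      (by
        rw [hmap]
        intro x hx
        rcases List.mem_cons.1 hx with rfl | hx
        · exact (findBelow_le (Nat.zero_le _) le_rfl).trans hn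
        · exact hε x hx)
      ((hag.2 0 (by omega)).trans h0) ((hag.2 1 (by omega)).trans h1) (hag.1.trans hm)
      ((Nat.pow_le_pow_right hR0 (by simp [degree])).trans hW)
      (fun s hs => by
        rcases List.mem_cons.1 hs with rfl | hs
        · omega
        · exact (hρ' s hs).trans (by omega))
    refine ⟨t + t', τ', ?_, hrun.seq hrun', hag.trans (hag'.mono (by omega)), ?_⟩
    · exact (Nat.le_succ_of_le (Nat.add_le_add ht ht')).trans (factor_add_le hn0)
    · rw [hout', hout, hmap]; rfl

/-- A program that reads the number `size` from cell `0`, puts the values of `e` into the cells with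
the addresses given by `a`, and then runs `s`. -/
def tableProgram (a e : Expr) (s : Stmt) : RAM :=
  .seq (.load 0 0) (.seq (.const 1 1) (.seq
    (.seq (copy 2 0) (.whileNonzero 2 (.seq (.sub 2 2 1)
      (.seq (a.compile [2] 3) (.seq (e.compile [2] 4) (.store 3 4))))))
    (s.compile [] 2)))

/-- The memory after the table `f` has been stored after the input `w` of length `b`. -/
def tableMemory (w : List ℕ) (b n : ℕ) (f : ℕ → ℕ) (x : ℕ) : ℕ :=
  if b ≤ x ∧ x < b + n then f (x - b) else w.getD x 0

/-- The table program is correct and takes at most a constant times `n ^ D` steps if all parts have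
loops of depth at most `D`, including the loop over the table. -/
theorem exists_runs_tableProgram {n R W D b : ℕ} {w : List ℕ} {a e : Expr} {s : Stmt} {f : ℕ → ℕ}
    (hn : n ≤ R) (hn0 : 0 < n) (hR : 2 ≤ R) (hw : ∀ x, w.getD x 0 ≤ R) (hw0 : w.getD 0 0 = n)
    (ha : ∀ μ x, a.eval n μ [x] = b + x)
    (he : ∀ μ, (∀ x < b, μ x = w.getD x 0) → ∀ x < n, e.eval n μ [x] = f x)
    (hf : ∀ x, f x ≤ R) (haD : a.depth + 1 ≤ D) (heD : e.depth + 1 ≤ D) (hsD : s.depth ≤ D)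
    (hW : R ^ (a.degree + e.degree + s.degree + 1) ≤ W) :
    ∃ t τ, t ≤ (a.factor + e.factor + s.factor + 8) * n ^ D ∧
      Runs W (tableProgram a e s) (init w) t τ ∧ τ.output = s.eval n (tableMemory w b n f) [] := by
  have hR0 : 0 < R := by omega
  have hRW : R ≤ W :=
    (pow_one R).symm.le.trans ((Nat.pow_le_pow_right hR0 (by omega)).trans hW)
  have hs1 := Runs.load (W := W) (init w) 0 0
  have hv : (init w).mem ((init w).reg 0) = n := hw0
  rw [hv] at hs1
  have hs2 := Runs.const (W := W) ((init w).setReg 0 n) 1 1 (by omega)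
  set σ := ((init w).setReg 0 n).setReg 1 1 with hσ
  have hs3 := runs_copy (W := W) (σ := σ) (r := 2) (s := 0) (by omega)
    (by simpa [hσ, State.setReg] using hn.trans hRW)
  have hσ0 : σ.reg 0 = n := by simp [hσ, State.setReg]
  rw [hσ0] at hs3
  obtain ⟨t, τ, ht, hrun, -, h0, h1, -, hout, hmem⟩ := runs_loop (W := W) (r := 2)
    (body := .seq (a.compile [2] 3) (.seq (e.compile [2] 4) (.store 3 4)))
    (fun c τ => c ≤ n ∧ τ.reg 0 = n ∧ τ.reg 1 = 1 ∧ τ.reg 2 = c ∧ τ.output = [] ∧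
      ∀ x, τ.mem x = if b + c ≤ x ∧ x < b + n then f (x - b) else w.getD x 0)
    (a.factor * n ^ a.depth + e.factor * n ^ e.depth + 1) (fun c τ hτ => ⟨hτ.2.2.2.1, hτ.2.2.1⟩)
    (fun c τ hτ => by
      obtain ⟨hc, h0, h1, h2, hout, hmem⟩ := hτ
      have hμ : ∀ x, τ.mem x ≤ R := fun x => by rw [hmem]; split_ifs; exacts [hf _, hw _]
      have hc2 : (τ.setReg 2 c).reg 2 = c := by simp [State.setReg]
      obtain ⟨t, τ₁, ht, hrun, hag, hout₁, hval⟩ := a.computes_compile (W := W) hn hn0 hR hμ [2] 3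
        (τ.setReg 2 c) (by omega) (by simp) (by simp [hc2]; omega)
        (by simpa [State.setReg] using h0) (by simpa [State.setReg] using h1) rfl
        ((Nat.pow_le_pow_right hR0 (by omega)).trans hW)
      have hc3 : τ₁.reg 2 = c := (hag.2 2 (by omega)).trans hc2
      obtain ⟨t', τ₂, ht', hrun', hag', hout₂, hval'⟩ := e.computes_compile (W := W) hn hn0 hR hμ [2] 4
        τ₁ (by omega) (by simp) (by simp [hc3]; omega)
        ((hag.2 0 (by omega)).trans (by simpa [State.setReg] using h0))
        ((hag.2 1 (by omega)).trans (by simpa [State.setReg] using h1)) hag.1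
        ((Nat.pow_le_pow_right hR0 (by omega)).trans hW)
      have e3 : τ₂.reg 3 = b + c := by
        rw [hag'.2 3 (by omega), hval, List.map_singleton, hc2, ha]
      have e4 : τ₂.reg 4 = f c := by
        rw [hval', List.map_singleton, hc3]
        exact he _ (fun x hx => by rw [hmem, if_neg (by omega)]) c (by omega)
      refine ⟨t + (t' + 1), _, by omega, hrun.seq (hrun'.seq (.store τ₂ 3 4)), by omega, ?_, ?_, ?_, ?_,
        ?_⟩
      · exact (hag'.2 0 (by omega)).trans ((hag.2 0 (by omega)).trans (by simpa [State.setReg] using h0))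
      · exact (hag'.2 1 (by omega)).trans ((hag.2 1 (by omega)).trans (by simpa [State.setReg] using h1))
      · exact (hag'.2 2 (by omega)).trans hc3
      · exact hout₂.trans (hout₁.trans hout)
      · intro x
        have hmx : τ₂.mem x = τ.mem x := by rw [hag'.1, hag.1]; rfl
        simp only [State.setMem, e3, e4]
        by_cases hx : x = b + c
        · subst hx
          rw [Function.update_self, if_pos (by omega), Nat.add_sub_cancel_left]
        · rw [Function.update_of_ne hx, hmx, hmem]
          by_cases h : b + (c + 1) ≤ x ∧ x < b + n
          · rw [if_pos h, if_pos (by omega)]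
          · rw [if_neg h, if_neg (by omega)])
    n (σ.setReg 2 n) ⟨le_rfl, by simp [hσ, State.setReg], by simp [hσ, State.setReg],
      by simp [State.setReg], rfl, fun x => by rw [if_neg (by omega)]; rfl⟩
  have hμ : τ.mem = tableMemory w b n f := by
    funext x; rw [hmem]; rfl
  have hμ' : ∀ x, tableMemory w b n f x ≤ R := fun x => by
    rw [tableMemory]; split_ifs; exacts [hf _, hw _]
  obtain ⟨t', τ', ht', hrun', hag', hout'⟩ := s.writes_compile (W := W) hn hn0 hR hμ' [] 2 τ le_rfl
    (by simp) (by simp) h0 h1 hμ ((Nat.pow_le_pow_right hR0 (by omega)).trans hW)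
  refine ⟨1 + (1 + ((2 + t) + t')), τ', ?_, hs1.seq (hs2.seq ((hs3.seq hrun).seq hrun')), ?_⟩
  · have k1 : n * (a.factor * n ^ a.depth) ≤ a.factor * n ^ D := by
      have := Nat.mul_le_mul_left a.factor (Nat.pow_le_pow_right hn0 haD)
      rw [pow_succ] at this; nlinarith
    have k2 : n * (e.factor * n ^ e.depth) ≤ e.factor * n ^ D := by
      have := Nat.mul_le_mul_left e.factor (Nat.pow_le_pow_right hn0 heD)
      rw [pow_succ] at this; nlinarith
    have k3 := Nat.mul_le_mul_left s.factor (Nat.pow_le_pow_right hn0 hsD)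
    have k4 : n ≤ n ^ D := Nat.le_self_pow (by omega) n
    have k5 : n * (a.factor * n ^ a.depth + e.factor * n ^ e.depth + 1 + 2) =
      n * (a.factor * n ^ a.depth) + n * (e.factor * n ^ e.depth) + 3 * n := by ring
    rw [k5] at ht
    rw [add_mul, add_mul, add_mul]
    omega
  · rw [hout', hout]; rfl

end RAM

/-! ### The description of the simulating matroid -/

/-- The list of all elements of `Fin n`, in descending order. -/
def finDown (n : ℕ) : List (Fin n) := (List.finRange n).reverse

theorem mem_finDown {n : ℕ} (x : Fin n) : x ∈ finDown n := by simp [finDown]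

theorem map_val_finDown (n : ℕ) : (finDown n).map Fin.val = RAM.down n := by
  have h : ∀ c, RAM.down c = (List.range c).reverse := fun c => by
    induction c with
    | zero => rfl
    | succ c ih => rw [RAM.down, ih, List.range_succ, List.reverse_append]; rfl
  rw [finDown, List.map_reverse, h]
  simp

/-- The list of all tuples with entries in `Fin n`. -/
def tuples (n : ℕ) : (s : ℕ) → List (Fin s → Fin n)
  | 0 => [Fin.elim0]
  | s + 1 => (finDown n).flatMap fun x => (tuples n s).map fun t => Fin.snoc t x

theorem mem_tuples {n s : ℕ} (t : Fin s → Fin n) : t ∈ tuples n s := by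
  induction s with
  | zero => simp only [tuples, List.mem_singleton]; exact Subsingleton.elim _ _
  | succ s ih =>
    simp only [tuples, List.mem_flatMap, List.mem_map]
    exact ⟨t (Fin.last s), mem_finDown _, Fin.init t, ih _, Fin.snoc_init_self t⟩

theorem length_tuples (n s : ℕ) : (tuples n s).length = n ^ s := by
  induction s with
  | zero => rfl
  | succ s ih =>
    simp [tuples, List.length_flatMap, ih, finDown, pow_succ, mul_comm]

/-- The list of the entries of a tuple. -/
def digits {n s : ℕ} (t : Fin s → Fin n) : List ℕ := List.ofFn fun j => (t j : ℕ)

theorem digits_snoc {n s : ℕ} (t : Fin s → Fin n) (x : Fin n) :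
    digits (Fin.snoc (α := fun _ => Fin n) t x) = digits t ++ [(x : ℕ)] := by
  simp only [digits, List.ofFn_succ', List.concat_eq_append, Fin.snoc_castSucc, Fin.snoc_last]

theorem length_digits {n s : ℕ} (t : Fin s → Fin n) : (digits t).length = s := by simp [digits]

theorem exists_digits_eq {n s : ℕ} {l : List ℕ} (hl : l.length = s) (h : ∀ x ∈ l, x < n) :
    ∃ t : Fin s → Fin n, digits t = l := by
  subst hl
  exact ⟨fun j => ⟨l[j], h _ (List.getElem_mem _)⟩, by simp [digits]⟩

theorem mem_digits {n s : ℕ} {t : Fin s → Fin n} {e : Fin n} :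
    (e : ℕ) ∈ digits t ↔ e ∈ Set.range t := by
  simp [digits, List.mem_ofFn, Fin.ext_iff]

theorem nodup_digits {n s : ℕ} {t : Fin s → Fin n} : (digits t).Nodup ↔ Function.Injective t := by
  rw [digits, List.nodup_ofFn]
  exact ⟨fun h i j hij => h (by simp [hij]), fun h i j hij => h (Fin.ext hij)⟩

/-- The position of an auxiliary element in the list of the auxiliary elements of its tuple. -/
def Aux.slot {m n : ℕ} : Aux m n → ℕ
  | .l j => j
  | .g => m
  | .c b => m + 1 + b.toNat
  | .i b => m + 3 + b.toNat
  | .q s => m + 5 + signCode s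
  | .corner α β a => m + 8 + 2 * α.toNat + β.toNat + 4 * a

theorem Aux.slot_lt {m n : ℕ} (s : Aux m n) : s.slot < m + 8 + 4 * n := by
  rcases s with j | _ | b | b | s | ⟨α, β, a⟩ <;> simp only [Aux.slot]
  · omega
  · omega
  · cases b <;> simp <;> omega
  · cases b <;> simp <;> omega
  · cases s <;> simp [signCode] <;> omega
  · have := a.2
    cases α <;> cases β <;> simp <;> omega

theorem Aux.slot_injective {m n : ℕ} : Function.Injective (Aux.slot : Aux m n → ℕ) := by
  have hb : ∀ b : Bool, b.toNat ≤ 1 := by decide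
  have hbi : ∀ b b' : Bool, b.toNat = b'.toNat → b = b' := by decide
  have hs : ∀ s : SignType, signCode s ≤ 2 := by decide
  have hsi : ∀ s s' : SignType, signCode s = signCode s' → s = s' := by decide
  rintro (j | _ | b | b | s | ⟨α, β, a⟩) (j' | _ | b' | b' | s' | ⟨α', β', a'⟩) h <;>
    simp only [Aux.slot] at h
  all_goals try have := hb b
  all_goals try have := hb b'
  all_goals try have := hs s
  all_goals try have := hs s'
  all_goals try have := hb α
  all_goals try have := hb α'
  all_goals try have := hb β
  all_goals try have := hb β'
  all_goals first
    | omega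
    | rfl
    | (congr 1; exact Fin.ext (by omega))
    | (congr 1
       · exact hbi _ _ (by omega)
       · exact hbi _ _ (by omega)
       · exact Fin.ext (by omega))
    | (congr 1; exact hbi _ _ (by omega))
    | (congr 1; exact hsi _ _ (by omega))

/-- The number of an element of the simulating matroid. -/
def label {m n : ℕ} : Elt m n → ℕ
  | .inl e => e
  | .inr (t, s) => n + finFunctionFinEquiv t * (m + 8 + 4 * n) + s.slot

/-- The number of elements of the simulating matroid. -/
def eltCount (m n : ℕ) : ℕ := n + n ^ (m + 2) * (m + 8 + 4 * n)

theorem label_lt {m n : ℕ} (x : Elt m n) : label x < eltCount m n := by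
  rcases x with e | ⟨t, s⟩
  · exact e.2.trans_le (Nat.le_add_right _ _)
  · have h1 := s.slot_lt
    have h2 := Nat.mul_le_mul_right (m + 8 + 4 * n)
      (show (finFunctionFinEquiv t : ℕ) + 1 ≤ n ^ (m + 2) from (finFunctionFinEquiv t).2)
    rw [add_mul, one_mul] at h2
    simp only [label, eltCount]
    omega

theorem label_injective {m n : ℕ} : Function.Injective (label : Elt m n → ℕ) := by
  rintro (e | ⟨t, s⟩) (e' | ⟨t', s'⟩) h <;> simp only [label] at h
  · rw [Fin.ext h]
  · omega
  · omega
  · have h1 := s.slot_lt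
    have h2 := s'.slot_lt
    have h3 : (finFunctionFinEquiv t : ℕ) * (m + 8 + 4 * n) + s.slot =
        finFunctionFinEquiv t' * (m + 8 + 4 * n) + s'.slot := by omega
    have h4 : s.slot = s'.slot := by
      have := congrArg (· % (m + 8 + 4 * n)) h3
      simpa only [Nat.mul_add_mod', Nat.mod_eq_of_lt h1, Nat.mod_eq_of_lt h2] using this
    have h5 : (finFunctionFinEquiv t : ℕ) = finFunctionFinEquiv t' := by
      have : (finFunctionFinEquiv t : ℕ) * (m + 8 + 4 * n) =
        finFunctionFinEquiv t' * (m + 8 + 4 * n) := by omega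
      exact Nat.eq_of_mul_eq_mul_right (by omega) this
    rw [Aux.slot_injective h4, finFunctionFinEquiv.injective (Fin.ext h5)]

theorem label_surjective {m n x : ℕ} (hx : x < eltCount m n) : ∃ y : Elt m n, label y = x := by
  rcases Nat.lt_or_ge x n with h | h
  · exact ⟨.inl ⟨x, h⟩, rfl⟩
  have hM : 0 < m + 8 + 4 * n := by omega
  have hdiv := Nat.div_add_mod (x - n) (m + 8 + 4 * n)
  have hmod := Nat.mod_lt (x - n) hM
  set y := (x - n) % (m + 8 + 4 * n) with hy
  set z := (x - n) / (m + 8 + 4 * n) with hz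
  have hzlt : z < n ^ (m + 2) := by
    rw [hz, Nat.div_lt_iff_lt_mul hM]
    rw [eltCount] at hx
    omega
  have hslot : ∃ s : Aux m n, s.slot = y := by
    have hsgn : ∀ i < 3, ∃ s : SignType, signCode s = i := by decide
    by_cases h1 : y < m
    · exact ⟨.l ⟨y, h1⟩, rfl⟩
    by_cases h2 : y < m + 1
    · exact ⟨.g, show m = y by omega⟩
    by_cases h3 : y < m + 2
    · exact ⟨.c false, show m + 1 + 0 = y by omega⟩
    by_cases h4 : y < m + 3
    · exact ⟨.c true, show m + 1 + 1 = y by omega⟩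
    by_cases h5 : y < m + 4
    · exact ⟨.i false, show m + 3 + 0 = y by omega⟩
    by_cases h6 : y < m + 5
    · exact ⟨.i true, show m + 3 + 1 = y by omega⟩
    by_cases h7 : y < m + 8
    · obtain ⟨s, hs⟩ := hsgn (y - (m + 5)) (by omega)
      exact ⟨.q s, show m + 5 + signCode s = y by omega⟩
    have ha : (y - (m + 8)) / 4 < n := by omega
    have hr : (y - (m + 8)) % 4 < 4 := Nat.mod_lt _ (by omega)
    have hd := Nat.div_add_mod (y - (m + 8)) 4
    have hcases : ∀ r < 4, ∃ α β : Bool, 2 * α.toNat + β.toNat = r := by decide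
    obtain ⟨α, β, hαβ⟩ := hcases _ hr
    exact ⟨.corner α β ⟨_, ha⟩, show m + 8 + 2 * α.toNat + β.toNat + 4 * _ = y by simp only; omega⟩
  obtain ⟨s, hs⟩ := hslot
  refine ⟨.inr (finFunctionFinEquiv.symm ⟨z, hzlt⟩, s), ?_⟩
  simp only [label, Equiv.apply_symm_apply, hs]
  rw [mul_comm] at hdiv
  omega

/-- The numbering of the elements of the simulating matroid. -/
noncomputable def eltEquiv (m n : ℕ) : Elt m n ≃ Fin (eltCount m n) :=
  Equiv.ofBijective (fun x => ⟨label x, label_lt x⟩)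
    ⟨fun _ _ h => label_injective (Fin.ext_iff.1 h), fun y =>
      let ⟨x, hx⟩ := label_surjective y.2
      ⟨x, Fin.ext hx⟩⟩

theorem val_eltEquiv {m n : ℕ} (x : Elt m n) : (eltEquiv m n x : ℕ) = label x := rfl

namespace AbstractOrderType

variable {m n : ℕ} (O : AbstractOrderType (m + 2) n)

/-- The elements `l j` of a tuple. -/
def lList (t : Fin (m + 2) → Fin n) : List (Elt m n) :=
  List.ofFn fun j : Fin m => .inr (t, .l j)

/-- The elements of the hyperplane at infinity. -/
def infinityList (m n : ℕ) : List (Elt m n) :=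
  (tuples n (m + 2)).flatMap fun t => lList t ++
    ([.inr (t, .g), .inr (t, .i false), .inr (t, .i true)] ++
      (finDown n).map fun a => .inr (t, .corner true true a))

open Classical in
/-- The elements of the hyperplane of a tuple. -/
noncomputable def flatList (t : Fin (m + 2) → Fin n) : List (Elt m n) :=
  ((finDown n).filter fun a => O.side t a = 0).map .inl ++ (lList t ++
    ([.inr (t, .g), .inr (t, .c false), .inr (t, .c true)] ++
      (finDown n).map fun a => .inr (t, .corner false false a)))

/-- The lines of the quadrilateral that determines `q (-1)`. -/
def harmonicLists (t : Fin (m + 2) → Fin n) : List (List (Elt m n)) :=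
  [lList t ++ [.inr (t, .c false), .inr (t, .i false), .inr (t, .q 1)],
    lList t ++ [.inr (t, .c true), .inr (t, .i true), .inr (t, .q 1)],
    lList t ++ [.inr (t, .c false), .inr (t, .i true), .inr (t, .q (-1))],
    lList t ++ [.inr (t, .c true), .inr (t, .i false), .inr (t, .q (-1))]]

/-- The lines of the quadrilateral that relates `a` to `q (±1)`. Each element of a parallel class
gets lists of its own, with the auxiliary elements of the representative of the class. -/
noncomputable def cornerLists (t : Fin (m + 2) → Fin n) (a : Fin n) : List (List (Elt m n)) :=
  let c α β : Elt m n := .inr (t, .corner α β (O.rep a))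
  let q : Elt m n := .inr (t, .q (O.side t (O.rep a)))
  [lList t ++ [.inl a, c false false, c true false],
    lList t ++ [.inl a, c false true, c true true],
    lList t ++ [q, c false false, c false true],
    lList t ++ [q, c true false, c true true],
    lList t ++ [.inr (t, .g), c true false, c false true]]

open Classical in
/-- The lists of elements in the hyperplanes that belong to a tuple. -/
noncomputable def blockLists (t : Fin (m + 2) → Fin n) : List (List (Elt m n)) :=
  O.flatList t :: (harmonicLists t ++ (finDown n).flatMap fun a =>
    if O.side t (O.rep a) ≠ 0 then O.cornerLists t a else [])

open Classical in
/-- The constraints that describe the simulating matroid: those for the dependent sets of the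
underlying matroid, and those for the prescribed hyperplanes. -/
noncomputable def constraintList : List (ℕ × List (Elt m n)) :=
  ((List.range (m + 3)).flatMap fun s => (tuples n (s + 1)).flatMap fun z =>
    if Function.Injective z ∧ O.matroid.Indep (Set.range z) then []
    else [(s, List.ofFn fun j => .inl (z j))]) ++
  ((m + 2, infinityList m n) :: (tuples n (m + 2)).flatMap fun t =>
    if O.Canonical t then (O.blockLists t).map fun l => (m + 2, l) else [])

/-- The description of the simulating matroid. -/
noncomputable def code : MatroidCode where
  size := eltCount m n
  infinity := (infinityList m n).map label
  constraints := O.constraintList.map fun p => (p.1, p.2.map label)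

end AbstractOrderType

namespace AbstractOrderType

variable {m n : ℕ} (O : AbstractOrderType (m + 2) n)

theorem mem_lList {t : Fin (m + 2) → Fin n} {x : Elt m n} :
    x ∈ lList t ↔ ∃ j, x = .inr (t, .l j) := by
  simp [lList, List.mem_ofFn, eq_comm]

theorem mem_infinityList {x : Elt m n} : x ∈ infinityList m n ↔ x ∈ O.planeSet .infinity := by
  simp only [infinityList, List.mem_flatMap, List.mem_append, mem_lList, List.mem_cons,
    List.mem_map, mem_finDown, mem_tuples, true_and, List.not_mem_nil, or_false]
  constructor
  · rintro ⟨t, ⟨j, rfl⟩ | (rfl | rfl | rfl) | ⟨a, rfl⟩⟩ <;> simp [planeSet, Aux.AtInfinity]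
  · rcases x with e | ⟨t, j | _ | b | b | s | ⟨α, β, a⟩⟩ <;> intro h <;>
      simp only [planeSet, Set.mem_ofPred_eq, Sum.elim_inl, Sum.elim_inr, Aux.AtInfinity] at h
    · exact ⟨t, by simp⟩
    · exact ⟨t, by simp⟩
    · exact ⟨t, by cases b <;> simp⟩
    · exact ⟨t, by simp [h.1, h.2]⟩

theorem mem_flatList {t : Fin (m + 2) → Fin n} {x : Elt m n} :
    x ∈ O.flatList t ↔ x ∈ O.planeSet (.flat t) := by
  simp only [flatList, List.mem_append, mem_lList, List.mem_cons,
    List.mem_map, List.mem_filter, mem_finDown, true_and, List.not_mem_nil, or_false,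
    decide_eq_true_eq]
  constructor
  · rintro (⟨a, ha, rfl⟩ | ⟨j, rfl⟩ | (rfl | rfl | rfl) | ⟨a, rfl⟩) <;> simp [planeSet, Aux.OnFlat]
    exact ha
  · rcases x with e | ⟨t', j | _ | b | b | s | ⟨α, β, a⟩⟩ <;> intro h <;>
      simp only [planeSet, Set.mem_ofPred_eq, Sum.elim_inl, Sum.elim_inr, Aux.OnFlat, and_true,
        and_false] at h
    · exact Or.inl ⟨e, h, rfl⟩
    · subst h; simp
    · subst h; simp
    · subst h; cases b <;> simp
    · obtain ⟨rfl, rfl, rfl⟩ := h; simp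

theorem exists_plane_of_mem_blockLists {t : Fin (m + 2) → Fin n} (ht : O.Canonical t)
    {l : List (Elt m n)} (hl : l ∈ O.blockLists t) :
    ∃ P, O.PlaneValid P ∧ ∀ x ∈ l, x ∈ O.planeSet P := by
  classical
  simp only [blockLists, harmonicLists, List.mem_cons, List.mem_append, List.not_mem_nil, or_false,
    List.mem_flatMap, mem_finDown, true_and] at hl
  rcases hl with rfl | (rfl | rfl | rfl | rfl) | ⟨a, hl⟩
  · exact ⟨.flat t, ht, fun x hx => O.mem_flatList.1 hx⟩
  · refine ⟨.harmonic t false false, ht, fun x hx => ?_⟩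
    simp only [List.mem_append, mem_lList, List.mem_cons, List.not_mem_nil, or_false] at hx
    rcases hx with ⟨j, rfl⟩ | rfl | rfl | rfl <;> simp [planeSet, Aux.OnHarmonic]
  · refine ⟨.harmonic t true true, ht, fun x hx => ?_⟩
    simp only [List.mem_append, mem_lList, List.mem_cons, List.not_mem_nil, or_false] at hx
    rcases hx with ⟨j, rfl⟩ | rfl | rfl | rfl <;> simp [planeSet, Aux.OnHarmonic]
  · refine ⟨.harmonic t false true, ht, fun x hx => ?_⟩
    simp only [List.mem_append, mem_lList, List.mem_cons, List.not_mem_nil, or_false] at hx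
    rcases hx with ⟨j, rfl⟩ | rfl | rfl | rfl <;> simp [planeSet, Aux.OnHarmonic]
  · refine ⟨.harmonic t true false, ht, fun x hx => ?_⟩
    simp only [List.mem_append, mem_lList, List.mem_cons, List.not_mem_nil, or_false] at hx
    rcases hx with ⟨j, rfl⟩ | rfl | rfl | rfl <;> simp [planeSet, Aux.OnHarmonic]
  · by_cases ha : O.side t (O.rep a) = 0
    · rw [if_neg (by simpa using ha)] at hl; cases hl
    rw [if_pos ha] at hl
    have hv : O.Canonical t ∧ O.rep (O.rep a) = O.rep a ∧ O.side t (O.rep a) ≠ 0 :=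
      ⟨ht, O.rep_rep a, ha⟩
    simp only [cornerLists, List.mem_cons, List.not_mem_nil, or_false] at hl
    have hpar := (O.parallel_rep a).symm
    rcases hl with rfl | rfl | rfl | rfl | rfl
    · refine ⟨.row t (O.rep a) false, hv, fun x hx => ?_⟩
      simp only [List.mem_append, mem_lList, List.mem_cons, List.not_mem_nil, or_false] at hx
      rcases hx with ⟨j, rfl⟩ | rfl | rfl | rfl <;> simp [planeSet, Aux.OnRow, hpar]
    · refine ⟨.row t (O.rep a) true, hv, fun x hx => ?_⟩
      simp only [List.mem_append, mem_lList, List.mem_cons, List.not_mem_nil, or_false] at hx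
      rcases hx with ⟨j, rfl⟩ | rfl | rfl | rfl <;> simp [planeSet, Aux.OnRow, hpar]
    · refine ⟨.column t (O.rep a) false, hv, fun x hx => ?_⟩
      simp only [List.mem_append, mem_lList, List.mem_cons, List.not_mem_nil, or_false] at hx
      rcases hx with ⟨j, rfl⟩ | rfl | rfl | rfl <;> simp [planeSet, Aux.OnColumn]
    · refine ⟨.column t (O.rep a) true, hv, fun x hx => ?_⟩
      simp only [List.mem_append, mem_lList, List.mem_cons, List.not_mem_nil, or_false] at hx
      rcases hx with ⟨j, rfl⟩ | rfl | rfl | rfl <;> simp [planeSet, Aux.OnColumn]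
    · refine ⟨.diagonal t (O.rep a), hv, fun x hx => ?_⟩
      simp only [List.mem_append, mem_lList, List.mem_cons, List.not_mem_nil, or_false] at hx
      rcases hx with ⟨j, rfl⟩ | rfl | rfl | rfl <;> simp [planeSet, Aux.OnDiagonal]

theorem mem_blockLists_of_cornerLists {t : Fin (m + 2) → Fin n} {a : Fin n}
    (ha : O.side t (O.rep a) ≠ 0) {l : List (Elt m n)} (hl : l ∈ O.cornerLists t a) :
    l ∈ O.blockLists t := by
  classical
  simp only [blockLists, List.mem_cons, List.mem_append, List.mem_flatMap, mem_finDown, true_and]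
  exact Or.inr (Or.inr ⟨a, by rwa [if_pos ha]⟩)

/-- The listed sets impose all constraints. A set that is independent in the order type contains at
most one of several parallel elements, so that each of these may have a row list of its own. -/
theorem exists_mem_blockLists {P : Plane m n} (hP : O.PlaneValid P) {t : Fin (m + 2) → Fin n}
    (ht : P.block = some t) {I : Set (Elt m n)} (hI : O.matroid.Indep (Sum.inl ⁻¹' I))
    (hIP : I ⊆ O.planeSet P) : O.Canonical t ∧ ∃ l ∈ O.blockLists t, ∀ x ∈ I, x ∈ l := by
  classical
  cases P <;> simp only [Plane.block, reduceCtorEq, Option.some.injEq] at ht <;> subst ht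
  case flat t =>
    exact ⟨hP, O.flatList t, by simp [blockLists], fun x hx => O.mem_flatList.2 (hIP hx)⟩
  case harmonic t x y =>
    refine ⟨hP, lList t ++ [.inr (t, .c x), .inr (t, .i y), .inr (t, .q (if x = y then 1 else -1))],
      ?_, fun z hz => ?_⟩
    · cases x <;> cases y <;> simp [blockLists, harmonicLists]
    · have hz := hIP hz
      rcases z with e | ⟨t', s⟩
      · exact hz.elim
      · obtain ⟨rfl, hz⟩ := hz
        cases s <;> simp only [Aux.OnHarmonic] at hz <;> simp [mem_lList, hz]
  case row t a β =>
    obtain ⟨htc, hrep, ha⟩ := hP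
    obtain ⟨e, he, hIe⟩ : ∃ e, O.Parallel a e ∧ ∀ e', Sum.inl e' ∈ I → e' = e := by
      by_cases h : ∃ e, Sum.inl e ∈ I
      · obtain ⟨e, he⟩ := h
        exact ⟨e, hIP he, fun e' he' =>
          O.subsingleton_of_parallel hI (fun b hb => hIP hb) he' he⟩
      · exact ⟨a, (O.parallel_iff (by omega) a a).2 (Or.inl rfl), fun e' he' => (h ⟨e', he'⟩).elim⟩
    have hre : O.rep e = a := by rw [← O.rep_eq_of_parallel he, hrep]
    refine ⟨htc, lList t ++ [.inl e, .inr (t, .corner false β a), .inr (t, .corner true β a)],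
      O.mem_blockLists_of_cornerLists (a := e) (by rwa [hre]) ?_, fun z hz => ?_⟩
    · cases β <;> simp [cornerLists, hre]
    · have hzP := hIP hz
      rcases z with e' | ⟨t', s⟩
      · simp [hIe e' hz]
      · obtain ⟨rfl, hs⟩ := hzP
        cases s <;> simp only [Aux.OnRow] at hs
        · simp [mem_lList]
        · rename_i α β' a'
          obtain ⟨rfl, rfl⟩ := hs
          cases α <;> simp
  case column t a α =>
    obtain ⟨htc, hrep, ha⟩ := hP
    refine ⟨htc, lList t ++ [.inr (t, .q (O.side t a)), .inr (t, .corner α false a),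
      .inr (t, .corner α true a)],
      O.mem_blockLists_of_cornerLists (a := a) (by rwa [hrep]) ?_, fun z hz => ?_⟩
    · cases α <;> simp [cornerLists, hrep]
    · have hzP := hIP hz
      rcases z with e' | ⟨t', s⟩
      · exact hzP.elim
      · obtain ⟨rfl, hs⟩ := hzP
        cases s <;> simp only [Aux.OnColumn] at hs
        · simp [mem_lList]
        · simp [hs]
        · rename_i α' β a'
          obtain ⟨rfl, rfl⟩ := hs
          cases β <;> simp
  case diagonal t a =>
    obtain ⟨htc, hrep, ha⟩ := hP
    refine ⟨htc, lList t ++ [.inr (t, .g), .inr (t, .corner true false a),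
      .inr (t, .corner false true a)],
      O.mem_blockLists_of_cornerLists (a := a) (by rwa [hrep]) ?_, fun z hz => ?_⟩
    · simp [cornerLists, hrep]
    · have hzP := hIP hz
      rcases z with e' | ⟨t', s⟩
      · exact hzP.elim
      · obtain ⟨rfl, hs⟩ := hzP
        cases s <;> simp only [Aux.OnDiagonal] at hs
        · simp [mem_lList]
        · simp
        · rename_i α β a'
          obtain ⟨hs, rfl⟩ := hs
          cases α <;> cases β <;> simp at hs ⊢

theorem setOf_mem_ofFn {s : ℕ} (z : Fin s → Fin n) :
    {x : Elt m n | x ∈ List.ofFn fun j => (Sum.inl (z j) : Elt m n)} = Sum.inl '' Set.range z := by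
  ext x
  simp [List.mem_ofFn]

/-- The constraints describe the simulating matroid. -/
theorem simulation_indep_iff_constraintList (I : Set (Elt m n)) : O.simulation.Indep I ↔
    I.ncard ≤ m + 3 ∧ ∀ p ∈ O.constraintList, (I ∩ {x | x ∈ p.2}).ncard ≤ p.1 := by
  classical
  rw [simulation_indep_iff]
  constructor
  · rintro ⟨h1, h2, h3⟩
    refine ⟨h2, fun p hp => ?_⟩
    have hplane : ∀ l : List (Elt m n), (∃ P, O.PlaneValid P ∧ ∀ x ∈ l, x ∈ O.planeSet P) →
        (I ∩ {x | x ∈ l}).ncard ≤ m + 2 := by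
      rintro l ⟨P, hP, hl⟩
      by_contra hcon
      have h4 : I ∩ {x | x ∈ l} = I :=
        Set.eq_of_subset_of_ncard_le Set.inter_subset_left (by omega) (Set.toFinite _)
      have h5 := h3 P hP fun x hx => hl x (Set.inter_eq_left.1 h4 hx)
      rw [h4] at hcon
      omega
    simp only [constraintList, List.mem_append, List.mem_flatMap, List.mem_range, List.mem_cons,
      mem_tuples, true_and] at hp
    rcases hp with ⟨s, hs, z, hz⟩ | rfl | ⟨t, ht⟩
    · split_ifs at hz with hzi
      · cases hz
      · rw [List.mem_singleton] at hz
        subst hz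
        by_contra hcon
        simp only [setOf_mem_ofFn, not_le] at hcon
        have hr : (Set.range z).ncard ≤ s + 1 := by
          have := Set.ncard_image_le (f := z) (s := Set.univ) (Set.toFinite _)
          simpa [Set.image_univ] using this
        have hc : (Sum.inl '' Set.range z : Set (Elt m n)).ncard = (Set.range z).ncard :=
          Set.ncard_image_of_injective _ Sum.inl_injective
        have heq : I ∩ Sum.inl '' Set.range z = Sum.inl '' Set.range z :=
          Set.eq_of_subset_of_ncard_le Set.inter_subset_right (by omega) (Set.toFinite _)
        rw [heq, hc] at hcon
        refine hzi ⟨?_, h1.subset ?_⟩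
        · rw [← Set.injOn_univ, ← Set.ncard_image_iff (Set.toFinite _), Set.image_univ]
          simp only [Set.ncard_univ, Nat.card_eq_fintype_card, Fintype.card_fin]
          omega
        · intro e he
          exact Set.inter_eq_right.1 heq ⟨e, he, rfl⟩
    · exact hplane _ ⟨.infinity, trivial, fun x hx => O.mem_infinityList.1 hx⟩
    · split_ifs at ht with htc
      · obtain ⟨l, hl, rfl⟩ := List.mem_map.1 ht
        exact hplane l (O.exists_plane_of_mem_blockLists htc hl)
      · cases ht
  · rintro ⟨h2, h3⟩
    have h1 : O.matroid.Indep (Sum.inl ⁻¹' I) := by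
      by_contra hcon
      set X : Set (Fin n) := Sum.inl ⁻¹' I with hX
      have hXI : Sum.inl '' X ⊆ I := Set.image_preimage_subset _ _
      have hcX : (Sum.inl '' X : Set (Elt m n)).ncard = X.ncard :=
        Set.ncard_image_of_injective _ Sum.inl_injective
      have hle := (Set.ncard_le_ncard hXI (Set.toFinite _)).trans h2
      rw [hcX] at hle
      have hpos : X.ncard ≠ 0 := fun h => hcon (by
        rw [(Set.ncard_eq_zero (Set.toFinite _)).1 h]; exact O.matroid.empty_indep)
      obtain ⟨s, hs⟩ := Nat.exists_eq_succ_of_ne_zero hpos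
      obtain ⟨z⟩ : Nonempty (Fin (s + 1) ≃ X) := by
        rw [← Nat.card_coe_set_eq] at hs
        exact ⟨(Finite.equivFinOfCardEq hs).symm⟩
      have hr : Set.range (fun i => (z i : Fin n)) = X := by
        rw [← Function.comp_def Subtype.val z, Set.range_comp, z.range_eq_univ]; simp
      have hmem : (s, List.ofFn fun j => (Sum.inl (z j : Fin n) : Elt m n)) ∈ O.constraintList := by
        refine List.mem_append_left _ (List.mem_flatMap.2 ⟨s, List.mem_range.2 (by omega),
          List.mem_flatMap.2 ⟨fun i => z i, mem_tuples _, ?_⟩⟩)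
        rw [if_neg (by rw [hr]; exact fun h => hcon h.2)]
        exact List.mem_singleton_self _
      have h4 := h3 _ hmem
      simp only at h4
      rw [setOf_mem_ofFn (fun i => (z i : Fin n)), hr, Set.inter_eq_right.2 hXI, hcX] at h4
      omega
    refine ⟨h1, h2, fun P hP hIP => ?_⟩
    obtain ⟨l, hl, hIl⟩ : ∃ l, (m + 2, l) ∈ O.constraintList ∧ ∀ x ∈ I, x ∈ l := by
      rcases hb : P.block with _ | t
      · cases P <;> simp only [Plane.block, reduceCtorEq] at hb
        exact ⟨_, List.mem_append_right _ (List.mem_cons_self),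
          fun x hx => O.mem_infinityList.2 (hIP hx)⟩
      · obtain ⟨ht, l, hl, hIl⟩ := O.exists_mem_blockLists hP hb h1 hIP
        refine ⟨l, List.mem_append_right _ (List.mem_cons_of_mem _
          (List.mem_flatMap.2 ⟨t, mem_tuples t, ?_⟩)), hIl⟩
        rw [if_pos ht]
        exact List.mem_map_of_mem hl
    have h4 := h3 _ hl
    rw [Set.inter_eq_left.2 (show I ⊆ {x | x ∈ l} from hIl)] at h4
    exact Nat.lt_succ_of_le h4

theorem mapEquiv_simulation_indep_iff (I : Finset (Fin (eltCount m n))) :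
    (O.simulation.mapEquiv (eltEquiv m n)).Indep (I : Set (Fin (eltCount m n))) ↔
      I.card ≤ m + 3 ∧ ∀ p ∈ O.constraintList.map fun p => (p.1, p.2.map label),
        (I.filter fun e : Fin (eltCount m n) => (e : ℕ) ∈ p.2).card ≤ p.1 := by
  have himg : ∀ J : Set (Fin (eltCount m n)), ((eltEquiv m n).symm '' J).ncard = J.ncard :=
    fun J => Set.ncard_image_of_injective _ (eltEquiv m n).symm.injective
  rw [Matroid.mapEquiv_indep_iff, simulation_indep_iff_constraintList, himg]
  refine and_congr (by rw [Set.ncard_coe_finset]) ?_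
  simp only [List.forall_mem_map]
  refine forall₂_congr fun p _ => ?_
  rw [← Set.ncard_coe_finset, ← himg]
  have : (eltEquiv m n).symm '' (↑(I.filter fun e : Fin (eltCount m n) =>
      (e : ℕ) ∈ p.2.map label) : Set (Fin (eltCount m n))) =
      (eltEquiv m n).symm '' (I : Set (Fin (eltCount m n))) ∩ {x | x ∈ p.2} := by
    ext x
    simp only [Set.mem_image, Finset.coe_filter, Set.mem_ofPred_eq, Set.mem_inter_iff,
      Finset.mem_coe, List.mem_map]
    constructor
    · rintro ⟨e, ⟨he, y, hy, hye⟩, rfl⟩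
      have : y = (eltEquiv m n).symm e := by
        rw [Equiv.eq_symm_apply]; exact Fin.ext hye
      exact ⟨⟨e, he, rfl⟩, this ▸ hy⟩
    · rintro ⟨⟨e, he, rfl⟩, hx⟩
      refine ⟨e, ⟨he, _, hx, ?_⟩, rfl⟩
      rw [← val_eltEquiv, Equiv.apply_symm_apply]
  exact (congrArg (fun J => Set.ncard J ≤ p.1) this).symm.to_iff

/-- The description is correct. -/
theorem code_describes : O.code.Describes (m + 3) (O.simulation.mapEquiv (eltEquiv m n))
    (eltEquiv m n '' O.planeSet .infinity) where
  infinity_lt a ha := by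
    obtain ⟨x, -, rfl⟩ := List.mem_map.1 ha
    exact label_lt x
  mem_infinity_iff e := by
    constructor
    · rintro ⟨x, hx, rfl⟩
      exact List.mem_map_of_mem (O.mem_infinityList.2 hx)
    · intro he
      obtain ⟨x, hx, hxe⟩ := List.mem_map.1 he
      exact ⟨x, O.mem_infinityList.1 hx, Fin.ext hxe⟩
  constraint_lt p hp a ha := by
    obtain ⟨q, -, rfl⟩ := List.mem_map.1 hp
    obtain ⟨x, -, rfl⟩ := List.mem_map.1 ha
    exact label_lt x
  indep_iff := O.mapEquiv_simulation_indep_iff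

end AbstractOrderType

/-! ### Expressions for tuples, signs and representatives -/

namespace RAM

theorem sum_range_eq_sum_down (f : ℕ → ℕ) (c : ℕ) :
    ∑ x ∈ Finset.range c, f x = ((down c).map f).sum := by
  induction c with
  | zero => rfl
  | succ c ih => rw [Finset.sum_range_succ, ih, down, List.map_cons, List.sum_cons, add_comm]

namespace Expr

/-- The variables from the `i`-th one on. -/
def vars (s i : ℕ) (j : Fin s) : Expr := var (i + j)

/-- The value `∑ j, f j * size ^ j`, i.e. the position of the tuple with entries `f j`. -/
def index : {s : ℕ} → (Fin s → Expr) → Expr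
  | 0, _ => const 0
  | _ + 1, f => add (f 0) (mul size (index fun j => f j.succ))

/-- The sum of finitely many expressions. -/
def total : {s : ℕ} → (Fin s → Expr) → Expr
  | 0, _ => const 0
  | _ + 1, f => add (f 0) (total fun j => f j.succ)

/-- The power `size ^ s`. -/
def sizePow : ℕ → Expr
  | 0 => const 1
  | s + 1 => mul (sizePow s) size

/-- `1` if the value is zero, otherwise `0`. -/
def isZero (e : Expr) : Expr := sub (const 1) e

/-- The sum over all tuples of `s` new variables. -/
def sums : ℕ → Expr → Expr
  | 0, e => e
  | s + 1, e => sum (sums s e)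

/-- The sign of a tuple, from the table that follows the number `size` in the memory. -/
def chi {s : ℕ} (f : Fin s → Expr) : Expr := read (add (const 1) (index f))

/-- The side of a tuple on which an element lies. -/
def side {s : ℕ} (f : Fin s → Expr) (e : Expr) : Expr := chi (Fin.snoc (α := fun _ => Expr) f e)

/-- The address of an entry in the table that follows the table of the signs of `k`-tuples. -/
def address (k : ℕ) (e : Expr) : Expr := add (add (sizePow k) (const 1)) e

/-- The first element that is parallel to the variable `0`. -/
def rep (m : ℕ) : Expr := find (isZero (sums (m + 1) (chi (vars (m + 3) 0))))

variable {n : ℕ} {μ : ℕ → ℕ} {ε : List ℕ}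

theorem eval_vars_cons {s i x : ℕ} (j : Fin s) :
    (vars s (i + 1) j).eval n μ (x :: ε) = (vars s i j).eval n μ ε := by
  simp only [vars, eval]
  rw [Nat.add_right_comm, List.getD_cons_succ]

theorem eval_vars_digits {s : ℕ} (t : Fin s → Fin n) (j : Fin s) :
    (vars s 0 j).eval n μ (digits t) = t j := by
  simp only [vars, eval, zero_add, digits]
  rw [List.getD_eq_getElem _ _ (by simp)]
  simp

theorem eval_index {s : ℕ} {f : Fin s → Expr} {t : Fin s → Fin n}
    (h : ∀ j, (f j).eval n μ ε = t j) : (index f).eval n μ ε = finFunctionFinEquiv t := by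
  rw [finFunctionFinEquiv_apply]
  induction s with
  | zero => simp [index, eval]
  | succ s ih =>
    simp only [index, eval]
    have := ih (f := fun j => f j.succ) (t := fun j => t j.succ) (fun j => h j.succ)
    rw [this, h, Fin.sum_univ_succ, Finset.mul_sum]
    simp only [Fin.val_zero, pow_zero, mul_one, Fin.val_succ, pow_succ]
    congr 1
    exact Finset.sum_congr rfl fun j _ => by ring

theorem eval_total {s : ℕ} (f : Fin s → Expr) :
    (total f).eval n μ ε = ∑ j, (f j).eval n μ ε := by
  induction s with
  | zero => rfl
  | succ s ih => rw [Fin.sum_univ_succ, total, eval, ih]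

theorem eval_sizePow (s : ℕ) : (sizePow s).eval n μ ε = n ^ s := by
  induction s with
  | zero => rfl
  | succ s ih => rw [sizePow, eval, ih, pow_succ]; rfl

theorem eval_isZero_ne_zero_iff (e : Expr) :
    (isZero e).eval n μ ε ≠ 0 ↔ e.eval n μ ε = 0 := by
  simp only [isZero, eval]
  omega

theorem eval_sums_eq_zero_iff (s : ℕ) (e : Expr) : (sums s e).eval n μ ε = 0 ↔
    ∀ y : Fin s → Fin n, e.eval n μ (digits y ++ ε) = 0 := by
  induction s generalizing ε with
  | zero => simp [sums, digits]
  | succ s ih =>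
    rw [sums, eval, Finset.sum_eq_zero_iff]
    constructor
    · intro h y
      rw [← Fin.snoc_init_self y, digits_snoc, List.append_assoc]
      exact ih.1 (h _ (Finset.mem_range.2 (y (Fin.last s)).2)) (Fin.init y)
    · intro h x hx
      refine ih.2 fun y => ?_
      have := h (Fin.snoc (α := fun _ => Fin n) y ⟨x, Finset.mem_range.1 hx⟩)
      rwa [digits_snoc, List.append_assoc] at this

theorem depth_index_le {s D : ℕ} {f : Fin s → Expr} (h : ∀ j, (f j).depth ≤ D) :
    (index f).depth ≤ D := by
  induction s with
  | zero => exact Nat.zero_le D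
  | succ s ih => exact max_le (h 0) (max_le (Nat.zero_le D) (ih fun j => h j.succ))

theorem depth_total_le {s D : ℕ} {f : Fin s → Expr} (h : ∀ j, (f j).depth ≤ D) :
    (total f).depth ≤ D := by
  induction s with
  | zero => exact Nat.zero_le D
  | succ s ih => exact max_le (h 0) (ih fun j => h j.succ)

theorem depth_sizePow (s : ℕ) : (sizePow s).depth = 0 := by
  induction s with
  | zero => rfl
  | succ s ih => simp [sizePow, depth, ih]

theorem depth_isZero (e : Expr) : (isZero e).depth = e.depth := by simp [isZero, depth]

theorem depth_sums (s : ℕ) (e : Expr) : (sums s e).depth = e.depth + s := by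
  induction s with
  | zero => rfl
  | succ s ih => rw [sums, depth, ih]; rfl

theorem depth_chi {s : ℕ} {f : Fin s → Expr} (h : ∀ j, (f j).depth = 0) : (chi f).depth = 0 := by
  have := depth_index_le (D := 0) fun j => (h j).le
  simp only [chi, depth]
  omega

theorem depth_side {s : ℕ} {f : Fin s → Expr} {e : Expr} (h : ∀ j, (f j).depth = 0)
    (he : e.depth = 0) : (side f e).depth = 0 := by
  refine depth_chi fun j => ?_
  induction j using Fin.lastCases with
  | last => simpa using he
  | cast j => simpa using h j

theorem depth_address (k : ℕ) (e : Expr) : (address k e).depth = e.depth := by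
  simp [address, depth, depth_sizePow]

theorem depth_rep (m : ℕ) : (rep m).depth = m + 2 := by
  rw [rep, depth, depth_isZero, depth_sums, depth_chi fun _ => rfl]
  omega

theorem eval_address (k : ℕ) (e : Expr) :
    (address k e).eval n μ ε = n ^ k + 1 + e.eval n μ ε := by
  simp [address, eval, eval_sizePow]

end Expr

end RAM

theorem signCode_eq_zero_iff {s : SignType} : signCode s = 0 ↔ s = 0 := by
  revert s; decide

namespace AbstractOrderType

variable {d n : ℕ} (O : AbstractOrderType d n)

/-- The memory `μ` contains the table of the chirotope. -/
def IsStored (μ : ℕ → ℕ) : Prop := ∀ x, μ (1 + finFunctionFinEquiv x) = signCode (O.χ x)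

theorem eval_chi {μ : ℕ → ℕ} (hμ : O.IsStored μ) {ε : List ℕ} {f : Fin (d + 1) → RAM.Expr}
    {x : Fin (d + 1) → Fin n} (h : ∀ j, (f j).eval n μ ε = x j) :
    (RAM.Expr.chi f).eval n μ ε = signCode (O.χ x) := by
  rw [RAM.Expr.chi, RAM.Expr.eval, RAM.Expr.eval, RAM.Expr.eval_index h, RAM.Expr.eval, hμ]

theorem eval_side {μ : ℕ → ℕ} (hμ : O.IsStored μ) {ε : List ℕ} {f : Fin d → RAM.Expr}
    {e : RAM.Expr} {t : Fin d → Fin n} {a : Fin n} (h : ∀ j, (f j).eval n μ ε = t j)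
    (he : e.eval n μ ε = a) : (RAM.Expr.side f e).eval n μ ε = signCode (O.side t a) := by
  refine O.eval_chi hμ fun j => ?_
  induction j using Fin.lastCases with
  | last => simpa using he
  | cast j => simpa using h j

/-- A tuple is independent if and only if it can be extended to a basis. -/
theorem exists_digits_append_iff {r s : ℕ} (h : r + s = d + 1) (z : Fin s → Fin n) :
    (∃ (y : Fin r → Fin n) (x : Fin (d + 1) → Fin n), digits x = digits y ++ digits z ∧ O.χ x ≠ 0) ↔
      Function.Injective z ∧ O.matroid.Indep (Set.range z) := by
  constructor
  · rintro ⟨y, x, hxy, hx⟩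
    obtain ⟨hinj, hind⟩ := (O.chi_ne_zero_iff x).1 hx
    rw [← nodup_digits, hxy] at hinj
    refine ⟨nodup_digits.1 (List.nodup_append.1 hinj).2.1, hind.subset fun e he => ?_⟩
    rw [← mem_digits, hxy]
    exact List.mem_append_right _ (mem_digits.2 he)
  · rintro ⟨hinj, hind⟩
    obtain ⟨B, hB, hzB⟩ := hind.exists_isBase_superset
    have hz : (Set.range z).ncard = s := by
      rw [← Set.image_univ, Set.ncard_image_of_injective _ hinj]; simp
    have hc : (B \ Set.range z).ncard = r := by
      rw [Set.ncard_sdiff hzB (Set.toFinite _), O.ncard_of_isBase hB, hz]; omega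
    obtain ⟨φ⟩ : Nonempty (Fin r ≃ (B \ Set.range z : Set (Fin n))) := by
      rw [← Nat.card_coe_set_eq] at hc
      exact ⟨(Finite.equivFinOfCardEq hc).symm⟩
    obtain ⟨x, hx⟩ : ∃ x : Fin (d + 1) → Fin n,
        digits x = digits (fun i => (φ i : Fin n)) ++ digits z := by
      refine exists_digits_eq (by simp [length_digits, h]) fun x hx => ?_
      rcases List.mem_append.1 hx with hx | hx <;>
        · obtain ⟨j, rfl⟩ := (List.mem_ofFn' _ _).1 hx
          exact Fin.isLt _
    refine ⟨_, x, hx, (O.chi_ne_zero_iff x).2 ⟨nodup_digits.1 ?_, hB.indep.subset fun e he => ?_⟩⟩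
    · rw [hx, List.nodup_append]
      refine ⟨nodup_digits.2 (Subtype.val_injective.comp φ.injective), nodup_digits.2 hinj, ?_⟩
      rintro a ha b hb rfl
      obtain ⟨j, rfl⟩ := (List.mem_ofFn' _ _).1 ha
      exact (φ j).2.2 (mem_digits.1 hb)
    · rw [← mem_digits, hx, List.mem_append, mem_digits, mem_digits] at he
      rcases he with ⟨j, rfl⟩ | he
      · exact (φ j).2.1
      · exact hzB he

/-- A tuple is independent if and only if some extension of it is a basis. -/
theorem eval_sums_chi_eq_zero_iff {μ : ℕ → ℕ} (hμ : O.IsStored μ) {r s : ℕ} (h : r + s = d + 1)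
    (z : Fin s → Fin n) :
    (RAM.Expr.sums r (RAM.Expr.chi (RAM.Expr.vars (d + 1) 0))).eval n μ (digits z) = 0 ↔
      ¬ (Function.Injective z ∧ O.matroid.Indep (Set.range z)) := by
  rw [RAM.Expr.eval_sums_eq_zero_iff, ← O.exists_digits_append_iff h z]
  push Not
  refine forall_congr' fun y => ?_
  obtain ⟨x, hx⟩ : ∃ x : Fin (d + 1) → Fin n, digits x = digits y ++ digits z := by
    refine exists_digits_eq (by simp [length_digits, h]) fun x hx => ?_
    rcases List.mem_append.1 hx with hx | hx <;>
      · obtain ⟨j, rfl⟩ := (List.mem_ofFn' _ _).1 hx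
        exact Fin.isLt _
  rw [← hx, O.eval_chi hμ (RAM.Expr.eval_vars_digits x), signCode_eq_zero_iff]
  constructor
  · intro h0 x' hx'
    have : x' = x := by
      funext j
      have := List.ofFn_injective hx'
      exact Fin.ext (congrFun this j)
    rwa [this]
  · exact fun h0 => h0 x rfl

end AbstractOrderType

theorem AbstractOrderType.eval_rep {m n : ℕ} (O : AbstractOrderType (m + 2) n) {μ : ℕ → ℕ}
    (hμ : O.IsStored μ) (a : Fin n) : (RAM.Expr.rep m).eval n μ [(a : ℕ)] = O.rep a := by
  have key : ∀ b : Fin n, (RAM.Expr.isZero (RAM.Expr.sums (m + 1)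
      (RAM.Expr.chi (RAM.Expr.vars (m + 3) 0)))).eval n μ [(b : ℕ), (a : ℕ)] ≠ 0 ↔
        O.Parallel a b := by
    intro b
    have h2 : digits ![b, a] = [(b : ℕ), (a : ℕ)] := by simp [digits]
    rw [RAM.Expr.eval_isZero_ne_zero_iff, ← h2, O.eval_sums_chi_eq_zero_iff hμ (by omega),
      O.parallel_iff (by omega)]
    have hr : Set.range ![b, a] = {a, b} := by
      rw [Matrix.range_cons, Matrix.range_cons, Matrix.range_empty, Set.union_empty, Set.union_comm]
      rfl
    rw [hr, not_and_or, ← nodup_digits, h2]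
    simp [Fin.ext_iff, eq_comm]
  refine RAM.findBelow_eq (O.rep a).2 ((key _).2 (O.parallel_rep a)) fun x hx => ?_
  by_contra h
  exact absurd (O.rep_le ((key ⟨x, hx.trans (O.rep a).2⟩).1 h)) (not_le.2 hx)

/-! ### The program -/

namespace RAM

namespace Stmt

/-- Run finitely many programs one after the other. -/
def seqs : List Stmt → Stmt
  | [] => when (.const 0) (emit (.const 0))
  | s :: l => seq s (seqs l)

/-- Write the values of finitely many expressions. -/
def emits (l : List Expr) : Stmt := seqs (l.map emit)

/-- Run `b` for all tuples of `s` new variables. -/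
def loops : ℕ → Stmt → Stmt
  | 0, b => b
  | s + 1, b => loop (loops s b)

variable {n : ℕ} {μ : ℕ → ℕ} {ε : List ℕ}

theorem eval_seqs (l : List Stmt) : (seqs l).eval n μ ε = l.flatMap fun s => s.eval n μ ε := by
  induction l with
  | nil => simp [seqs, eval, Expr.eval]
  | cons s l ih => rw [seqs, eval, ih, List.flatMap_cons]

theorem eval_emits (l : List Expr) : (emits l).eval n μ ε = l.map fun e => e.eval n μ ε := by
  rw [emits, eval_seqs, List.flatMap_map]
  exact List.flatMap_pure_eq_map _ _

theorem eval_loop (b : Stmt) : (loop b).eval n μ ε =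
    (finDown n).flatMap fun x : Fin n => b.eval n μ ((x : ℕ) :: ε) := by
  rw [eval, ← map_val_finDown, List.flatMap_map]

theorem eval_loops (s : ℕ) (b : Stmt) : (loops s b).eval n μ ε =
    (tuples n s).flatMap fun t => b.eval n μ (digits t ++ ε) := by
  induction s generalizing ε with
  | zero => simp [loops, tuples, digits]
  | succ s ih =>
    rw [loops, eval_loop, tuples, List.flatMap_assoc]
    refine congrArg (fun f => (finDown n).flatMap f) (funext fun x => ?_)
    rw [ih, List.flatMap_map]
    exact congrArg (fun f => (tuples n s).flatMap f)
      (funext fun t => by rw [digits_snoc, List.append_assoc]; rfl)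

theorem depth_seqs_le {D : ℕ} {l : List Stmt} (h : ∀ s ∈ l, s.depth ≤ D) : (seqs l).depth ≤ D := by
  induction l with
  | nil => exact Nat.zero_le D
  | cons s l ih => exact max_le (h s (by simp)) (ih fun s hs => h s (by simp [hs]))

theorem depth_emits_le {D : ℕ} {l : List Expr} (h : ∀ e ∈ l, e.depth ≤ D) :
    (emits l).depth ≤ D :=
  depth_seqs_le fun s hs => by
    obtain ⟨e, he, rfl⟩ := List.mem_map.1 hs
    exact h e he

theorem depth_loops (s : ℕ) (b : Stmt) : (loops s b).depth = b.depth + s := by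
  induction s with
  | zero => rfl
  | succ s ih => rw [loops, depth, ih]; rfl

/-- The label of the auxiliary element of the tuple `f` with the number `s`. -/
def _root_.RAM.Expr.auxLabel (m : ℕ) (f : Fin (m + 2) → Expr) (s : Expr) : Expr :=
  .add (.add .size (.mul (.index f) (.add (.const (m + 8)) (.mul (.const 4) .size)))) s

/-- The number of the element `corner α β e` of a tuple. -/
def _root_.RAM.Expr.cornerSlot (m : ℕ) (α β : Bool) (e : Expr) : Expr :=
  .add (.const (m + 8 + 2 * α.toNat + β.toNat)) (.mul (.const 4) e)

/-- The labels of the elements `l j` of a tuple. -/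
def lLabels (m : ℕ) (f : Fin (m + 2) → Expr) : List Expr :=
  List.ofFn fun j : Fin m => .auxLabel m f (.const j)

/-- Write a constraint for a list of fixed length. -/
def constraint (r : ℕ) (l : List Expr) : Stmt :=
  emits (.const r :: .const l.length :: l)

/-- Write the elements of the hyperplane at infinity. -/
def infinity (m : ℕ) : Stmt :=
  loops (m + 2) (seqs [emits (lLabels m (.vars _ 0) ++ [.auxLabel m (.vars _ 0) (.const m),
      .auxLabel m (.vars _ 0) (.const (m + 3)), .auxLabel m (.vars _ 0) (.const (m + 4))]),
    loop (emit (.auxLabel m (.vars _ 1) (.cornerSlot m true true (.var 0))))])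

/-- The number of elements of the hyperplane at infinity. -/
def infinityLength (m : ℕ) : Expr :=
  .mul (.sizePow (m + 2)) (.add (.const (m + 3)) .size)

/-- Write the constraint for the hyperplane of the tuple in the variables from the `i`-th on. -/
def flat (m i : ℕ) : Stmt :=
  seqs [emits [.const (m + 2), .add (.sum (.isZero (.side (.vars (m + 2) (i + 1)) (.var 0))))
      (.add (.const (m + 3)) .size)],
    loop (when (.isZero (.side (.vars (m + 2) (i + 1)) (.var 0))) (emit (.var 0))),
    emits (lLabels m (.vars _ i) ++ [.auxLabel m (.vars _ i) (.const m),
      .auxLabel m (.vars _ i) (.const (m + 1)), .auxLabel m (.vars _ i) (.const (m + 2))]),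
    loop (emit (.auxLabel m (.vars _ (i + 1)) (.cornerSlot m false false (.var 0))))]

/-- Write the constraint for a tuple `f` and three further elements, given by their numbers. -/
def line (m : ℕ) (f : Fin (m + 2) → Expr) (x y z : Expr) : Stmt :=
  constraint (m + 2) (lLabels m f ++ [x, .auxLabel m f y, .auxLabel m f z])

/-- Write the constraints of the quadrilateral that determines `q (-1)`. -/
def harmonic (m : ℕ) (f : Fin (m + 2) → Expr) : Stmt :=
  seqs [line m f (.auxLabel m f (.const (m + 1))) (.const (m + 3)) (.const (m + 6)),
    line m f (.auxLabel m f (.const (m + 2))) (.const (m + 4)) (.const (m + 6)),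
    line m f (.auxLabel m f (.const (m + 1))) (.const (m + 4)) (.const (m + 7)),
    line m f (.auxLabel m f (.const (m + 2))) (.const (m + 3)) (.const (m + 7))]

/-- Write the constraints that relate the element `a` with representative `r` to `q (±1)`. -/
def corners (m : ℕ) (f : Fin (m + 2) → Expr) (a r : Expr) : Stmt :=
  when (.side f r) (seqs
    [line m f a (.cornerSlot m false false r) (.cornerSlot m true false r),
    line m f a (.cornerSlot m false true r) (.cornerSlot m true true r),
    line m f (.auxLabel m f (.add (.const (m + 5)) (.side f r)))
      (.cornerSlot m false false r) (.cornerSlot m false true r),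
    line m f (.auxLabel m f (.add (.const (m + 5)) (.side f r)))
      (.cornerSlot m true false r) (.cornerSlot m true true r),
    line m f (.auxLabel m f (.const m)) (.cornerSlot m true false r) (.cornerSlot m false true r)])

/-- Write the constraints of the tuple in the variables from the `i`-th on. -/
def block (m i : ℕ) : Stmt :=
  seqs [flat m i, harmonic m (.vars _ i),
    loop (corners m (.vars _ (i + 1)) (.var 0) (.read (.address (m + 3) (.var 0))))]

/-- Zero if and only if the tuple in the variables from the first on is canonical, provided that the
variable `0` does not lie in its hyperplane. -/
def _root_.RAM.Expr.notCanonical (m : ℕ) : Expr :=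
  .add (.total fun j : Fin (m + 1) =>
      .isZero (.sub (.vars (m + 2) 1 j.succ) (.vars (m + 2) 1 j.castSucc)))
    (.total fun j : Fin (m + 2) => .sum (.mul (.sub (.vars (m + 2) 2 j) (.var 0))
      (.mul (.isZero (.side (.vars (m + 2) 2) (.var 0)))
        (.side (Function.update (.vars (m + 2) 2) j (.var 0)) (.var 1)))))

/-- Write the constraints of the tuple in the first variables if it is canonical. -/
def canonicalBlock (m : ℕ) : Stmt :=
  bind (.side (.vars (m + 2) 1) (.var 0)) (when (.side (.vars (m + 2) 1) (.var 0))
    (when (.isZero (.notCanonical m)) (block m 1)))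

/-- Write the constraints for the dependent tuples of length `s + 1`. -/
def dependent (m s : ℕ) : Stmt :=
  loops (s + 1) (when (.isZero (.sums (m + 2 - s) (.chi (.vars (m + 3) 0))))
    (constraint s (List.ofFn (.vars (s + 1) 0))))

/-- Write the description of the simulating matroid. -/
def simulation (m : ℕ) : Stmt :=
  seqs ([emits [.add .size (.mul (.sizePow (m + 2)) (.add (.const (m + 8)) (.mul (.const 4) .size))),
      infinityLength m], infinity m] ++ (List.range (m + 3)).map (dependent m) ++
    [emits [.const (m + 2), infinityLength m], infinity m, loops (m + 2) (canonicalBlock m)])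

theorem depth_auxLabel {m : ℕ} {f : Fin (m + 2) → Expr} {s : Expr} (h : ∀ j, (f j).depth = 0)
    (hs : s.depth = 0) : (Expr.auxLabel m f s).depth = 0 := by
  have := Expr.depth_index_le (D := 0) fun j => (h j).le
  simp only [Expr.auxLabel, Expr.depth]
  omega

theorem depth_of_mem_lLabels {m : ℕ} {f : Fin (m + 2) → Expr} (h : ∀ j, (f j).depth = 0) :
    ∀ e ∈ lLabels m f, e.depth = 0 := by
  intro e he
  obtain ⟨j, rfl⟩ := (List.mem_ofFn' _ _).1 he
  exact depth_auxLabel h rfl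

theorem depth_line {m : ℕ} {f : Fin (m + 2) → Expr} {x y z : Expr} (h : ∀ j, (f j).depth = 0)
    (hx : x.depth = 0) (hy : y.depth = 0) (hz : z.depth = 0) : (line m f x y z).depth = 0 := by
  refine Nat.le_zero.1 (depth_emits_le fun e he => ?_)
  simp only [List.mem_cons, List.mem_append, List.not_mem_nil, or_false] at he
  rcases he with rfl | rfl | he | rfl | rfl | rfl
  · exact le_rfl
  · exact le_rfl
  · exact (depth_of_mem_lLabels h e he).le
  · exact hx.le
  · exact (depth_auxLabel h hy).le
  · exact (depth_auxLabel h hz).le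

theorem depth_infinity_le (m : ℕ) : (infinity m).depth ≤ m + 3 := by
  have h1 : ∀ (i : ℕ) (e : Expr), e.depth = 0 → (Expr.auxLabel m (.vars _ i) e).depth = 0 :=
    fun i e he => depth_auxLabel (fun _ => rfl) he
  rw [infinity, depth_loops]
  have : ∀ b : Stmt, b.depth ≤ 1 → b.depth + (m + 2) ≤ m + 3 := fun b hb => by omega
  refine this _ (depth_seqs_le ?_)
  simp only [List.forall_mem_cons, List.not_mem_nil, false_imp_iff, implies_true, and_true]
  refine ⟨depth_emits_le fun e he => ?_, ?_⟩
  · simp only [List.mem_append, List.mem_cons, List.not_mem_nil, or_false] at he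
    rcases he with he | rfl | rfl | rfl
    · exact (depth_of_mem_lLabels (fun _ => rfl) e he).le.trans (Nat.zero_le 1)
    all_goals exact (h1 _ _ rfl).le.trans (Nat.zero_le 1)
  · rw [depth, depth, h1 _ _ rfl]

theorem depth_block_le (m i : ℕ) : (block m i).depth ≤ 1 := by
  have h1 : ∀ (i : ℕ) (e : Expr), e.depth = 0 → (Expr.auxLabel m (.vars _ i) e).depth = 0 :=
    fun i e he => depth_auxLabel (fun _ => rfl) he
  have h2 : ∀ (i : ℕ) (e : Expr), e.depth = 0 → (Expr.side (.vars (m + 2) i) e).depth = 0 :=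
    fun i e he => Expr.depth_side (fun _ => rfl) he
  have h3 : ∀ i x y z, x.depth = 0 → y.depth = 0 → z.depth = 0 →
      (line m (.vars _ i) x y z).depth = 0 := fun i x y z => depth_line fun _ => rfl
  have h4 : ∀ α β e, e.depth = 0 → (Expr.cornerSlot m α β e).depth = 0 := fun α β e he => by
    simp [Expr.cornerSlot, Expr.depth, he]
  refine depth_seqs_le ?_
  simp only [List.forall_mem_cons, List.not_mem_nil, false_imp_iff, implies_true, and_true]
  refine ⟨depth_seqs_le ?_, depth_seqs_le ?_, ?_⟩
  · simp only [List.forall_mem_cons, List.not_mem_nil, false_imp_iff, implies_true, and_true]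
    refine ⟨depth_emits_le ?_, ?_, depth_emits_le fun e he => ?_, ?_⟩
    · simp [Expr.depth, Expr.depth_isZero, h2 _ (.var 0) rfl]
    · simp [depth, Expr.depth, Expr.depth_isZero, h2 _ (.var 0) rfl]
    · simp only [List.mem_append, List.mem_cons, List.not_mem_nil, or_false] at he
      rcases he with he | rfl | rfl | rfl
      · exact (depth_of_mem_lLabels (fun _ => rfl) e he).le.trans (Nat.zero_le 1)
      all_goals exact (h1 _ _ rfl).le.trans (Nat.zero_le 1)
    · rw [depth, depth, h1 _ _ (h4 _ _ _ rfl)]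
  · simp only [List.forall_mem_cons, List.not_mem_nil, false_imp_iff, implies_true, and_true]
    refine ⟨?_, ?_, ?_, ?_⟩ <;> rw [h3 _ _ _ _ (h1 _ _ rfl) rfl rfl] <;> exact Nat.zero_le 1
  · set r : Expr := .read (.address (m + 3) (.var 0)) with hr
    have hr0 : r.depth = 0 := by rw [hr, Expr.depth, Expr.depth_address]; rfl
    have h5 := h2 (i + 1) r hr0
    rw [depth]
    refine Nat.succ_le_succ (max_le (h2 _ _ hr0).le (depth_seqs_le ?_))
    simp only [List.forall_mem_cons, List.not_mem_nil, false_imp_iff, implies_true, and_true]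
    have h6 : (Expr.add (.const (m + 5)) (.side (.vars (m + 2) (i + 1)) r)).depth = 0 := by
      rw [Expr.depth, h5]; rfl
    exact ⟨(h3 _ _ _ _ rfl (h4 _ _ _ hr0) (h4 _ _ _ hr0)).le,
      (h3 _ _ _ _ rfl (h4 _ _ _ hr0) (h4 _ _ _ hr0)).le,
      (h3 _ _ _ _ (h1 _ _ h6) (h4 _ _ _ hr0) (h4 _ _ _ hr0)).le,
      (h3 _ _ _ _ (h1 _ _ h6) (h4 _ _ _ hr0) (h4 _ _ _ hr0)).le,
      (h3 _ _ _ _ (h1 _ _ rfl) (h4 _ _ _ hr0) (h4 _ _ _ hr0)).le⟩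

theorem depth_canonicalBlock_le (m : ℕ) : (canonicalBlock m).depth ≤ 1 := by
  have h2 : ∀ (i : ℕ) (e : Expr), e.depth = 0 → (Expr.side (.vars (m + 2) i) e).depth = 0 :=
    fun i e he => Expr.depth_side (fun _ => rfl) he
  rw [canonicalBlock, depth, depth, depth, Expr.depth, h2 _ _ rfl, Expr.depth_isZero]
  refine max_le le_rfl (max_le (Nat.zero_le 1) (max_le (max_le ?_ ?_) (depth_block_le m 1)))
  · exact Expr.depth_total_le fun j => by rw [Expr.depth_isZero]; exact Nat.zero_le 1
  · refine Expr.depth_total_le fun j => ?_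
    have h3 : (Expr.side (Function.update (Expr.vars (m + 2) 2) j (.var 0)) (.var 1)).depth = 0 := by
      refine Expr.depth_side (fun l => ?_) rfl
      rw [Function.update_apply]
      split_ifs <;> rfl
    simp [Expr.depth, Expr.depth_isZero, h2 _ (.var 0) rfl, h3, Expr.vars]

theorem depth_simulation_le (m : ℕ) : (simulation m).depth ≤ m + 3 := by
  have h0 : (infinityLength m).depth = 0 := by
    simp [infinityLength, Expr.depth, Expr.depth_sizePow]
  refine depth_seqs_le ?_
  simp only [List.forall_mem_append, List.forall_mem_cons, List.not_mem_nil, false_imp_iff,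
    implies_true, and_true, List.forall_mem_map, List.mem_range]
  refine ⟨⟨⟨depth_emits_le ?_, depth_infinity_le m⟩, fun s hs => ?_⟩, depth_emits_le ?_,
    depth_infinity_le m, ?_⟩
  · simp [Expr.depth, Expr.depth_sizePow, h0]
  · rw [dependent, depth_loops, depth, Expr.depth_isZero, Expr.depth_sums,
      Expr.depth_chi fun _ => rfl]
    have h1 : (constraint s (List.ofFn (Expr.vars (s + 1) 0))).depth ≤ 0 :=
      depth_emits_le fun e he => by
        simp only [List.mem_cons] at he
        rcases he with rfl | rfl | he
        · exact le_rfl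
        · exact le_rfl
        · obtain ⟨j, rfl⟩ := (List.mem_ofFn' _ _).1 he
          exact le_rfl
    omega
  · simp [Expr.depth, h0]
  · rw [depth_loops]
    have := depth_canonicalBlock_le m
    omega

end Stmt

end RAM

/-! ### The output of the program -/

/-- A constraint written as a list of numbers. -/
def constraintWords {m n : ℕ} (p : ℕ × List (Elt m n)) : List ℕ :=
  p.1 :: p.2.length :: p.2.map label

open RAM RAM.Stmt in
theorem eval_auxLabel {m n : ℕ} {μ : ℕ → ℕ} {ε : List ℕ} {f : Fin (m + 2) → Expr} {s : Expr}
    {t : Fin (m + 2) → Fin n} {x : Aux m n} (hf : ∀ j, (f j).eval n μ ε = t j)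
    (hs : s.eval n μ ε = x.slot) :
    (Expr.auxLabel m f s).eval n μ ε = label (.inr (t, x) : Elt m n) := by
  simp only [Expr.auxLabel, Expr.eval, Expr.eval_index hf, hs, label]

namespace AbstractOrderType

open RAM RAM.Stmt

variable {m n : ℕ} (O : AbstractOrderType (m + 2) n) {μ : ℕ → ℕ} {ε : List ℕ}
  {f : Fin (m + 2) → Expr} {t : Fin (m + 2) → Fin n}

theorem map_eval_lLabels (hf : ∀ j, (f j).eval n μ ε = t j) :
    (lLabels m f).map (fun e => e.eval n μ ε) = (lList t).map label := by
  rw [lLabels, lList, List.map_ofFn, List.map_ofFn]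
  exact congrArg List.ofFn (funext fun j => eval_auxLabel (x := .l j) hf rfl)

theorem eval_line (hf : ∀ j, (f j).eval n μ ε = t j) {x y z : Expr} {x' : Elt m n}
    {y' z' : Aux m n} (hx : x.eval n μ ε = label x') (hy : y.eval n μ ε = y'.slot)
    (hz : z.eval n μ ε = z'.slot) : (line m f x y z).eval n μ ε =
      constraintWords (m + 2, lList t ++ [x', .inr (t, y'), .inr (t, z')]) := by
  simp only [line, Stmt.constraint, eval_emits, constraintWords, List.map_cons, List.map_append,
    map_eval_lLabels hf, hx, eval_auxLabel hf hy, eval_auxLabel hf hz, List.map_nil, Expr.eval,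
    List.length_append]
  simp [lLabels, lList]

theorem eval_cornerSlot {α β : Bool} {e : Expr} {a : Fin n} (he : e.eval n μ ε = a) :
    (Expr.cornerSlot m α β e).eval n μ ε = (Aux.corner α β a : Aux m n).slot := by
  simp only [Expr.cornerSlot, Expr.eval, he, Aux.slot]

theorem eval_infinity : (infinity m).eval n μ [] = (infinityList m n).map label := by
  rw [Stmt.infinity, eval_loops, infinityList, List.map_flatMap]
  refine congrArg (List.flatMap · (tuples n (m + 2))) (funext fun t => ?_)
  have h0 : ∀ j, (Expr.vars (m + 2) 0 j).eval n μ (digits t ++ []) = t j := fun j => by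
    rw [List.append_nil]; exact Expr.eval_vars_digits t j
  have h1 : ∀ (a : ℕ) (j), (Expr.vars (m + 2) 1 j).eval n μ (a :: (digits t ++ [])) = t j :=
    fun a j => (Expr.eval_vars_cons j).trans (h0 j)
  simp only [eval_seqs, List.flatMap_cons, List.flatMap_nil, List.append_nil, eval_emits,
    List.map_append, List.map_cons, List.map_nil] at *
  rw [map_eval_lLabels h0, eval_auxLabel (x := .g) h0 rfl, eval_auxLabel (x := .i false) h0 rfl,
    eval_auxLabel (x := .i true) h0 rfl, List.append_assoc]
  congr 2
  rw [eval_loop, List.map_map, ← List.flatMap_pure_eq_map]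
  exact congrArg (List.flatMap · (finDown n)) (funext fun a => congrArg (fun x => [x])
    (eval_auxLabel (x := .corner true true a) (h1 a) (eval_cornerSlot rfl)))

theorem eval_infinityLength :
    (infinityLength m).eval n μ ε = (infinityList m n).length := by
  simp [infinityLength, Expr.eval, Expr.eval_sizePow, infinityList, List.length_flatMap, lList,
    finDown, length_tuples]
  exact Or.inl (by ring)

theorem eval_flat (hμ : O.IsStored μ) {i : ℕ}
    (ht : ∀ j, (Expr.vars (m + 2) i j).eval n μ ε = t j) :
    (flat m i).eval n μ ε = constraintWords (m + 2, O.flatList t) := by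
  classical
  have h1 : ∀ (a : ℕ) (j), (Expr.vars (m + 2) (i + 1) j).eval n μ (a :: ε) = t j :=
    fun a j => (Expr.eval_vars_cons j).trans (ht j)
  have h2 : ∀ a : Fin n, (Expr.side (.vars (m + 2) (i + 1)) (.var 0)).eval n μ ((a : ℕ) :: ε) =
      signCode (O.side t a) := fun a => O.eval_side hμ (h1 a) rfl
  have h3 : (Expr.sum (.isZero (.side (.vars (m + 2) (i + 1)) (.var 0)))).eval n μ ε =
      ((finDown n).filter fun a => O.side t a = 0).length := by
    rw [Expr.eval, sum_range_eq_sum_down, ← map_val_finDown, List.map_map, ← List.countP_eq_length_filter]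
    induction finDown n with
    | nil => rfl
    | cons a l ih =>
      rw [List.map_cons, List.sum_cons, ih, List.countP_cons, add_comm]
      congr 1
      simp only [Function.comp_apply, Expr.isZero, Expr.eval]
      rw [h2]
      generalize O.side t a = s
      revert s
      decide
  have h4 : (loop (when (.isZero (.side (.vars (m + 2) (i + 1)) (.var 0)))
      (Stmt.emit (.var 0)))).eval n μ ε = (((finDown n).filter fun a => O.side t a = 0).map
        (fun a => (.inl a : Elt m n))).map label := by
    rw [eval_loop]
    induction finDown n with
    | nil => rfl
    | cons a l ih =>
      rw [List.flatMap_cons, ih, List.filter_cons, Stmt.eval]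
      have := Expr.eval_isZero_ne_zero_iff (n := n) (μ := μ) (ε := (a : ℕ) :: ε)
        (.side (.vars (m + 2) (i + 1)) (.var 0))
      rw [h2, signCode_eq_zero_iff] at this
      by_cases ha : O.side t a = 0
      · rw [if_pos (this.2 ha), if_pos (decide_eq_true ha)]; rfl
      · rw [if_neg (fun h => ha (this.1 h)), if_neg (by simpa using ha)]; rfl
  have h5 : (loop (Stmt.emit (.auxLabel m (.vars _ (i + 1))
      (.cornerSlot m false false (.var 0))))).eval n μ ε =
        ((finDown n).map fun a => (.inr (t, .corner false false a) : Elt m n)).map label := by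
    rw [eval_loop, List.map_map, ← List.flatMap_pure_eq_map]
    exact congrArg (List.flatMap · (finDown n)) (funext fun a => congrArg (fun x => [x])
      (eval_auxLabel (x := .corner false false a) (h1 a) (eval_cornerSlot rfl)))
  have h6 : (Expr.auxLabel m (.vars _ i) (.const m)).eval n μ ε = label (.inr (t, .g) : Elt m n) :=
    eval_auxLabel ht rfl
  have h7 : (Expr.auxLabel m (.vars _ i) (.const (m + 1))).eval n μ ε =
      label (.inr (t, .c false) : Elt m n) := eval_auxLabel ht rfl
  have h8 : (Expr.auxLabel m (.vars _ i) (.const (m + 2))).eval n μ ε =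
      label (.inr (t, .c true) : Elt m n) := eval_auxLabel ht rfl
  simp only [flat, eval_seqs, List.flatMap_cons, List.flatMap_nil, List.append_nil, eval_emits,
    List.map_cons, List.map_nil, h4, h5, constraintWords, flatList, List.map_append,
    map_eval_lLabels ht, h6, h7, h8]
  rw [Expr.eval, Expr.eval, h3]
  simp [Expr.eval, lList, finDown]
  ring

theorem eval_harmonic (hf : ∀ j, (f j).eval n μ ε = t j) : (harmonic m f).eval n μ ε =
    (harmonicLists t).flatMap fun l => constraintWords (m + 2, l) := by
  simp only [Stmt.harmonic, harmonicLists, eval_seqs, List.flatMap_cons, List.flatMap_nil]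
  rw [eval_line (y' := .i false) (z' := .q 1) hf (eval_auxLabel (x := .c false) hf rfl) rfl rfl,
    eval_line (y' := .i true) (z' := .q 1) hf (eval_auxLabel (x := .c true) hf rfl) rfl rfl,
    eval_line (y' := .i true) (z' := .q (-1)) hf (eval_auxLabel (x := .c false) hf rfl) rfl rfl,
    eval_line (y' := .i false) (z' := .q (-1)) hf (eval_auxLabel (x := .c true) hf rfl) rfl rfl]

theorem eval_corners (hμ : O.IsStored μ) (hf : ∀ j, (f j).eval n μ ε = t j) {e r : Expr} {a : Fin n}
    (he : e.eval n μ ε = a) (hr : r.eval n μ ε = O.rep a) : (corners m f e r).eval n μ ε =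
      if O.side t (O.rep a) = 0 then []
      else (O.cornerLists t a).flatMap fun l => constraintWords (m + 2, l) := by
  have hs := O.eval_side hμ hf hr
  rw [corners, Stmt.eval, hs]
  by_cases h : O.side t (O.rep a) = 0
  · rw [if_neg (by rw [signCode_eq_zero_iff.2 h]; simp), if_pos h]
  rw [if_pos (mt signCode_eq_zero_iff.1 h), if_neg h]
  have hq : (Expr.auxLabel m f (.add (.const (m + 5)) (.side f r))).eval n μ ε =
      label (.inr (t, .q (O.side t (O.rep a))) : Elt m n) :=
    eval_auxLabel hf (by rw [Expr.eval, hs]; rfl)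
  have hc := fun α β => eval_cornerSlot (m := m) (α := α) (β := β) hr
  simp only [eval_seqs, cornerLists, List.flatMap_cons, List.flatMap_nil]
  rw [eval_line (x' := .inl a) hf he (hc _ _) (hc _ _), eval_line (x' := .inl a) hf he (hc _ _) (hc _ _),
    eval_line hf hq (hc _ _) (hc _ _), eval_line hf hq (hc _ _) (hc _ _),
    eval_line hf (eval_auxLabel (x := .g) hf rfl) (hc _ _) (hc _ _)]

theorem eval_block (hμ : O.IsStored μ) (hrep : ∀ a : Fin n, μ (n ^ (m + 3) + 1 + a) = O.rep a) {i : ℕ}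
    (ht : ∀ j, (Expr.vars (m + 2) i j).eval n μ ε = t j) :
    (block m i).eval n μ ε = (O.blockLists t).flatMap fun l => constraintWords (m + 2, l) := by
  simp only [block, eval_seqs, List.flatMap_cons, List.flatMap_nil, List.append_nil, blockLists,
    List.flatMap_append]
  rw [O.eval_flat hμ ht, eval_harmonic ht, List.flatMap_assoc, eval_loop]
  congr 3
  funext a
  have h1 : ∀ j, (Expr.vars (m + 2) (i + 1) j).eval n μ ((a : ℕ) :: ε) = t j :=
    fun j => (Expr.eval_vars_cons j).trans (ht j)
  rw [O.eval_corners hμ (a := a) h1 rfl (by rw [Expr.eval, Expr.eval_address]; exact hrep a)]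
  by_cases h : O.side t (O.rep a) = 0
  · rw [if_pos h, if_neg (by simpa using h)]; rfl
  · rw [if_neg h, if_pos h]

theorem eval_notCanonical (hμ : O.IsStored μ) {a : Fin n} (ha : O.side t a ≠ 0) :
    (Expr.notCanonical m).eval n μ ((a : ℕ) :: digits t) = 0 ↔ O.Canonical t := by
  have h1 : ∀ (a : ℕ) (j), (Expr.vars (m + 2) 1 j).eval n μ (a :: digits t) = t j :=
    fun a j => (Expr.eval_vars_cons j).trans (Expr.eval_vars_digits t j)
  have h2 : ∀ (y : ℕ) (j), (Expr.vars (m + 2) 2 j).eval n μ (y :: (a : ℕ) :: digits t) = t j :=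
    fun y j => (Expr.eval_vars_cons j).trans (h1 a j)
  have h3 : ∀ (y : Fin n) (j), (Expr.side (Function.update (Expr.vars (m + 2) 2) j (.var 0))
      (.var 1)).eval n μ ((y : ℕ) :: (a : ℕ) :: digits t) =
        signCode (O.side (Function.update t j y) a) := fun y j => by
    refine O.eval_side hμ (fun l => ?_) rfl
    by_cases hl : l = j
    · subst hl; rw [Function.update_self, Function.update_self]; rfl
    · rw [Function.update_of_ne hl, Function.update_of_ne hl, h2]
  have h4 : O.Canonical t ↔ StrictMono t ∧ ∀ (j : Fin (m + 2)) (y : Fin n),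
      O.side t y = 0 → y < t j → O.side (Function.update t j y) a = 0 :=
    ⟨fun h => ⟨h.1, fun j y hy hj => h.side_update hy hj a⟩, fun h => ⟨h.1, a, ha, h.2⟩⟩
  rw [h4, Fin.strictMono_iff_lt_succ, Expr.notCanonical, Expr.eval, Nat.add_eq_zero_iff,
    Expr.eval_total, Expr.eval_total, Finset.sum_eq_zero_iff, Finset.sum_eq_zero_iff]
  simp only [Finset.mem_univ, forall_const]
  refine and_congr (forall_congr' fun j => ?_) (forall_congr' fun j => ?_)
  · change 1 - ((Expr.vars (m + 2) 1 j.succ).eval n μ ((a : ℕ) :: digits t) -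
      (Expr.vars (m + 2) 1 j.castSucc).eval n μ ((a : ℕ) :: digits t)) = 0 ↔ _
    rw [h1, h1, Fin.lt_def]
    omega
  · rw [Expr.eval, Finset.sum_eq_zero_iff]
    have key : ∀ y : Fin n, (Expr.mul (.sub (.vars (m + 2) 2 j) (.var 0))
        (.mul (.isZero (.side (.vars (m + 2) 2) (.var 0)))
          (.side (Function.update (.vars (m + 2) 2) j (.var 0)) (.var 1)))).eval n μ
            ((y : ℕ) :: (a : ℕ) :: digits t) = 0 ↔
        (O.side t y = 0 → y < t j → O.side (Function.update t j y) a = 0) := fun y => by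
      have h5 := Expr.eval_isZero_ne_zero_iff (n := n) (μ := μ)
        (ε := (y : ℕ) :: (a : ℕ) :: digits t) (.side (.vars (m + 2) 2) (.var 0))
      rw [O.eval_side hμ (h2 y) rfl, signCode_eq_zero_iff] at h5
      change ((Expr.vars (m + 2) 2 j).eval n μ ((y : ℕ) :: (a : ℕ) :: digits t) - y) *
        ((Expr.isZero (.side (.vars (m + 2) 2) (.var 0))).eval n μ ((y : ℕ) :: (a : ℕ) :: digits t) *
          (Expr.side (Function.update (Expr.vars (m + 2) 2) j (.var 0)) (.var 1)).eval n μ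
            ((y : ℕ) :: (a : ℕ) :: digits t)) = 0 ↔ _
      rw [h3, h2, mul_eq_zero, mul_eq_zero, signCode_eq_zero_iff,
        ← h5, Fin.lt_def]
      by_cases h : (y : ℕ) < t j
      · have : ¬ (t j : ℕ) - y = 0 := by omega
        tauto
      · have : (t j : ℕ) - y = 0 := by omega
        tauto
    constructor
    · exact fun h y => (key y).1 (h y (Finset.mem_range.2 y.2))
    · exact fun h y hy => (key ⟨y, Finset.mem_range.1 hy⟩).2 (h _)

open Classical in
theorem eval_canonicalBlock (hμ : O.IsStored μ)
    (hrep : ∀ a : Fin n, μ (n ^ (m + 3) + 1 + a) = O.rep a) (t : Fin (m + 2) → Fin n) :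
    (canonicalBlock m).eval n μ (digits t) = if O.Canonical t then
      (O.blockLists t).flatMap fun l => constraintWords (m + 2, l) else [] := by
  have h1 : ∀ (a : ℕ) (j), (Expr.vars (m + 2) 1 j).eval n μ (a :: digits t) = t j :=
    fun a j => (Expr.eval_vars_cons j).trans (Expr.eval_vars_digits t j)
  have hs : ∀ a : Fin n, (Expr.side (.vars (m + 2) 1) (.var 0)).eval n μ ((a : ℕ) :: digits t) =
      signCode (O.side t a) := fun a => O.eval_side hμ (h1 a) rfl
  obtain ⟨a, hfind, ha⟩ : ∃ a : Fin n,
      (Expr.find (.side (.vars (m + 2) 1) (.var 0))).eval n μ (digits t) = a ∧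
        (O.side t a = 0 → ¬ O.Canonical t) := by
    by_cases h : ∃ x, ∃ hx : x < n, O.side t ⟨x, hx⟩ ≠ 0
    · obtain ⟨hx, hne⟩ := Nat.find_spec h
      refine ⟨⟨Nat.find h, hx⟩, findBelow_eq hx ?_ fun y hy => ?_, fun h0 => (hne h0).elim⟩
      · exact (hs ⟨_, hx⟩).trans_ne (mt signCode_eq_zero_iff.1 hne)
      · have := Nat.find_min h hy
        push Not at this
        exact (hs ⟨y, hy.trans hx⟩).trans (signCode_eq_zero_iff.2 (this _))
    · push Not at h
      refine ⟨⟨0, (t 0).pos⟩, findBelow_eq_of_forall fun x hx => ?_, fun _ hc => ?_⟩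
      · exact (hs ⟨x, hx⟩).trans (signCode_eq_zero_iff.2 (h x hx))
      · obtain ⟨-, a, ha, -⟩ := hc
        exact ha (h a a.2)
  rw [canonicalBlock, Stmt.eval, hfind, Stmt.eval, Stmt.eval, hs, O.eval_block hμ hrep (h1 a)]
  by_cases h : O.side t a = 0
  · rw [if_neg (by rw [signCode_eq_zero_iff.2 h]; simp), if_neg (ha h)]
  · rw [if_pos (mt signCode_eq_zero_iff.1 h)]
    refine if_congr ?_ rfl rfl
    rw [Expr.eval_isZero_ne_zero_iff]
    exact O.eval_notCanonical hμ h

open Classical in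
theorem eval_dependent (hμ : O.IsStored μ) {s : ℕ} (hs : s < m + 3) :
    (dependent m s).eval n μ [] = (tuples n (s + 1)).flatMap fun z =>
      if Function.Injective z ∧ O.matroid.Indep (Set.range z) then []
      else constraintWords (s, List.ofFn fun j => (.inl (z j) : Elt m n)) := by
  rw [dependent, eval_loops]
  refine congrArg (List.flatMap · (tuples n (s + 1))) (funext fun z => ?_)
  simp only [List.append_nil]
  have h := O.eval_sums_chi_eq_zero_iff hμ (show m + 2 - s + (s + 1) = m + 2 + 1 by omega) z
  rw [← Expr.eval_isZero_ne_zero_iff] at h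
  rw [Stmt.eval]
  by_cases hz : Function.Injective z ∧ O.matroid.Indep (Set.range z)
  · rw [if_pos hz, if_neg (fun h' => h.1 h' hz)]
  · rw [if_neg hz, if_pos (h.2 hz)]
    simp only [Stmt.constraint, eval_emits, constraintWords, List.map_cons, List.map_ofFn, Expr.eval,
      List.length_ofFn]
    refine congrArg (fun l => s :: (s + 1) :: l) (congrArg List.ofFn (funext fun j => ?_))
    exact Expr.eval_vars_digits (μ := μ) z j

/-- The program writes the description of the simulating matroid. -/
theorem eval_simulation (hμ : O.IsStored μ)
    (hrep : ∀ a : Fin n, μ (n ^ (m + 3) + 1 + a) = O.rep a) :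
    (Stmt.simulation m).eval n μ [] = O.code.words := by
  classical
  have h1 : ((List.range (m + 3)).map (dependent m)).flatMap (fun s => s.eval n μ []) =
      ((List.range (m + 3)).flatMap fun s => (tuples n (s + 1)).flatMap fun z =>
        if Function.Injective z ∧ O.matroid.Indep (Set.range z) then []
        else [(s, List.ofFn fun j => (.inl (z j) : Elt m n))]).flatMap constraintWords := by
    rw [List.flatMap_map, List.flatMap_assoc]
    refine List.flatMap_congr fun s hs => ?_
    rw [O.eval_dependent hμ (List.mem_range.1 hs), List.flatMap_assoc]
    refine List.flatMap_congr fun z _ => ?_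
    split_ifs
    · rfl
    · rw [List.flatMap_singleton]
  have h2 : (loops (m + 2) (canonicalBlock m)).eval n μ [] =
      ((tuples n (m + 2)).flatMap fun t =>
        if O.Canonical t then (O.blockLists t).map fun l => (m + 2, l) else []).flatMap
          constraintWords := by
    rw [eval_loops, List.flatMap_assoc]
    refine List.flatMap_congr fun t _ => ?_
    rw [List.append_nil, O.eval_canonicalBlock hμ hrep]
    split_ifs
    · rw [List.flatMap_map]
    · rfl
  have h3 : (O.constraintList.map fun p => (p.1, p.2.map label)).flatMap
      (fun p => p.1 :: p.2.length :: p.2) = O.constraintList.flatMap constraintWords := by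
    rw [List.flatMap_map]
    refine List.flatMap_congr fun p _ => ?_
    rw [List.length_map]; rfl
  rw [MatroidCode.words, code]
  simp only [h3]
  rw [Stmt.simulation, eval_seqs, List.flatMap_append, List.flatMap_append, h1]
  simp only [List.flatMap_cons, List.flatMap_nil, List.append_nil, eval_emits, h2, List.map_cons,
    List.map_nil, eval_infinity, eval_infinityLength, constraintList, List.flatMap_append,
    constraintWords, List.length_map, Expr.eval, Expr.eval_sizePow, eltCount, List.cons_append,
    List.nil_append, List.append_assoc]

end AbstractOrderType

/-! ### The machine on the input -/

namespace AbstractOrderType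

variable {d n : ℕ} (O : AbstractOrderType d n)

theorem length_input : O.input.length = n ^ (d + 1) + 1 := by simp [input]

theorem getD_input (x : Fin (d + 1) → Fin n) :
    O.input.getD (1 + finFunctionFinEquiv x) 0 = signCode (O.χ x) := by
  rw [input, Nat.add_comm 1, List.getD_cons_succ, List.getD_eq_getElem _ _ 
    (by rw [List.length_ofFn]; exact (finFunctionFinEquiv x).2), List.getElem_ofFn, Fin.eta,
    Equiv.symm_apply_apply]

theorem size_pos (O : AbstractOrderType d n) : 0 < n := by
  obtain ⟨x, -⟩ := O.nonzero
  exact (x 0).pos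

theorem getD_input_le (a : ℕ) : O.input.getD a 0 ≤ O.input.length + 1 := by
  have hs : ∀ s : SignType, signCode s ≤ 2 := by decide
  rw [length_input]
  rcases Nat.lt_or_ge a O.input.length with ha | ha
  · rw [List.getD_eq_getElem _ _ ha]
    have := List.getElem_mem ha
    generalize O.input[a] = y at this
    rcases List.mem_cons.1 this with rfl | hy
    · exact (Nat.le_self_pow (Nat.succ_ne_zero d) y).trans (Nat.le_add_right _ 2)
    · obtain ⟨i, rfl⟩ := (List.mem_ofFn' _ _).1 hy
      exact (hs _).trans (Nat.le_add_left _ _)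
  · rw [List.getD_eq_default _ _ ha]
    exact Nat.zero_le _

end AbstractOrderType

theorem eltCount_le {m n : ℕ} (hn : 0 < n) : eltCount m n ≤ (m + 13) * n ^ (m + 3) := by
  have h1 : n ≤ n ^ (m + 3) := Nat.le_self_pow (by omega) n
  have h2 : n ^ (m + 2) * (m + 8 + 4 * n) ≤ n ^ (m + 2) * ((m + 12) * n) :=
    Nat.mul_le_mul_left _ (by nlinarith)
  have h3 : n ^ (m + 2) * ((m + 12) * n) = (m + 12) * n ^ (m + 3) := by ring
  rw [eltCount, show (m + 13) * n ^ (m + 3) = (m + 12) * n ^ (m + 3) + n ^ (m + 3) by ring]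
  omega

theorem RAM.Runs.mono {W W' : ℕ} (hW : W ≤ W') {p : RAM} {σ τ : RAM.State} {t : ℕ}
    (h : RAM.Runs W p σ t τ) : RAM.Runs W' p σ t τ := by
  induction h with
  | skip σ => exact .skip σ
  | const σ r c h => exact .const σ r c (h.trans hW)
  | add σ r s t h => exact .add σ r s t (h.trans hW)
  | sub σ r s t => exact .sub σ r s t
  | mul σ r s t h => exact .mul σ r s t (h.trans hW)
  | load σ r s => exact .load σ r s
  | store σ r s => exact .store σ r s
  | emit σ r => exact .emit σ r
  | seq _ _ ih ih' => exact .seq ih ih'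
  | if_true hr _ ih => exact .if_true hr ih
  | if_false hr _ ih => exact .if_false hr ih
  | while_true hr _ _ ih ih' => exact .while_true hr ih ih'
  | while_false hr => exact .while_false hr

/-- The program that writes the description of the simulating matroid of an order type. -/
def simulationProgram (m : ℕ) : RAM :=
  RAM.tableProgram (.address (m + 3) (.var 0)) (.rep m) (.simulation m)

theorem exists_runs_simulationProgram (m : ℕ) :
    ∃ C : ℕ, ∀ (n : ℕ) (O : AbstractOrderType (m + 2) n), ∃ t τ,
      t ≤ C * O.input.length ∧
      RAM.Runs ((O.input.length + 1) ^ C) (simulationProgram m) (RAM.init O.input) t τ ∧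
      τ.output = O.code.words := by
  set a : RAM.Expr := .address (m + 3) (.var 0) with ha
  refine ⟨(a.factor + (RAM.Expr.rep m).factor + (RAM.Stmt.simulation m).factor + 8) +
    (a.degree + (RAM.Expr.rep m).degree + (RAM.Stmt.simulation m).degree + 1), fun n O => ?_⟩
  have hn := O.size_pos
  have hlen := O.length_input
  have hpow : n ≤ O.input.length :=
    hlen ▸ (Nat.le_self_pow (Nat.succ_ne_zero _) n).trans (Nat.le_succ _)
  have hstored : ∀ μ : ℕ → ℕ, (∀ x < n ^ (m + 3) + 1, μ x = O.input.getD x 0) → O.IsStored μ :=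
    fun μ hμ x => by
      rw [hμ _ (by rw [add_comm]; exact Nat.succ_lt_succ (finFunctionFinEquiv x).2), O.getD_input]
  obtain ⟨t, τ, ht, hrun, hout⟩ := RAM.exists_runs_tableProgram (n := n) (R := O.input.length + 1)
    (D := m + 3) (b := n ^ (m + 3) + 1) (w := O.input) (a := a) (e := .rep m)
    (s := .simulation m) (f := fun x => if h : x < n then O.rep ⟨x, h⟩ else 0)
    (by omega) hn (by omega) O.getD_input_le rfl
    (fun μ x => RAM.Expr.eval_address _ _)
    (fun μ hμ x hx => by rw [dif_pos hx]; exact O.eval_rep (hstored μ hμ) ⟨x, hx⟩)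
    (fun x => by
      split_ifs
      · exact (Fin.isLt _).le.trans (by omega)
      · exact Nat.zero_le _)
    (by rw [ha, RAM.Expr.depth_address]; exact Nat.succ_le_succ (Nat.zero_le _))
    (by rw [RAM.Expr.depth_rep]) (RAM.Stmt.depth_simulation_le m)
    (Nat.pow_le_pow_right (by omega) (Nat.le_add_left _ _))
  refine ⟨t, τ, ht.trans (Nat.mul_le_mul (Nat.le_add_right _ _) (hlen ▸ Nat.le_succ _)), hrun, ?_⟩
  rw [hout]
  refine O.eval_simulation (hstored _ fun x hx => ?_) fun a => ?_
  · rw [RAM.tableMemory, if_neg (by omega)]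
  · rw [RAM.tableMemory, if_pos ⟨Nat.le_add_right _ _, Nat.add_lt_add_left a.2 _⟩,
      Nat.add_sub_cancel_left, dif_pos a.2]

/-- The rank is `k = d + 1 ≥ 3`. The time is linear in the length `N` of the table of the chirotope,
and the machine works with words of `O(log N)` bits. -/
theorem theorem2 (d : ℕ) (hd : 2 ≤ d) :
    ∃ (prog : RAM) (C : ℕ), ∀ (n : ℕ) (O : AbstractOrderType d n),
      ∃ (code : MatroidCode) (M : Matroid (Fin code.size)) (H : Set (Fin code.size))
        (hn : n ≤ code.size) (t : ℕ) (final : RAM.State),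
        RAM.Runs ((O.input.length + 1) ^ C) prog (RAM.init O.input) t final ∧
        t ≤ C * O.input.length ∧
        final.output = code.words ∧
        code.size ≤ C * O.input.length ∧
        code.Describes (d + 1) M H ∧
        Simulates M H (Fin.castLEEmb hn) O := by
  obtain ⟨m, rfl⟩ := Nat.exists_eq_add_of_le' hd
  obtain ⟨C, hC⟩ := exists_runs_simulationProgram m
  refine ⟨simulationProgram m, C + (m + 13), fun n O => ?_⟩
  obtain ⟨t, τ, ht, hrun, hout⟩ := hC n O
  have hsize : eltCount m n ≤ (m + 13) * O.input.length :=
    (eltCount_le O.size_pos).trans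
      (Nat.mul_le_mul_left _ (by rw [O.length_input]; exact Nat.le_succ _))
  exact ⟨O.code, O.simulation.mapEquiv (eltEquiv m n), eltEquiv m n '' O.planeSet .infinity,
    Nat.le_add_right _ _, t, τ,
    hrun.mono (hW := Nat.pow_le_pow_right (Nat.succ_pos _) (Nat.le_add_right _ _)),
    ht.trans (Nat.mul_le_mul_right _ (Nat.le_add_right _ _)), hout,
    hsize.trans (Nat.mul_le_mul_right _ (Nat.le_add_left _ _)), O.code_describes,
    O.simulates (eltEquiv m n) (Nat.le_add_right _ _) fun e => Fin.ext rfl⟩
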